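/- **Setting.** Let $(\mathcal P,d)$ be a finite metric space with at least two points, $d_{\min}$, $d_{\max}$ the smallest and largest distance between distinct points, $\Delta=d_{\max}/d_{\min}$. The input is a set $A$ of $n$ nodes, partitioned into nonempty parts $A_1,\dots,A_s$ with $n_i=|A_i|$; node $j$ is a probability distribution $\mathcal D_j$ on $\mathcal P$, known to the site $i$ with $j\in A_i$. Let $1\le k\le n$, $0\le t\le n$, $\epsilon>0$. A solution consists of centers $K\subseteq\mathcal P$, ignored nodes $O\subseteq A$ and an assignment $\pi:A\to K$; its $(k,t)$-center-g cost is $$\mathbb E_{\sigma\sim\prod_j\mathcal D_j}\Big[\max_{j\in A\setminus O} d(\sigma(j),\pi(j))\Big],$$ and $\mathrm{OPT}(A,k,t)$ is the least cost of a solution with $|K|\le k$, $|O|\le t$. **Model.** In the coordinator model, in each round the coordinator sends a (possibly empty) message to every site and every site answers; at the end the coordinator outputs the centers and announces the answer to the sites, each of which labels its own nodes by their center or as ignored. All sites run the same fixed program, and the coordinator runs a fixed program. The programs run on a random access machine whose words are natural numbers, reals, points or nodes, with unit-cost addition and subtraction of naturals, real arithmetic, comparisons and binary exponents $\lfloor\log_2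 x\rfloor$ of reals, and unit-cost oracles for the distance $d(x,y)$, the truncated expected distance $\rho_\tau(j,y)=\mathbb E_{x\sim\mathcal D_j}\max\{d(x,y)-\tau,0\}$, and a 1-median of a node (a point $y$ minimizing $\mathbb E_{x\sim \mathcal D_j}d(x,y)$). All parties are given $k,t,\epsilon,d_{\min},d_{\max}$; a site is also given $n_i$ and its nodes, and the coordinator $s$. Messages are sequences of natural numbers in self-delimiting binary, points ($B$ bits each, $|\mathcal P|\le 2^B$), nodes ($I\geq1$ bits each) and blanks, with a constant number of bits to mark the kind of a word; reals cannot be sent. Here $I$ bits encode a node: distinct distributions that occur have distinct $I$-bit codewords, and nonzero probabilities are at least $2^{-I}$ (as when the probabilities are written in binary within the $I$ bits). **Theorem.** There are a deterministic two-round protocol (fixed programs, independent of the instance) and absolute constants $C>0$, $c\in\mathbb N$ such that on every such input the protocol halts and outputs a solution $(K,O,\pi)$ with at most $k$ centers, at most $(1+\epsilon)t$ ignored nodes, and cost at most $$C\,(1+1/\epsilon)\cdot\mathrm{OPT}(A,k,t).$$ The total number of bits exchanged, in both directions and including the announcement of the answer, is at most $$C\log^c(n+1)\cdot\big(skB+s\log_2\Delta+tI\big),$$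 the running time of site $i$ is at most $C\log^c(n+1)\cdot(k+t)\,n_i\,(\log_2\Delta+1)$, and the running time of the coordinator is at most $C\log^c(n+1)\cdot(sk+t)^2$. -/

import Mathlib

open scoped BigOperators NNReal

noncomputable section

namespace CenterG

universe u v

/-! ## Uncertain (k,t)-center-g -/

/-- A distributed input: `s` sites; site `i` holds `size i` nodes, and node `j` of site `i` is
a probability distribution `D i j` on the point set `P`. -/
structure Input (P : Type u) where
  s : ℕ
  size : Fin s → ℕ
  D : (i : Fin s) → Fin (size i) → PMF P

/-- The node set `A`, the disjoint union of the parts `A_1, …, A_s`. -/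
abbrev Input.Node {P : Type u} (X : Input P) : Type := (i : Fin X.s) × Fin (X.size i)

/-- The distribution of a node. -/
def Input.law {P : Type u} (X : Input P) (a : X.Node) : PMF P := X.D a.1 a.2

/-- The total number of nodes. -/
def Input.n {P : Type u} (X : Input P) : ℕ := ∑ i, X.size i

section Problem

variable {P : Type u} [MetricSpace P] [Fintype P]

/-- Truncated expected distance `ρ_τ(μ, y) = E_{x ∼ μ} [max (d(x, y) - τ, 0)]`. -/
def rho (μ : PMF P) (τ : ℝ) (y : P) : ℝ := ∑ x, (μ x).toReal * max (dist x y - τ) 0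

/-- `y` is a 1-median of `μ`: it minimizes `E_{x ∼ μ} [d(x, y)]` over `P`. -/
def IsMedian (μ : PMF P) (y : P) : Prop :=
  ∀ z, ∑ x, (μ x).toReal * dist x y ≤ ∑ x, (μ x).toReal * dist x z

/-- Centers, ignored nodes and assignment. -/
structure Solution (P : Type u) (A : Type v) where
  K : Finset P
  O : Finset A
  asg : A → P

/-- At most `k` centers, at most `m` ignored nodes, and the assignment maps into the centers. -/
def Solution.Feasible {A : Type v} (S : Solution P A) (k : ℕ) (m : ℝ) : Prop :=
  S.K.card ≤ k ∧ (S.O.card : ℝ) ≤ m ∧ ∀ a, S.asg a ∈ S.K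

/-- `E_σ [max_{a ∉ O} d(σ a, π a)]`, the nodes being realized independently, `σ a ∼ law a`.
The maximum over no node at all is `0`. -/
def cost (X : Input P) (S : Solution P X.Node) : ℝ :=
  ∑ σ : X.Node → P, (∏ a, (X.law a (σ a)).toReal) *
    (((Finset.univ \ S.O).sup fun a => nndist (σ a) (S.asg a) : ℝ≥0) : ℝ)

/-- The optimum with at most `k` centers and at most `t` ignored nodes. -/
def optCost (X : Input P) (k t : ℕ) : ℝ :=
  sInf {c | ∃ S : Solution P X.Node, S.Feasible k t ∧ c = cost X S}

/-- Smallest distance between two distinct points. -/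
def dmin (P : Type u) [MetricSpace P] : ℝ := sInf {r | ∃ x y : P, x ≠ y ∧ r = dist x y}

/-- Largest distance between two distinct points. -/
def dmax (P : Type u) [MetricSpace P] : ℝ := sSup {r | ∃ x y : P, x ≠ y ∧ r = dist x y}

/-- `log₂ Δ`, where `Δ = dmax / dmin`. -/
def logDelta (P : Type u) [MetricSpace P] : ℝ := Real.logb 2 (dmax P / dmin P)

/-- `I` bits suffice to write a node: the distributions that occur have distinct codewords of
`I` bits, and a probability that is not zero is at least `2⁻ᴵ`, as is the case whenever the
probabilities themselves are written out in binary within these `I` bits. -/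
def NodesHaveBits (X : Input P) (I : ℕ) : Prop :=
  0 < I ∧ (∃ code : PMF P → Fin I → Bool, Set.InjOn code (Set.range X.law)) ∧
    ∀ a x, X.law a x ≠ 0 → (1 / 2 : ℝ) ^ I ≤ (X.law a x).toReal

end Problem

/-! ## Programs with a step count

A random access machine with natural numbers, reals, points and nodes as words. A word that
holds a point or a node can be copied, sent, and handed to the oracles; it cannot be forged. -/

/-- Contents of a memory cell. -/
inductive Word (P : Type u) (A : Type v) where
  | blank : Word P A
  | nat : ℕ → Word P A
  | real : ℝ → Word P A
  | pt : P → Word P A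
  | node : A → Word P A

namespace Word

variable {P : Type u} {A : Type v}

def toNat : Word P A → ℕ
  | nat n => n
  | _ => 0

def toReal : Word P A → ℝ
  | real x => x
  | _ => 0

def pt? : Word P A → Option P
  | pt p => some p
  | _ => none

/-- What arrives when a word is sent: real numbers cannot be transmitted. -/
def sent : Word P A → Word P A
  | real _ => blank
  | w => w

/-- Bits needed to transmit a word, if a point takes `B` bits and a node takes `I` bits:
two bits announce the kind of the word, and natural numbers are sent in a self-delimiting binary
code. Real numbers are never transmitted. -/
def bits (B I : ℕ) : Word P A → ℕ
  | nat n => 2 * n.size + 3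
  | pt _ => B + 2
  | node _ => I + 2
  | _ => 2

end Word

/-- A machine state: memory, and for every port the words still to be read and the words
written. -/
structure State (P : Type u) (A : Type v) where
  mem : ℕ → Word P A
  inbox : ℕ → List (Word P A)
  outbox : ℕ → List (Word P A)

/-- Elementary instructions; the arguments are addresses of memory cells, the first one being the
target (for `const`, the second argument is the constant). -/
inductive Instr where
  /-- `r := n` -/
  | const (r n : ℕ)
  /-- `r := a` -/
  | copy (r a : ℕ)
  /-- `r :=` the cell whose address is in `a` -/
  | load (r a : ℕ)
  /-- the cell whose address is in `r` `:= a` -/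
  | store (r a : ℕ)
  /-- sum of natural numbers -/
  | add (r a b : ℕ)
  /-- truncated difference of natural numbers -/
  | sub (r a b : ℕ)
  /-- natural number to real number -/
  | ofNat (r a : ℕ)
  /-- real arithmetic -/
  | radd (r a b : ℕ)
  | rsub (r a b : ℕ)
  | rmul (r a b : ℕ)
  | rdiv (r a b : ℕ)
  /-- binary exponent `⌊log₂ x⌋` of a real number `x ≥ 1`, as a natural number -/
  | expo (r a : ℕ)
  /-- distance of the points in `a` and `b` -/
  | distance (r a b : ℕ)
  /-- truncated expected distance `ρ_τ(j, y)`: node `j` in `a`, point `y` in `b`, `τ` in `c` -/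
  | trunc (r a b c : ℕ)
  /-- 1-median of the node in `a` -/
  | median (r a : ℕ)
  /-- read the next word from the port whose number is in `p` (`blank` if there is none) -/
  | recv (r p : ℕ)
  /-- write the word in `a` to the port whose number is in `p` -/
  | send (p a : ℕ)

/-- Tests. -/
inductive Test where
  | natLe (a b : ℕ)
  | realLe (a b : ℕ)
  | isBlank (a : ℕ)

/-- Structured programs. -/
inductive Cmd where
  | skip
  | instr (o : Instr)
  | seq (c₁ c₂ : Cmd)
  | ite (b : Test) (c₁ c₂ : Cmd)
  | loop (b : Test) (c : Cmd)

section Semantics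

variable {P : Type u} {A : Type v} [MetricSpace P] [Fintype P]

namespace State

def set (st : State P A) (r : ℕ) (w : Word P A) : State P A :=
  { st with mem := Function.update st.mem r w }

/-- The natural number in cell `a`. -/
def nat (st : State P A) (a : ℕ) : ℕ := (st.mem a).toNat

/-- The real number in cell `a`. -/
def real (st : State P A) (a : ℕ) : ℝ := (st.mem a).toReal

/-- Start of a new phase: the words written before have left the machine, and new words arrive. -/
def deliver (st : State P A) (msg : ℕ → List (Word P A)) : State P A :=
  { mem := st.mem, inbox := fun p => st.inbox p ++ msg p, outbox := fun _ => [] }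

/-- The empty state with `tape` at port `0`. -/
def start (tape : List (Word P A)) : State P A :=
  { mem := fun _ => .blank, inbox := fun p => if p = 0 then tape else [], outbox := fun _ => [] }

end State

/-- Effect of one instruction; `D` gives the distributions of the nodes, `med` their 1-medians. -/
def Instr.run (D : A → PMF P) (med : A → P) (st : State P A) : Instr → State P A
  | .const r n => st.set r (.nat n)
  | .copy r a => st.set r (st.mem a)
  | .load r a => st.set r (st.mem (st.nat a))
  | .store r a => st.set (st.nat r) (st.mem a)
  | .add r a b => st.set r (.nat (st.nat a + st.nat b))
  | .sub r a b => st.set r (.nat (st.nat a - st.nat b))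
  | .ofNat r a => st.set r (.real (st.nat a))
  | .radd r a b => st.set r (.real (st.real a + st.real b))
  | .rsub r a b => st.set r (.real (st.real a - st.real b))
  | .rmul r a b => st.set r (.real (st.real a * st.real b))
  | .rdiv r a b => st.set r (.real (st.real a / st.real b))
  | .expo r a => st.set r (.nat (Nat.log 2 ⌊st.real a⌋₊))
  | .distance r a b =>
      match st.mem a, st.mem b with
      | .pt x, .pt y => st.set r (.real (dist x y))
      | _, _ => st.set r .blank
  | .trunc r a b c =>
      match st.mem a, st.mem b with
      | .node j, .pt y => st.set r (.real (rho (D j) (st.real c) y))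
      | _, _ => st.set r .blank
  | .median r a =>
      match st.mem a with
      | .node j => st.set r (.pt (med j))
      | _ => st.set r .blank
  | .recv r p =>
      let q := st.nat p
      { st.set r ((st.inbox q).headD .blank) with
        inbox := Function.update st.inbox q (st.inbox q).tail }
  | .send p a =>
      let q := st.nat p
      { st with outbox := Function.update st.outbox q (st.outbox q ++ [(st.mem a).sent]) }

def Test.holds (st : State P A) : Test → Prop
  | .natLe a b => st.nat a ≤ st.nat b
  | .realLe a b => st.real a ≤ st.real b
  | .isBlank a => st.mem a = .blank

/-- `Exec D med c st m st'`: program `c`, started in `st`, halts in `st'` after `m` steps. Every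
instruction and every evaluation of a test is one step. -/
inductive Exec (D : A → PMF P) (med : A → P) : Cmd → State P A → ℕ → State P A → Prop
  | skip (st) : Exec D med .skip st 0 st
  | instr (o st) : Exec D med (.instr o) st 1 (o.run D med st)
  | seq {c₁ c₂ st₁ st₂ st₃ m₁ m₂} (h₁ : Exec D med c₁ st₁ m₁ st₂)
      (h₂ : Exec D med c₂ st₂ m₂ st₃) : Exec D med (.seq c₁ c₂) st₁ (m₁ + m₂) st₃
  | iteTrue {b c₁ c₂ st st' m} (hb : b.holds st) (h : Exec D med c₁ st m st') :
      Exec D med (.ite b c₁ c₂) st (m + 1) st'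
  | iteFalse {b c₁ c₂ st st' m} (hb : ¬ b.holds st) (h : Exec D med c₂ st m st') :
      Exec D med (.ite b c₁ c₂) st (m + 1) st'
  | loopTrue {b c st₁ st₂ st₃ m₁ m₂} (hb : b.holds st₁) (h₁ : Exec D med c st₁ m₁ st₂)
      (h₂ : Exec D med (.loop b c) st₂ m₂ st₃) : Exec D med (.loop b c) st₁ (m₁ + m₂ + 1) st₃
  | loopFalse {b c st} (hb : ¬ b.holds st) : Exec D med (.loop b c) st 1 st

end Semantics

/-! ## Two-round protocols in the coordinator model -/

/-- The programs of a two-round protocol. Round one: every site runs `site₁` and sends a message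
to the coordinator (whose own message in round one is empty). Round two: the coordinator runs
`coord₁` and sends a message to every site, every site runs `site₂` and sends a message back.
Then the coordinator runs `coord₂`, which outputs the centers and announces the answer to the
sites, and every site runs `site₃`, which writes the label of each of its nodes. All sites run
the same programs, and memory is kept from one phase to the next. -/
structure Protocol where
  site₁ : Cmd
  coord₁ : Cmd
  site₂ : Cmd
  coord₂ : Cmd
  site₃ : Cmd

section Protocols

variable {P : Type u} [MetricSpace P] [Fintype P]

/-- Port `0` is the local tape. What a site finds there: the parameters and its own nodes. -/
def siteTape (X : Input P) (k t : ℕ) (ε : ℝ) (i : Fin X.s) : List (Word P X.Node) :=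
  [.nat k, .nat t, .real ε, .real (dmin P), .real (dmax P), .nat (X.size i)] ++
    List.ofFn fun j : Fin (X.size i) => .node ⟨i, j⟩

/-- What the coordinator finds on its local tape: the parameters only. -/
def coordTape (X : Input P) (k t : ℕ) (ε : ℝ) : List (Word P X.Node) :=
  [.nat k, .nat t, .real ε, .real (dmin P), .real (dmax P), .nat X.s]

/-- The coordinator is connected to site `i` through port `i + 1`, a site to the coordinator
through port `1`. -/
def toCoord {X : Input P} (S : Fin X.s → State P X.Node) : ℕ → List (Word P X.Node)
  | 0 => []
  | i + 1 => if h : i < X.s then (S ⟨i, h⟩).outbox 1 else []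

def toSite {X : Input P} (Q : State P X.Node) (i : Fin X.s) : ℕ → List (Word P X.Node) :=
  fun p => if p = 1 then Q.outbox (i + 1) else []

/-- A complete, halting run of the protocol `pr`: the state of every party at the end of each of
its phases and the number of steps of the phase. -/
structure Run (pr : Protocol) (X : Input P) (med : X.Node → P) (k t : ℕ) (ε : ℝ) where
  S₁ : Fin X.s → State P X.Node
  S₂ : Fin X.s → State P X.Node
  S₃ : Fin X.s → State P X.Node
  Q₁ : State P X.Node
  Q₂ : State P X.Node
  a₁ : Fin X.s → ℕ
  a₂ : Fin X.s → ℕ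
  a₃ : Fin X.s → ℕ
  b₁ : ℕ
  b₂ : ℕ
  exec_site₁ : ∀ i, Exec X.law med pr.site₁ (.start (siteTape X k t ε i)) (a₁ i) (S₁ i)
  exec_coord₁ : Exec X.law med pr.coord₁
    ((State.start (coordTape X k t ε)).deliver (toCoord S₁)) b₁ Q₁
  exec_site₂ : ∀ i, Exec X.law med pr.site₂ ((S₁ i).deliver (toSite Q₁ i)) (a₂ i) (S₂ i)
  exec_coord₂ : Exec X.law med pr.coord₂ (Q₁.deliver (toCoord S₂)) b₂ Q₂
  exec_site₃ : ∀ i, Exec X.law med pr.site₃ ((S₂ i).deliver (toSite Q₂ i)) (a₃ i) (S₃ i)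

namespace Run

variable {pr : Protocol} {X : Input P} {med : X.Node → P} {k t : ℕ} {ε : ℝ}

/-- Running time of site `i`. -/
def siteTime (R : Run pr X med k t ε) (i : Fin X.s) : ℕ := R.a₁ i + R.a₂ i + R.a₃ i

/-- Running time of the coordinator. -/
def coordTime (R : Run pr X med k t ε) : ℕ := R.b₁ + R.b₂

/-- Total number of bits exchanged, in both directions, the announcement of the answer
included. -/
def comm (R : Run pr X med k t ε) (B I : ℕ) : ℕ :=
  ∑ i : Fin X.s, (((R.S₁ i).outbox 1 ++ R.Q₁.outbox (i + 1) ++ (R.S₂ i).outbox 1 ++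
    R.Q₂.outbox (i + 1)).map (Word.bits B I)).sum

/-- The label that node `a` gets from its site: a center, or `none` for an ignored node. -/
def label (R : Run pr X med k t ε) (a : X.Node) : Option P :=
  (((R.S₃ a.1).outbox 0)[(a.2 : ℕ)]?).bind Word.pt?

/-- The run outputs the solution `S`: the coordinator lists exactly the centers of `S`, and every
node is labelled with its center in `S` or, if it is ignored in `S`, not labelled. -/
def Outputs (R : Run pr X med k t ε) (S : Solution P X.Node) : Prop :=
  (∀ p, p ∈ S.K ↔ Word.pt p ∈ R.Q₂.outbox 0) ∧
    (∀ a ∈ S.O, R.label a = none) ∧ ∀ a, a ∉ S.O → R.label a = some (S.asg a)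

end Run

end Protocols

end CenterG

end

open scoped BigOperators NNReal

noncomputable section

namespace CenterG

universe u v

set_option linter.unusedSectionVars false

open Finset

/-! ## A small imperative language and its compilation

The programs are written in a language with variables, infinite arrays and bounded loops, whose
semantics is a total function on states that also counts time. -/

inductive Cmp where
  | nat
  | real
  | blank

inductive Op1 where
  | ofNat
  | expo
  | median

inductive Op2 where
  | add
  | sub
  | radd
  | rsub
  | rmul
  | rdiv
  | dist

inductive Expr where
  | const (n : ℕ)
  | var (x : ℕ)
  | arr (α : ℕ) (e : Expr)
  | op1 (o : Op1) (e : Expr)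
  | op2 (o : Op2) (e1 e2 : Expr)
  | trunc (e1 e2 e3 : Expr)
  | cond (b : Cmp) (e1 e2 e3 e4 : Expr)

inductive Stm where
  | skip
  | set (x : ℕ) (e : Expr)
  | put (α : ℕ) (i e : Expr)
  | recv (x : ℕ) (p : Expr)
  | send (p e : Expr)
  | seq (c1 c2 : Stm)
  | ite (b : Cmp) (e1 e2 : Expr) (c1 c2 : Stm)
  | rep (x : ℕ) (e : Expr) (c : Stm)

/-- A state of the language; `arr α i` is entry `i` of array `α`. -/
@[ext] structure St (P : Type u) (A : Type v) where
  var : ℕ → Word P A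
  arr : ℕ → ℕ → Word P A
  inbox : ℕ → List (Word P A)
  outbox : ℕ → List (Word P A)
  time : ℕ

section

variable {P : Type u} {A : Type v}

namespace St

@[simps -fullyApplied]
def tick (s : St P A) : St P A := { s with time := s.time + 1 }

@[simps -fullyApplied arr inbox outbox time]
def setVar (s : St P A) (x : ℕ) (w : Word P A) : St P A :=
  { s with var := Function.update s.var x w, time := s.time + 1 }

@[simps -fullyApplied var inbox outbox time]
def setArr (s : St P A) (α i : ℕ) (w : Word P A) : St P A :=
  { s with
    arr := Function.update s.arr α (Function.update (s.arr α) i w), time := s.time + 1 }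

@[simps -fullyApplied arr outbox time]
def read (s : St P A) (x q : ℕ) : St P A :=
  { s with
    var := Function.update s.var x ((s.inbox q).headD .blank)
    inbox := Function.update s.inbox q (s.inbox q).tail
    time := s.time + 1 }

@[simps -fullyApplied var arr inbox time]
def write (s : St P A) (q : ℕ) (w : Word P A) : St P A :=
  { s with
    outbox := Function.update s.outbox q (s.outbox q ++ [w.sent]), time := s.time + 1 }

variable (s : St P A) (x y α β i j q q' : ℕ) (w : Word P A)

@[simp] lemma setVar_var : (s.setVar x w).var y = if y = x then w else s.var y := by
  simp [setVar, Function.update_apply]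
@[simp] lemma setArr_arr :
    (s.setArr α i w).arr β j = if β = α ∧ j = i then w else s.arr β j := by
  by_cases h : β = α
  · subst h; simp [setArr, Function.update_apply]
  · simp [setArr, h]
@[simp] lemma read_var :
    (s.read x q).var y = if y = x then (s.inbox q).headD .blank else s.var y := by
  simp [read, Function.update_apply]
@[simp] lemma read_inbox :
    (s.read x q).inbox q' = if q' = q then (s.inbox q).tail else s.inbox q' := by
  simp [read, Function.update_apply]
@[simp] lemma write_outbox :
    (s.write q w).outbox q' = if q' = q then s.outbox q ++ [w.sent] else s.outbox q' := by
  simp [write, Function.update_apply]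

end St

@[simp] lemma Word.toNat_nat (n : ℕ) : (Word.nat n : Word P A).toNat = n := rfl
@[simp] lemma Word.toReal_real (x : ℝ) : (Word.real x : Word P A).toReal = x := rfl
@[simp] lemma Word.sent_nat (n : ℕ) : (Word.nat n : Word P A).sent = .nat n := rfl
@[simp] lemma Word.sent_pt (x : P) : (Word.pt x : Word P A).sent = .pt x := rfl
@[simp] lemma Word.sent_node (a : A) : (Word.node a : Word P A).sent = .node a := rfl
@[simp] lemma Word.sent_blank : (Word.blank : Word P A).sent = .blank := rfl
@[simp] lemma Word.pt?_pt (x : P) : (Word.pt x : Word P A).pt? = some x := rfl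
@[simp] lemma Word.pt?_blank : (Word.blank : Word P A).pt? = none := rfl

def Cmp.holds (w1 w2 : Word P A) : Cmp → Prop
  | .nat => w1.toNat ≤ w2.toNat
  | .real => w1.toReal ≤ w2.toReal
  | .blank => w1 = .blank

@[simp] lemma Cmp.holds_nat (w1 w2 : Word P A) :
    Cmp.holds w1 w2 .nat ↔ w1.toNat ≤ w2.toNat := Iff.rfl
@[simp] lemma Cmp.holds_real (w1 w2 : Word P A) :
    Cmp.holds w1 w2 .real ↔ w1.toReal ≤ w2.toReal := Iff.rfl
@[simp] lemma Cmp.holds_blank (w1 w2 : Word P A) : Cmp.holds w1 w2 .blank ↔ w1 = .blank := Iff.rfl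

variable [MetricSpace P] [Fintype P]

def Op1.eval (med : A → P) (w : Word P A) : Op1 → Word P A
  | .ofNat => .real w.toNat
  | .expo => .nat (Nat.log 2 ⌊w.toReal⌋₊)
  | .median => match w with
    | .node j => .pt (med j)
    | _ => .blank

def Op2.eval (w1 w2 : Word P A) : Op2 → Word P A
  | .add => .nat (w1.toNat + w2.toNat)
  | .sub => .nat (w1.toNat - w2.toNat)
  | .radd => .real (w1.toReal + w2.toReal)
  | .rsub => .real (w1.toReal - w2.toReal)
  | .rmul => .real (w1.toReal * w2.toReal)
  | .rdiv => .real (w1.toReal / w2.toReal)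
  | .dist => match w1, w2 with
    | .pt x, .pt y => .real (Dist.dist x y)
    | _, _ => .blank

def truncEval (D : A → PMF P) (w1 w2 w3 : Word P A) : Word P A :=
  match w1, w2 with
  | .node j, .pt y => .real (rho (D j) w3.toReal y)
  | _, _ => .blank

open Classical in
def Expr.eval (D : A → PMF P) (med : A → P) (s : St P A) : Expr → Word P A
  | .const n => .nat n
  | .var x => s.var x
  | .arr α e => s.arr α (e.eval D med s).toNat
  | .op1 o e => o.eval med (e.eval D med s)
  | .op2 o e1 e2 => o.eval (e1.eval D med s) (e2.eval D med s)
  | .trunc e1 e2 e3 => truncEval D (e1.eval D med s) (e2.eval D med s) (e3.eval D med s)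
  | .cond b e1 e2 e3 e4 =>
      if b.holds (e1.eval D med s) (e2.eval D med s) then e3.eval D med s else e4.eval D med s

/-- `m` rounds of a loop with counter `x` and body `f`. -/
def forIter (f : St P A → St P A) (x : ℕ) : ℕ → St P A → St P A
  | 0, s => s
  | m + 1, s => f ((forIter f x m s).setVar x (.nat m))

open Classical in
def Stm.run (D : A → PMF P) (med : A → P) : Stm → St P A → St P A
  | .skip, s => s
  | .set x e, s => s.setVar x (e.eval D med s)
  | .put α i e, s => s.setArr α (i.eval D med s).toNat (e.eval D med s)
  | .recv x p, s => s.read x (p.eval D med s).toNat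
  | .send p e, s => s.write (p.eval D med s).toNat (e.eval D med s)
  | .seq c1 c2, s => c2.run D med (c1.run D med s)
  | .ite b e1 e2 c1 c2, s =>
      if b.holds (e1.eval D med s) (e2.eval D med s) then c1.run D med s.tick
      else c2.run D med s.tick
  | .rep x e c, s => forIter (c.run D med) x (e.eval D med s).toNat s.tick

attribute [simp] Op1.eval Op2.eval Expr.eval Stm.run

end

/-! ### Frames -/

/-- `c` may write variable `y`. -/
def Stm.wv : Stm → ℕ → Bool
  | .set x _, y => x == y
  | .recv x _, y => x == y
  | .seq c1 c2, y => c1.wv y || c2.wv y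
  | .ite _ _ _ c1 c2, y => c1.wv y || c2.wv y
  | .rep x _ c, y => x == y || c.wv y
  | _, _ => false

/-- `c` may write array `α`. -/
def Stm.wa : Stm → ℕ → Bool
  | .put β _ _, α => β == α
  | .seq c1 c2, α => c1.wa α || c2.wa α
  | .ite _ _ _ c1 c2, α => c1.wa α || c2.wa α
  | .rep _ _ c, α => c.wa α
  | _, _ => false

def Stm.receives : Stm → Bool
  | .recv _ _ => true
  | .seq c1 c2 => c1.receives || c2.receives
  | .ite _ _ _ c1 c2 => c1.receives || c2.receives
  | .rep _ _ c => c.receives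
  | _ => false

def Stm.sends : Stm → Bool
  | .send _ _ => true
  | .seq c1 c2 => c1.sends || c2.sends
  | .ite _ _ _ c1 c2 => c1.sends || c2.sends
  | .rep _ _ c => c.sends
  | _ => false

/-- `s'` differs from `s` only where `c` may write. -/
structure Agree {P : Type u} {A : Type v} (c : Stm) (s s' : St P A) : Prop where
  var : ∀ y, c.wv y = false → s'.var y = s.var y
  arr : ∀ α, c.wa α = false → s'.arr α = s.arr α
  inbox : c.receives = false → s'.inbox = s.inbox
  outbox : c.sends = false → s'.outbox = s.outbox
  time : s.time ≤ s'.time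

section

variable {P : Type u} {A : Type v}

lemma Agree.refl (c : Stm) (s : St P A) : Agree c s s :=
  ⟨fun _ _ => rfl, fun _ _ => rfl, fun _ => rfl, fun _ => rfl, le_rfl⟩

lemma Agree.trans {c : Stm} {s1 s2 s3 : St P A} (h1 : Agree c s1 s2) (h2 : Agree c s2 s3) :
    Agree c s1 s3 where
  var y h := (h2.var y h).trans (h1.var y h)
  arr y h := (h2.arr y h).trans (h1.arr y h)
  inbox h := (h2.inbox h).trans (h1.inbox h)
  outbox h := (h2.outbox h).trans (h1.outbox h)
  time := h1.time.trans h2.time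

lemma Agree.tick (c : Stm) (s : St P A) : Agree c s s.tick :=
  ⟨fun _ _ => rfl, fun _ _ => rfl, fun _ => rfl, fun _ => rfl, by simp⟩

variable [MetricSpace P] [Fintype P] (D : A → PMF P) (med : A → P)

lemma Agree.forIter {x : ℕ} {e : Expr} {c : Stm} {s : St P A}
    (ih : ∀ s, Agree c s (c.run D med s)) (m : ℕ) :
    Agree (.rep x e c) s (forIter (c.run D med) x m s) := by
  induction m with
  | zero => exact Agree.refl _ _
  | succ m hm =>
    have h := ih ((CenterG.forIter (c.run D med) x m s).setVar x (.nat m))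
    refine hm.trans ⟨fun y hy => ?_, fun _ => h.arr _, h.inbox, h.outbox, ?_⟩
    · simp only [Stm.wv, Bool.or_eq_false_iff, beq_eq_false_iff_ne] at hy
      exact (h.var y hy.2).trans (by simp [hy.1.symm])
    · have := h.time
      simp [CenterG.forIter] at this ⊢; omega

lemma frame (c : Stm) (s : St P A) : Agree c s (c.run D med s) := by
  induction c generalizing s with
  | skip => exact Agree.refl _ _
  | seq c1 c2 h1 h2 =>
    have h1 := h1 s
    have h2 := h2 (c1.run D med s)
    constructor <;> simp_all [Stm.wv, Stm.wa, Stm.receives, Stm.sends, h1.var, h2.var, h1.arr,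
      h2.arr, h1.inbox, h2.inbox, h1.outbox, h2.outbox, h1.time.trans h2.time]
  | ite b e1 e2 c1 c2 h1 h2 =>
    have h1 := h1 s.tick
    have h2 := h2 s.tick
    simp only [Stm.run]
    split_ifs
    · refine (Agree.tick _ s).trans ⟨fun y h => h1.var y ?_, fun y h => h1.arr y ?_,
        fun h => h1.inbox ?_, fun h => h1.outbox ?_, h1.time⟩ <;>
        simp_all [Stm.wv, Stm.wa, Stm.receives, Stm.sends]
    · refine (Agree.tick _ s).trans ⟨fun y h => h2.var y ?_, fun y h => h2.arr y ?_,
        fun h => h2.inbox ?_, fun h => h2.outbox ?_, h2.time⟩ <;>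
        simp_all [Stm.wv, Stm.wa, Stm.receives, Stm.sends]
  | rep x e c ih => exact (Agree.tick _ s).trans (Agree.forIter D med ih _)
  | _ => constructor <;> simp_all [Stm.wv, Stm.wa, Stm.receives, Stm.sends, funext_iff] <;> grind

/-- Loop rule. In every round the frame of the loop is known. -/
lemma for_rule {x : ℕ} {e : Expr} {c : Stm} {s : St P A} {n : ℕ}
    (I : ℕ → St P A → Prop) (hn : (e.eval D med s).toNat = n) (h0 : I 0 s.tick)
    (step : ∀ i < n, ∀ s', Agree (.rep x e c) s s' → I i s' →
      I (i + 1) (c.run D med (s'.setVar x (.nat i)))) :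
    I n (Stm.run D med (.rep x e c) s) := by
  simp only [Stm.run, hn]
  have key : ∀ m ≤ n, I m (forIter (c.run D med) x m s.tick) := by
    intro m hm
    induction m with
    | zero => exact h0
    | succ m ih =>
      exact step m (by omega) _ ((Agree.tick _ s).trans (Agree.forIter D med (frame D med c) m))
        (ih (by omega))
  exact key n le_rfl

end

/-! ### Compilation -/

def vcell (x : ℕ) : ℕ := 4 * x + 1
def tmp (d : ℕ) : ℕ := 4 * d + 2
def lpc (d : ℕ) : ℕ := 4 * d + 3
def acell (α i : ℕ) : ℕ := (2 * i + 1) * 2 ^ (α + 2)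

lemma acell_mod (α i : ℕ) : acell α i % 4 = 0 := by
  simp [acell, pow_add, ← mul_assoc]

lemma acell_inj {α β i j : ℕ} (h : acell α i = acell β j) : α = β ∧ i = j := by
  unfold acell at h
  have aux : ∀ {α β i j : ℕ}, α < β → (2 * i + 1) * 2 ^ (α + 2) ≠ (2 * j + 1) * 2 ^ (β + 2) := by
    intro α β i j hlt h
    obtain ⟨d, rfl⟩ := Nat.exists_eq_add_of_lt hlt
    have h2 : (2 * i + 1) * 2 ^ (α + 2) = ((2 * j + 1) * 2 ^ d * 2) * 2 ^ (α + 2) := by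
      rw [h]; ring
    have := Nat.eq_of_mul_eq_mul_right (by positivity) h2
    omega
  rcases lt_trichotomy α β with hlt | rfl | hlt
  · exact absurd h (aux hlt)
  · have := Nat.eq_of_mul_eq_mul_right (by positivity) h
    exact ⟨rfl, by omega⟩
  · exact absurd h.symm (aux hlt)

/-- Doubles the number in cell `r` `m` times. -/
def doubleCmd (r : ℕ) : ℕ → Cmd
  | 0 => .skip
  | m + 1 => .seq (doubleCmd r m) (.instr (.add r r r))

/-- Replaces the index in cell `tmp d` by the address of that entry of array `α`. -/
def addrCmd (α d : ℕ) : Cmd :=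
  .seq (.instr (.add (tmp d) (tmp d) (tmp d)))
    (.seq (.instr (.const (tmp (d + 1)) 1))
      (.seq (.instr (.add (tmp d) (tmp d) (tmp (d + 1)))) (doubleCmd (tmp d) (α + 2))))

def Op1.instr (r a : ℕ) : Op1 → Instr
  | .ofNat => .ofNat r a
  | .expo => .expo r a
  | .median => .median r a

def Op2.instr (r a b : ℕ) : Op2 → Instr
  | .add => .add r a b
  | .sub => .sub r a b
  | .radd => .radd r a b
  | .rsub => .rsub r a b
  | .rmul => .rmul r a b
  | .rdiv => .rdiv r a b
  | .dist => .distance r a b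

def Cmp.test (a b : ℕ) : Cmp → Test
  | .nat => .natLe a b
  | .real => .realLe a b
  | .blank => .isBlank a

/-- Code that leaves the value of the expression in `tmp d`. -/
def Expr.compile : Expr → ℕ → Cmd
  | .const n, d => .instr (.const (tmp d) n)
  | .var x, d => .instr (.copy (tmp d) (vcell x))
  | .arr α e, d => .seq (e.compile d) (.seq (addrCmd α d) (.instr (.load (tmp d) (tmp d))))
  | .op1 o e, d => .seq (e.compile d) (.instr (o.instr (tmp d) (tmp d)))
  | .op2 o e1 e2, d => .seq (e1.compile d) (.seq (e2.compile (d + 1))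
      (.instr (o.instr (tmp d) (tmp d) (tmp (d + 1)))))
  | .trunc e1 e2 e3, d => .seq (e1.compile d) (.seq (e2.compile (d + 1))
      (.seq (e3.compile (d + 2)) (.instr (.trunc (tmp d) (tmp d) (tmp (d + 1)) (tmp (d + 2))))))
  | .cond b e1 e2 e3 e4, d => .seq (e1.compile d) (.seq (e2.compile (d + 1))
      (.ite (b.test (tmp d) (tmp (d + 1))) (e3.compile d) (e4.compile d)))

def Expr.steps : Expr → ℕ
  | .const _ => 1
  | .var _ => 1
  | .arr α e => e.steps + (α + 6)
  | .op1 _ e => e.steps + 1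
  | .op2 _ e1 e2 => e1.steps + e2.steps + 1
  | .trunc e1 e2 e3 => e1.steps + e2.steps + e3.steps + 1
  | .cond _ e1 e2 e3 e4 => e1.steps + e2.steps + e3.steps + e4.steps + 1

/-- The cells `lpc (2 * d)` and `lpc (2 * d + 1)` hold the counter and the bound of a
loop at nesting depth `d`. -/
def Stm.compile : Stm → ℕ → Cmd
  | .skip, _ => .skip
  | .set x e, _ => .seq (e.compile 0) (.instr (.copy (vcell x) (tmp 0)))
  | .put α i e, _ => .seq (e.compile 0) (.seq (i.compile 1) (.seq (addrCmd α 1)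
      (.instr (.store (tmp 1) (tmp 0)))))
  | .recv x p, _ => .seq (p.compile 0) (.instr (.recv (vcell x) (tmp 0)))
  | .send p e, _ => .seq (p.compile 0) (.seq (e.compile 1) (.instr (.send (tmp 0) (tmp 1))))
  | .seq c1 c2, d => .seq (c1.compile d) (c2.compile d)
  | .ite b e1 e2 c1 c2, d => .seq (e1.compile 0) (.seq (e2.compile 1)
      (.ite (b.test (tmp 0) (tmp 1)) (c1.compile d) (c2.compile d)))
  | .rep x e c, d => .seq (e.compile 0) (.seq (.instr (.copy (lpc (2 * d + 1)) (tmp 0)))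
      (.seq (.instr (.const (lpc (2 * d)) 1))
      (.loop (.natLe (lpc (2 * d)) (lpc (2 * d + 1))) (.seq (.instr (.const (tmp 0) 1))
        (.seq (.instr (.sub (vcell x) (lpc (2 * d)) (tmp 0)))
        (.seq (.instr (.add (lpc (2 * d)) (lpc (2 * d)) (tmp 0))) (c.compile (d + 1))))))))

/-- A bound on the machine steps per unit of time of the language. -/
def Stm.factor : Stm → ℕ
  | .skip => 1
  | .set _ e => e.steps + 1
  | .put α i e => e.steps + i.steps + (α + 7)
  | .recv _ p => p.steps + 1
  | .send p e => p.steps + e.steps + 1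
  | .seq c1 c2 => c1.factor + c2.factor
  | .ite _ e1 e2 c1 c2 => e1.steps + e2.steps + 1 + c1.factor + c2.factor
  | .rep _ e c => e.steps + 4 + c.factor

section

variable {P : Type u} {A : Type v}

structure Rel (s : St P A) (st : State P A) : Prop where
  var : ∀ x, st.mem (vcell x) = s.var x
  arr : ∀ α i, st.mem (acell α i) = s.arr α i
  inbox : st.inbox = s.inbox
  outbox : st.outbox = s.outbox

/-- `st'` differs from `st` at most in temporary cells from `d` on. -/
structure TmpEq (d : ℕ) (st st' : State P A) : Prop where
  mem : ∀ a, (∀ e, d ≤ e → a ≠ tmp e) → st'.mem a = st.mem a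
  inbox : st'.inbox = st.inbox
  outbox : st'.outbox = st.outbox

lemma TmpEq.trans {d d' : ℕ} {st1 st2 st3 : State P A} (h1 : TmpEq d st1 st2)
    (h2 : TmpEq d' st2 st3) (h : d ≤ d') : TmpEq d st1 st3 where
  mem a ha := (h2.mem a fun e he => ha e (h.trans he)).trans (h1.mem a ha)
  inbox := h2.inbox.trans h1.inbox
  outbox := h2.outbox.trans h1.outbox

lemma TmpEq.rel {d : ℕ} {s : St P A} {st st' : State P A} (h : TmpEq d st st') (hr : Rel s st) :
    Rel s st' where
  var x := (h.mem _ fun e _ => by unfold vcell tmp; omega).trans (hr.var x)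
  arr α i := (h.mem _ fun e _ => by
    have := acell_mod α i; unfold tmp; omega).trans (hr.arr α i)
  inbox := h.inbox.trans hr.inbox
  outbox := h.outbox.trans hr.outbox

lemma TmpEq.set {d e : ℕ} (st : State P A) (w : Word P A) (h : d ≤ e) :
    TmpEq d st (st.set (tmp e) w) where
  mem a ha := by simp [State.set, ha e h]
  inbox := rfl
  outbox := rfl

@[simp] lemma set_mem_self (st : State P A) (r : ℕ) (w : Word P A) : (st.set r w).mem r = w := by
  simp [State.set]

lemma set_mem_ne (st : State P A) {r a : ℕ} (w : Word P A) (h : a ≠ r) :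
    (st.set r w).mem a = st.mem a := by simp [State.set, h]

lemma TmpEq.keep {d : ℕ} {st st' : State P A} (h : TmpEq (d + 1) st st') :
    st'.mem (tmp d) = st.mem (tmp d) :=
  h.mem _ fun e he => by unfold tmp; omega

variable [MetricSpace P] [Fintype P] (D : A → PMF P) (med : A → P)

lemma doubleCmd_exec (r m : ℕ) (st : State P A) (n : ℕ) (h : st.nat r = n) :
    ∃ st', Exec D med (doubleCmd r m) st m st' ∧ st'.nat r = n * 2 ^ m ∧
      (∀ a ≠ r, st'.mem a = st.mem a) ∧ st'.inbox = st.inbox ∧ st'.outbox = st.outbox := by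
  induction m with
  | zero => exact ⟨st, .skip st, by simpa using h, fun _ _ => rfl, rfl, rfl⟩
  | succ m ih =>
    obtain ⟨st', he, hn, hm, hi, ho⟩ := ih
    refine ⟨_, .seq he (.instr _ _), ?_, fun a ha => ?_, hi, ho⟩
    · simp [Instr.run, State.nat, State.set] at hn ⊢
      rw [hn]; ring
    · simp [Instr.run, set_mem_ne _ _ ha, hm a ha]

lemma addrCmd_exec (α d : ℕ) (st : State P A) (i : ℕ) (h : st.nat (tmp d) = i) :
    ∃ st', Exec D med (addrCmd α d) st (α + 5) st' ∧ st'.nat (tmp d) = acell α i ∧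
      TmpEq d st st' := by
  have hne : tmp d ≠ tmp (d + 1) := by unfold tmp; omega
  set st1 := st.set (tmp d) (.nat (i + i)) with hst1
  set st2 := st1.set (tmp (d + 1)) (.nat 1) with hst2
  set st3 := st2.set (tmp d) (.nat (i + i + 1)) with hst3
  have e1 : Exec D med (.instr (.add (tmp d) (tmp d) (tmp d))) st 1 st1 := by
    have := Exec.instr (D := D) (med := med) (.add (tmp d) (tmp d) (tmp d)) st
    simpa [Instr.run, h] using this
  have e2 : Exec D med (.instr (.const (tmp (d + 1)) 1)) st1 1 st2 := Exec.instr _ _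
  have e3 : Exec D med (.instr (.add (tmp d) (tmp d) (tmp (d + 1)))) st2 1 st3 := by
    have := Exec.instr (D := D) (med := med) (.add (tmp d) (tmp d) (tmp (d + 1))) st2
    have h1 : st2.nat (tmp d) = i + i := by
      simp [State.nat, hst2, set_mem_ne _ _ hne, hst1]
    have h2 : st2.nat (tmp (d + 1)) = 1 := by simp [State.nat, hst2]
    simpa [Instr.run, h1, h2] using this
  obtain ⟨st4, e4, hn, hm, hi, ho⟩ := doubleCmd_exec D med (tmp d) (α + 2) st3 (i + i + 1)
    (by simp [State.nat, hst3])
  refine ⟨st4, ?_, ?_, ?_⟩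
  · have := Exec.seq e1 (Exec.seq e2 (Exec.seq e3 e4))
    rwa [show 1 + (1 + (1 + (α + 2))) = α + 5 by omega] at this
  · rw [hn]; unfold acell; ring
  · have t1 : TmpEq d st st1 := TmpEq.set _ _ le_rfl
    have t2 : TmpEq d st1 st2 := TmpEq.set _ _ (by omega)
    have t3 : TmpEq d st2 st3 := TmpEq.set _ _ le_rfl
    refine ((t1.trans t2 le_rfl).trans t3 le_rfl).trans (d' := d) ⟨fun a ha => ?_, hi, ho⟩ le_rfl
    exact hm a (ha d le_rfl)

lemma Op1.instr_run (o : Op1) (st : State P A) (r a : ℕ) :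
    (o.instr r a).run D med st = st.set r (o.eval med (st.mem a)) := by
  cases o <;> simp only [Op1.instr, Instr.run, Op1.eval, State.nat, State.real]
  cases st.mem a <;> rfl

lemma Op2.instr_run (o : Op2) (st : State P A) (r a b : ℕ) :
    (o.instr r a b).run D med st = st.set r (o.eval (st.mem a) (st.mem b)) := by
  cases o <;> simp only [Op2.instr, Instr.run, Op2.eval, State.nat, State.real]
  cases st.mem a <;> cases st.mem b <;> rfl

lemma trunc_run (st : State P A) (r a b c : ℕ) :
    (Instr.trunc r a b c).run D med st =
      st.set r (truncEval D (st.mem a) (st.mem b) (st.mem c)) := by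
  simp only [Instr.run, truncEval, State.real]
  cases st.mem a <;> cases st.mem b <;> rfl

lemma Cmp.test_holds (b : Cmp) (st : State P A) (x y : ℕ) :
    (b.test x y).holds st ↔ b.holds (st.mem x) (st.mem y) := by
  cases b <;> rfl

lemma Expr.compile_exec (e : Expr) (d : ℕ) (s : St P A) (st : State P A) (hr : Rel s st) :
    ∃ st' m, Exec D med (e.compile d) st m st' ∧ m ≤ e.steps ∧
      st'.mem (tmp d) = e.eval D med s ∧ TmpEq d st st' := by
  induction e generalizing d s st with
  | const n =>
    exact ⟨_, 1, .instr _ _, le_rfl, by simp [Instr.run], TmpEq.set _ _ le_rfl⟩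
  | var x =>
    exact ⟨_, 1, .instr _ _, le_rfl, by simp [Instr.run, hr.var], TmpEq.set _ _ le_rfl⟩
  | arr α e ih =>
    obtain ⟨st1, m, h1, hm, hv, t1⟩ := ih d s st hr
    obtain ⟨st2, h2, hv2, t2⟩ := addrCmd_exec D med α d st1 _ rfl
    refine ⟨_, _, .seq h1 (.seq h2 (.instr _ _)), ?_, ?_, ?_⟩
    · simp [Expr.steps]; omega
    · simp only [Instr.run, set_mem_self, hv2, Expr.eval]
      rw [((t1.trans t2 le_rfl).rel hr).arr, State.nat, hv]
    · exact (t1.trans t2 le_rfl).trans (TmpEq.set _ _ le_rfl) le_rfl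
  | op1 o e ih =>
    obtain ⟨st1, m, h1, hm, hv, t1⟩ := ih d s st hr
    refine ⟨_, _, .seq h1 (.instr _ _), ?_, ?_, ?_⟩
    · simp [Expr.steps]; omega
    · simp [Op1.instr_run, hv]
    · rw [Op1.instr_run]
      exact t1.trans (TmpEq.set _ _ le_rfl) le_rfl
  | op2 o e1 e2 ih1 ih2 =>
    obtain ⟨st1, m1, h1, hm1, hv1, t1⟩ := ih1 d s st hr
    obtain ⟨st2, m2, h2, hm2, hv2, t2⟩ := ih2 (d + 1) s st1 (t1.rel hr)
    refine ⟨_, _, .seq h1 (.seq h2 (.instr _ _)), ?_, ?_, ?_⟩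
    · simp [Expr.steps]; omega
    · simp [Op2.instr_run, t2.keep, hv1, hv2]
    · rw [Op2.instr_run]
      exact (t1.trans t2 (by omega)).trans (TmpEq.set _ _ le_rfl) le_rfl
  | trunc e1 e2 e3 ih1 ih2 ih3 =>
    obtain ⟨st1, m1, h1, hm1, hv1, t1⟩ := ih1 d s st hr
    obtain ⟨st2, m2, h2, hm2, hv2, t2⟩ := ih2 (d + 1) s st1 (t1.rel hr)
    obtain ⟨st3, m3, h3, hm3, hv3, t3⟩ := ih3 (d + 2) s st2 (t2.rel (t1.rel hr))
    refine ⟨_, _, .seq h1 (.seq h2 (.seq h3 (.instr _ _))), ?_, ?_, ?_⟩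
    · simp [Expr.steps]; omega
    · have := (t2.trans t3 (by omega)).keep
      simp [trunc_run, t3.keep, this, hv1, hv2, hv3]
    · rw [trunc_run]
      exact ((t1.trans t2 (by omega)).trans t3 (by omega)).trans (TmpEq.set _ _ le_rfl) le_rfl
  | cond b e1 e2 e3 e4 ih1 ih2 ih3 ih4 =>
    obtain ⟨st1, m1, h1, hm1, hv1, t1⟩ := ih1 d s st hr
    obtain ⟨st2, m2, h2, hm2, hv2, t2⟩ := ih2 (d + 1) s st1 (t1.rel hr)
    have hb : (b.test (tmp d) (tmp (d + 1))).holds st2 ↔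
        b.holds (e1.eval D med s) (e2.eval D med s) := by
      rw [Cmp.test_holds, t2.keep, hv1, hv2]
    by_cases h : b.holds (e1.eval D med s) (e2.eval D med s)
    · obtain ⟨st3, m3, h3, hm3, hv3, t3⟩ := ih3 d s st2 (t2.rel (t1.rel hr))
      refine ⟨_, _, .seq h1 (.seq h2 (.iteTrue (hb.2 h) h3)), ?_, ?_,
        (t1.trans t2 (by omega)).trans t3 le_rfl⟩
      · simp [Expr.steps]; omega
      · simp [h, hv3]
    · obtain ⟨st3, m3, h3, hm3, hv3, t3⟩ := ih4 d s st2 (t2.rel (t1.rel hr))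
      refine ⟨_, _, .seq h1 (.seq h2 (.iteFalse (fun h' => h (hb.1 h')) h3)), ?_, ?_,
        (t1.trans t2 (by omega)).trans t3 le_rfl⟩
      · simp [Expr.steps]; omega
      · simp [h, hv3]

lemma Rel.set_var {s : St P A} {st : State P A} (hr : Rel s st) (x : ℕ) (w : Word P A) :
    Rel (s.setVar x w) (st.set (vcell x) w) where
  var y := by
    by_cases h : y = x
    · subst h; simp
    · rw [set_mem_ne _ _ (by unfold vcell; omega), hr.var]; simp [h]
  arr α i := by
    rw [set_mem_ne _ _ (by have := acell_mod α i; unfold vcell; omega), hr.arr]; rfl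
  inbox := hr.inbox
  outbox := hr.outbox

lemma Rel.set_arr {s : St P A} {st : State P A} (hr : Rel s st) (α i : ℕ) (w : Word P A) :
    Rel (s.setArr α i w) (st.set (acell α i) w) where
  var y := by
    rw [set_mem_ne _ _ (by have := acell_mod α i; unfold vcell; omega), hr.var]; rfl
  arr β j := by
    by_cases h : β = α ∧ j = i
    · obtain ⟨rfl, rfl⟩ := h; simp
    · rw [set_mem_ne _ _ (fun h' => h (acell_inj h')), hr.arr]; simp [h]
  inbox := hr.inbox
  outbox := hr.outbox

lemma Rel.set_loop {s : St P A} {st : State P A} (hr : Rel s st) (d : ℕ) (w : Word P A) :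
    Rel s (st.set (lpc d) w) where
  var y := by rw [set_mem_ne _ _ (by unfold vcell lpc; omega), hr.var]
  arr α i := by
    rw [set_mem_ne _ _ (by have := acell_mod α i; unfold lpc; omega), hr.arr]
  inbox := hr.inbox
  outbox := hr.outbox

lemma Rel.tick {s : St P A} {st : State P A} (hr : Rel s st) : Rel s.tick st :=
  ⟨hr.var, hr.arr, hr.inbox, hr.outbox⟩

lemma TmpEq.loop {d : ℕ} {st st' : State P A} (h : TmpEq d st st') (e : ℕ) :
    st'.mem (lpc e) = st.mem (lpc e) :=
  h.mem _ fun e he => by unfold tmp lpc; omega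

/-- The compiled program simulates the program, and the loop cells below depth `d` are kept. -/
lemma Stm.compile_exec (c : Stm) (d : ℕ) (s : St P A) (st : State P A) (hr : Rel s st) :
    ∃ st' m, Exec D med (c.compile d) st m st' ∧
      m + c.factor * s.time ≤ c.factor * (c.run D med s).time ∧
      Rel (c.run D med s) st' ∧ ∀ e < 2 * d, st'.mem (lpc e) = st.mem (lpc e) := by
  induction c generalizing d s st with
  | skip =>
    exact ⟨st, 0, .skip st, by simp, hr, fun _ _ => rfl⟩
  | set x e =>
    obtain ⟨st1, m, h1, hm, hv, t1⟩ := e.compile_exec D med 0 s st hr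
    refine ⟨_, _, .seq h1 (.instr _ _), ?_, ?_, fun e' _ => ?_⟩
    · simp [Stm.factor, mul_add]; omega
    · simp only [Instr.run, hv, Stm.run]
      exact (t1.rel hr).set_var x _
    · simp only [Instr.run]
      rw [set_mem_ne _ _ (by unfold vcell lpc; omega), t1.loop]
  | put α i e =>
    obtain ⟨st1, m1, h1, hm1, hv1, t1⟩ := e.compile_exec D med 0 s st hr
    obtain ⟨st2, m2, h2, hm2, hv2, t2⟩ := i.compile_exec D med 1 s st1 (t1.rel hr)
    obtain ⟨st3, h3, hv3, t3⟩ := addrCmd_exec D med α 1 st2 _ rfl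
    have t := t2.trans t3 le_rfl
    refine ⟨_, _, .seq h1 (.seq h2 (.seq h3 (.instr _ _))), ?_, ?_, fun e' _ => ?_⟩
    · simp [Stm.factor, mul_add]; omega
    · simp only [Instr.run, hv3, Stm.run, t.keep, hv1]
      rw [State.nat, hv2]
      exact (t.rel (t1.rel hr)).set_arr _ _ _
    · simp only [Instr.run, hv3]
      rw [set_mem_ne _ _ (by
        have := acell_mod α (st2.nat (tmp 1)); unfold lpc; omega), t.loop, t1.loop]
  | recv x p =>
    obtain ⟨st1, m, h1, hm, hv, t1⟩ := p.compile_exec D med 0 s st hr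
    have hr1 := t1.rel hr
    refine ⟨_, _, .seq h1 (.instr _ _), ?_, ?_, fun e' _ => ?_⟩
    · simp [Stm.factor, mul_add]; omega
    · simp only [Instr.run, State.nat, hv, Stm.run, hr1.inbox]
      have h := hr1.set_var x ((s.inbox (p.eval D med s).toNat).headD .blank)
      exact ⟨h.var, h.arr, rfl, h.outbox⟩
    · simp only [Instr.run]
      rw [set_mem_ne _ _ (by unfold vcell lpc; omega), t1.loop]
  | send p e =>
    obtain ⟨st1, m1, h1, hm1, hv1, t1⟩ := p.compile_exec D med 0 s st hr
    obtain ⟨st2, m2, h2, hm2, hv2, t2⟩ := e.compile_exec D med 1 s st1 (t1.rel hr)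
    have hr2 := t2.rel (t1.rel hr)
    refine ⟨_, _, .seq h1 (.seq h2 (.instr _ _)), ?_, ?_, fun e' _ => ?_⟩
    · simp [Stm.factor, mul_add]; omega
    · simp only [Instr.run, State.nat, t2.keep, hv1, hv2, Stm.run, hr2.outbox]
      exact ⟨hr2.var, hr2.arr, hr2.inbox, rfl⟩
    · simp only [Instr.run]
      rw [t2.loop, t1.loop]
  | seq c1 c2 ih1 ih2 =>
    obtain ⟨st1, m1, h1, hm1, hr1, hl1⟩ := ih1 d s st hr
    obtain ⟨st2, m2, h2, hm2, hr2, hl2⟩ := ih2 d _ st1 hr1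
    refine ⟨_, _, .seq h1 h2, ?_, hr2, fun e he => (hl2 e he).trans (hl1 e he)⟩
    simp only [Stm.run, Stm.factor]
    have a1 := (frame D med c1 s).time
    have a2 := (frame D med c2 (c1.run D med s)).time
    nlinarith [Nat.mul_le_mul_left c1.factor a2, Nat.mul_le_mul_left c2.factor a1]
  | ite b e1 e2 c1 c2 ih1 ih2 =>
    obtain ⟨st1, m1, h1, hm1, hv1, t1⟩ := e1.compile_exec D med 0 s st hr
    obtain ⟨st2, m2, h2, hm2, hv2, t2⟩ := e2.compile_exec D med 1 s st1 (t1.rel hr)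
    have hr2 := t2.rel (t1.rel hr)
    have hb : (b.test (tmp 0) (tmp 1)).holds st2 ↔
        b.holds (e1.eval D med s) (e2.eval D med s) := by
      rw [Cmp.test_holds, t2.keep, hv1, hv2]
    by_cases h : b.holds (e1.eval D med s) (e2.eval D med s)
    · obtain ⟨st3, m3, h3, hm3, hr3, hl3⟩ := ih1 d s.tick st2 hr2.tick
      have a := (frame D med c1 s.tick).time
      refine ⟨st3, _, .seq h1 (.seq h2 (.iteTrue (hb.2 h) h3)), ?_, ?_, fun e he => ?_⟩
      · simp only [Stm.run, h, if_true, Stm.factor]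
        simp only [St.tick_time] at a hm3
        nlinarith [Nat.mul_le_mul_left (e1.steps + e2.steps + 1 + c2.factor) a]
      · simp only [Stm.run, h, if_true]; exact hr3
      · rw [hl3 e he, t2.loop, t1.loop]
    · obtain ⟨st3, m3, h3, hm3, hr3, hl3⟩ := ih2 d s.tick st2 hr2.tick
      have a := (frame D med c2 s.tick).time
      refine ⟨st3, _, .seq h1 (.seq h2 (.iteFalse (fun h' => h (hb.1 h')) h3)), ?_, ?_,
        fun e he => ?_⟩
      · simp only [Stm.run, h, if_false, Stm.factor]
        simp only [St.tick_time] at a hm3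
        nlinarith [Nat.mul_le_mul_left (e1.steps + e2.steps + 1 + c1.factor) a]
      · simp only [Stm.run, h, if_false]; exact hr3
      · rw [hl3 e he, t2.loop, t1.loop]
  | rep x e c ih =>
    obtain ⟨st1, m1, h1, hm1, hv1, t1⟩ := e.compile_exec D med 0 s st hr
    set n := (e.eval D med s).toNat with hn
    set st2 := st1.set (lpc (2 * d + 1)) (e.eval D med s) with hst2
    set st3 := st2.set (lpc (2 * d)) (.nat 1) with hst3
    have hr3 : Rel s.tick st3 := (((t1.rel hr).set_loop _ _).set_loop _ _).tick
    have hne : lpc (2 * d) ≠ lpc (2 * d + 1) := by unfold lpc; omega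
    set body := (Cmd.seq (.instr (.const (tmp 0) 1))
        (.seq (.instr (.sub (vcell x) (lpc (2 * d)) (tmp 0)))
        (.seq (.instr (.add (lpc (2 * d)) (lpc (2 * d)) (tmp 0))) (c.compile (d + 1))))) with hbody
    have loop : ∀ r j : ℕ, j + r = n → ∀ st : State P A,
        Rel (forIter (c.run D med) x j s.tick) st → st.nat (lpc (2 * d)) = j + 1 →
        st.nat (lpc (2 * d + 1)) = n →
        ∃ st' m, Exec D med (.loop (.natLe (lpc (2 * d)) (lpc (2 * d + 1))) body)
          st m st' ∧ m + (c.factor + 4) * (forIter (c.run D med) x j s.tick).time ≤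
            (c.factor + 4) * (forIter (c.run D med) x n s.tick).time + 1 ∧
          Rel (forIter (c.run D med) x n s.tick) st' ∧
          ∀ e < 2 * d, st'.mem (lpc e) = st.mem (lpc e) := by
      intro r
      induction r with
      | zero =>
        intro j hj st hr hc hN
        obtain rfl : j = n := by omega
        refine ⟨st, 1, .loopFalse ?_, by omega, hr, fun _ _ => rfl⟩
        simp only [Test.holds, hc, hN]; omega
      | succ r ihr =>
        intro j hj st hr hc hN
        set sa := st.set (tmp 0) (.nat 1) with hsa
        have ta : TmpEq 0 st sa := TmpEq.set _ _ le_rfl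
        set sb := sa.set (vcell x) (.nat j) with hsb
        set sc := sb.set (lpc (2 * d)) (.nat (j + 1 + 1)) with hsc
        have ha : Exec D med (.instr (.const (tmp 0) 1)) st 1 sa := .instr _ _
        have hb : Exec D med (.instr (.sub (vcell x) (lpc (2 * d)) (tmp 0))) sa 1 sb := by
          have := Exec.instr (D := D) (med := med) (.sub (vcell x) (lpc (2 * d)) (tmp 0)) sa
          have h1 : sa.nat (lpc (2 * d)) = j + 1 := by rw [State.nat, ta.loop]; exact hc
          have h2 : sa.nat (tmp 0) = 1 := by simp [State.nat, hsa]
          simpa [Instr.run, h1, h2] using this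
        have hcc : Exec D med (.instr (.add (lpc (2 * d)) (lpc (2 * d)) (tmp 0)))
            sb 1 sc := by
          have := Exec.instr (D := D) (med := med) (.add (lpc (2 * d)) (lpc (2 * d)) (tmp 0)) sb
          have h1 : sb.nat (lpc (2 * d)) = j + 1 := by
            rw [State.nat, hsb, set_mem_ne _ _ (by unfold vcell lpc; omega), ta.loop]
            exact hc
          have h2 : sb.nat (tmp 0) = 1 := by
            rw [State.nat, hsb, set_mem_ne _ _ (by unfold vcell tmp; omega)]
            simp [hsa]
          simpa [Instr.run, h1, h2] using this
        have hrc : Rel ((forIter (c.run D med) x j s.tick).setVar x (.nat j)) sc :=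
          ((ta.rel hr).set_var x _).set_loop _ _
        obtain ⟨sd, md, hd, hmd, hrd, hld⟩ := ih (d + 1) _ sc hrc
        have hsc1 : sc.nat (lpc (2 * d)) = j + 1 + 1 := by simp [State.nat, hsc]
        have hscl : ∀ e, e ≠ 2 * d → sc.mem (lpc e) = st.mem (lpc e) := by
          intro e he
          rw [hsc, set_mem_ne _ _ (by unfold lpc; omega), hsb,
            set_mem_ne _ _ (by unfold vcell lpc; omega), ta.loop]
        obtain ⟨se, me, hee, hme, hre, hle⟩ := ihr (j + 1) (by omega) sd hrd
          (by rw [State.nat, hld _ (by omega)]; exact hsc1)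
          (by rw [State.nat, hld _ (by omega), hscl _ (by omega)]; exact hN)
        refine ⟨se, _, .loopTrue ?_ (.seq ha (.seq hb (.seq hcc hd))) hee, ?_, hre, fun e he => ?_⟩
        · simp only [Test.holds, hc, hN]; omega
        · have a := (frame D med c ((forIter (c.run D med) x j s.tick).setVar x (.nat j))).time
          simp only [St.setVar_time] at hmd a
          simp only [forIter] at hme
          nlinarith
        · rw [hle e he, hld e (by omega), hscl e (by omega)]
    obtain ⟨st4, m4, h4, hm4, hr4, hl4⟩ := loop n 0 (by omega) st3 hr3 (by simp [State.nat, hst3])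
      (by rw [State.nat, hst3, set_mem_ne _ _ hne.symm, hst2, set_mem_self, hn])
    have hcopy : Exec D med (.instr (.copy (lpc (2 * d + 1)) (tmp 0))) st1 1 st2 := by
      have := Exec.instr (D := D) (med := med) (.copy (lpc (2 * d + 1)) (tmp 0)) st1
      simpa [Instr.run, hv1] using this
    refine ⟨st4, _, .seq h1 (.seq hcopy (.seq (.instr _ _) h4)), ?_, hr4, fun e he => ?_⟩
    · simp only [Stm.run, Stm.factor, ← hn]
      have a := (Agree.forIter (x := x) (e := e) (s := s.tick) D med (frame D med c) n).time
      simp only [forIter, St.tick_time] at hm4 a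
      nlinarith [Nat.mul_le_mul_left e.steps a]
    · rw [hl4 e he, hst3, set_mem_ne _ _ (by unfold lpc; omega), hst2,
        set_mem_ne _ _ (by unfold lpc; omega), t1.loop]

end

section
variable {P : Type u} {A : Type v} [MetricSpace P] [Fintype P] [Nontrivial P] {k t n : ℕ} {ε : ℝ}

/-! ## Truncated expected distances and the cost of a solution -/

lemma pmf_sum (μ : PMF P) : ∑ x, (μ x).toReal = 1 := by
  have h := μ.tsum_coe
  rw [tsum_fintype] at h
  rw [← ENNReal.toReal_sum fun x _ => μ.apply_ne_top x, h, ENNReal.toReal_one]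

lemma rho_nonneg (μ : PMF P) (τ : ℝ) (y : P) : 0 ≤ rho μ τ y :=
  Finset.sum_nonneg fun _ _ => mul_nonneg ENNReal.toReal_nonneg (le_max_right _ _)

lemma rho_anti (μ : PMF P) {τ τ' : ℝ} (h : τ ≤ τ') (y : P) : rho μ τ' y ≤ rho μ τ y :=
  sum_le_sum fun _ _ => mul_le_mul_of_nonneg_left
    (max_le_max (by linarith) le_rfl) ENNReal.toReal_nonneg

lemma rho_zero (μ : PMF P) (y : P) : rho μ 0 y = ∑ x, (μ x).toReal * dist x y := by
  unfold rho
  refine sum_congr rfl fun x _ => ?_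
  rw [sub_zero, max_eq_left dist_nonneg]

/-- Averaging a pointwise bound. -/
lemma rho_le_of_forall (μ : PMF P) {τ τ' c d : ℝ} {y z : P}
    (h : ∀ x, max (dist x y - τ) 0 ≤ c * max (dist x z - τ') 0 + d) :
    rho μ τ y ≤ c * rho μ τ' z + d := by
  calc rho μ τ y ≤ ∑ x, (μ x).toReal * (c * max (dist x z - τ') 0 + d) :=
        sum_le_sum fun x _ => mul_le_mul_of_nonneg_left (h x) ENNReal.toReal_nonneg
    _ = c * rho μ τ' z + (∑ x, (μ x).toReal) * d := by
        simp only [rho, mul_add, sum_add_distrib, mul_sum, sum_mul]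
        congr 1
        exact sum_congr rfl fun x _ => by ring
    _ = _ := by rw [pmf_sum, one_mul]

lemma rho_shift (μ : PMF P) {τ T : ℝ} {y z : P} (h : τ + dist z y ≤ T) :
    rho μ T y ≤ rho μ τ z := by
  have := rho_le_of_forall (τ := T) (τ' := τ) (c := 1) (d := 0) (y := y) (z := z) μ fun x => by
    have := dist_triangle x z y
    rw [one_mul, add_zero]
    exact max_le_max (by linarith) le_rfl
  simpa using this

lemma rho_zero_le (μ : PMF P) {τ : ℝ} (_ : 0 ≤ τ) (y : P) : rho μ 0 y ≤ rho μ τ y + τ := by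
  have := rho_le_of_forall (τ := 0) (τ' := τ) (c := 1) (d := τ) (y := y) (z := y) μ fun x => by
    rw [one_mul, sub_zero, max_eq_left dist_nonneg]
    linarith [le_max_left (dist x y - τ) 0]
  simpa using this

lemma IsMedian.rho_zero_le {μ : PMF P} {m : P} (hm : IsMedian μ m) (y : P) :
    rho μ 0 m ≤ rho μ 0 y := by
  rw [rho_zero, rho_zero]; exact hm y

lemma IsMedian.dist_le_zero {μ : PMF P} {m : P} (hm : IsMedian μ m) (y : P) :
    dist m y ≤ 2 * rho μ 0 y := by
  have h : dist m y ≤ rho μ 0 m + rho μ 0 y := by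
    rw [rho_zero, rho_zero, ← sum_add_distrib]
    calc dist m y = (∑ x, (μ x).toReal) * dist m y := by rw [pmf_sum, one_mul]
      _ = ∑ x, (μ x).toReal * dist m y := sum_mul _ _ _
      _ ≤ _ := sum_le_sum fun x _ => by
        rw [← mul_add]
        exact mul_le_mul_of_nonneg_left (dist_triangle_left m y x) ENNReal.toReal_nonneg
  linarith [hm.rho_zero_le y]

lemma IsMedian.dist_le {μ : PMF P} {m : P} (hm : IsMedian μ m) {τ : ℝ} (hτ : 0 ≤ τ) (y : P) :
    dist m y ≤ 2 * (τ + rho μ τ y) := by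
  linarith [hm.dist_le_zero y, CenterG.rho_zero_le μ hτ y]

lemma IsMedian.rho_le {μ : PMF P} {m : P} (hm : IsMedian μ m) {τ : ℝ} (hτ : 0 ≤ τ) (y : P) :
    rho μ (3 * τ) m ≤ 3 * rho μ τ y := by
  have h := hm.dist_le hτ y
  have := rho_le_of_forall (τ := 3 * τ) (τ' := τ) (c := 1) (d := 2 * rho μ τ y) (y := m) (z := y) μ
    fun x => by
      have h3 := dist_triangle_right x m y
      have := le_max_left (dist x y - τ) 0
      have := le_max_right (dist x y - τ) 0
      have := rho_nonneg μ τ y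
      refine max_le ?_ (by linarith)
      linarith
  linarith

/-! ### Distances -/

lemma dist_set_finite : {r | ∃ x y : P, x ≠ y ∧ r = dist x y}.Finite := by
  refine (Set.finite_range fun z : P × P => dist z.1 z.2).subset ?_
  rintro r ⟨x, y, -, rfl⟩
  exact ⟨(x, y), rfl⟩

lemma dmin_le {x y : P} (h : x ≠ y) : dmin P ≤ dist x y :=
  csInf_le dist_set_finite.bddBelow ⟨x, y, h, rfl⟩

lemma eq_of_dist_lt {x y : P} (h : dist x y < dmin P) : x = y := by
  by_contra hne
  exact absurd (dmin_le hne) (not_le.2 h)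

lemma dmin_pos : 0 < dmin P := by
  obtain ⟨x, y, h⟩ := exists_pair_ne P
  have hne : {r | ∃ x y : P, x ≠ y ∧ r = dist x y}.Nonempty := ⟨_, x, y, h, rfl⟩
  obtain ⟨a, b, hab, he⟩ := hne.csInf_mem dist_set_finite
  have : dmin P = dist a b := he
  rw [this]; exact dist_pos.2 hab

lemma dist_le_dmax (x y : P) : dist x y ≤ dmax P := by
  have h' : ∀ x y : P, x ≠ y → dist x y ≤ dmax P := fun x y h =>
    le_csSup dist_set_finite.bddAbove ⟨x, y, h, rfl⟩
  by_cases h : x = y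
  · obtain ⟨a, b, hab⟩ := exists_pair_ne P
    rw [h, dist_self]
    exact dist_nonneg.trans (h' a b hab)
  · exact h' x y h

lemma dmin_le_dmax : dmin P ≤ dmax P := by
  obtain ⟨a, b, hab⟩ := exists_pair_ne P
  exact (dmin_le hab).trans (dist_le_dmax a b)

lemma rho_eq_zero (μ : PMF P) {T : ℝ} (h : dmax P ≤ T) (y : P) : rho μ T y = 0 :=
  sum_eq_zero fun x _ => by
    rw [max_eq_right (by linarith [dist_le_dmax x y]), mul_zero]

lemma rho_zero_le_small (μ : PMF P) (y : P) :
    rho μ 0 y ≤ 4 / 3 * rho μ (dmin P / 4) y := by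
  have := rho_le_of_forall (τ := 0) (τ' := dmin P / 4) (c := 4 / 3) (d := 0) (y := y) (z := y) μ
    fun x => by
      rw [sub_zero, max_eq_left dist_nonneg, add_zero]
      by_cases h : x = y
      · subst h; rw [dist_self]; have := le_max_right (0 - dmin P / 4) 0; linarith
      · have := dmin_le h
        have := le_max_left (dist x y - dmin P / 4) 0
        linarith
  simpa using this

/-- If all `rho` mass is that of distances at least `dmin`. -/
lemma rho_zero_lower {μ : PMF P} {m : P} {δ : ℝ} (hδ : ∀ x, μ x ≠ 0 → δ ≤ (μ x).toReal)
    (h : rho μ 0 m ≠ 0) (hu : 0 ≤ dmin P) : δ * dmin P ≤ rho μ 0 m := by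
  rw [rho_zero] at h ⊢
  obtain ⟨x, -, hx⟩ := exists_ne_zero_of_sum_ne_zero h
  have h1 : μ x ≠ 0 := fun h0 => hx (by simp [h0])
  have h2 : x ≠ m := fun h0 => hx (by simp [h0])
  calc δ * dmin P ≤ (μ x).toReal * dist x m :=
        mul_le_mul (hδ x h1) (dmin_le h2) hu ENNReal.toReal_nonneg
    _ ≤ _ := single_le_sum (f := fun x => (μ x).toReal * dist x m)
        (fun x _ => mul_nonneg ENNReal.toReal_nonneg dist_nonneg) (mem_univ x)

/-! ### The cost -/

variable (X : Input P)

/-- Expectation over the independent realization of all nodes. -/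
def expect (f : (X.Node → P) → ℝ) : ℝ :=
  ∑ σ : X.Node → P, (∏ a, (X.law a (σ a)).toReal) * f σ

lemma expect_mono {f g : (X.Node → P) → ℝ} (h : ∀ σ, f σ ≤ g σ) : expect X f ≤ expect X g :=
  sum_le_sum fun σ _ => mul_le_mul_of_nonneg_left (h σ)
    (Finset.prod_nonneg fun _ _ => ENNReal.toReal_nonneg)

lemma expect_prod (g : X.Node → P → ℝ) :
    expect X (fun σ => ∏ a, g a (σ a)) = ∏ a, ∑ x, (X.law a x).toReal * g a x := by
  rw [prod_univ_sum]
  simp only [expect, Fintype.piFinset_univ, ← prod_mul_distrib]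

lemma expect_sum {ι : Type*} (s : Finset ι) (f : ι → (X.Node → P) → ℝ) :
    expect X (fun σ => ∑ i ∈ s, f i σ) = ∑ i ∈ s, expect X (f i) := by
  simp only [expect, mul_sum]
  exact Finset.sum_comm

lemma expect_add (f g : (X.Node → P) → ℝ) :
    expect X (fun σ => f σ + g σ) = expect X f + expect X g := by
  simp only [expect, mul_add, sum_add_distrib]

lemma expect_const (c : ℝ) : expect X (fun _ => c) = c := by
  have h := expect_prod X fun _ _ => 1
  simp only [prod_const_one, mul_one, pmf_sum] at h
  simp only [expect, mul_one] at h
  simp only [expect, ← sum_mul, h, one_mul]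

lemma expect_mul_prod_erase (a : X.Node) (f : P → ℝ) (g : X.Node → P → ℝ) :
    expect X (fun σ => f (σ a) * ∏ b ∈ univ.erase a, g b (σ b)) =
      (∑ x, (X.law a x).toReal * f x) *
        ∏ b ∈ univ.erase a, ∑ x, (X.law b x).toReal * g b x := by
  classical
  have h := expect_prod X fun b x => if b = a then f x else g b x
  rw [← mul_prod_erase univ _ (mem_univ a)] at h
  simp only [if_true] at h
  rw [prod_congr rfl (g := fun b => ∑ x, (X.law b x).toReal * g b x)
    (fun b hb => by simp [ne_of_mem_erase hb])] at h
  rw [← h]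
  congr 1
  funext σ
  rw [← mul_prod_erase univ _ (mem_univ a)]
  simp only [if_true]
  congr 1
  exact prod_congr rfl fun b hb => by simp [ne_of_mem_erase hb]

lemma expect_apply (a : X.Node) (f : P → ℝ) :
    expect X (fun σ => f (σ a)) = ∑ x, (X.law a x).toReal * f x := by
  have h := expect_mul_prod_erase X a f fun _ _ => 1
  simpa [pmf_sum] using h

variable {X}

lemma cost_eq (S : Solution P X.Node) : cost X S = expect X fun σ =>
    (((univ \ S.O).sup fun a => nndist (σ a) (S.asg a) : ℝ≥0) : ℝ) := rfl

lemma cost_nonneg (S : Solution P X.Node) : 0 ≤ cost X S :=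
  Finset.sum_nonneg fun _ _ => mul_nonneg
    (Finset.prod_nonneg fun _ _ => ENNReal.toReal_nonneg) (NNReal.coe_nonneg _)

lemma dist_le_sup (S : Solution P X.Node) (σ : X.Node → P) {a : X.Node} (ha : a ∉ S.O) :
    dist (σ a) (S.asg a) ≤
      (((univ \ S.O).sup fun a => nndist (σ a) (S.asg a) : ℝ≥0) : ℝ) := by
  rw [← coe_nndist, NNReal.coe_le_coe]
  exact Finset.le_sup (f := fun a => nndist (σ a) (S.asg a)) (by simp [ha])

lemma cost_le (S : Solution P X.Node) {T : ℝ} (hT : 0 ≤ T) :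
    cost X S ≤ T + ∑ a ∈ univ \ S.O, rho (X.law a) T (S.asg a) := by
  have h : ∀ σ : X.Node → P,
      (((univ \ S.O).sup fun a => nndist (σ a) (S.asg a) : ℝ≥0) : ℝ) ≤
        T + ∑ a ∈ univ \ S.O, max (dist (σ a) (S.asg a) - T) 0 := by
    intro σ
    have h0 : 0 ≤ T + ∑ a ∈ univ \ S.O, max (dist (σ a) (S.asg a) - T) 0 :=
      add_nonneg hT (Finset.sum_nonneg fun _ _ => le_max_right _ _)
    rw [← NNReal.coe_mk _ h0, NNReal.coe_le_coe]
    refine Finset.sup_le fun a ha => ?_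
    rw [← NNReal.coe_le_coe, coe_nndist, NNReal.coe_mk]
    have h1 := single_le_sum (f := fun a => max (dist (σ a) (S.asg a) - T) 0)
      (fun _ _ => le_max_right _ _) ha
    have h2 := le_max_left (dist (σ a) (S.asg a) - T) 0
    linarith
  rw [cost_eq]
  refine (expect_mono X h).trans_eq ?_
  rw [expect_add X (fun _ => T), expect_const, expect_sum]
  congr 1
  refine sum_congr rfl fun a _ => ?_
  exact expect_apply X a fun x => max (dist x (S.asg a) - T) 0

lemma sum_rho_le_cost (S : Solution P X.Node) {τ : ℝ} (hτ : 0 < τ) (h : 2 * cost X S ≤ τ) :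
    ∑ a ∈ univ \ S.O, rho (X.law a) τ (S.asg a) ≤ 2 * cost X S := by
  classical
  set W : (X.Node → P) → ℝ := fun σ =>
    (((univ \ S.O).sup fun a => nndist (σ a) (S.asg a) : ℝ≥0) : ℝ) with hW
  set g : X.Node → P → ℝ := fun b x => if b ∉ S.O ∧ τ < dist x (S.asg b) then 0 else 1 with hg
  have hg0 : ∀ b x, 0 ≤ g b x := fun b x => by simp only [hg]; split_ifs <;> norm_num
  have hg1 : ∀ b x, g b x ≤ 1 := fun b x => by simp only [hg]; split_ifs <;> norm_num
  set Q : X.Node → ℝ := fun b => ∑ x, (X.law b x).toReal * g b x with hQ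
  have hQ0 : ∀ b, 0 ≤ Q b := fun b => Finset.sum_nonneg fun x _ =>
    mul_nonneg ENNReal.toReal_nonneg (hg0 b x)
  have hQ1 : ∀ b, Q b ≤ 1 := fun b => by
    rw [← pmf_sum (X.law b)]
    exact sum_le_sum fun x _ => mul_le_of_le_one_right ENNReal.toReal_nonneg (hg1 b x)
  have hW0 : ∀ σ, 0 ≤ W σ := fun σ => NNReal.coe_nonneg _
  -- no distance exceeds `τ` with probability at least one half
  have hhalf : 1 / 2 ≤ ∏ b, Q b := by
    have hp : ∀ σ : X.Node → P, 1 ≤ (∏ b, g b (σ b)) + τ⁻¹ * W σ := by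
      intro σ
      by_cases hall : ∀ b, g b (σ b) = 1
      · rw [prod_eq_one fun b _ => hall b]
        have := mul_nonneg (inv_nonneg.2 hτ.le) (hW0 σ)
        linarith
      · push Not at hall
        obtain ⟨b, hb⟩ := hall
        have hb' : b ∉ S.O ∧ τ < dist (σ b) (S.asg b) := by
          by_contra hc
          exact hb (by simp only [hg]; rw [if_neg hc])
        have h1 := dist_le_sup S σ hb'.1
        have h2 : 0 ≤ ∏ b, g b (σ b) := Finset.prod_nonneg fun b _ => hg0 b _
        have h3 : 1 ≤ τ⁻¹ * W σ := by
          rw [inv_mul_eq_div, le_div_iff₀ hτ, one_mul]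
          exact hb'.2.le.trans h1
        linarith
    have := expect_mono X hp
    rw [expect_const, expect_add, expect_prod] at this
    have h2 : expect X (fun σ => τ⁻¹ * W σ) = τ⁻¹ * cost X S := by
      rw [cost_eq]
      simp only [expect, mul_sum]
      exact sum_congr rfl fun σ _ => by rw [hW]; ring
    rw [h2] at this
    have h3 : τ⁻¹ * cost X S ≤ 1 / 2 := by
      rw [inv_mul_eq_div, div_le_iff₀ hτ]; linarith
    linarith
  have hpt : ∀ σ : X.Node → P, ∑ a ∈ univ \ S.O,
      max (dist (σ a) (S.asg a) - τ) 0 * ∏ b ∈ univ.erase a, g b (σ b) ≤ W σ := by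
    intro σ
    by_cases hall : ∀ a ∉ S.O, dist (σ a) (S.asg a) ≤ τ
    · rw [sum_eq_zero fun a ha => ?_]
      · exact hW0 σ
      · rw [max_eq_right (by linarith [hall a (by simpa using ha)]), zero_mul]
    · push Not at hall
      obtain ⟨c, hc, hcτ⟩ := hall
      rw [sum_eq_single_of_mem c (by simpa using hc)]
      · have h1 : ∏ b ∈ univ.erase c, g b (σ b) ≤ 1 :=
          Finset.prod_le_one (fun b _ => hg0 b _) fun b _ => hg1 b _
        refine (mul_le_of_le_one_right (le_max_right _ _) h1).trans ?_
        refine max_le ?_ (hW0 σ)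
        have := dist_le_sup S σ hc
        simp only [hW]; linarith
      · intro a _ hac
        rw [prod_eq_zero (i := c) (by simp [Ne.symm hac]), mul_zero]
        simp only [hg]; rw [if_pos ⟨hc, hcτ⟩]
  have hE := expect_mono X hpt
  rw [expect_sum, ← cost_eq] at hE
  have hterm : ∀ a ∈ univ \ S.O, rho (X.law a) τ (S.asg a) * (1 / 2) ≤
      expect X (fun σ => max (dist (σ a) (S.asg a) - τ) 0 *
        ∏ b ∈ univ.erase a, g b (σ b)) := by
    intro a _
    rw [expect_mul_prod_erase X a (fun x => max (dist x (S.asg a) - τ) 0) g]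
    refine mul_le_mul_of_nonneg_left ?_ (rho_nonneg _ _ _)
    refine hhalf.trans ?_
    rw [← mul_prod_erase univ _ (mem_univ a)]
    exact mul_le_of_le_one_left (Finset.prod_nonneg fun b _ => hQ0 b) (hQ1 a)
  have := (sum_le_sum hterm).trans hE
  rw [← sum_mul] at this
  linarith

lemma exists_opt [Nonempty P] (X : Input P) (hk : 1 ≤ k) (t : ℕ) :
    ∃ S : Solution P X.Node, S.Feasible k t ∧ cost X S = optCost X k t := by
  classical
  have hfin : Finite (Solution P X.Node) := by
    refine Finite.of_injective (fun S : Solution P X.Node => (S.K, S.O, S.asg)) fun S S' h => ?_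
    cases S; cases S'; simp_all
  have hs : {c | ∃ S : Solution P X.Node, S.Feasible k t ∧ c = cost X S}.Finite :=
    (Set.finite_range (cost X)).subset (by rintro _ ⟨S, -, rfl⟩; exact ⟨S, rfl⟩)
  obtain ⟨p⟩ := ‹Nonempty P›
  have hne : {c | ∃ S : Solution P X.Node, S.Feasible k t ∧ c = cost X S}.Nonempty :=
    ⟨_, ⟨{p}, ∅, fun _ => p⟩, ⟨by simpa using hk, by simp, fun _ => by simp⟩, rfl⟩
  obtain ⟨S, hS, he⟩ := hne.csInf_mem hs
  exact ⟨S, hS, he.symm⟩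

/-! ## Levels -/

/-- Binary exponent of a real number. -/
def expo (x : ℝ) : ℕ := Nat.log 2 ⌊x⌋₊

lemma expo_le_iff {x : ℝ} (hx : 0 ≤ x) (G : ℕ) : expo x ≤ G ↔ x < 2 ^ (G + 1) := by
  have h1 : Nat.log 2 ⌊x⌋₊ ≤ G ↔ ⌊x⌋₊ < 2 ^ (G + 1) := by
    rcases Nat.eq_zero_or_pos ⌊x⌋₊ with h | h
    · simp [h]
    · rw [← Nat.lt_succ_iff, Nat.log_lt_iff_lt_pow one_lt_two h.ne']
  rw [expo, h1, Nat.floor_lt hx]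
  push_cast; rfl

lemma le_expo_iff {x : ℝ} (hx : 1 ≤ x) (G : ℕ) : G ≤ expo x ↔ 2 ^ G ≤ x := by
  rcases G with _ | G
  · simpa using hx
  · rw [Nat.succ_le_iff, ← not_le, expo_le_iff (by linarith), not_lt]

lemma pow_expo_le {x : ℝ} (hx : 1 ≤ x) : 2 ^ expo x ≤ x := (le_expo_iff hx _).1 le_rfl

lemma lt_pow_expo {x : ℝ} (hx : 0 ≤ x) : x < 2 ^ (expo x + 1) := (expo_le_iff hx _).1 le_rfl

lemma expo_mono {x y : ℝ} (h : x ≤ y) : expo x ≤ expo y :=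
  Nat.log_mono_right (Nat.floor_mono h)

/-- Levels are ordered by this value: `(0, 0)`, then `(0, m)` for decreasing `m ≥ 2`, then
`(p, 0)` for increasing `p`. -/
def V (p m : ℕ) : ℝ := if m = 0 then p else p + 1 / m

def ValidPair (p m : ℕ) : Prop := m = 0 ∨ (p = 0 ∧ 2 ≤ m)

lemma V_nonneg (p m : ℕ) : 0 ≤ V p m := by
  unfold V; split_ifs <;> positivity

lemma le_V (p m : ℕ) : (p : ℝ) ≤ V p m := by
  unfold V; split_ifs
  · exact le_rfl
  · have : (0 : ℝ) ≤ 1 / m := by positivity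
    linarith

lemma ValidPair.V_lt {p m : ℕ} (h : ValidPair p m) : V p m < p + 1 := by
  unfold V; split_ifs with hm
  · linarith
  · rcases h with h | ⟨-, h⟩
    · exact absurd h hm
    · have : (1 : ℝ) < m := by exact_mod_cast h
      have : (1 : ℝ) / m < 1 := by rw [div_lt_one (by linarith)]; exact this
      linarith

lemma ValidPair.le_of_V_le {p m p' m' : ℕ} (h' : ValidPair p' m') (hV : V p m ≤ V p' m') :
    p ≤ p' := by
  have h1 := le_V p m
  have h2 := h'.V_lt
  have : (p : ℝ) < (p' + 1 : ℕ) := by push_cast; linarith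
  exact Nat.lt_succ_iff.1 (by exact_mod_cast this)

def ValidKey (x : ℝ) : Prop := x = 0 ∨ (0 < x ∧ x ≤ 1 / 4) ∨ ∃ h : ℕ, 1 ≤ h ∧ x = 2 ^ h

def keyP (x : ℝ) : ℕ := expo (1 + x)

def keyM (x : ℝ) : ℕ := if x ≤ 0 then 0 else expo (1 + 1 / x)

def keyV (x : ℝ) : ℝ := V (keyP x) (keyM x)

lemma keyP_low {x : ℝ} (h0 : 0 ≤ x) (h : x ≤ 1 / 4) : keyP x = 0 := by
  rw [keyP, ← Nat.le_zero, expo_le_iff (by linarith)]; norm_num; linarith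

lemma keyM_low {x : ℝ} (h0 : 0 < x) (h : x ≤ 1 / 4) : 2 ≤ keyM x := by
  rw [keyM, if_neg (not_le.2 h0)]
  have : 4 ≤ 1 / x := by rw [le_div_iff₀ h0]; linarith
  rw [le_expo_iff (by linarith)]; linarith

lemma keyP_pow {h : ℕ} (h1 : 1 ≤ h) : keyP (2 ^ h) = h := by
  have h2 : (2 : ℝ) ≤ 2 ^ h := by simpa using pow_le_pow_right₀ (one_le_two (α := ℝ)) h1
  apply le_antisymm
  · rw [keyP, expo_le_iff (by positivity), pow_succ]; linarith
  · rw [keyP, le_expo_iff (by linarith)]; linarith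

lemma keyM_pow {h : ℕ} (h1 : 1 ≤ h) : keyM (2 ^ h) = 0 := by
  have h2 : (2 : ℝ) ≤ 2 ^ h := by simpa using pow_le_pow_right₀ (one_le_two (α := ℝ)) h1
  rw [keyM, if_neg (by linarith), ← Nat.le_zero, expo_le_iff (by positivity)]
  have : (1 : ℝ) / 2 ^ h ≤ 1 / 2 := one_div_le_one_div_of_le (by norm_num) h2
  norm_num at this ⊢; linarith

lemma keyV_zero : keyV 0 = 0 := by
  simp [keyV, V, keyM, keyP_low le_rfl (by norm_num : (0 : ℝ) ≤ 1 / 4)]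

lemma keyV_low {x : ℝ} (h0 : 0 < x) (h : x ≤ 1 / 4) : keyV x = 1 / keyM x := by
  have := keyM_low h0 h
  rw [keyV, V, keyP_low h0.le h, if_neg (by omega)]; simp

lemma keyV_pow {h : ℕ} (h1 : 1 ≤ h) : keyV (2 ^ h) = h := by
  rw [keyV, V, keyP_pow h1, keyM_pow h1, if_pos rfl]

lemma keyV_low_le {x : ℝ} (h0 : 0 < x) (h : x ≤ 1 / 4) : 0 < keyV x ∧ keyV x ≤ 1 / 2 := by
  have h2 : (2 : ℝ) ≤ keyM x := by exact_mod_cast keyM_low h0 h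
  rw [keyV_low h0 h]
  exact ⟨by positivity, one_div_le_one_div_of_le (by norm_num) h2⟩

lemma ValidKey.validPair {x : ℝ} (h : ValidKey x) : ValidPair (keyP x) (keyM x) := by
  rcases h with rfl | ⟨h0, h⟩ | ⟨h, h1, rfl⟩
  · left; simp [keyM]
  · exact .inr ⟨keyP_low h0.le h, keyM_low h0 h⟩
  · exact .inl (keyM_pow h1)

lemma ValidKey.nonneg {x : ℝ} (h : ValidKey x) : 0 ≤ x := by
  rcases h with rfl | ⟨h0, h⟩ | ⟨h, h1, rfl⟩
  · exact le_rfl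
  · exact h0.le
  · positivity

lemma keyV_mono {x y : ℝ} (hx : ValidKey x) (hy : ValidKey y) (hxy : x ≤ y) :
    keyV x ≤ keyV y := by
  rcases hx with rfl | ⟨h0, h⟩ | ⟨h, h1, rfl⟩
  · rw [keyV_zero]; exact V_nonneg _ _
  · rcases hy with rfl | ⟨h0', h'⟩ | ⟨i, i1, rfl⟩
    · linarith
    · rw [keyV_low h0 h, keyV_low h0' h']
      have h2 := keyM_low h0' h'
      have : keyM y ≤ keyM x := by
        rw [keyM, keyM, if_neg (not_le.2 h0), if_neg (not_le.2 h0')]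
        exact expo_mono (by linarith [one_div_le_one_div_of_le h0 hxy])
      exact one_div_le_one_div_of_le (by exact_mod_cast (by omega : 0 < keyM y))
        (by exact_mod_cast this)
    · rw [keyV_pow i1]
      have : (1 : ℝ) ≤ i := by exact_mod_cast i1
      linarith [(keyV_low_le h0 h).2]
  · have h2 : (2 : ℝ) ≤ 2 ^ h := by simpa using pow_le_pow_right₀ (one_le_two (α := ℝ)) h1
    rcases hy with rfl | ⟨h0', h'⟩ | ⟨i, i1, rfl⟩
    · linarith
    · linarith
    · rw [keyV_pow h1, keyV_pow i1]
      exact_mod_cast (pow_le_pow_iff_right₀ (one_lt_two (α := ℝ))).1 hxy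

lemma lt_of_keyV_lt {x y : ℝ} (hx : ValidKey x) (hy : ValidKey y) (h : keyV x < keyV y) :
    x < y := by
  by_contra hc
  exact absurd (keyV_mono hy hx (not_lt.1 hc)) (not_le.2 h)

lemma le_four_mul_of_keyV_le {x y : ℝ} (hx : ValidKey x) (hy0 : 0 ≤ y) (hy : y ≤ 1 / 4)
    (h : keyV x ≤ keyV y) : x ≤ 4 * y := by
  have hy2 : keyV y ≤ 1 / 2 := by
    rcases hy0.eq_or_lt with rfl | h0
    · rw [keyV_zero]; norm_num
    · exact (keyV_low_le h0 hy).2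
  rcases hx with rfl | ⟨h0, hx⟩ | ⟨i, i1, rfl⟩
  · linarith
  · rcases hy0.eq_or_lt with rfl | hy0
    · rw [keyV_zero] at h
      linarith [(keyV_low_le h0 hx).1]
    · rw [keyV_low h0 hx, keyV_low hy0 hy] at h
      have m1 := keyM_low h0 hx
      have m2 := keyM_low hy0 hy
      have h3 : keyM y ≤ keyM x := by
        have := (one_div_le_one_div (by exact_mod_cast (by omega : 0 < keyM x))
          (by exact_mod_cast (by omega : 0 < keyM y))).1 h
        exact_mod_cast this
      rw [keyM, keyM, if_neg (not_le.2 h0), if_neg (not_le.2 hy0)] at h3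
      have hx1 : (0 : ℝ) < 1 / x := by positivity
      have hy1 : (0 : ℝ) < 1 / y := by positivity
      have a1 := pow_expo_le (x := 1 + 1 / x) (by linarith)
      have a2 := lt_pow_expo (x := 1 + 1 / y) (by linarith)
      have a3 : (2 : ℝ) ^ expo (1 + 1 / y) ≤ 2 ^ expo (1 + 1 / x) :=
        pow_le_pow_right₀ one_le_two h3
      rw [pow_succ] at a2
      have a4 : 4 ≤ 1 / y := by rw [le_div_iff₀ hy0]; linarith
      have a5 : 1 / (4 * y) < 1 / x := by
        have : 1 / (4 * y) = 1 / y / 4 := by field_simp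
        rw [this]; linarith
      exact ((one_div_lt_one_div (by linarith) h0).1 a5).le
  · rw [keyV_pow i1] at h
    have : (1 : ℝ) ≤ i := by exact_mod_cast i1
    linarith

/-- The distance of two points on a logarithmic scale. -/
def lev (x y : P) : ℕ := expo (1 + 64 * dist x y / dmin P)

/-- The radius of level `g`. -/
def rad (P : Type u) [MetricSpace P] (g : ℕ) : ℝ := 2 ^ g * dmin P / 64

/-- The truncation of level `h`. -/
def tau (P : Type u) [MetricSpace P] (h : ℕ) : ℝ := 2 ^ h * dmin P / 256

lemma lev_comm (x y : P) : lev x y = lev y x := by rw [lev, lev, dist_comm]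

lemma lev_le_iff (x y : P) (G : ℕ) : lev x y ≤ G ↔ 1 + 64 * dist x y / dmin P < 2 ^ (G + 1) :=
  expo_le_iff (by have := dmin_pos (P := P); have := dist_nonneg (x := x) (y := y); positivity) _

lemma dist_lt_of_lev {x y : P} {g : ℕ} (c : ℕ) (h : lev x y ≤ g + c) :
    dist x y < 2 ^ (c + 1) * rad P g := by
  rw [lev_le_iff] at h
  have hu := dmin_pos (P := P)
  have h1 : 64 * dist x y / dmin P < 2 ^ (g + c + 1) := by linarith
  rw [div_lt_iff₀ hu] at h1
  have : 2 ^ (c + 1) * rad P g = 2 ^ (g + c + 1) * dmin P / 64 := by unfold rad; ring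
  rw [this]; linarith

lemma lev_le_of_dist {x y : P} {g : ℕ} (c : ℕ) (h : dist x y < (2 ^ (c + 1) - 1) * rad P g) :
    lev x y ≤ g + c := by
  rw [lev_le_iff]
  have hu := dmin_pos (P := P)
  have h1 : 64 * dist x y / dmin P < (2 ^ (c + 1) - 1) * 2 ^ g := by
    rw [div_lt_iff₀ hu]
    have : (2 ^ (c + 1) - 1) * rad P g = (2 ^ (c + 1) - 1) * 2 ^ g * dmin P / 64 := by
      unfold rad; ring
    linarith
  have h2 : (1 : ℝ) ≤ 2 ^ g := one_le_pow₀ one_le_two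
  have h3 : (2 : ℝ) ^ (g + c + 1) = 2 ^ (c + 1) * 2 ^ g := by ring
  rw [h3]; linarith

lemma rad_pos (g : ℕ) : 0 < rad P g := by
  have := dmin_pos (P := P); unfold rad; positivity

lemma rad_mono {g h : ℕ} (hgh : g ≤ h) : rad P g ≤ rad P h := by
  have := dmin_pos (P := P)
  have h2 : (2 : ℝ) ^ g ≤ 2 ^ h := pow_le_pow_right₀ one_le_two hgh
  unfold rad; gcongr

lemma tau_pos (g : ℕ) : 0 < tau P g := by
  have := dmin_pos (P := P); unfold tau; positivity

lemma tau_mono {g h : ℕ} (hgh : g ≤ h) : tau P g ≤ tau P h := by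
  have := dmin_pos (P := P)
  have h2 : (2 : ℝ) ^ g ≤ 2 ^ h := pow_le_pow_right₀ one_le_two hgh
  unfold tau; gcongr

lemma rad_eq (g : ℕ) : rad P g = 4 * tau P g := by unfold rad tau; ring

lemma eq_of_lev {x y : P} (h : lev x y ≤ 5) : x = y := by
  have := dist_lt_of_lev (g := 0) 5 (by simpa using h)
  unfold rad at this
  exact eq_of_dist_lt (by norm_num at this; linarith)

/-- The number of nodes that may be ignored on top of `t`. -/
def quota (ε : ℝ) (t : ℕ) : ℝ := min ε 1 * t

lemma quota_nonneg (hε : 0 < ε) (t : ℕ) : 0 ≤ quota ε t :=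
  mul_nonneg (le_min hε.le zero_le_one) (Nat.cast_nonneg t)

/-- `x` is the key of a node with distribution `μ` and median `m`: on the scale of levels, the
first level at which the node need not be ignored. -/
def IsKey (μ : PMF P) (m : P) (q x : ℝ) : Prop :=
  (rho μ 0 m * q ≤ 0 ∧ x = 0) ∨
  (0 < rho μ 0 m * q ∧ 4 * (rho μ 0 m * max 1 q) ≤ dmin P ∧ x = rho μ 0 m * max 1 q / dmin P) ∨
  (dmin P < 4 * (rho μ 0 m * max 1 q) ∧ ∃ h : ℕ, 1 ≤ h ∧ x = 2 ^ h ∧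
    rho μ (3 * tau P h) m * q ≤ 3 * tau P h ∧
    ∀ h' : ℕ, 1 ≤ h' → h' < h → 3 * tau P h' < rho μ (3 * tau P h') m * q)

lemma IsKey.valid {μ : PMF P} {m : P} {q x : ℝ} (h : IsKey μ m q x) (hq : 0 ≤ q) :
    ValidKey x := by
  rcases h with ⟨-, rfl⟩ | ⟨h0, h1, rfl⟩ | ⟨-, h, h1, rfl, -⟩
  · exact .inl rfl
  · have hu := dmin_pos (P := P)
    have he := pos_of_mul_pos_left h0 hq
    have : 0 < max 1 q := lt_max_of_lt_left one_pos
    refine .inr (.inl ⟨by positivity, ?_⟩)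
    rw [div_le_iff₀ hu]; linarith
  · exact .inr (.inr ⟨h, h1, rfl⟩)

variable (X : Input P) (med : X.Node → P) (kx : X.Node → ℝ) (k t : ℕ) (q : ℝ)

/-- At level `(p, m)` the medians are covered with at most `k` balls, up to at most `t` nodes, and
at most `q` of the covered nodes have a larger key. -/
def Good (p m : ℕ) : Prop :=
  ValidPair p m ∧ ∃ (K : Finset P) (O : Finset X.Node), K.card ≤ k ∧ O.card ≤ t ∧
    (∀ a, a ∉ O → ∃ y ∈ K, dist (med a) y ≤ rad P p) ∧
    (((univ \ O).filter fun a => V p m < keyV (kx a)).card : ℝ) ≤ q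

variable {X med kx k t}

lemma sum_le_of_mul_le (hε : 0 < ε) {O O' : Finset X.Node} (hO : O.card ≤ t)
    {f : X.Node → ℝ} (hf : ∀ a, 0 ≤ f a) {F G : ℝ} (hG : 0 ≤ G)
    (hF : ∑ a ∈ univ \ O, f a ≤ F)
    (hb : ∀ a, a ∉ O' → a ∈ O → f a * quota ε t ≤ G) :
    ∑ a ∈ univ \ O', f a ≤ F + G * (1 + 1 / ε) := by
  have hm : 0 < min ε 1 := lt_min hε one_pos
  have h1 : ∑ a ∈ univ \ O', f a ≤
      ∑ a ∈ univ \ O, f a + ∑ a ∈ O \ O', f a := by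
    rw [← sum_union (Finset.disjoint_left.2 fun a ha hb => by simp_all)]
    exact sum_le_sum_of_subset_of_nonneg (fun a ha => by
      by_cases h : a ∈ O <;> simp_all) fun a _ _ => hf a
  have h2 : ∑ a ∈ O \ O', f a ≤ G * (1 + 1 / ε) := by
    rcases (O \ O').eq_empty_or_nonempty with he | hne
    · rw [he, sum_empty]; positivity
    · have hc : (O \ O').card ≤ t := (card_le_card Finset.sdiff_subset).trans hO
      have ht : 0 < t := (Finset.card_pos.2 hne).trans_le hc
      have ht' : (0 : ℝ) < t := by exact_mod_cast ht
      have hq : 0 < quota ε t := mul_pos hm ht'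
      calc ∑ a ∈ O \ O', f a ≤ ∑ a ∈ O \ O', G / quota ε t := by
            refine sum_le_sum fun a ha => ?_
            rw [mem_sdiff] at ha
            rw [le_div_iff₀ hq]; exact hb a ha.2 ha.1
        _ = (O \ O').card * (G / quota ε t) := by rw [sum_const, nsmul_eq_mul]
        _ ≤ t * (G / quota ε t) := by
            have : ((O \ O').card : ℝ) ≤ t := by exact_mod_cast hc
            gcongr
        _ = G * (1 / min ε 1) := by unfold quota; field_simp
        _ ≤ G * (1 + 1 / ε) := by
            refine mul_le_mul_of_nonneg_left ?_ hG
            rcases min_choice ε 1 with h | h <;> rw [h]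
            · linarith
            · have : 0 < 1 / ε := by positivity
              linarith
  linarith

lemma optCost_low (hε : 0 < ε) (hmed : ∀ a, IsMedian (X.law a) (med a))
    (hkx : ∀ a, IsKey (X.law a) (med a) (quota ε t) (kx a)) (S : Solution P X.Node)
    (hS : S.Feasible k t) (hlow : cost X S < dmin P / 16) :
    ∃ p m, Good X med kx k t (quota ε t) p m ∧ ∀ p' m', ValidPair p' m' → V p' m' ≤ V p m →
      ∀ S' : Solution P X.Node,
        (∀ a, a ∉ S'.O → keyV (kx a) ≤ V p' m' ∧ lev (med a) (S'.asg a) ≤ p' + 5) →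
        cost X S' ≤ 1060 * (1 + 1 / ε) * cost X S := by
  have hu := dmin_pos (P := P)
  set q := quota ε t with hqd
  have hq : 0 ≤ q := quota_nonneg hε t
  set c := cost X S with hc
  have hc0 : 0 ≤ c := cost_nonneg S
  have hsum4 := sum_rho_le_cost S (τ := dmin P / 4) (by linarith) (by linarith)
  have hsum0 : ∑ a ∈ univ \ S.O, rho (X.law a) 0 (S.asg a) ≤ 3 * c := by
    have : ∑ a ∈ univ \ S.O, rho (X.law a) 0 (S.asg a) ≤
        4 / 3 * ∑ a ∈ univ \ S.O, rho (X.law a) (dmin P / 4) (S.asg a) := by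
      rw [mul_sum]
      exact sum_le_sum fun a _ => rho_zero_le_small _ _
    linarith
  have hone : ∀ a, a ∉ S.O → rho (X.law a) 0 (S.asg a) ≤ 3 * c := fun a ha =>
    (single_le_sum (f := fun a => rho (X.law a) 0 (S.asg a))
      (fun a _ => rho_nonneg _ _ _) (by simpa using ha)).trans hsum0
  have hasg : ∀ a, a ∉ S.O → med a = S.asg a := fun a ha =>
    eq_of_dist_lt (by linarith [(hmed a).dist_le_zero (S.asg a), hone a ha])
  set e : X.Node → ℝ := fun a => rho (X.law a) 0 (med a) with he
  have he0 : ∀ a, 0 ≤ e a := fun a => rho_nonneg _ _ _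
  have hesum : ∑ a ∈ univ \ S.O, e a ≤ 3 * c :=
    (sum_le_sum fun a _ => (hmed a).rho_zero_le (S.asg a)).trans hsum0
  have heone : ∀ a, a ∉ S.O → e a ≤ 3 * c := fun a ha =>
    ((hmed a).rho_zero_le _).trans (hone a ha)
  set x := 3 * c / dmin P with hx
  have hx0 : 0 ≤ x := by positivity
  have hx4 : x ≤ 1 / 4 := by rw [hx, div_le_iff₀ hu]; linarith
  have hxv : ValidKey x := hx0.eq_or_lt.elim (fun h => .inl h.symm) fun h => .inr (.inl ⟨h, hx4⟩)
  have hmq : 0 < max 1 q := lt_max_of_lt_left one_pos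
  refine ⟨keyP x, keyM x, ⟨hxv.validPair, S.K, S.O, hS.1, by exact_mod_cast hS.2.1,
    fun a ha => ⟨S.asg a, hS.2.2 a, ?_⟩, ?_⟩, ?_⟩
  · rw [hasg a ha, dist_self]; exact (rad_pos _).le
  · -- nodes with a larger key have a large expected distance
    have hbig : ∀ a, keyV x < keyV (kx a) → 3 * c < e a * max 1 q := by
      intro a ha
      have hlt := lt_of_keyV_lt hxv ((hkx a).valid hq) ha
      rcases hkx a with ⟨-, h0⟩ | ⟨-, -, h0⟩ | ⟨h0, -⟩
      · rw [h0] at hlt; linarith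
      · rw [h0, hx, div_lt_div_iff_of_pos_right hu] at hlt; exact hlt
      · linarith
    set B := (univ \ S.O).filter fun a => V (keyP x) (keyM x) < keyV (kx a) with hB
    have hBm : ∀ a ∈ B, a ∉ S.O ∧ 3 * c < e a * max 1 q := fun a ha => by
      rw [hB, mem_filter] at ha
      exact ⟨by simpa using ha.1, hbig a ha.2⟩
    rcases lt_or_ge q 1 with hq1 | hq1
    · have : B = ∅ := eq_empty_of_forall_notMem fun a ha => by
        obtain ⟨h1, h2⟩ := hBm a ha
        rw [max_eq_left hq1.le, mul_one] at h2
        linarith [heone a h1]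
      rw [this]; simpa using hq
    · rw [max_eq_right hq1] at hBm
      rcases hc0.eq_or_lt with hc1 | hc1
      · have : B = ∅ := eq_empty_of_forall_notMem fun a ha => by
          obtain ⟨h1, h2⟩ := hBm a ha
          have := pos_of_mul_pos_left (by linarith : 0 < e a * q) hq
          linarith [heone a h1]
        rw [this]; simpa using hq
      · have h1 : (B.card : ℝ) * (3 * c) ≤ (3 * c) * q := by
          calc (B.card : ℝ) * (3 * c) = ∑ a ∈ B, 3 * c := by rw [sum_const, nsmul_eq_mul]
            _ ≤ ∑ a ∈ B, e a * q := sum_le_sum fun a ha => (hBm a ha).2.le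
            _ = (∑ a ∈ B, e a) * q := (sum_mul _ _ _).symm
            _ ≤ (∑ a ∈ univ \ S.O, e a) * q :=
                mul_le_mul_of_nonneg_right (sum_le_sum_of_subset_of_nonneg
                  (filter_subset _ _) fun a _ _ => he0 a) hq
            _ ≤ _ := mul_le_mul_of_nonneg_right hesum hq
        rw [mul_comm] at h1
        exact le_of_mul_le_mul_left h1 (by linarith)
  · intro p' m' hv' hV' S' hS'
    have hp' : p' = 0 := by
      have := hxv.validPair.le_of_V_le hV'
      rw [keyP_low hx0 hx4] at this; omega
    subst hp'
    have hcost := cost_le S' (T := 0) le_rfl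
    have h1 : ∑ a ∈ univ \ S'.O, rho (X.law a) 0 (S'.asg a) =
        ∑ a ∈ univ \ S'.O, e a := sum_congr rfl fun a ha => by
      rw [← eq_of_lev (x := med a) (y := S'.asg a) (by simpa using (hS' a (by simpa using ha)).2)]
    have h2 := sum_le_of_mul_le (O' := S'.O) (G := 12 * c) hε (by exact_mod_cast hS.2.1) he0
      (by linarith) hesum
      fun a ha _ => by
        have h3 := le_four_mul_of_keyV_le ((hkx a).valid hq) hx0 hx4 ((hS' a ha).1.trans hV')
        rcases hkx a with ⟨h0, -⟩ | ⟨-, -, h0⟩ | ⟨h4, h, hh, h0, -⟩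
        · exact h0.trans (by linarith)
        · rw [h0, hx, div_le_iff₀ hu] at h3
          have : 4 * (3 * c / dmin P) * dmin P = 12 * c := by field_simp; ring
          rw [this] at h3
          exact (mul_le_mul_of_nonneg_left (le_max_right _ _) (he0 a)).trans h3
        · have : (2 : ℝ) ≤ 2 ^ h := by simpa using pow_le_pow_right₀ (one_le_two (α := ℝ)) hh
          rw [h0] at h3; linarith
    have h3 : 0 < 1 / ε := by positivity
    rw [h1, zero_add] at hcost
    nlinarith [mul_nonneg h3.le hc0]

lemma optCost_high (hε : 0 < ε) (hmed : ∀ a, IsMedian (X.law a) (med a))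
    (hkx : ∀ a, IsKey (X.law a) (med a) (quota ε t) (kx a)) (S : Solution P X.Node)
    (hS : S.Feasible k t) (hhigh : dmin P / 16 ≤ cost X S) :
    ∃ p m, Good X med kx k t (quota ε t) p m ∧ ∀ p' m', ValidPair p' m' → V p' m' ≤ V p m →
      ∀ S' : Solution P X.Node,
        (∀ a, a ∉ S'.O → keyV (kx a) ≤ V p' m' ∧ lev (med a) (S'.asg a) ≤ p' + 5) →
        cost X S' ≤ 1060 * (1 + 1 / ε) * cost X S := by
  have hu := dmin_pos (P := P)
  set q := quota ε t with hqd
  have hq : 0 ≤ q := quota_nonneg hε t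
  set c := cost X S with hc
  have hc0 : 0 < c := by linarith
  have hex : ∃ h, 1 ≤ h ∧ 2 * c ≤ tau P h := by
    obtain ⟨h, hh⟩ := pow_unbounded_of_one_lt (2 * c * 256 / dmin P) (one_lt_two (α := ℝ))
    refine ⟨h + 1, by omega, ?_⟩
    rw [div_lt_iff₀ hu] at hh
    have := tau_mono (P := P) (Nat.le_add_right h 1)
    unfold tau at this ⊢
    linarith
  classical
  set g := Nat.find hex with hg
  obtain ⟨hg1, hgc⟩ := Nat.find_spec hex
  rw [← hg] at hg1 hgc
  have hg4 : tau P g ≤ 4 * c := by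
    rcases hg1.eq_or_lt with h | h
    · rw [← h]; unfold tau; linarith
    · have := Nat.find_min hex (m := g - 1) (by omega)
      push Not at this
      have h2 := this (by omega)
      have h3 : tau P g = 2 * tau P (g - 1) := by
        unfold tau
        rw [show (2 : ℝ) ^ g = 2 ^ (g - 1 + 1) by rw [Nat.sub_add_cancel hg1]]; ring
      linarith
  set τ := tau P g with hτ
  have hτ0 : 0 < τ := tau_pos g
  have hsum := sum_rho_le_cost S hτ0 hgc
  have hone : ∀ a, a ∉ S.O → rho (X.law a) τ (S.asg a) ≤ τ := fun a ha =>
    ((single_le_sum (f := fun a => rho (X.law a) τ (S.asg a))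
      (fun a _ => rho_nonneg _ _ _) (by simpa using ha)).trans hsum).trans hgc
  set r : X.Node → ℝ := fun a => rho (X.law a) (3 * τ) (med a) with hr
  have hr0 : ∀ a, 0 ≤ r a := fun a => rho_nonneg _ _ _
  have hrsum : ∑ a ∈ univ \ S.O, r a ≤ 3 * τ := by
    calc ∑ a ∈ univ \ S.O, r a ≤ ∑ a ∈ univ \ S.O, 3 * rho (X.law a) τ (S.asg a) :=
          sum_le_sum fun a _ => (hmed a).rho_le hτ0.le _
      _ ≤ 3 * τ := by rw [← mul_sum]; linarith
  have hgR : (1 : ℝ) ≤ g := by exact_mod_cast hg1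
  have hV : V g 0 = g := by simp [V]
  refine ⟨g, 0, ⟨.inl rfl, S.K, S.O, hS.1, by exact_mod_cast hS.2.1,
    fun a ha => ⟨S.asg a, hS.2.2 a, ?_⟩, ?_⟩, ?_⟩
  · have := (hmed a).dist_le hτ0.le (S.asg a)
    rw [rad_eq]; linarith [hone a ha]
  · set B := (univ \ S.O).filter fun a => V g 0 < keyV (kx a) with hB
    have hBm : ∀ a ∈ B, 3 * τ ≤ r a * q := fun a ha => by
      rw [hB, mem_filter, hV] at ha
      have hv := ha.2
      rcases hkx a with ⟨-, h0⟩ | h' | ⟨-, h, h1, h0, -, h3⟩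
      · rw [h0, keyV_zero] at hv; linarith
      · have hv' := (hkx a).valid hq
        rcases hv' with h0 | ⟨h0, h4⟩ | ⟨i, i1, h0⟩
        · rw [h0, keyV_zero] at hv; linarith
        · linarith [(keyV_low_le h0 h4).2]
        · have : kx a ≤ 1 / 4 := by rw [h'.2.2, div_le_iff₀ hu]; linarith [h'.2.1]
          have h2 : (2 : ℝ) ≤ 2 ^ i := by simpa using pow_le_pow_right₀ (one_le_two (α := ℝ)) i1
          rw [h0] at this; linarith
      · rw [h0, keyV_pow h1] at hv
        exact (h3 g hg1 (by exact_mod_cast hv)).le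
    have h1 : (B.card : ℝ) * (3 * τ) ≤ (3 * τ) * q := by
      calc (B.card : ℝ) * (3 * τ) = ∑ a ∈ B, 3 * τ := by rw [sum_const, nsmul_eq_mul]
        _ ≤ ∑ a ∈ B, r a * q := sum_le_sum fun a ha => hBm a ha
        _ = (∑ a ∈ B, r a) * q := (sum_mul _ _ _).symm
        _ ≤ (∑ a ∈ univ \ S.O, r a) * q :=
            mul_le_mul_of_nonneg_right (sum_le_sum_of_subset_of_nonneg
              (filter_subset _ _) fun a _ _ => hr0 a) hq
        _ ≤ _ := mul_le_mul_of_nonneg_right hrsum hq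
    rw [mul_comm] at h1
    exact le_of_mul_le_mul_left h1 (by linarith)
  · intro p' m' hv' hV' S' hS'
    have hp' : p' ≤ g := ValidPair.le_of_V_le (.inl rfl) hV'
    have hcost := cost_le S' (T := 259 * τ) (by linarith)
    have h1 : ∑ a ∈ univ \ S'.O, rho (X.law a) (259 * τ) (S'.asg a) ≤
        ∑ a ∈ univ \ S'.O, r a := sum_le_sum fun a ha => by
      refine rho_shift _ ?_
      have h2 := dist_lt_of_lev 5 (hS' a (by simpa using ha)).2
      have h3 := rad_mono (P := P) hp'
      rw [rad_eq g] at h3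
      norm_num at h2
      linarith
    have h2 := sum_le_of_mul_le (O' := S'.O) (G := 3 * τ) hε (by exact_mod_cast hS.2.1) hr0
      (by linarith) hrsum
      fun a ha _ => by
        have hle : r a ≤ rho (X.law a) 0 (med a) := rho_anti _ (by linarith) _
        have hkv := (hS' a ha).1.trans hV'
        rcases hkx a with ⟨h0, -⟩ | ⟨-, h0, -⟩ | ⟨-, h, hh, h0, h1, -⟩
        · exact (mul_le_mul_of_nonneg_right hle hq).trans (h0.trans (by linarith))
        · have h4 : r a * q ≤ rho (X.law a) 0 (med a) * max 1 q :=
            mul_le_mul hle (le_max_right _ _) hq (rho_nonneg _ _ _)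
          show r a * q ≤ _
          linarith
        · rw [h0, keyV_pow hh, hV] at hkv
          have hhg : h ≤ g := by exact_mod_cast hkv
          have := tau_mono (P := P) hhg
          have h5 : r a ≤ rho (X.law a) (3 * tau P h) (med a) := rho_anti _ (by linarith) _
          exact (mul_le_mul_of_nonneg_right h5 hq).trans (h1.trans (by linarith))
    have h3 : 0 < 1 / ε := by positivity
    nlinarith [mul_nonneg h3.le hc0.le, mul_le_mul_of_nonneg_left hg4 h3.le]

/-- There is a good level such that every output at a level not above it is cheap. -/
theorem exists_good_level (hk : 1 ≤ k) (hε : 0 < ε) (hmed : ∀ a, IsMedian (X.law a) (med a))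
    (hkx : ∀ a, IsKey (X.law a) (med a) (quota ε t) (kx a)) :
    ∃ p m, Good X med kx k t (quota ε t) p m ∧ ∀ p' m', ValidPair p' m' → V p' m' ≤ V p m →
      ∀ S' : Solution P X.Node,
        (∀ a, a ∉ S'.O → keyV (kx a) ≤ V p' m' ∧ lev (med a) (S'.asg a) ≤ p' + 5) →
        cost X S' ≤ 1060 * (1 + 1 / ε) * optCost X k t := by
  obtain ⟨S, hS, hc⟩ := exists_opt X hk t
  rw [← hc]
  rcases lt_or_ge (cost X S) (dmin P / 16) with h | h
  · exact optCost_low hε hmed hkx S hS h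
  · exact optCost_high hε hmed hkx S hS h

/-! ## The programs -/

lemma lt_or_eq {i j : ℕ} : i < j + 1 → i < j ∨ i = j := Nat.lt_succ_iff_lt_or_eq.1

abbrev Expr.median (e : Expr) : Expr := .op1 .median e
abbrev Expr.real (e : Expr) : Expr := .op1 .ofNat e
/-- The real number `n`. -/
abbrev Expr.num (n : ℕ) : Expr := .op1 .ofNat (.const n)
abbrev Expr.expo (e : Expr) : Expr := .op1 .expo e

prefix:max "♯" => Expr.const
infixl:65 " +ₙ " => Expr.op2 Op2.add
infixl:65 " -ₙ " => Expr.op2 Op2.sub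
infixl:65 " +ᵣ " => Expr.op2 Op2.radd
infixl:65 " -ᵣ " => Expr.op2 Op2.rsub
infixl:70 " *ᵣ " => Expr.op2 Op2.rmul
infixl:70 " /ᵣ " => Expr.op2 Op2.rdiv
infixr:50 " ;; " => Stm.seq

instance : Coe ℕ Expr := ⟨Expr.var⟩

/-! Variables of both parties: the parameters, the quota, the number of budgets, `4 t + 5`. -/

notation "vK" => (0 : ℕ)
notation "vT" => (1 : ℕ)
notation "vEps" => (2 : ℕ)
notation "vMin" => (3 : ℕ)
notation "vMax" => (4 : ℕ)
notation "vN" => (5 : ℕ)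
notation "vQ" => (6 : ℕ)
notation "vNB" => (7 : ℕ)
notation "vR" => (8 : ℕ)
notation "vTop" => (9 : ℕ)
notation "vi" => (11 : ℕ)
notation "vj" => (12 : ℕ)
notation "vl" => (13 : ℕ)
notation "vb" => (14 : ℕ)
notation "vx" => (15 : ℕ)
notation "vy" => (16 : ℕ)
notation "vz" => (17 : ℕ)
notation "vp" => (18 : ℕ)
notation "vm" => (19 : ℕ)
notation "vw" => (20 : ℕ)
notation "vg" => (21 : ℕ)
notation "vf" => (22 : ℕ)
notation "vc" => (23 : ℕ)
notation "vh" => (24 : ℕ)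
notation "ve" => (25 : ℕ)
notation "vv" => (26 : ℕ)
notation "vd" => (27 : ℕ)
notation "vtot" => (28 : ℕ)
notation "vok" => (29 : ℕ)
notation "vbest" => (30 : ℕ)
notation "vbp" => (31 : ℕ)
notation "vbm" => (32 : ℕ)
notation "vM" => (33 : ℕ)
notation "vcn" => (34 : ℕ)
notation "vlo" => (35 : ℕ)
notation "vhi" => (36 : ℕ)
notation "vrem" => (37 : ℕ)
notation "vrp" => (38 : ℕ)
notation "vrm" => (39 : ℕ)
notation "vr" => (40 : ℕ)
notation "va" => (41 : ℕ)
notation "vu" => (42 : ℕ)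
notation "aBud" => (0 : ℕ)
notation "aNode" => (1 : ℕ)
notation "aMed" => (2 : ℕ)
notation "aKey" => (3 : ℕ)
notation "aTop" => (4 : ℕ)
notation "aRest" => (5 : ℕ)
notation "aNet" => (6 : ℕ)
notation "aWt" => (7 : ℕ)
notation "aLev" => (8 : ℕ)
notation "aKC" => (9 : ℕ)
notation "aLV" => (10 : ℕ)
notation "aLP" => (11 : ℕ)
notation "aLM" => (12 : ℕ)
notation "aBI" => (13 : ℕ)
notation "aPt" => (14 : ℕ)
notation "aKV" => (15 : ℕ)
notation "aKP" => (16 : ℕ)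
notation "aKM" => (17 : ℕ)
notation "aDist" => (18 : ℕ)
notation "aCV" => (19 : ℕ)
notation "aCP" => (20 : ℕ)
notation "aCM" => (21 : ℕ)
notation "aLive" => (22 : ℕ)
notation "aCnt" => (23 : ℕ)
notation "aBest" => (24 : ℕ)
notation "aGen" => (25 : ℕ)

def levE (e1 e2 : Expr) : Expr :=
  .expo (.num 1 +ᵣ .num 64 *ᵣ .op2 .dist e1 e2 /ᵣ vMin)

def keyPE (e : Expr) : Expr := .expo (.num 1 +ᵣ e)

def keyME (e : Expr) : Expr :=
  .cond .real e (.num 0) ♯0 (.expo (.num 1 +ᵣ .num 1 /ᵣ e))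

def levelE (p m : Expr) : Expr :=
  .cond .nat m ♯0 (.real p) (.real p +ᵣ .num 1 /ᵣ .real m)

/-- Reads the parameters and tabulates the budgets `0, 1, 2, 4, …`. -/
def initS : Stm :=
  .recv vK ♯0 ;; .recv vT ♯0 ;; .recv vEps ♯0 ;;
  .recv vMin ♯0 ;; .recv vMax ♯0 ;; .recv vN ♯0 ;;
  .set vQ (.cond .real vEps (.num 1) vEps (.num 1) *ᵣ .real vT) ;;
  .set vNB (.expo (.num 1 +ᵣ .real vT) +ₙ ♯4) ;;
  .set vR (vT +ₙ vT +ₙ vT +ₙ vT +ₙ ♯5) ;;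
  .put aBud ♯0 ♯0 ;;
  .set vw ♯1 ;;
  .rep vi vNB (.put aBud (vi +ₙ ♯1) vw ;; .set vw (vw +ₙ vw))

def readNodesS : Stm :=
  .rep vj vN (.recv vx ♯0 ;; .put aNode vj vx ;; .put aMed vj (.median vx))

def highKeyS : Stm :=
  .rep vl vTop (.set vy (.num 3 *ᵣ (vx *ᵣ vMin /ᵣ .num 256)) ;;
    .ite .real (.trunc (.arr aNode vj) (.arr aMed vj) vy *ᵣ vQ) vy .skip (.set vx (vx +ᵣ vx)))

/-- Computes the key of node `vj` in `vx`; `vz` is the maximum of `1` and the quota. -/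
def keyS : Stm :=
  .set ve (.trunc (.arr aNode vj) (.arr aMed vj) (.num 0)) ;;
  .ite .real (ve *ᵣ vQ) (.num 0) (.set vx (.num 0))
    (.ite .real (.num 4 *ᵣ (ve *ᵣ vz)) vMin (.set vx (ve *ᵣ vz /ᵣ vMin))
      (.set vx (.num 2) ;; highKeyS))

def keysS : Stm :=
  .set vTop (.expo (vMax /ᵣ vMin) +ₙ ♯8) ;;
  .set vz (.cond .real (.num 1) vQ vQ (.num 1)) ;;
  .rep vj vN (keyS ;; .put aKey vj vx)

/-- Largest entry `vy` of `aRest`, at index `vm`. -/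
def maxRestS : Stm :=
  .rep vj vN (.ite .real (.arr aRest vj) vy .skip (.set vy (.arr aRest vj) ;; .set vm vj))

def copyKeysS : Stm := .rep vj vN (.put aRest vj (.arr aKey vj))

/-- Lists the largest keys in decreasing order. -/
def topKeysS : Stm :=
  copyKeysS ;;
  .rep vi vR (.set vy (.num 0) ;; .set vm vN ;; maxRestS ;;
    .put aTop vi vy ;; .put aRest vm (.num 0))

/-- Finds a net point near node `vj`. -/
def attachS : Stm :=
  .rep vl vc (.ite .nat (levE (.arr aMed vj) (.arr aMed (.arr aNet vl))) (vg +ₙ ♯1)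
    (.set vf vl) .skip)

/-- Makes node `vj` a net point if no net point is near. -/
def growS : Stm :=
  .ite .nat vc vf
    (.ite .nat vc (vK +ₙ vR) (.put aNet vc vj ;; .put aWt vc ♯0 ;; .set vc (vc +ₙ ♯1)) .skip) .skip

def tallyS : Stm :=
  .ite .real (.arr aKey vj) vx (.put aWt vf (.arr aWt vf +ₙ ♯1)) (.set vh (vh +ₙ ♯1))

/-- Greedy net of the medians at level `vg`, of at most `k + 4 t + 6` points. Nodes with a key of
at most `vx` are counted at the net point that they are attached to, the others in `vh`. -/
def netS : Stm :=
  .set vc ♯0 ;; .set vh ♯0 ;;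
  .rep vj vN (.set vf vc ;; attachS ;; growS ;; tallyS)

/-- Records the current level for all budgets for which it is the first that suffices. -/
def recordS : Stm :=
  .rep vb vNB (.ite .blank (.arr aLev vb) ♯0
    (.ite .nat vc (vK +ₙ .arr aBud vb)
      (.put aLev vb (.cond .real (.arr aTop (.arr aBud vb)) vz vz (.arr aTop (.arr aBud vb))) ;;
        .put aGen vb vg) .skip) .skip)

/-- Finds, for every budget, a level at which it suffices. -/
def profileS : Stm :=
  .set vx (.num 0) ;; .set vz (.num 0) ;;
  .rep vg (vTop +ₙ ♯1) (netS ;; recordS ;; .set vz (.cond .real vz (.num 0) (.num 2) (vz +ᵣ vz)))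

def sendProfileS : Stm :=
  .rep vb vNB (.send ♯1 (keyPE (.arr aLev vb)) ;; .send ♯1 (keyME (.arr aLev vb)))

def site₁S : Stm := initS ;; readNodesS ;; keysS ;; topKeysS ;; profileS ;; sendProfileS

def sendNetS : Stm :=
  .rep vl vc (.ite .nat (vl +ₙ ♯1) vK (.send ♯1 (.arr aMed (.arr aNet vl)))
    (.send ♯1 (.arr aNode (.arr aNet vl))) ;; .send ♯1 (.arr aWt vl))

def sendCutS : Stm :=
  .rep vj vN (.ite .real (.arr aKey vj) vx .skip
    (.send ♯1 (.arr aNode vj) ;; .send ♯1 (keyPE (.arr aKey vj)) ;;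
      .send ♯1 (keyME (.arr aKey vj))))

def site₂S : Stm :=
  .recv vb ♯1 ;; .set vx (.arr aLev vb) ;; .set vg (.arr aGen vb) ;;
  netS ;; .send ♯1 vc ;; .send ♯1 vh ;; sendNetS ;; sendCutS

def readCentersS : Stm := .rep vi vK (.recv vx ♯1 ;; .put aKC vi vx)

/-- Finds a center near node `vj`. -/
def nearS : Stm :=
  .rep vi vK (.ite .nat (levE (.arr aMed vj) (.arr aKC vi)) (vp +ₙ ♯5)
    (.set vf (.arr aKC vi)) .skip)

def sendLabelS : Stm :=
  .ite .real (levelE (keyPE (.arr aKey vj)) (keyME (.arr aKey vj))) vv (.send ♯0 vf) (.send ♯0 ♯0)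

def labelS : Stm :=
  .rep vj vN (.set vf ♯0 ;; nearS ;; sendLabelS)

def site₃S : Stm :=
  readCentersS ;; .recv vp ♯1 ;; .recv vm ♯1 ;; .set vv (levelE vp vm) ;; labelS

/-- Stores the levels received from site `vi`. -/
def readProfileS : Stm :=
  .rep vb vNB (.recv vp (vi +ₙ ♯1) ;; .recv vm (vi +ₙ ♯1) ;;
    .put aLP vd vp ;; .put aLM vd vm ;; .put aLV vd (levelE vp vm) ;; .set vd (vd +ₙ ♯1))

/-- Stores the levels received from the sites. -/
def readProfilesS : Stm :=
  .set vd ♯0 ;; .rep vi vN readProfileS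

/-- The least budget `vw` of site `vi` that suffices at level `vv`. -/
def leastBudgetS : Stm :=
  .rep vb vNB (
    .ite .real (.arr aLV vd) vv
      (.ite .nat (.arr aBud vb +ₙ ♯1) vw (.set vw (.arr aBud vb) ;; .put aBI vi vb) .skip) .skip ;;
    .set vd (vd +ₙ ♯1))

/-- Total of the least budgets that suffice at level `vv`. -/
def evalLevelS : Stm :=
  .set vtot ♯0 ;; .set vd ♯0 ;;
  .rep vi vN (.set vw vR ;; leastBudgetS ;; .set vtot (vtot +ₙ vw))

def acceptS : Stm :=
  .set vok ♯1 ;; .set vbest vv ;; .set vbp (.arr aLP vc) ;; .set vbm (.arr aLM vc)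

def tryAcceptS : Stm :=
  .ite .nat (vtot +ₙ ♯5) vR (.ite .nat vok ♯0 acceptS (.ite .real vbest vv .skip acceptS)) .skip

/-- The least level with a total of at most `4 t`. -/
def chooseS : Stm :=
  .set vok ♯0 ;; .set vu vd ;;
  .rep vc vu (.set vv (.arr aLV vc) ;; evalLevelS ;; tryAcceptS)

def sendBudgetsS : Stm := .rep vi vN (.send (vi +ₙ ♯1) (.arr aBI vi))

def coord₁S : Stm :=
  initS ;; readProfilesS ;; chooseS ;; .set vv vbest ;; evalLevelS ;; sendBudgetsS

/-- Appends an item with the point `e`, weight `vw` and key `(vp, vm)`. -/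
def pushItemS (e : Expr) : Stm :=
  .put aPt vM e ;; .put aWt vM vw ;; .put aKP vM vp ;; .put aKM vM vm ;;
  .put aKV vM (levelE vp vm) ;; .set vM (vM +ₙ ♯1)

abbrev pushNetS : Stm := pushItemS (.cond .nat (vl +ₙ ♯1) vK vx (.median vx))

def readNetS : Stm :=
  .set vp ♯0 ;; .set vm ♯0 ;;
  .rep vl vc (.recv vx (vi +ₙ ♯1) ;; .recv vw (vi +ₙ ♯1) ;; pushNetS)

def readCutS : Stm :=
  .set vw ♯1 ;;
  .rep vl vh (.recv vx (vi +ₙ ♯1) ;; .recv vp (vi +ₙ ♯1) ;; .recv vm (vi +ₙ ♯1) ;;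
    pushItemS (.median vx))

def readItemsS : Stm :=
  .set vM ♯0 ;;
  .rep vi vN (.recv vc (vi +ₙ ♯1) ;; .recv vh (vi +ₙ ♯1) ;; readNetS ;; readCutS)

/-- Makes `(vp, vm)` a candidate, unless it is below the least admissible level. -/
def pushCandS : Stm :=
  .set vv (levelE vp vm) ;;
  .ite .real vbest vv (.put aCP vcn vp ;; .put aCM vcn vm ;; .put aCV vcn vv ;;
    .set vhi (vhi +ᵣ vv) ;; .set vcn (vcn +ₙ ♯1)) .skip

def startDistS : Stm := .rep vi vM (.put aDist vi (.op2 .dist (.arr aPt ♯0) (.arr aPt vi)))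

/-- The farthest item `vx`, at distance `vy`. -/
def farthestS : Stm :=
  .set vx ♯0 ;; .set vy (.arr aDist ♯0) ;;
  .rep vi vM (.ite .real (.arr aDist vi) vy .skip (.set vy (.arr aDist vi) ;; .set vx vi))

def pushRadiusS : Stm :=
  .set vg (.expo (.num 1 +ᵣ .num 64 *ᵣ vy /ᵣ vMin)) ;; .set vm ♯0 ;;
  .rep vl ♯6 (.set vp (vg -ₙ vl) ;; pushCandS)

def updateDistS : Stm :=
  .rep vi vM (.set vz (.op2 .dist (.arr aPt vx) (.arr aPt vi)) ;;
    .put aDist vi (.cond .real (.arr aDist vi) vz (.arr aDist vi) vz))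

/-- Farthest-first traversal; every radius gives rise to candidates. -/
def traverseS : Stm :=
  startDistS ;; .rep vj vM (farthestS ;; pushRadiusS ;; updateDistS)

def pushKeysS : Stm := .rep vi vM (.set vp (.arr aKP vi) ;; .set vm (.arr aKM vi) ;; pushCandS)

def candidatesS : Stm :=
  .set vcn ♯0 ;; .set vhi (.num 1) ;;
  .set vp vbp ;; .set vm vbm ;; pushCandS ;; pushKeysS ;; traverseS

/-- Live items are those that may still be covered at level `vv`; `vrem` is the total weight. -/
def liveS : Stm :=
  .set vrem ♯0 ;;
  .rep vi vM (.put aLive vi (.cond .real (.arr aKV vi) vv ♯1 ♯0) ;; .set vrem (vrem +ₙ .arr aWt vi))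

/-- The live weight near item `vi`. -/
def ballS : Stm :=
  .set vw ♯0 ;;
  .rep vj vM (.ite .nat ♯1 (.arr aLive vj)
    (.ite .nat (levE (.arr aPt vi) (.arr aPt vj)) (vp +ₙ ♯3)
      (.set vw (vw +ₙ .arr aWt vj)) .skip) .skip)

def countS : Stm := .rep vi vM (ballS ;; .put aCnt vi vw)

/-- Item `vj` is covered. -/
def killS : Stm :=
  .put aLive vj ♯0 ;; .set vrem (vrem -ₙ .arr aWt vj) ;;
  .rep vi vM (.ite .nat (levE (.arr aPt vi) (.arr aPt vj)) (vp +ₙ ♯3)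
    (.put aCnt vi (.arr aCnt vi -ₙ .arr aWt vj)) .skip)

/-- The item `vx` with the largest live weight nearby. -/
def heaviestS : Stm :=
  .set vx ♯0 ;; .set vw (.arr aCnt ♯0) ;;
  .rep vi vM (.ite .nat (.arr aCnt vi) vw .skip (.set vw (.arr aCnt vi) ;; .set vx vi))

def killNearS : Stm :=
  .ite .nat ♯1 (.arr aLive vj)
    (.ite .nat (levE (.arr aPt vx) (.arr aPt vj)) (vp +ₙ ♯4) killS .skip) .skip

/-- Covers everything near item `vx`. -/
def killBallS : Stm :=
  .rep vj vM killNearS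

/-- Greedy covering with `k` balls at level `(vp, vv)`. -/
def coverS : Stm :=
  liveS ;; countS ;; .rep vb vK (heaviestS ;; .put aKC vb (.arr aPt vx) ;; killBallS)

def compareS : Stm :=
  .ite .real (.arr aCV vj) vlo .skip (.ite .real vhi (.arr aCV vj) .skip
    (.set vtot (vtot +ₙ ♯1) ;; .ite .real (.arr aCV vi) (.arr aCV vj) .skip (.set va (va +ₙ ♯1)) ;;
      .ite .real (.arr aCV vj) (.arr aCV vi) .skip (.set vu (vu +ₙ ♯1))))

/-- Counts the candidates in the open interval from `vlo` to `vhi` in `vtot`, those of them below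
candidate `vi` in `va`, and those above in `vu`. -/
def rankS : Stm :=
  .set vtot ♯0 ;; .set va ♯0 ;; .set vu ♯0 ;;
  .rep vj vcn compareS

/-- A median of the candidates in the interval. -/
def pivotS : Stm :=
  .set vf vcn ;;
  .rep vi vcn (.ite .real (.arr aCV vi) vlo .skip (.ite .real vhi (.arr aCV vi) .skip
    (rankS ;; .ite .nat (va +ₙ va) vtot (.ite .nat (vu +ₙ vu) vtot (.set vf vi) .skip) .skip)))

def saveS : Stm := .rep vi vK (.put aBest vi (.arr aKC vi))

/-- Tests candidate `vf`. -/
def probeS : Stm :=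
  .set vp (.arr aCP vf) ;; .set vv (.arr aCV vf) ;; coverS ;;
  .ite .real (.real vrem) (.real vT +ᵣ vQ)
    (.set vhi vv ;; .set vrp vp ;; .set vrm (.arr aCM vf) ;; saveS) (.set vlo vv)

def bisectS : Stm :=
  .set vlo (.num 0 -ᵣ .num 1) ;;
  .rep vr (.expo (.real vcn) +ₙ ♯1) (pivotS ;; .ite .nat vcn vf .skip probeS)

def sendCentersS (e : Expr) : Stm := .rep vi vK (.send e (.arr aBest vi))

def announceS : Stm :=
  sendCentersS ♯0 ;;
  .rep vj vN (sendCentersS (vj +ₙ ♯1) ;; .send (vj +ₙ ♯1) vrp ;; .send (vj +ₙ ♯1) vrm)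

def coord₂S : Stm := readItemsS ;; candidatesS ;; bisectS ;; announceS

def centerProtocol : Protocol where
  site₁ := site₁S.compile 0
  coord₁ := coord₁S.compile 0
  site₂ := site₂S.compile 0
  coord₂ := coord₂S.compile 0
  site₃ := site₃S.compile 0

/-! ### Values of expressions -/

def bud (b : ℕ) : ℕ := if b = 0 then 0 else 2 ^ (b - 1)

variable {D : A → PMF P} {med : A → P} {s : St P A}

lemma eval_levE {e1 e2 : Expr} {x y : P} (h1 : e1.eval D med s = .pt x)
    (h2 : e2.eval D med s = .pt y) (hm : s.var vMin = .real (dmin P)) :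
    (levE e1 e2).eval D med s = .nat (lev x y) := by
  simp [levE, h1, h2, hm, lev, expo]

lemma eval_keyPE {e : Expr} {x : ℝ} (h : e.eval D med s = .real x) :
    (keyPE e).eval D med s = .nat (keyP x) := by
  simp [keyPE, h, keyP, expo]

lemma eval_keyME {e : Expr} {x : ℝ} (h : e.eval D med s = .real x) :
    (keyME e).eval D med s = .nat (keyM x) := by
  by_cases hx : x ≤ 0 <;> simp [keyME, h, keyM, expo, hx]

lemma eval_levelE {e1 e2 : Expr} {p m : ℕ} (h1 : e1.eval D med s = .nat p)
    (h2 : e2.eval D med s = .nat m) :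
    (levelE e1 e2).eval D med s = .real (V p m) := by
  by_cases hm : m = 0 <;> simp [levelE, h1, h2, V, hm]

variable (D : A → PMF P) (md : A → P) {s s' : St P A} {nd : ℕ → A} {mp : ℕ → P} {x : ℕ → ℝ}

local notation "ℛ" => Stm.run D md

/-! ## What the programs of the sites do -/

/-- The number of budgets. -/
def numB (t : ℕ) : ℕ := expo (1 + t) + 4

/-- The parameters are in place; `n` is the number of nodes or sites. -/
structure Params (k t : ℕ) (ε : ℝ) (n : ℕ) (s : St P A) : Prop where
  hk : s.var vK = .nat k
  ht : s.var vT = .nat t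
  hmin : s.var vMin = .real (dmin P)
  hmax : s.var vMax = .real (dmax P)
  hn : s.var vN = .nat n
  hq : s.var vQ = .real (quota ε t)
  hnb : s.var vNB = .nat (numB t)
  hr : s.var vR = .nat (4 * t + 5)
  bud : ∀ b ≤ numB t, s.arr aBud b = .nat (bud b)

lemma Params.congr (h : Params k t ε n s) (hv : ∀ y < 9, s'.var y = s.var y)
    (ha : s'.arr aBud = s.arr aBud) : Params k t ε n s' := by
  constructor <;>
    simp +contextual [hv, ha, h.hk, h.ht, h.hmin, h.hmax, h.hn, h.hq, h.hnb, h.hr, h.bud]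

/-- `c` does not change the parameters. -/
def Stm.safe (c : Stm) : Bool := (List.range 9).all (fun y => !c.wv y) && !c.wa aBud

lemma Params.mono (h : Params k t ε n s) {c : Stm} (ag : Agree c s s')
    (hc : c.safe = true := by rfl) : Params k t ε n s' := by
  simp only [Stm.safe, Bool.and_eq_true, List.all_eq_true, List.mem_range, Bool.not_eq_true'] at hc
  exact h.congr (fun y hy => ag.var y (hc.1 y hy)) (ag.arr _ hc.2)

lemma Params.setVar (h : Params k t ε n s) {x : ℕ} (w : Word P A) (hx : 9 ≤ x := by norm_num) :
    Params k t ε n (s.setVar x w) :=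
  h.congr (fun y hy => by simp [show ¬ y = x by omega]) rfl

lemma Params.tick (h : Params k t ε n s) : Params k t ε n s.tick := h.congr (fun _ _ => rfl) rfl

/-- The nodes of a site and their medians are in place. -/
structure Nodes (n : ℕ) (nd : ℕ → A) (mp : ℕ → P) (s : St P A) : Prop where
  node : ∀ j < n, s.arr aNode j = .node (nd j)
  med : ∀ j < n, s.arr aMed j = .pt (mp j)

lemma Nodes.mono (h : Nodes n nd mp s) {c : Stm} (ag : Agree c s s')
    (hc : (c.wa aNode || c.wa aMed) = false := by rfl) : Nodes n nd mp s' := by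
  rw [Bool.or_eq_false_iff] at hc
  exact ⟨fun j hj => by rw [ag.arr _ hc.1]; exact h.node j hj,
    fun j hj => by rw [ag.arr _ hc.2]; exact h.med j hj⟩

/-- Net point number `l`, as an index of a node. -/
def net (s : St P A) (l : ℕ) : ℕ := (s.arr aNet l).toNat

/-- The greedy net of the first `i` points at level `g`, with at most `cap + 1` points. -/
def netList (mp : ℕ → P) (g cap : ℕ) : ℕ → List ℕ
  | 0 => []
  | i + 1 =>
    if (∀ l ∈ netList mp g cap i, g + 1 < lev (mp i) (mp l)) ∧ (netList mp g cap i).length ≤ cap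
    then netList mp g cap i ++ [i] else netList mp g cap i

/-- The net after node `i` has been added, before it is counted. -/
structure NetStep (n : ℕ) (mp : ℕ → P) (x : ℕ → ℝ) (g cap : ℕ) (X : ℝ) (i cnt : ℕ) (f : ℕ → ℕ)
    (s : St P A) : Prop where
  hcnt : s.var vc = .nat cnt
  le : cnt ≤ cap + 1
  list : netList mp g cap (i + 1) = (List.range cnt).map (net s)
  hnet : ∀ l < cnt, net s l < n
  sep : ∀ l l', l < l' → l' < cnt → g + 1 < lev (mp (net s l')) (mp (net s l))
  att : ∀ j < i, (f j < cnt ∧ lev (mp j) (mp (net s (f j))) ≤ g + 1) ∨ cnt = cap + 1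
  wt : ∀ l < cnt, s.arr aWt l = .nat ((range i).filter fun j => x j ≤ X ∧ f j = l).card
  cut : s.var vh = .nat ((range i).filter fun j => ¬ x j ≤ X).card

/-- State of the net after `i` nodes. -/
structure NetInv (n : ℕ) (mp : ℕ → P) (x : ℕ → ℝ) (g cap : ℕ) (X : ℝ) (i cnt : ℕ) (f : ℕ → ℕ)
    (s : St P A) : Prop where
  hcnt : s.var vc = .nat cnt
  le : cnt ≤ cap + 1
  list : netList mp g cap i = (List.range cnt).map (net s)
  hnet : ∀ l < cnt, net s l < n
  sep : ∀ l l', l < l' → l' < cnt → g + 1 < lev (mp (net s l')) (mp (net s l))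
  att : ∀ j < i, (f j < cnt ∧ lev (mp j) (mp (net s (f j))) ≤ g + 1) ∨ cnt = cap + 1
  wt : ∀ l < cnt, s.arr aWt l = .nat ((range i).filter fun j => x j ≤ X ∧ f j = l).card
  cut : s.var vh = .nat ((range i).filter fun j => ¬ x j ≤ X).card

lemma attachS_spec (hp : Params k t ε n s) (hn : Nodes n nd mp s) {j g cnt : ℕ} (hj : j < n)
    (hvj : s.var vj = .nat j) (hg : s.var vg = .nat g) (hc : s.var vc = .nat cnt)
    (hf : s.var vf = .nat cnt) (hnet : ∀ l < cnt, net s l < n) :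
    ∃ F, (ℛ attachS s).var vf = .nat F ∧
      ((F = cnt ∧ ∀ l < cnt, g + 1 < lev (mp j) (mp (net s l))) ∨
        (F < cnt ∧ lev (mp j) (mp (net s F)) ≤ g + 1)) ∧
      (ℛ attachS s).time ≤ s.time + 1 + cnt * 3 := by
  refine for_rule D md (n := cnt) (fun i s' => ∃ F, s'.var vf = .nat F ∧
      ((F = cnt ∧ ∀ l < i, g + 1 < lev (mp j) (mp (net s l))) ∨
        (F < cnt ∧ lev (mp j) (mp (net s F)) ≤ g + 1)) ∧ s'.time ≤ s.time + 1 + i * 3)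
    (by simp [hc]) ⟨cnt, hf, .inl ⟨rfl, by simp⟩, by simp⟩ ?_
  rintro i hi s' ag ⟨F, hF, hF', ht⟩
  have e : (levE (.arr aMed vj) (.arr aMed (.arr aNet vl))).eval D md
      (s'.setVar vl (.nat i)) = .nat (lev (mp j) (mp (net s i))) := by
    refine eval_levE ?_ ?_ ?_
    · simp only [Expr.eval, St.setVar_var, St.setVar_arr]
      rw [ag.arr _ rfl]
      simp [ag.var vj rfl, hvj, hn.med j hj]
    · simp only [Expr.eval, St.setVar_var, St.setVar_arr]
      rw [ag.arr _ rfl, ag.arr _ rfl]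
      simpa [net] using hn.med _ (hnet i hi)
    · simp [ag.var vMin rfl, hp.hmin]
  have eg : s'.var vg = .nat g := (ag.var _ rfl).trans hg
  simp only [Stm.run]
  rw [e]
  by_cases h : lev (mp j) (mp (net s i)) ≤ g + 1
  · refine ⟨i, ?_, .inr ⟨hi, h⟩, ?_⟩
    · simp [eg, h]
    · simp [eg, h]; omega
  · refine ⟨F, ?_, ?_, ?_⟩
    · simp [eg, h, hF]
    · rcases hF' with ⟨h1, h2⟩ | h1
      · refine .inl ⟨h1, fun l hl => ?_⟩
        rcases lt_or_eq hl with h3 | rfl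
        · exact h2 l h3
        · omega
      · exact .inr h1
    · simp [eg, h]; omega

lemma card_filter_range_succ (p : ℕ → Prop) [DecidablePred p] (i : ℕ) :
    ((range (i + 1)).filter p).card =
      ((range i).filter p).card + if p i then 1 else 0 := by
  rw [Finset.range_add_one, filter_insert]
  split_ifs
  · rw [card_insert_of_notMem (by simp)]
  · rfl

lemma netS_spec (hp : Params k t ε n s) (hn : Nodes n nd mp s) {g : ℕ} {X : ℝ}
    (hg : s.var vg = .nat g) (hX : s.var vx = .real X)
    (hx : ∀ j < n, s.arr aKey j = .real (x j)) :
    ∃ cnt f, NetInv n mp x g (k + (4 * t + 5)) X n cnt f (ℛ netS s) ∧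
      (ℛ netS s).time ≤ s.time + 3 + n * (3 * (k + (4 * t + 6)) + 11) := by
  set cap := k + (4 * t + 5) with hcap
  set s0 := (s.setVar vc (.nat 0)).setVar vh (.nat 0) with hs0
  have hp0 : Params k t ε n s0 := (hp.setVar _).setVar _
  have hn0 : Nodes n nd mp s0 := ⟨hn.node, hn.med⟩
  rw [show ℛ netS s = ℛ (.rep vj vN _) s0 from rfl]
  have htime : s0.time = s.time + 2 := by simp [hs0]
  refine for_rule D md (n := n) (fun i s' => ∃ cnt f, NetInv n mp x g cap X i cnt f s' ∧
    s'.time ≤ s.time + 3 + i * (3 * (k + (4 * t + 6)) + 11))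
    (by simp [hp0.hn]) ⟨0, fun _ => 0, ⟨?_, by simp, by simp [netList], by simp, by simp, by simp,
    by simp, ?_⟩,
      by simp [htime]⟩ ?_
  · simp [hs0]
  · simp [hs0]
  rintro i hi s1 ag ⟨cnt, f, hI, ht⟩
  have hp1 : Params k t ε n s1 := hp0.mono ag
  have hn1 : Nodes n nd mp s1 := hn0.mono ag
  have hg1 : s1.var vg = .nat g := (ag.var _ rfl).trans (by simp [hs0, hg])
  have hX1 : s1.var vx = .real X := (ag.var _ rfl).trans (by simp [hs0, hX])
  have hx1 : ∀ j < n, s1.arr aKey j = .real (x j) := fun j hj => by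
    rw [ag.arr _ rfl]; exact hx j hj
  clear_value s0
  set s2 := (s1.setVar vj (.nat i)).setVar vf (.nat cnt) with hs2
  obtain ⟨F, hF, hF', htF⟩ := attachS_spec D md (s := s2) (g := g)
    ((hp1.setVar _).setVar _) ⟨hn1.node, hn1.med⟩ hi (by simp [hs2])
    (by simp [hs2, hg1]) (by simp [hs2, hI.hcnt]) (by simp [hs2]) hI.hnet
  have ag3 := frame D md attachS s2
  set s3 := ℛ attachS s2 with hs3
  have hp3 : Params k t ε n s3 :=
    Params.mono ((hp1.setVar _).setVar _) ag3 rfl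
  have hvj : s3.var vj = .nat i := (ag3.var _ rfl).trans (by simp [hs2])
  have hvx : s3.var vx = .real X := (ag3.var _ rfl).trans (by simp [hs2, hX1])
  have hvc : s3.var vc = .nat cnt := (ag3.var _ rfl).trans (by simp [hs2, hI.hcnt])
  have hvh : s3.var vh = _ := (ag3.var _ rfl).trans hI.cut
  have hnt : s3.arr aNet = s1.arr aNet := ag3.arr _ rfl
  have hwt : s3.arr aWt = s1.arr aWt := ag3.arr _ rfl
  have hkey : s3.arr aKey i = .real (x i) := by rw [ag3.arr _ rfl]; exact hx1 i hi
  have ht3 : s3.time ≤ s1.time + 3 + cnt * 3 := by simp [hs2] at htF; omega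
  have hle := hI.le
  have hnet3 : ∀ l, net s3 l = net s1 l := fun l => by rw [net, hnt]; rfl
  have hnets2 : ∀ l, net s2 l = net s1 l := fun l => rfl
  simp only [hnets2] at hF'
  have ag4 := frame D md growS s3
  have h4 : ∃ cnt', NetStep n mp x g cap X i cnt' (Function.update f i F) (ℛ growS s3) ∧
      (F < cnt' ∧ lev (mp i) (mp (net (ℛ growS s3) F)) ≤ g + 1 ∨ cnt' = cap + 1) ∧
      (ℛ growS s3).time ≤ s3.time + 5 := by
    have hfilt : ∀ l, ((range i).filter fun j => x j ≤ X ∧ Function.update f i F j = l) =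
        (range i).filter fun j => x j ≤ X ∧ f j = l := fun l =>
      filter_congr fun j hj => by
        rw [Function.update_of_ne (by rw [mem_range] at hj; omega)]
    have hold : ∀ j < i, Function.update f i F j = f j := fun j hj =>
      Function.update_of_ne (by omega) _ _
    have hlen : (netList mp g cap i).length = cnt := by simp [hI.list]
    have hlist : (∀ l ∈ netList mp g cap i, g + 1 < lev (mp i) (mp l)) ↔
        ∀ l < cnt, g + 1 < lev (mp i) (mp (net s1 l)) := by
      rw [hI.list]; simp
    rcases hF' with ⟨rfl, hfar⟩ | ⟨hlt, hclose⟩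
    · by_cases hcp : F ≤ cap
      · have hr : ℛ growS s3 = (((s3.tick.tick.setArr aNet F (.nat i)).setArr aWt F
            (.nat 0)).setVar vc (.nat (F + 1))) := by
          simp [growS, hvc, hF, hp3.hk, hp3.hr, hcap ▸ hcp, hvj]
        rw [hr]
        have hnew : ∀ l, net (((s3.tick.tick.setArr aNet F (.nat i)).setArr aWt F
            (.nat 0)).setVar vc (.nat (F + 1))) l = if l = F then i else net s1 l := by
          intro l
          by_cases hl : l = F <;> simp [net, hl, hnt]
        refine ⟨F + 1, ⟨by simp, by omega, ?_, ?_, ?_, ?_, ?_, ?_⟩, ?_, ?_⟩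
        · rw [netList, if_pos ⟨hlist.2 hfar, by omega⟩, List.range_succ, List.map_append, hI.list]
          congr 1
          · exact List.map_congr_left fun l hl => by
              rw [hnew, if_neg (by have := List.mem_range.1 hl; omega)]
          · simp [hnew]
        · intro l hl
          rw [hnew]
          split_ifs with h
          · exact hi
          · exact hI.hnet l (by omega)
        · intro l l' hll hl'
          rw [hnew, hnew, if_neg (show l ≠ F by omega)]
          split_ifs with h
          · exact hfar l (by omega)
          · exact hI.sep l l' hll (by omega)
        · intro j hj
          rw [hold j hj, hnew]
          rcases hI.att j hj with h | h
          · rw [if_neg (by omega)]; exact .inl ⟨by omega, h.2⟩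
          · omega
        · intro l hl
          rw [hfilt]
          by_cases h : l = F
          · subst h
            have : ((range i).filter fun j => x j ≤ X ∧ f j = l) = ∅ :=
              filter_eq_empty_iff.2 fun j hj => by
                rcases hI.att j (mem_range.1 hj) with h | h <;> omega
            simp [this]
          · simp [h, hwt, hI.wt l (by omega)]
        · simpa using hvh
        · refine .inl ⟨by omega, ?_⟩
          rw [hnew, if_pos rfl]
          simp [lev, expo]
        · simp
      · have hr : ℛ growS s3 = s3.tick.tick := by
          simp [growS, hvc, hF, hp3.hk, hp3.hr,
            show ¬ F ≤ k + (4 * t + 5) from hcp]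
        rw [hr]
        refine ⟨F, ⟨by simpa using hvc, hle, ?_, ?_, ?_, ?_, ?_, ?_⟩, .inr (by omega), by simp⟩
        · rw [netList, if_neg (fun h => hcp (hlen ▸ h.2)), hI.list]
          exact List.map_congr_left fun l _ => by simp [net, hnt]
        · intro l hl; simpa [net, hnt] using hI.hnet l hl
        · intro l l' h1 h2; simpa [net, hnt] using hI.sep l l' h1 h2
        · intro j hj; exact .inr (by omega)
        · intro l hl; rw [hfilt]; simpa [hwt] using hI.wt l hl
        · simpa using hvh
    · have hr : ℛ growS s3 = s3.tick := by
        simp [growS, hvc, hF, show ¬ cnt ≤ F by omega]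
      rw [hr]
      refine ⟨cnt, ⟨by simpa using hvc, hle, ?_, ?_, ?_, ?_, ?_, ?_⟩, .inl ⟨hlt, ?_⟩, by simp⟩
      · rw [netList, if_neg (fun h => by have := hlist.1 h.1 F hlt; omega), hI.list]
        exact List.map_congr_left fun l _ => by simp [net, hnt]
      · intro l hl; simpa [net, hnt] using hI.hnet l hl
      · intro l l' h1 h2; simpa [net, hnt] using hI.sep l l' h1 h2
      · intro j hj; rw [hold j hj]; simpa [net, hnt] using hI.att j hj
      · intro l hl; rw [hfilt]; simpa [hwt] using hI.wt l hl
      · simpa using hvh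
      · simpa [net, hnt] using hclose
  obtain ⟨cnt', hI', hF'', ht4⟩ := h4
  have hF4 : (ℛ growS s3).var vf = .nat F := (ag4.var _ rfl).trans hF
  have hj4 : (ℛ growS s3).var vj = .nat i := (ag4.var _ rfl).trans hvj
  have hX4 : (ℛ growS s3).var vx = .real X := (ag4.var _ rfl).trans hvx
  have hk4 : (ℛ growS s3).arr aKey i = .real (x i) := by rw [ag4.arr _ rfl]; exact hkey
  have hrun4 : ℛ (.set vf vc ;; attachS ;; growS ;; tallyS) (s1.setVar vj (.nat i)) =
      ℛ tallyS (ℛ growS s3) := by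
    simp only [Stm.run, hs3, hs2, Expr.eval]
    simp [hI.hcnt]
  rw [hrun4]
  set s4 := ℛ growS s3 with hs4
  have hatt : ∀ j < i + 1, (Function.update f i F j < cnt' ∧
      lev (mp j) (mp (net s4 (Function.update f i F j))) ≤ g + 1) ∨ cnt' = cap + 1 := by
    intro j hj
    rcases lt_or_eq hj with h | rfl
    · exact hI'.att j h
    · rw [Function.update_self]; exact hF''
  have htt : s4.time + 2 ≤ s.time + 3 + (i + 1) * (3 * (k + (4 * t + 6)) + 11) := by
    have : cnt * 3 ≤ 3 * (k + (4 * t + 6)) := by omega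
    rw [add_mul, one_mul]; omega
  by_cases hcut : x i ≤ X
  · have hr : ℛ tallyS s4 =
        s4.tick.setArr aWt F (.nat ((s4.arr aWt F).toNat + 1)) := by
      simp [tallyS, hF4, hj4, hX4, hk4, hcut]
    rw [hr]
    refine ⟨cnt', Function.update f i F, ⟨by simpa using hI'.hcnt, hI'.le, ?_, ?_, ?_, ?_, ?_, ?_⟩,
      by simp; omega⟩
    · rw [hI'.list]; exact List.map_congr_left fun l _ => by simp [net]
    · intro l hl; simpa [net] using hI'.hnet l hl
    · intro l l' h1 h2; simpa [net] using hI'.sep l l' h1 h2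
    · intro j hj; simpa [net] using hatt j hj
    · intro l hl
      rw [card_filter_range_succ]
      have := hI'.wt l hl
      by_cases h : l = F
      · subst h; simp [hcut, this]
      · simp [h, Ne.symm h, this]
    · rw [card_filter_range_succ]; simpa [hcut] using hI'.cut
  · have hr : ℛ tallyS s4 =
        s4.tick.setVar vh (.nat (((range i).filter fun j => ¬ x j ≤ X).card + 1)) := by
      simp [tallyS, hj4, hX4, hk4, hcut, hI'.cut]
    rw [hr]
    refine ⟨cnt', Function.update f i F, ⟨by simpa using hI'.hcnt, hI'.le, ?_, ?_, ?_, ?_, ?_, ?_⟩,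
      by simp; omega⟩
    · rw [hI'.list]; exact List.map_congr_left fun l _ => by simp [net]
    · intro l hl; simpa [net] using hI'.hnet l hl
    · intro l l' h1 h2; simpa [net] using hI'.sep l l' h1 h2
    · intro j hj; simpa [net] using hatt j hj
    · intro l hl
      rw [card_filter_range_succ]
      simpa [hcut] using hI'.wt l hl
    · rw [card_filter_range_succ]; simp [hcut]

lemma initS_spec {rest : List (Word P A)}
    (hin : s.inbox 0 = [.nat k, .nat t, .real ε, .real (dmin P), .real (dmax P), .nat n] ++ rest) :
    Params k t ε n (ℛ initS s) ∧ (ℛ initS s).inbox = Function.update s.inbox 0 rest ∧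
      (ℛ initS s).time ≤ s.time + 12 + numB t * 3 := by
  set s0 := ℛ (.recv vK ♯0 ;; .recv vT ♯0 ;; .recv vEps ♯0 ;;
    .recv vMin ♯0 ;; .recv vMax ♯0 ;; .recv vN ♯0 ;;
    .set vQ (.cond .real vEps (.num 1) vEps (.num 1) *ᵣ .real vT) ;;
    .set vNB (.expo (.num 1 +ᵣ .real vT) +ₙ ♯4) ;;
    .set vR (vT +ₙ vT +ₙ vT +ₙ vT +ₙ ♯5) ;;
    .put aBud ♯0 ♯0 ;; .set vw ♯1) s with hs0
  have hrun : ℛ initS s = ℛ (.rep vi vNB _) s0 := rfl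
  have h0 : s0.var vK = .nat k ∧ s0.var vT = .nat t ∧ s0.var vMin = .real (dmin P) ∧
      s0.var vMax = .real (dmax P) ∧ s0.var vN = .nat n ∧ s0.var vQ = .real (quota ε t) ∧
      s0.var vNB = .nat (numB t) ∧ s0.var vR = .nat (4 * t + 5) ∧
      s0.arr aBud 0 = .nat 0 ∧ s0.var vw = .nat 1 ∧ s0.inbox = Function.update s.inbox 0 rest ∧
      s0.time = s.time + 11 := by
    have hq : (if ε ≤ 1 then Word.real ε else Word.real 1 : Word P A).toReal = min ε 1 := by
      rw [min_def]; split_ifs <;> rfl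
    refine ⟨?_, ?_, ?_, ?_, ?_, ?_, ?_, ?_, ?_, ?_, ?_, ?_⟩ <;>
      simp [hs0, hin, numB, expo, quota, hq]
    · ring
    · funext q
      by_cases h : q = 0 <;> simp [h, hin]
  rw [hrun]
  obtain ⟨hk, ht, hmin, hmax, hn, hq, hnb, hr, hb0, hw, hin', htm⟩ := h0
  clear_value s0
  refine for_rule D md (n := numB t) (fun i s' => (s'.var vw = .nat (2 ^ i) ∧
      ∀ b ≤ i, s'.arr aBud b = .nat (bud b)) ∧ s'.time ≤ s.time + 12 + i * 3)
    (by simp [hnb]) ⟨⟨by simp [hw], fun b hb => ?_⟩, by simp [htm]⟩ ?_ |> fun h =>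
      have ag := frame D md (.rep vi vNB (.put aBud (vi +ₙ ♯1) vw ;; .set vw (vw +ₙ vw))) s0
      ⟨⟨(ag.var _ rfl).trans hk, (ag.var _ rfl).trans ht, (ag.var _ rfl).trans hmin,
        (ag.var _ rfl).trans hmax, (ag.var _ rfl).trans hn, (ag.var _ rfl).trans hq,
        (ag.var _ rfl).trans hnb, (ag.var _ rfl).trans hr, h.1.2⟩, (ag.inbox rfl).trans hin', h.2⟩
  · obtain rfl : b = 0 := by omega
    simp [hb0, bud]
  · rintro i hi s1 ag ⟨⟨hw1, hb1⟩, ht1⟩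
    simp only [Stm.run]
    refine ⟨⟨?_, fun b hb => ?_⟩, ?_⟩
    · simp [hw1]; ring
    · by_cases h : b = i + 1
      · subst h; simp [hw1, bud]
      · simp [h, hb1 b (by omega)]
    · simp; omega

lemma readNodesS_spec (hp : Params k t ε n s)
    (hin : s.inbox 0 = (List.range' 0 n).map fun j => .node (nd j)) :
    Nodes n nd (md ∘ nd) (ℛ readNodesS s) ∧ (ℛ readNodesS s).inbox 0 = [] ∧
      (ℛ readNodesS s).time ≤ s.time + 1 + n * 4 := by
  have := for_rule D md (x := vj) (e := vN)
    (c := .recv vx ♯0 ;; .put aNode vj vx ;; .put aMed vj (.median vx)) (s := s) (n := n)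
    (fun i s' => ((∀ j < i, s'.arr aNode j = .node (nd j)) ∧
      ∀ j < i, s'.arr aMed j = .pt (md (nd j))) ∧
      s'.inbox 0 = ((List.range' i (n - i)).map fun j => .node (nd j)) ∧
      s'.time ≤ s.time + 1 + i * 4)
    (by simp [hp.hn]) ⟨⟨by simp, by simp⟩, by simpa using hin, by simp⟩ ?_
  · refine ⟨⟨this.1.1, this.1.2⟩, this.2.1.trans (by simp), this.2.2⟩
  rintro i hi s' - ⟨⟨h1, h2⟩, h3, h4⟩
  rw [show n - i = n - (i + 1) + 1 by omega, List.range'_succ, List.map_cons] at h3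
  simp only [Stm.run]
  refine ⟨⟨fun j hj => ?_, fun j hj => ?_⟩, ?_, ?_⟩
  · by_cases h : j = i
    · subst h; simp [h3]
    · simp [h, h1 j (by omega)]
  · by_cases h : j = i
    · subst h; simp [h3]
    · simp [h, h2 j (by omega)]
  · simp [h3]
  · simp; omega

/-- The number of levels. -/
def numL (P : Type u) [MetricSpace P] : ℕ := expo (dmax P / dmin P) + 8

lemma dmax_lt_pow : dmax P < 2 ^ (numL P) * dmin P / 128 := by
  have hu := dmin_pos (P := P)
  have h := lt_pow_expo (x := dmax P / dmin P) (div_nonneg (hu.le.trans dmin_le_dmax) hu.le)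
  rw [div_lt_iff₀ hu] at h
  rw [show (2 : ℝ) ^ numL P * dmin P / 128 = 2 ^ (expo (dmax P / dmin P) + 1) * dmin P by
    rw [numL]; ring]
  exact h

lemma lev_le_numL (y z : P) : lev y z ≤ numL P + 1 := by
  refine lev_le_of_dist (g := numL P) 1 ?_
  have h := dmax_lt_pow (P := P)
  have h1 := dist_le_dmax y z
  have hu : 0 < 2 ^ numL P * dmin P := by have := dmin_pos (P := P); positivity
  unfold rad; norm_num; linarith

lemma highKeyS_spec (hn : Nodes n nd mp s) {j : ℕ} {q : ℝ} (hj : j < n)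
    (hvj : s.var vj = .nat j) (hq : s.var vQ = .real q) (hm : s.var vMin = .real (dmin P))
    (hT : s.var vTop = .nat (numL P)) (hx : s.var vx = .real 2) :
    (∃ h : ℕ, 1 ≤ h ∧ (ℛ highKeyS s).var vx = .real (2 ^ h) ∧
      rho (D (nd j)) (3 * tau P h) (mp j) * q ≤ 3 * tau P h ∧
      ∀ h' : ℕ, 1 ≤ h' → h' < h → 3 * tau P h' < rho (D (nd j)) (3 * tau P h') (mp j) * q) ∧
    (ℛ highKeyS s).time ≤ s.time + 1 + numL P * 4 := by
  have := for_rule D md (x := vl) (e := vTop)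
    (c := .set vy (.num 3 *ᵣ (vx *ᵣ vMin /ᵣ .num 256)) ;;
      .ite .real (.trunc (.arr aNode vj) (.arr aMed vj) vy *ᵣ vQ) vy .skip
      (.set vx (vx +ᵣ vx))) (s := s) (n := numL P)
    (fun i s' => (∃ h : ℕ, 1 ≤ h ∧ s'.var vx = .real (2 ^ h) ∧
      (h = i + 1 ∨ rho (D (nd j)) (3 * tau P h) (mp j) * q ≤ 3 * tau P h) ∧
      ∀ h' : ℕ, 1 ≤ h' → h' < h → 3 * tau P h' < rho (D (nd j)) (3 * tau P h') (mp j) * q) ∧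
      s'.time ≤ s.time + 1 + i * 4)
    (by simp [hT]) ⟨⟨1, le_rfl, by simp [hx], .inl rfl, by omega⟩, by simp⟩ ?_
  · obtain ⟨⟨h, h1, h2, h3, h4⟩, h5⟩ := this
    refine ⟨⟨h, h1, h2, ?_, h4⟩, h5⟩
    rcases h3 with rfl | h3
    · have h6 := h4 (numL P) (by unfold numL; omega) (by omega)
      have h7 := dmax_lt_pow (P := P)
      have hu : 0 < 2 ^ numL P * dmin P := by have := dmin_pos (P := P); positivity
      rw [rho_eq_zero] at h6
      · have := tau_pos (P := P) (numL P)
        linarith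
      · unfold tau; linarith
    · exact h3
  rintro i hi s1 ag ⟨⟨h, h1, h2, h3, h4⟩, h5⟩
  have e1 : s1.arr aNode j = .node (nd j) := by rw [ag.arr _ rfl]; exact hn.node j hj
  have e2 : s1.arr aMed j = .pt (mp j) := by rw [ag.arr _ rfl]; exact hn.med j hj
  have e3 : s1.var vj = .nat j := (ag.var _ rfl).trans hvj
  have e4 : s1.var vQ = .real q := (ag.var _ rfl).trans hq
  have e5 : s1.var vMin = .real (dmin P) := (ag.var _ rfl).trans hm
  by_cases hc : rho (D (nd j)) (3 * tau P h) (mp j) * q ≤ 3 * tau P h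
  · refine ⟨⟨h, h1, ?_, .inr hc, h4⟩, ?_⟩
    · unfold tau at hc
      simp [truncEval, e1, e2, e3, e4, e5, h2, hc]
    · unfold tau at hc
      simp [truncEval, e1, e2, e3, e4, e5, h2, hc]
      omega
  · have hh : h = i + 1 := h3.resolve_right hc
    refine ⟨⟨h + 1, by omega, ?_, .inl (by omega), fun h' ha hb => ?_⟩, ?_⟩
    · unfold tau at hc
      simp [truncEval, e1, e2, e3, e4, e5, h2, hc]
      ring
    · rcases lt_or_eq hb with hb | rfl
      · exact h4 h' ha hb
      · exact not_le.1 hc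
    · unfold tau at hc
      simp [truncEval, e1, e2, e3, e4, e5, h2, hc]
      omega

lemma keyS_spec (hp : Params k t ε n s) (hn : Nodes n nd mp s) {j : ℕ} (hj : j < n)
    (hvj : s.var vj = .nat j) (hz : s.var vz = .real (max 1 (quota ε t)))
    (hT : s.var vTop = .nat (numL P)) :
    (∃ y, IsKey (D (nd j)) (mp j) (quota ε t) y ∧ (ℛ keyS s).var vx = .real y) ∧
    (ℛ keyS s).time ≤ s.time + 5 + numL P * 4 := by
  have e1 := hn.node j hj
  have e2 := hn.med j hj
  have hq := hp.hq
  have hm := hp.hmin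
  by_cases hc : rho (D (nd j)) 0 (mp j) * quota ε t ≤ 0
  · refine ⟨⟨0, .inl ⟨hc, rfl⟩, ?_⟩, ?_⟩ <;>
      simp [keyS, truncEval, e1, e2, hvj, hq, hc]
    omega
  by_cases hd : 4 * (rho (D (nd j)) 0 (mp j) * max 1 (quota ε t)) ≤ dmin P
  · refine ⟨⟨_, .inr (.inl ⟨not_le.1 hc, hd, rfl⟩), ?_⟩, ?_⟩ <;>
      simp only [keyS, Stm.run, Expr.eval, Op2.eval, Op1.eval] <;>
      simp [truncEval, e1, e2, hvj, hq, hc, hz, hm, hd]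
    omega
  rw [show ℛ keyS s = ℛ highKeyS
      ((s.setVar ve (.real (rho (D (nd j)) 0 (mp j)))).tick.tick.setVar vx (.real 2)) by
    simp only [keyS, Stm.run, Expr.eval, Op2.eval, Op1.eval]
    simp [truncEval, e1, e2, hvj, hq, hc, hz, hm, hd]]
  obtain ⟨⟨h, h1, h2, h3, h4⟩, h5⟩ := highKeyS_spec D md (mp := mp) (nd := nd)
    (s := (s.setVar ve (.real (rho (D (nd j)) 0 (mp j)))).tick.tick.setVar vx (.real 2))
    ⟨hn.node, hn.med⟩ hj (by simp [hvj]) (by simpa using hq) (by simpa using hm)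
    (by simpa using hT) (by simp)
  refine ⟨⟨_, .inr (.inr ⟨not_le.1 hd, h, h1, rfl, h3, h4⟩), h2⟩, ?_⟩
  simp at h5
  omega

lemma keysS_spec (hp : Params k t ε n s) (hn : Nodes n nd mp s) :
    (∀ j < n, ∃ y, IsKey (D (nd j)) (mp j) (quota ε t) y ∧ (ℛ keysS s).arr aKey j = .real y) ∧
    (ℛ keysS s).var vTop = .nat (numL P) ∧
    (ℛ keysS s).time ≤ s.time + 3 + n * (numL P * 4 + 7) := by
  set s0 := ℛ (.set vTop (.expo (vMax /ᵣ vMin) +ₙ ♯8) ;;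
    .set vz (.cond .real (.num 1) vQ vQ (.num 1))) s with hs0
  have hrun : ℛ keysS s = ℛ (.rep vj vN _) s0 := rfl
  have ag0 := frame D md (.set vTop (.expo (vMax /ᵣ vMin) +ₙ ♯8) ;;
    .set vz (.cond .real (.num 1) vQ vQ (.num 1))) s
  have hp0 : Params k t ε n s0 := hp.mono ag0
  have hn0 : Nodes n nd mp s0 := hn.mono ag0
  have hT : s0.var vTop = .nat (numL P) := by
    simp [hs0, numL, expo, hp.hmin, hp.hmax]
  have hz : s0.var vz = .real (max 1 (quota ε t)) := by
    rw [max_def]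
    split_ifs with h <;> simp [hs0, hp.hq, h]
  have ht : s0.time = s.time + 2 := by simp [hs0]
  clear_value s0
  rw [hrun]
  have := for_rule D md (x := vj) (e := vN) (c := keyS ;; .put aKey vj vx) (s := s0) (n := n)
    (fun i s' => (∀ j < i, ∃ y, IsKey (D (nd j)) (mp j) (quota ε t) y ∧
      s'.arr aKey j = .real y) ∧ s'.time ≤ s.time + 3 + i * (numL P * 4 + 7))
    (by simp [hp0.hn]) ⟨by simp, by simp [ht]⟩ ?_
  · exact ⟨this.1, ((frame D md (.rep vj vN (keyS ;; .put aKey vj vx)) s0).var _ rfl).trans hT,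
      this.2⟩
  rintro i hi s1 ag ⟨h1, h2⟩
  obtain ⟨⟨y, hy, hy'⟩, hty⟩ := keyS_spec D md (s := s1.setVar vj (.nat i)) ((hp0.mono ag).setVar _)
    ⟨(hn0.mono ag).node, (hn0.mono ag).med⟩ hi (by simp)
    (by simpa using (ag.var vz rfl).trans hz) (by simpa using (ag.var vTop rfl).trans hT)
  have ag2 := frame D md keyS (s1.setVar vj (.nat i))
  have hvj : (ℛ keyS (s1.setVar vj (.nat i))).var vj = .nat i :=
    (ag2.var _ rfl).trans (by simp)
  simp only [Stm.run]
  refine ⟨fun j hj => ?_, ?_⟩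
  · by_cases h : j = i
    · subst h; exact ⟨y, hy, by simp [hvj, hy']⟩
    · obtain ⟨z, hz, hz'⟩ := h1 j (by omega)
      refine ⟨z, hz, ?_⟩
      simp only [Expr.eval, St.setArr_arr, hvj]
      simp only [Word.toNat_nat, h, and_false, if_false]
      rw [ag2.arr _ rfl]; exact hz'
  · simp at hty ⊢
    rw [add_mul, one_mul]; omega

/-- `y` is the `(r + 1)`-st largest key, or `0` if there is none. -/
def TopKey (n : ℕ) (x : ℕ → ℝ) (r : ℕ) (y : ℝ) : Prop :=
  (y = 0 ∨ ∃ j < n, y = x j) ∧ ((range n).filter fun j => y < x j).card ≤ r ∧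
    (y = 0 ∨ r + 1 ≤ ((range n).filter fun j => y ≤ x j).card)

lemma maxRestS_spec (hp : Params k t ε n s) (hx : ∀ j < n, s.arr aRest j = .real (x j))
    (hy : s.var vy = .real 0) (hm : s.var vm = .nat n) :
    ∃ (y : ℝ) (m : ℕ), (ℛ maxRestS s).var vy = .real y ∧
      (ℛ maxRestS s).var vm = .nat m ∧ (∀ j < n, x j ≤ y) ∧
      ((y = 0 ∧ m = n) ∨ (m < n ∧ y = x m ∧ 0 < y)) ∧
      (ℛ maxRestS s).time ≤ s.time + 1 + n * 4 := by
  refine for_rule D md (x := vj) (e := vN) (n := n) (fun i s' =>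
    ∃ (y : ℝ) (m : ℕ), s'.var vy = .real y ∧ s'.var vm = .nat m ∧ (∀ j < i, x j ≤ y) ∧
      ((y = 0 ∧ m = n) ∨ (m < n ∧ y = x m ∧ 0 < y)) ∧ s'.time ≤ s.time + 1 + i * 4)
    (by simp [hp.hn])
    ⟨0, n, by simpa using hy, by simpa using hm, by simp, .inl ⟨rfl, rfl⟩, by simp⟩ ?_
  rintro i hi s1 ag ⟨y, m, h1, h2, h3, h4, h5⟩
  have e1 : s1.arr aRest i = .real (x i) := by rw [ag.arr _ rfl]; exact hx i hi
  by_cases hc : x i ≤ y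
  · refine ⟨y, m, ?_, ?_, fun j hj => ?_, h4, ?_⟩
    · simp [e1, h1, hc]
    · simp [e1, h1, hc, h2]
    · rcases lt_or_eq hj with h | rfl
      · exact h3 j h
      · exact hc
    · simp [e1, h1, hc]; omega
  · refine ⟨x i, i, ?_, ?_, fun j hj => ?_, .inr ⟨hi, rfl, ?_⟩, ?_⟩
    · simp [e1, h1, hc]
    · simp [e1, h1, hc]
    · rcases lt_or_eq hj with h | rfl
      · linarith [h3 j h]
      · exact le_rfl
    · have : 0 ≤ y := by rcases h4 with h | h <;> linarith [h.1, h.2]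
      linarith
    · simp [e1, h1, hc]; omega

lemma copyKeysS_spec (hp : Params k t ε n s) (hx : ∀ j < n, s.arr aKey j = .real (x j)) :
    (∀ j < n, (ℛ copyKeysS s).arr aRest j = .real (x j)) ∧
      (ℛ copyKeysS s).time ≤ s.time + 1 + n * 2 := by
  refine for_rule D md (x := vj) (e := vN) (n := n) (fun i s' =>
    (∀ j < i, s'.arr aRest j = .real (x j)) ∧ s'.time ≤ s.time + 1 + i * 2)
    (by simp [hp.hn]) ⟨by simp, by simp⟩ ?_
  rintro i hi s1 ag ⟨h1, h2⟩
  have e1 : s1.arr aKey i = .real (x i) := by rw [ag.arr _ rfl]; exact hx i hi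
  simp only [Stm.run]
  refine ⟨fun j hj => ?_, by simp; omega⟩
  by_cases h : j = i
  · subst h; simp [e1]
  · simp [h, h1 j (by omega)]

lemma topKeysS_spec (hp : Params k t ε n s) (hx : ∀ j < n, s.arr aKey j = .real (x j))
    (hx0 : ∀ j < n, 0 ≤ x j) :
    (∀ r < 4 * t + 5, ∃ y, (ℛ topKeysS s).arr aTop r = .real y ∧ TopKey n x r y) ∧
      (ℛ topKeysS s).time ≤ s.time + 2 + n * 2 + (4 * t + 5) * (6 + n * 4) := by
  obtain ⟨hc, hct⟩ := copyKeysS_spec D md hp hx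
  have ag0 := frame D md copyKeysS s
  rw [show ℛ topKeysS s = ℛ (.rep vi vR _) (ℛ copyKeysS s) from rfl]
  set s0 := ℛ copyKeysS s
  have hp0 : Params k t ε n s0 := hp.mono ag0
  clear_value s0
  have := for_rule D md (x := vi) (e := vR) (c := .set vy (.num 0) ;; .set vm vN ;; maxRestS ;;
    .put aTop vi vy ;; .put aRest vm (.num 0)) (s := s0) (n := 4 * t + 5) (fun i s' =>
    (∃ M : Finset ℕ, M ⊆ range n ∧ M.card ≤ i ∧
      (∀ j < n, s'.arr aRest j = .real (if j ∈ M then 0 else x j)) ∧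
      (∀ a ∈ M, ∀ b < n, b ∉ M → x b ≤ x a) ∧ (M.card = i ∨ ∀ j < n, j ∉ M → x j ≤ 0)) ∧
    (∀ r < i, ∃ y, s'.arr aTop r = .real y ∧ TopKey n x r y) ∧
    s'.time ≤ s.time + 2 + n * 2 + i * (6 + n * 4)) (by simp [hp0.hr])
    ⟨⟨∅, by simp, by simp, by simpa using hc, by simp, by simp⟩, by simp, by simp; omega⟩ ?_
  · exact this.2
  rintro i hi s1 ag ⟨⟨M, hM, hMc, hrest, hord, hfull⟩, htop, ht⟩
  have hp1 : Params k t ε n s1 := hp0.mono ag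
  set s2 := ((s1.setVar vi (.nat i)).setVar vy (.real 0)).setVar vm (.nat n) with hs2
  obtain ⟨y, m, hy, hm, hle, hcase, htm⟩ := maxRestS_spec D md (s := s2)
    (x := fun j => if j ∈ M then 0 else x j)
    (((hp1.setVar _).setVar _).setVar _)
    hrest (by simp [hs2]) (by simp [hs2])
  have ag3 := frame D md maxRestS s2
  have hr : ℛ (.set vy (.num 0) ;; .set vm vN ;; maxRestS ;;
      .put aTop vi vy ;; .put aRest vm (.num 0)) (s1.setVar vi (.nat i)) =
      ((ℛ maxRestS s2).setArr aTop i (.real y)).setArr aRest m (.real 0) := by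
    have e : ℛ (.set vy (.num 0) ;; .set vm vN) (s1.setVar vi (.nat i)) = s2 := by
      simp [hs2, hp1.hn]
    have e2 : ℛ (.set vy (.num 0) ;; .set vm vN ;; maxRestS ;;
      .put aTop vi vy ;; .put aRest vm (.num 0)) (s1.setVar vi (.nat i)) =
      ℛ (.put aTop vi vy ;; .put aRest vm (.num 0)) (ℛ maxRestS s2) := by
      rw [← e]; rfl
    rw [e2]
    have hvi : (ℛ maxRestS s2).var vi = .nat i := (ag3.var _ rfl).trans (by simp [hs2])
    simp [hvi, hy, hm]
  rw [hr]
  have hrest3 : ∀ j < n, (ℛ maxRestS s2).arr aRest j =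
      .real (if j ∈ M then 0 else x j) := fun j hj => by rw [ag3.arr _ rfl]; exact hrest j hj
  have htop3 : ∀ r < i, ∃ y, (ℛ maxRestS s2).arr aTop r = .real y ∧ TopKey n x r y :=
    fun r hr => by rw [ag3.arr _ rfl]; exact htop r hr
  have hnew : TopKey n x i y → ∀ r < i + 1, ∃ y', (((ℛ maxRestS s2).setArr aTop i
      (.real y)).setArr aRest m (.real 0)).arr aTop r = .real y' ∧ TopKey n x r y' := by
    intro hy r hr
    by_cases h : r = i
    · subst h; exact ⟨y, by simp, hy⟩
    · obtain ⟨z, hz, hz'⟩ := htop3 r (by omega)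
      exact ⟨z, by simp [h, hz], hz'⟩
  have htt : (((ℛ maxRestS s2).setArr aTop i (.real y)).setArr aRest m (.real 0)).time ≤
      s.time + 2 + n * 2 + (i + 1) * (6 + n * 4) := by
    simp [hs2] at htm ⊢
    rw [add_mul, one_mul]; omega
  have hcard : ((range n).filter fun j => y < x j).card ≤ i := by
    refine (card_le_card fun j hj => ?_).trans hMc
    rw [mem_filter, mem_range] at hj
    by_contra hjM
    have := hle j hj.1
    simp only [hjM, if_false] at this
    linarith [hj.2]
  rcases hcase with ⟨rfl, rfl⟩ | ⟨hmn, hym, hy0⟩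
  · refine ⟨⟨M, hM, hMc.trans (by omega), fun j hj => ?_, hord, .inr fun j hj hjM => ?_⟩,
      hnew ⟨.inl rfl, hcard, .inl rfl⟩, htt⟩
    · simp [hj.ne, hrest3 j hj]
    · have := hle j hj
      simpa only [hjM, if_false] using this
  · have hmM : m ∉ M := fun h => by simp only [h, if_true] at hym; linarith
    simp only [hmM, if_false] at hym
    have hMi : M.card = i := hfull.resolve_right fun h => by
      have := h m hmn hmM
      linarith
    refine ⟨⟨insert m M, ?_, ?_, fun j hj => ?_, ?_, .inl ?_⟩, hnew ⟨.inr ⟨m, hmn, hym⟩, hcard,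
      .inr ?_⟩, htt⟩
    · exact insert_subset (mem_range.2 hmn) hM
    · rw [card_insert_of_notMem hmM]; omega
    · by_cases h : j = m
      · simp [h]
      · simp [h, hrest3 j hj]
    · intro a ha b hb hbM
      simp only [mem_insert, not_or] at ha hbM
      rcases ha with rfl | ha
      · have := hle b hb
        simp only [hbM.2, if_false] at this
        linarith
      · exact hord a ha b hb hbM.2
    · rw [card_insert_of_notMem hmM, hMi]
    · rw [← hMi, ← card_insert_of_notMem hmM]
      refine card_le_card fun j hj => ?_
      rw [mem_filter]
      refine ⟨(insert_subset (mem_range.2 hmn) hM) hj, ?_⟩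
      rcases mem_insert.1 hj with rfl | hj
      · exact hym.le
      · have := hord j hj m hmn hmM
        linarith

lemma bud_le {b : ℕ} (hb : b < numB t) : bud b ≤ 4 * t + 4 := by
  unfold bud
  split_ifs with h
  · omega
  · have h1 : b - 1 ≤ expo (1 + t) + 2 := by unfold numB at hb; omega
    have h2 : (2 : ℝ) ^ expo (1 + t) ≤ 1 + t := pow_expo_le
        (by linarith [Nat.cast_nonneg (α := ℝ) t])
    have h3 : 2 ^ expo (1 + t) ≤ 1 + t := by exact_mod_cast h2
    calc 2 ^ (b - 1) ≤ 2 ^ (expo (1 + t) + 2) := Nat.pow_le_pow_right (by norm_num) h1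
      _ ≤ 4 * t + 4 := by rw [pow_add]; omega

/-- Level `y` is what budget `b` requires, and `g` is its generator. -/
structure Profile (n k t : ℕ) (mp : ℕ → P) (x : ℕ → ℝ) (b : ℕ) (y : ℝ) (g : ℕ) : Prop where
  le : g ≤ numL P
  top : ∃ z, TopKey n x (bud b) z ∧ y = max z (if g = 0 then 0 else 2 ^ g)
  len : (netList mp g (k + (4 * t + 5)) n).length ≤ k + bud b
  min : ∀ g' < g, k + bud b < (netList mp g' (k + (4 * t + 5)) n).length

lemma recordS_spec (hp : Params k t ε n s) {cnt g : ℕ} {z : ℝ} {y : ℕ → ℝ}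
    (hc : s.var vc = .nat cnt) (hg : s.var vg = .nat g) (hz : s.var vz = .real z)
    (hy : ∀ r < 4 * t + 5, s.arr aTop r = .real (y r)) :
    (∀ b < numB t, s.arr aLev b = .blank → cnt ≤ k + bud b →
      (ℛ recordS s).arr aLev b = .real (max (y (bud b)) z) ∧
      (ℛ recordS s).arr aGen b = .nat g) ∧
    (∀ b < numB t, (s.arr aLev b ≠ .blank ∨ k + bud b < cnt) →
      (ℛ recordS s).arr aLev b = s.arr aLev b ∧
      (ℛ recordS s).arr aGen b = s.arr aGen b) ∧
    (ℛ recordS s).time ≤ s.time + 1 + numB t * 5 := by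
  have := for_rule D md (x := vb) (e := vNB) (c := .ite .blank (.arr aLev vb) ♯0
    (.ite .nat vc (vK +ₙ .arr aBud vb)
      (.put aLev vb (.cond .real (.arr aTop (.arr aBud vb)) vz vz (.arr aTop (.arr aBud vb))) ;;
        .put aGen vb vg) .skip) .skip) (s := s) (n := numB t) (fun i s' =>
    (∀ b < i, s.arr aLev b = .blank → cnt ≤ k + bud b →
      s'.arr aLev b = .real (max (y (bud b)) z) ∧ s'.arr aGen b = .nat g) ∧
    (∀ b, (i ≤ b ∨ s.arr aLev b ≠ .blank ∨ k + bud b < cnt) →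
      s'.arr aLev b = s.arr aLev b ∧ s'.arr aGen b = s.arr aGen b) ∧
    s'.time ≤ s.time + 1 + i * 5) (by simp [hp.hnb])
    ⟨by simp, by simp, by simp⟩ ?_
  · exact ⟨this.1, fun b _ h => this.2.1 b (.inr h), this.2.2⟩
  rintro i hi s1 ag ⟨h1, h2, h3⟩
  have hp1 : Params k t ε n s1 := hp.mono ag
  have e1 : s1.arr aBud i = .nat (bud i) := hp1.bud i hi.le
  have e2 : s1.arr aTop (bud i) = .real (y (bud i)) := by
    rw [ag.arr _ rfl]; exact hy _ (by have := bud_le hi; omega)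
  have e3 : s1.var vc = .nat cnt := (ag.var _ rfl).trans hc
  have e4 : s1.var vg = .nat g := (ag.var _ rfl).trans hg
  have e5 : s1.var vz = .real z := (ag.var _ rfl).trans hz
  have e6 := h2 i (.inl le_rfl)
  have hmax : (if y (bud i) ≤ z then Word.real z else Word.real (y (bud i)) : Word P A) =
      .real (max (y (bud i)) z) := by rw [max_def]; split_ifs <;> rfl
  by_cases hb : s.arr aLev i = .blank
  · by_cases hcn : cnt ≤ k + bud i
    · have hr : ℛ (.ite .blank (.arr aLev vb) ♯0 (.ite .nat vc (vK +ₙ .arr aBud vb)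
          (.put aLev vb (.cond .real (.arr aTop (.arr aBud vb)) vz vz (.arr aTop (.arr aBud vb))) ;;
          .put aGen vb vg) .skip) .skip) (s1.setVar vb (.nat i)) =
          ((((s1.setVar vb (.nat i)).tick).tick).setArr aLev i (.real (max (y (bud i)) z))).setArr
            aGen i (.nat g) := by
        simp [e6, hb, e1, e2, e3, e4, e5, hp1.hk, hcn, hmax]
      rw [hr]
      refine ⟨fun b hbi hb1 hb2 => ?_, fun b hb1 => ?_, ?_⟩
      · by_cases h : b = i
        · subst h; simp
        · simpa [h] using h1 b (by omega) hb1 hb2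
      · have h : b ≠ i := by
          rintro rfl
          rcases hb1 with h | h | h
          · omega
          · exact h hb
          · omega
        simpa [h] using h2 b (by rcases hb1 with h | h <;> [exact .inl (by omega); exact .inr h])
      · simp; omega
    · have hr : ℛ (.ite .blank (.arr aLev vb) ♯0 (.ite .nat vc (vK +ₙ .arr aBud vb)
          (.put aLev vb (.cond .real (.arr aTop (.arr aBud vb)) vz vz (.arr aTop (.arr aBud vb))) ;;
          .put aGen vb vg) .skip) .skip) (s1.setVar vb (.nat i)) =
          ((s1.setVar vb (.nat i)).tick).tick := by
        simp [e6, hb, e1, e3, hp1.hk, hcn]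
      rw [hr]
      refine ⟨fun b hbi hb1 hb2 => ?_, fun b hb1 => ?_, by simp; omega⟩
      · rcases lt_or_eq hbi with h | rfl
        · exact h1 b h hb1 hb2
        · omega
      · by_cases h : b = i
        · subst h; exact h2 b (.inl le_rfl)
        · exact h2 b (by rcases hb1 with h | h <;> [exact .inl (by omega); exact .inr h])
  · have hr : ℛ (.ite .blank (.arr aLev vb) ♯0 (.ite .nat vc (vK +ₙ .arr aBud vb)
        (.put aLev vb (.cond .real (.arr aTop (.arr aBud vb)) vz vz (.arr aTop (.arr aBud vb))) ;;
        .put aGen vb vg) .skip) .skip) (s1.setVar vb (.nat i)) =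
        (s1.setVar vb (.nat i)).tick := by
      simp [e6, hb]
    rw [hr]
    refine ⟨fun b hbi hb1 hb2 => ?_, fun b hb1 => ?_, by simp; omega⟩
    · rcases lt_or_eq hbi with h | rfl
      · exact h1 b h hb1 hb2
      · exact absurd hb1 hb
    · by_cases h : b = i
      · subst h; exact h2 b (.inl le_rfl)
      · exact h2 b (by rcases hb1 with h | h <;> [exact .inl (by omega); exact .inr h])

lemma netList_length_le_one {g : ℕ} (h : ∀ y z : P, lev y z ≤ g + 1) (cap i : ℕ) :
    (netList mp g cap i).length ≤ 1 := by
  induction i with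
  | zero => simp [netList]
  | succ i ih =>
    rw [netList]
    split_ifs with hc
    · rcases hl : netList mp g cap i with _ | ⟨a, l⟩
      · simp
      · have h1 := hc.1 a (by rw [hl]; simp)
        have h2 := h (mp i) (mp a)
        omega
    · exact ih

/-- What a site knows after the first phase. -/
structure SiteSt (D : A → PMF P) (k t : ℕ) (ε : ℝ) (n : ℕ) (nd : ℕ → A) (mp : ℕ → P) (x : ℕ → ℝ)
    (lv : ℕ → ℝ) (gn : ℕ → ℕ) (s : St P A) : Prop where
  params : Params k t ε n s
  nodes : Nodes n nd mp s
  key : ∀ j < n, s.arr aKey j = .real (x j)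
  isKey : ∀ j < n, IsKey (D (nd j)) (mp j) (quota ε t) (x j)
  lev : ∀ b < numB t, s.arr aLev b = .real (lv b)
  gen : ∀ b < numB t, s.arr aGen b = .nat (gn b)
  profile : ∀ b < numB t, Profile n k t mp x b (lv b) (gn b)

/-- The time bound of `netS`. -/
def netTime (k t n : ℕ) : ℕ := 3 + n * (3 * (k + (4 * t + 6)) + 11)

lemma profileS_spec (hp : Params k t ε n s) (hn : Nodes n nd mp s) (hk1 : 1 ≤ k)
    (hx : ∀ j < n, s.arr aKey j = .real (x j))
    (htop : ∀ r < 4 * t + 5, ∃ y, s.arr aTop r = .real y ∧ TopKey n x r y)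
    (hT : s.var vTop = .nat (numL P)) (hbl : ∀ b, s.arr aLev b = .blank) :
    (∀ b < numB t, ∃ y g, (ℛ profileS s).arr aLev b = .real y ∧
      (ℛ profileS s).arr aGen b = .nat g ∧ Profile n k t mp x b y g) ∧
    (ℛ profileS s).time ≤
      s.time + 3 + (numL P + 1) * (netTime k t n + (3 + numB t * 5)) := by
  choose! y hy hty using htop
  set s0 := (s.setVar vx (.real 0)).setVar vz (.real 0) with hs0
  rw [show ℛ profileS s = ℛ (.rep vg (vTop +ₙ ♯1) (netS ;; recordS ;;
    .set vz (.cond .real vz (.num 0) (.num 2) (vz +ᵣ vz)))) s0 by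
    simp [profileS, hs0]]
  have hp0 : Params k t ε n s0 := (hp.setVar _).setVar _
  have hn0 : Nodes n nd mp s0 := ⟨hn.node, hn.med⟩
  set cap := k + (4 * t + 5) with hcap
  have := for_rule D md (x := vg) (e := vTop +ₙ ♯1) (c := netS ;; recordS ;;
    .set vz (.cond .real vz (.num 0) (.num 2) (vz +ᵣ vz))) (s := s0) (n := numL P + 1)
    (fun i s' => (s'.var vz = .real (if i = 0 then 0 else 2 ^ i)) ∧
      (∀ b < numB t, s'.arr aLev b = .blank → ∀ g < i, k + bud b < (netList mp g cap n).length) ∧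
      (∀ b < numB t, s'.arr aLev b ≠ .blank → ∃ y g, s'.arr aLev b = .real y ∧
        s'.arr aGen b = .nat g ∧ g < i ∧ Profile n k t mp x b y g) ∧
      s'.time ≤ s.time + 3 + i * (netTime k t n + (3 + numB t * 5)))
    (by simp [hs0, hT])
    ⟨by simp [hs0], by simp, fun b _ h => absurd (hbl b) h, by simp [hs0]⟩ ?_
  · refine ⟨fun b hb => ?_, this.2.2.2⟩
    by_cases h : (ℛ (.rep vg (vTop +ₙ ♯1) (netS ;; recordS ;;
      .set vz (.cond .real vz (.num 0) (.num 2) (vz +ᵣ vz)))) s0).arr aLev b = .blank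
    · have h1 := this.2.1 b hb h (numL P) (by omega)
      have h2 := netList_length_le_one (mp := mp) (g := numL P) lev_le_numL cap n
      omega
    · obtain ⟨y, g, h1, h2, -, h4⟩ := this.2.2.1 b hb h
      exact ⟨y, g, h1, h2, h4⟩
  rintro i hi s1 ag ⟨h1, h2, h3, h4⟩
  have hp1 := hp0.mono ag
  set s2 := s1.setVar vg (.nat i) with hs2
  have hp2 : Params k t ε n s2 := hp1.setVar _
  have hx2 : ∀ j < n, s2.arr aKey j = .real (x j) := fun j hj => by
    have e : s2.arr aKey = s0.arr aKey := ag.arr _ rfl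
    rw [e]; exact hx j hj
  have hg2 : s2.var vg = .nat i := by simp [hs2]
  have hX1 : s1.var vx = s0.var vx := ag.var _ rfl
  have hX2 : s2.var vx = .real 0 := by simp [hs2, hX1, hs0]
  obtain ⟨cnt, f, hI, hnt⟩ := netS_spec D md (s := s2) (g := i) (X := 0) hp2
    ((hn0.mono ag : Nodes n nd mp s1) |> fun h => ⟨h.node, h.med⟩) hg2
    hX2 hx2
  have ag3 := frame D md netS s2
  set s3 := ℛ netS s2 with hs3
  have hlen : (netList mp i cap n).length = cnt := by rw [hcap, hI.list]; simp
  have hlev3 : ∀ b, s3.arr aLev b = s1.arr aLev b := fun b => by rw [ag3.arr _ rfl]; rfl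
  have hgen3 : ∀ b, s3.arr aGen b = s1.arr aGen b := fun b => by rw [ag3.arr _ rfl]; rfl
  have hz3 : s3.var vz = .real (if i = 0 then 0 else 2 ^ i) :=
    (ag3.var _ rfl).trans (by simpa [hs2] using h1)
  obtain ⟨hr1, hr2, hr3⟩ := recordS_spec D md (s := s3) (g := i) (y := y)
    (hp2.mono ag3) hI.hcnt ((ag3.var _ rfl).trans (by simp [hs2])) hz3
    (fun r hr => by
      have e1 : s3.arr aTop = s2.arr aTop := ag3.arr _ rfl
      have e2 : s2.arr aTop = s0.arr aTop := ag.arr _ rfl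
      rw [e1, e2]; exact hy r hr)
  have ag4 := frame D md recordS s3
  set s4 := ℛ recordS s3 with hs4
  have hz4 : s4.var vz = .real (if i = 0 then 0 else 2 ^ i) := (ag4.var _ rfl).trans hz3
  rw [show ℛ (netS ;; recordS ;; .set vz (.cond .real vz (.num 0) (.num 2) (vz +ᵣ vz))) s2 =
      s4.setVar vz (.real (2 ^ (i + 1))) by
    have : (2 : ℝ) ^ i ≠ 0 := by positivity
    have h2 : ¬ (2 : ℝ) ^ i ≤ 0 := by have : (0 : ℝ) < 2 ^ i := by positivity
                                      linarith
    simp only [Stm.run, ← hs3, ← hs4]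
    by_cases hi0 : i = 0
    · subst hi0; simp [hz4]
    · simp [hz4, hi0, h2]; ring_nf]
  refine ⟨by simp, fun b hb hbl g hg => ?_, fun b hb hbl => ?_, ?_⟩
  · by_cases hold : s1.arr aLev b = .blank
    · rcases lt_or_eq hg with hg | rfl
      · exact h2 b hb hold g hg
      · by_contra hc
        rw [hlen, not_lt] at hc
        have := (hr1 b hb ((hlev3 b).trans hold) hc).1
        simp only [St.setVar_arr] at hbl
        rw [this] at hbl
        cases hbl
    · have := (hr2 b hb (.inl (by rwa [hlev3]))).1
      simp only [St.setVar_arr] at hbl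
      rw [this, hlev3] at hbl
      exact absurd hbl hold
  · simp only [St.setVar_arr] at hbl ⊢
    by_cases hold : s1.arr aLev b = .blank
    · by_cases hc : cnt ≤ k + bud b
      · obtain ⟨e1, e2⟩ := hr1 b hb ((hlev3 b).trans hold) hc
        refine ⟨_, i, e1, e2, by omega, ⟨by omega, ⟨_, hty _ (by have := bud_le hb; omega), rfl⟩,
          hlen ▸ hc, fun g' hg' => h2 b hb hold g' hg'⟩⟩
      · have := (hr2 b hb (.inr (not_le.1 hc))).1
        rw [this, hlev3] at hbl
        exact absurd hold hbl
    · obtain ⟨e1, e2⟩ := hr2 b hb (.inl (by rwa [hlev3]))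
      rw [e1, e2, hlev3, hgen3]
      obtain ⟨y, g, a1, a2, a3, a4⟩ := h3 b hb hold
      exact ⟨y, g, a1, a2, by omega, a4⟩
  · simp [hs2] at hnt hr3 ⊢
    rw [add_mul, one_mul]; unfold netTime at h4 ⊢; omega

/-- The time bound of `site₁S`. -/
def siteTime₁ (k t n l : ℕ) : ℕ :=
  22 + numB t * 6 + n * 6 + n * (l * 4 + 7) + (4 * t + 5) * (6 + n * 4) +
    (l + 1) * (netTime k t n + (3 + numB t * 5))

lemma site₁S_spec (hk1 : 1 ≤ k)
    (hin : s.inbox 0 = [.nat k, .nat t, .real ε, .real (dmin P), .real (dmax P), .nat n] ++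
      (List.range' 0 n).map fun j => .node (nd j))
    (hout : s.outbox 1 = []) (hbl : ∀ b, s.arr aLev b = .blank) (hq : 0 ≤ quota ε t)
    (hin1 : s.inbox 1 = []) :
    ∃ x lv gen, SiteSt D k t ε n nd (md ∘ nd) x lv gen (ℛ site₁S s) ∧
      (ℛ site₁S s).outbox 1 =
        (List.range (numB t)).flatMap (fun b => [.nat (keyP (lv b)), .nat (keyM (lv b))]) ∧
      (ℛ site₁S s).inbox 1 = [] ∧
      (ℛ site₁S s).time ≤ s.time + siteTime₁ k t n (numL P) := by
  obtain ⟨p1, i1, t1⟩ := initS_spec D md hin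
  have ag1 := frame D md initS s
  rw [show ℛ site₁S s = ℛ sendProfileS (ℛ profileS (ℛ topKeysS
    (ℛ keysS (ℛ readNodesS (ℛ initS s))))) from rfl]
  set s1 := ℛ initS s
  obtain ⟨n2, i2, t2⟩ := readNodesS_spec D md (nd := nd) p1 (by rw [i1]; simp)
  have ag2 := frame D md readNodesS s1
  have i2' : (ℛ readNodesS s1).inbox 1 = [] := by
    have := for_rule D md (x := vj) (e := vN)
      (c := .recv vx ♯0 ;; .put aNode vj vx ;; .put aMed vj (.median vx)) (s := s1) (n := n)
      (fun i s' => s'.inbox 1 = []) (by simp [p1.hn]) (by simp [i1, hin1])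
      (by rintro i hi s' - h; simpa using h)
    exact this
  set s2 := ℛ readNodesS s1
  have p2 : Params k t ε n s2 := p1.mono ag2
  obtain ⟨h3, T3, t3⟩ := keysS_spec D md p2 n2
  have ag3 := frame D md keysS s2
  set s3 := ℛ keysS s2
  have p3 : Params k t ε n s3 := p2.mono ag3
  have n3 : Nodes n nd (md ∘ nd) s3 := n2.mono ag3
  choose! x hx hkx using h3
  obtain ⟨h4, t4⟩ := topKeysS_spec D md (x := x) p3 hkx (fun j hj => ((hx j hj).valid hq).nonneg)
  have ag4 := frame D md topKeysS s3
  set s4 := ℛ topKeysS s3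
  have p4 : Params k t ε n s4 := p3.mono ag4
  have n4 : Nodes n nd (md ∘ nd) s4 := n3.mono ag4
  have k4 : ∀ j < n, s4.arr aKey j = .real (x j) := fun j hj => by
    rw [ag4.arr _ rfl]; exact hkx j hj
  obtain ⟨h5, t5⟩ := profileS_spec D md (x := x) p4 n4 hk1 k4 h4
    ((ag4.var _ rfl).trans T3) (fun b => by
      rw [ag4.arr _ rfl, ag3.arr _ rfl, ag2.arr _ rfl, ag1.arr _ rfl]; exact hbl b)
  have ag5 := frame D md profileS s4
  set s5 := ℛ profileS s4
  choose! lv gen h6 h7 h8 using h5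
  have p5 : Params k t ε n s5 := p4.mono ag5
  have S5 : SiteSt D k t ε n nd (md ∘ nd) x lv gen s5 := ⟨p5, n4.mono ag5,
    fun j hj => by rw [ag5.arr _ rfl]; exact k4 j hj, hx, h6, h7, h8⟩
  have o5 : s5.outbox 1 = [] := by
    rw [ag5.outbox rfl, ag4.outbox rfl, ag3.outbox rfl, ag2.outbox rfl, ag1.outbox rfl, hout]
  have i5 : s5.inbox 1 = [] := by
    rw [ag5.inbox rfl, ag4.inbox rfl, ag3.inbox rfl, i2']
  have ag6 := frame D md sendProfileS s5
  have := for_rule D md (x := vb) (e := vNB)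
    (c := .send ♯1 (keyPE (.arr aLev vb)) ;; .send ♯1 (keyME (.arr aLev vb)))
    (s := s5) (n := numB t) (fun i s' => s'.outbox 1 =
      (List.range i).flatMap (fun b => [.nat (keyP (lv b)), .nat (keyM (lv b))]) ∧
      s'.time ≤ s5.time + 1 + i * 3)
    (by simp [p5.hnb]) ⟨by simp [o5], by simp⟩ (by
      rintro i hi s' ag ⟨h1, h2⟩
      have e : ∀ s'' : St P A, s''.arr = s'.arr → s''.var vb = .nat i →
          Expr.eval D md s'' (.arr aLev vb) = .real (lv i) := fun s'' h h' => by
        simp only [Expr.eval, h, h', Word.toNat_nat]; rw [ag.arr _ rfl]; exact h6 i hi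
      simp only [Stm.run]
      rw [eval_keyPE (x := lv i) (e _ (by simp) (by simp)),
        eval_keyME (x := lv i) (e _ (by simp) (by simp))]
      refine ⟨?_, ?_⟩
      · simp [h1, List.range_succ]
      · simp; omega)
  refine ⟨x, lv, gen, ⟨S5.params.mono ag6, S5.nodes.mono ag6, fun j hj => ?_, S5.isKey,
    fun b hb => ?_, fun b hb => ?_, S5.profile⟩, this.1, ?_, ?_⟩
  · rw [ag6.arr _ rfl]; exact S5.key j hj
  · rw [ag6.arr _ rfl]; exact S5.lev b hb
  · rw [ag6.arr _ rfl]; exact S5.gen b hb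
  · rw [ag6.inbox rfl, i5]
  · have e : (ℛ sendProfileS s5).time ≤ s5.time + 1 + numB t * 3 := this.2
    unfold siteTime₁
    omega

open Classical in
/-- The nodes with a key above `X`. -/
def cutList (n : ℕ) (x : ℕ → ℝ) (X : ℝ) : List ℕ := (List.range n).filter fun j => ¬ x j ≤ X

/-- The summary of a site: net points `c l` with weights `w l`, node `j` being attached to net
point `f j`. -/
structure Summary (n k : ℕ) (mp : ℕ → P) (x : ℕ → ℝ) (r : ℕ) (X : ℝ) (g cnt : ℕ) (c w f : ℕ → ℕ) :
    Prop where
  cnt_le : cnt ≤ k + r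
  cut_le : (cutList n x X).length ≤ r
  lt : ∀ l < cnt, c l < n
  att : ∀ j < n, f j < cnt ∧ lev (mp j) (mp (c (f j))) ≤ g + 1
  weight : ∀ l < cnt, w l = ((range n).filter fun j => x j ≤ X ∧ f j = l).card

def netWords (k : ℕ) (nd : ℕ → A) (mp : ℕ → P) (c w : ℕ → ℕ) (l : ℕ) : List (Word P A) :=
  [if l + 1 ≤ k then .pt (mp (c l)) else .node (nd (c l)), .nat (w l)]

def cutWords (nd : ℕ → A) (x : ℕ → ℝ) (j : ℕ) : List (Word P A) :=
  [.node (nd j), .nat (keyP (x j)), .nat (keyM (x j))]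

def summaryWords (n k : ℕ) (nd : ℕ → A) (mp : ℕ → P) (x : ℕ → ℝ) (X : ℝ) (cnt : ℕ)
    (c w : ℕ → ℕ) : List (Word P A) :=
  [.nat cnt, .nat (cutList n x X).length] ++ (List.range cnt).flatMap (netWords k nd mp c w) ++
    (cutList n x X).flatMap (cutWords nd x)

lemma length_cutList (n : ℕ) (x : ℕ → ℝ) (X : ℝ) :
    (cutList n x X).length = ((range n).filter fun j => ¬ x j ≤ X).card := by
  classical
  rw [cutList, card, filter_val, range_val, Multiset.range, Multiset.filter_coe, Multiset.coe_card]

lemma sendNetS_spec (hp : Params k t ε n s) (hn : Nodes n nd mp s) {cnt : ℕ} {w : ℕ → ℕ}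
    (hc : s.var vc = .nat cnt) (hnet : ∀ l < cnt, net s l < n)
    (hw : ∀ l < cnt, s.arr aWt l = .nat (w l)) :
    (ℛ sendNetS s).outbox 1 = s.outbox 1 ++ (List.range cnt).flatMap (netWords k nd mp (net s) w) ∧
      (ℛ sendNetS s).time ≤ s.time + 1 + cnt * 4 := by
  refine for_rule D md (x := vl) (e := vc) (n := cnt) (fun i s' => s'.outbox 1 =
    s.outbox 1 ++ (List.range i).flatMap (netWords k nd mp (net s) w) ∧
      s'.time ≤ s.time + 1 + i * 4) (by simp [hc]) ⟨by simp, by simp⟩ ?_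
  rintro i hi s' ag ⟨h1, h2⟩
  have e1 : (s'.arr aNet i).toNat = net s i := by rw [ag.arr _ rfl]; rfl
  have e2 : s'.arr aWt i = .nat (w i) := by rw [ag.arr _ rfl]; exact hw i hi
  have e3 : s'.arr aMed (net s i) = .pt (mp (net s i)) := by
    rw [ag.arr _ rfl]; exact hn.med _ (hnet i hi)
  have e4 : s'.arr aNode (net s i) = .node (nd (net s i)) := by
    rw [ag.arr _ rfl]; exact hn.node _ (hnet i hi)
  have e5 : s'.var vK = .nat k := (ag.var _ rfl).trans hp.hk
  by_cases hik : i + 1 ≤ k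
  · refine ⟨?_, ?_⟩
    · simp [e1, e2, e3, e5, hik, h1, List.range_succ, netWords]
    · simp [e5, hik]; omega
  · refine ⟨?_, ?_⟩
    · simp [e1, e2, e4, e5, hik, h1, List.range_succ, netWords]
    · simp [e5, hik]; omega

lemma sendCutS_spec (hp : Params k t ε n s) (hn : Nodes n nd mp s) {X : ℝ}
    (hX : s.var vx = .real X) (hx : ∀ j < n, s.arr aKey j = .real (x j)) :
    (ℛ sendCutS s).outbox 1 = s.outbox 1 ++ (cutList n x X).flatMap (cutWords nd x) ∧
      (ℛ sendCutS s).time ≤ s.time + 1 + n * 5 := by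
  refine for_rule D md (x := vj) (e := vN) (n := n) (fun i s' => s'.outbox 1 =
    s.outbox 1 ++ (cutList i x X).flatMap (cutWords nd x) ∧
      s'.time ≤ s.time + 1 + i * 5) (by simp [hp.hn]) ⟨by simp [cutList], by simp⟩ ?_
  rintro i hi s' ag ⟨h1, h2⟩
  have e1 : s'.arr aKey i = .real (x i) := by rw [ag.arr _ rfl]; exact hx i hi
  have e2 : s'.arr aNode i = .node (nd i) := by rw [ag.arr _ rfl]; exact hn.node i hi
  have e3 : s'.var vx = .real X := (ag.var _ rfl).trans hX
  have ek : ∀ s'' : St P A, s''.arr = s'.arr → s''.var vj = .nat i →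
      Expr.eval D md s'' (.arr aKey vj) = .real (x i) := fun s'' h h' => by
    simp [h, h', e1]
  by_cases hc : x i ≤ X
  · refine ⟨?_, ?_⟩
    · simp [e1, e3, hc, h1, cutList, List.range_succ]
    · simp [e1, e3, hc]; omega
  · have hr : ℛ (.ite .real (.arr aKey vj) vx .skip
        (.send ♯1 (.arr aNode vj) ;; .send ♯1 (keyPE (.arr aKey vj)) ;;
        .send ♯1 (keyME (.arr aKey vj)))) (s'.setVar vj (.nat i)) =
        ((((s'.setVar vj (.nat i)).tick).write 1 (.node (nd i))).write 1 (.nat (keyP (x i)))).write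
          1 (.nat (keyM (x i))) := by
      simp only [Stm.run]
      rw [eval_keyPE (x := x i) (ek _ (by simp) (by simp)),
        eval_keyME (x := x i) (ek _ (by simp) (by simp))]
      simp [e1, e2, e3, hc]
    rw [hr]
    refine ⟨?_, ?_⟩
    · simp [h1, cutList, List.range_succ, not_le.1 hc, cutWords]
    · simp; omega

/-- The time bound of `site₂S`. -/
def siteTime₂ (k t n : ℕ) : ℕ := 7 + netTime k t n + (k + (4 * t + 4)) * 4 + n * 5

lemma site₂S_spec {lv : ℕ → ℝ} {gen : ℕ → ℕ} (hs : SiteSt D k t ε n nd mp x lv gen s) {b : ℕ}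
    (hb : b < numB t) (hin : s.inbox 1 = [.nat b]) (hout : s.outbox 1 = []) :
    ∃ cnt c w f, Summary n k mp x (bud b) (lv b) (gen b) cnt c w f ∧
      (ℛ site₂S s).outbox 1 = summaryWords n k nd mp x (lv b) cnt c w ∧
      SiteSt D k t ε n nd mp x lv gen (ℛ site₂S s) ∧
      (ℛ site₂S s).inbox 1 = [] ∧
      (ℛ site₂S s).time ≤ s.time + siteTime₂ k t n := by
  set s0 := ((s.read vb 1).setVar vx (.real (lv b))).setVar vg (.nat (gen b)) with hs0
  have hrun : ℛ site₂S s = ℛ (.send ♯1 vc ;; .send ♯1 vh ;;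
      sendNetS ;; sendCutS) (ℛ netS s0) := by
    have : ℛ (.recv vb ♯1 ;; .set vx (.arr aLev vb) ;; .set vg (.arr aGen vb)) s
        = s0 := by
      simp [hs0, hin, hs.lev b hb, hs.gen b hb]
    rw [← this]; rfl
  have hp0 : Params k t ε n s0 := hs.params.mono (frame D md
    (.recv vb ♯1 ;; .set vx (.arr aLev vb) ;; .set vg (.arr aGen vb)) s) rfl |> fun h => by
    have : ℛ (.recv vb ♯1 ;; .set vx (.arr aLev vb) ;; .set vg (.arr aGen vb)) s
        = s0 := by
      simp [hs0, hin, hs.lev b hb, hs.gen b hb]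
    exact this ▸ h
  have hn0 : Nodes n nd mp s0 := ⟨hs.nodes.node, hs.nodes.med⟩
  have hX0 : s0.var vx = .real (lv b) := by simp [hs0]
  obtain ⟨cnt, f, hI, ht⟩ := netS_spec D md (s := s0) (g := gen b) hp0 hn0
    (by simp [hs0]) hX0 hs.key
  have ag1 := frame D md netS s0
  set s1 := ℛ netS s0 with hs1
  set s2 := (s1.write 1 (.nat cnt)).write 1 (.nat (cutList n x (lv b)).length) with hs2
  have hrun2 : ℛ site₂S s = ℛ sendCutS (ℛ sendNetS s2) := by
    rw [hrun]
    simp only [Stm.run, Expr.eval, Word.toNat_nat]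
    rw [show ((s1.write 1 (s1.var vc)).write 1 ((s1.write 1 (s1.var vc)).var vh)) = s2 by
      simp [hs2, hI.hcnt, hI.cut, length_cutList]]
  have hp1 : Params k t ε n s1 := hp0.mono ag1
  have hn1 : Nodes n nd mp s1 := hn0.mono ag1
  have hp2 : Params k t ε n s2 := hp1.congr (fun _ _ => rfl) rfl
  have hpr := hs.profile b hb
  have hlen : cnt = (netList mp (gen b) (k + (4 * t + 5)) n).length := by rw [hI.list]; simp
  have hcnt : cnt ≤ k + bud b := hlen ▸ hpr.len
  have hbud := bud_le hb
  obtain ⟨z, hz, hzl⟩ := hpr.top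
  have hcut : (cutList n x (lv b)).length ≤ bud b := by
    rw [length_cutList]
    refine (card_le_card fun j hj => ?_).trans hz.2.1
    simp only [mem_filter, not_le] at hj ⊢
    exact ⟨hj.1, lt_of_le_of_lt (hzl ▸ le_max_left _ _) hj.2⟩
  obtain ⟨h3, t3⟩ := sendNetS_spec D md (s := s2) hp2 ⟨hn1.node, hn1.med⟩
    (cnt := cnt) (w := fun l => ((range n).filter fun j => x j ≤ lv b ∧ f j = l).card)
    hI.hcnt hI.hnet hI.wt
  have ag3 := frame D md sendNetS s2
  obtain ⟨h4, t4⟩ := sendCutS_spec D md (s := ℛ sendNetS s2) (X := lv b)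
    (x := x) (hp2.mono ag3) ((⟨hn1.node, hn1.med⟩ : Nodes n nd mp s2).mono ag3)
    ((ag3.var _ rfl).trans ((ag1.var _ rfl).trans hX0))
    (fun j hj => by
      rw [ag3.arr _ rfl]; show s1.arr aKey j = _; rw [ag1.arr _ rfl]; exact hs.key j hj)
  have ag := frame D md site₂S s
  refine ⟨cnt, net s1, _, f, ⟨hcnt, hcut, hI.hnet, fun j hj => ?_, fun l _ => rfl⟩, ?_,
    ⟨hs.params.mono ag, hs.nodes.mono ag, fun j hj => ?_, hs.isKey, fun b hb => ?_,
      fun b hb => ?_, hs.profile⟩, ?_, ?_⟩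
  · rcases hI.att j hj with h | h
    · exact h
    · omega
  · have ho : s1.outbox 1 = [] := by rw [ag1.outbox rfl]; simpa [hs0] using hout
    rw [hrun2, h4, h3]
    simp [hs2, ho, summaryWords]; rfl
  · rw [ag.arr _ rfl]; exact hs.key j hj
  · rw [ag.arr _ rfl]; exact hs.lev b hb
  · rw [ag.arr _ rfl]; exact hs.gen b hb
  · rw [hrun2, (frame D md sendCutS _).inbox rfl, ag3.inbox rfl]
    show s1.inbox 1 = []
    rw [ag1.inbox rfl]; simp [hs0, hin]
  · rw [hrun2]
    have e : s2.time = s1.time + 2 := by simp [hs2]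
    have e' : s0.time = s.time + 3 := by simp [hs0]
    unfold siteTime₂ netTime
    omega

/-! ### Labels -/

/-- Word `w` labels a node with median `m` and key `y` correctly. -/
def LabelOK (k : ℕ) (kc : ℕ → P) (p : ℕ) (v : ℝ) (m : P) (y : ℝ) (w : Word P A) : Prop :=
  (keyV y ≤ v ∧ ∃ i < k, lev m (kc i) ≤ p + 5 ∧ w = .pt (kc i)) ∨
    ((v < keyV y ∨ ∀ i < k, p + 5 < lev m (kc i)) ∧ w.pt? = none)

lemma nearS_spec (hp : Params k t ε n s) (hn : Nodes n nd mp s) {j p : ℕ} {kc : ℕ → P}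
    (hj : j < n) (hvj : s.var vj = .nat j) (hvp : s.var vp = .nat p)
    (hkc : ∀ i < k, s.arr aKC i = .pt (kc i)) (hf : s.var vf = .nat 0) :
    ((∃ i < k, lev (mp j) (kc i) ≤ p + 5 ∧ (ℛ nearS s).var vf = .pt (kc i)) ∨
      ((∀ i < k, p + 5 < lev (mp j) (kc i)) ∧ (ℛ nearS s).var vf = .nat 0)) ∧
    (ℛ nearS s).time ≤ s.time + 1 + k * 3 := by
  have := for_rule D md (x := vi) (e := vK)
    (c := .ite .nat (levE (.arr aMed vj) (.arr aKC vi)) (vp +ₙ ♯5) (.set vf (.arr aKC vi))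
      .skip) (s := s) (n := k) (fun i s' =>
    ((∃ l < k, lev (mp j) (kc l) ≤ p + 5 ∧ s'.var vf = .pt (kc l)) ∨
      ((∀ l < i, p + 5 < lev (mp j) (kc l)) ∧ s'.var vf = .nat 0)) ∧
    s'.time ≤ s.time + 1 + i * 3) (by simp [hp.hk])
    ⟨.inr ⟨by simp, by simpa using hf⟩, by simp⟩ ?_
  · exact this
  rintro i hi s' ag ⟨h1, h2⟩
  have e0 : s'.arr aKC i = .pt (kc i) := by rw [ag.arr _ rfl]; exact hkc i hi
  have e : (levE (.arr aMed vj) (.arr aKC vi)).eval D md (s'.setVar vi (.nat i)) =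
      .nat (lev (mp j) (kc i)) := by
    refine eval_levE ?_ ?_ ?_
    · simp only [Expr.eval, St.setVar_var, St.setVar_arr]
      rw [ag.arr _ rfl]
      simp [ag.var vj rfl, hvj, hn.med j hj]
    · simp [e0]
    · simp [ag.var vMin rfl, hp.hmin]
  have ep : s'.var vp = .nat p := (ag.var _ rfl).trans hvp
  simp only [Stm.run]
  rw [e]
  by_cases h : lev (mp j) (kc i) ≤ p + 5
  · refine ⟨.inl ⟨i, hi, h, ?_⟩, ?_⟩
    · simp [ep, h, e0]
    · simp [ep, h]; omega
  · refine ⟨?_, ?_⟩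
    · simp only [Expr.eval, Op2.eval]
      rcases h1 with h1 | h1
      · left; simpa [ep, h] using h1
      · right
        refine ⟨fun l hl => ?_, by simpa [ep, h] using h1.2⟩
        rcases lt_or_eq hl with h3 | rfl
        · exact h1.1 l h3
        · omega
    · simp [ep, h]; omega

/-- The time bound of `site₃S`. -/
def siteTime₃ (k n : ℕ) : ℕ := 5 + k * 3 + n * (5 + k * 3)

lemma site₃S_spec (hp : Params k t ε n s) (hn : Nodes n nd mp s)
    (hx : ∀ j < n, s.arr aKey j = .real (x j)) {kc : ℕ → P} {p m : ℕ}
    (hin : s.inbox 1 = (List.range' 0 k).map (fun i => .pt (kc i)) ++ [.nat p, .nat m])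
    (hout : s.outbox 0 = []) :
    (∃ out : ℕ → Word P A, (ℛ site₃S s).outbox 0 = (List.range n).map out ∧
      ∀ j < n, LabelOK k kc p (V p m) (mp j) (x j) (out j)) ∧
    (ℛ site₃S s).time ≤ s.time + siteTime₃ k n := by
  have h1 := for_rule D md (x := vi) (e := vK) (c := .recv vx ♯1 ;; .put aKC vi vx)
    (s := s) (n := k) (fun i s' => (∀ l < i, s'.arr aKC l = .pt (kc l)) ∧
      s'.inbox 1 = (List.range' i (k - i)).map (fun i => .pt (kc i)) ++ [.nat p, .nat m] ∧
      s'.time ≤ s.time + 1 + i * 3) (by simp [hp.hk])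
    ⟨by simp, by simpa using hin, by simp⟩ (by
      rintro i hi s' - ⟨h1, h2, h3⟩
      rw [show k - i = k - (i + 1) + 1 by omega, List.range'_succ, List.map_cons] at h2
      simp only [Stm.run]
      refine ⟨fun l hl => ?_, ?_, by simp; omega⟩
      · by_cases h : l = i
        · subst h; simp [h2]
        · simp [h, h1 l (by omega)]
      · simp [h2])
  obtain ⟨hkc, hin1, ht1⟩ := h1
  have ag1 := frame D md readCentersS s
  change ∀ l < k, (ℛ readCentersS s).arr aKC l = _ at hkc
  change (ℛ readCentersS s).inbox 1 = _ at hin1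
  change (ℛ readCentersS s).time ≤ _ at ht1
  set s1 := ℛ readCentersS s with hs1
  have hin2 : s1.inbox 1 = [.nat p, .nat m] := by rw [hin1]; simp
  set c2 : Stm := .recv vp ♯1 ;; .recv vm ♯1 ;; .set vv (levelE vp vm) with hc2
  have ag2 := frame D md c2 s1
  have hrun : ℛ site₃S s = ℛ labelS (ℛ c2 s1) := rfl
  have hv2 : (ℛ c2 s1).var vv = .real (V p m) ∧ (ℛ c2 s1).var vp = .nat p ∧
      (ℛ c2 s1).time = s1.time + 3 := by
    simp only [hc2, Stm.run]
    rw [eval_levelE (p := p) (m := m) (by simp [hin2]) (by simp [hin2])]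
    simp [hin2]
  rw [hrun]
  set s2 := ℛ c2 s1 with hs2
  have hp2 : Params k t ε n s2 := (hp.mono ag1).mono ag2
  have hn2 : Nodes n nd mp s2 := (hn.mono ag1).mono ag2
  have hx2 : ∀ j < n, s2.arr aKey j = .real (x j) := fun j hj => by
    rw [ag2.arr _ rfl, ag1.arr _ rfl]; exact hx j hj
  have hkc2 : ∀ l < k, s2.arr aKC l = .pt (kc l) := fun l hl => by
    rw [ag2.arr _ rfl]; exact hkc l hl
  have ho2 : s2.outbox 0 = [] := by rw [ag2.outbox rfl, ag1.outbox rfl, hout]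
  have := for_rule D md (x := vj) (e := vN) (c := .set vf ♯0 ;; nearS ;;
    sendLabelS) (s := s2) (n := n) (fun i s' =>
    (∃ out : ℕ → Word P A, s'.outbox 0 = (List.range i).map out ∧
      ∀ j < i, LabelOK k kc p (V p m) (mp j) (x j) (out j)) ∧
    s'.time ≤ s2.time + 1 + i * (5 + k * 3)) (by simp [hp2.hn])
    ⟨⟨fun _ => .blank, by simp [ho2], by simp⟩, by simp⟩ ?_
  · refine ⟨this.1, this.2.trans ?_⟩
    unfold siteTime₃
    omega
  rintro i hi s' ag ⟨⟨out, h1, h2⟩, h3⟩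
  set s3 := (s'.setVar vj (.nat i)).setVar vf (.nat 0) with hs3
  have hp3 : Params k t ε n s3 :=
    ((hp2.mono ag).setVar _).setVar _
  obtain ⟨h4, h5⟩ := nearS_spec D md (s := s3) (j := i) (p := p) (kc := kc) hp3
    (⟨(hn2.mono ag).node, (hn2.mono ag).med⟩) hi (by simp [hs3])
    (by simpa [hs3] using (ag.var vp rfl).trans hv2.2.1)
    (fun l hl => by show s'.arr aKC l = _; rw [ag.arr _ rfl]; exact hkc2 l hl) (by simp [hs3])
  have ag4 := frame D md nearS s3
  set s4 := ℛ nearS s3 with hs4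
  have ej : s4.var vj = .nat i := (ag4.var _ rfl).trans (by simp [hs3])
  have ev : s4.var vv = .real (V p m) :=
    (ag4.var _ rfl).trans (by simpa [hs3] using (ag.var vv rfl).trans hv2.1)
  have ek : Expr.eval D md s4 (.arr aKey vj) = .real (x i) := by
    simp only [Expr.eval, ej, Word.toNat_nat]
    rw [ag4.arr _ rfl]; show s'.arr aKey i = _; rw [ag.arr _ rfl]; exact hx2 i hi
  have elev : (levelE (keyPE (.arr aKey vj)) (keyME (.arr aKey vj))).eval D md s4 =
      .real (keyV (x i)) := eval_levelE (eval_keyPE ek) (eval_keyME ek)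
  have ho4 : s4.outbox 0 = s'.outbox 0 := by rw [ag4.outbox rfl]; rfl
  rw [show ℛ (.set vf ♯0 ;; nearS ;; sendLabelS) (s'.setVar vj (.nat i)) = ℛ sendLabelS s4 from rfl]
  obtain ⟨w, hw, hwl, hwt⟩ : ∃ w : Word P A, (ℛ sendLabelS s4).outbox 0 =
      s'.outbox 0 ++ [w] ∧ LabelOK k kc p (V p m) (mp i) (x i) w ∧
      (ℛ sendLabelS s4).time ≤ s4.time + 2 := by
    simp only [sendLabelS, Stm.run]
    rw [elev]
    by_cases hc : keyV (x i) ≤ V p m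
    · rcases h4 with ⟨l, hl, hl', hvf⟩ | ⟨hfar, hvf⟩
      · exact ⟨.pt (kc l), by simp [ev, hc, hvf, ho4], .inl ⟨hc, l, hl, hl', rfl⟩, by simp [ev, hc]⟩
      · exact ⟨.nat 0, by simp [ev, hc, hvf, ho4], .inr ⟨.inr hfar, rfl⟩, by simp [ev, hc]⟩
    · exact ⟨.nat 0, by simp [ev, hc, ho4], .inr ⟨.inl (not_le.1 hc), rfl⟩, by simp [ev, hc]⟩
  refine ⟨⟨fun j => if j = i then w else out j, ?_, fun j hj => ?_⟩, ?_⟩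
  · rw [hw, h1, List.range_succ, List.map_append]
    congr 1
    · exact List.map_congr_left fun j hj => by
        rw [if_neg (by have := List.mem_range.1 hj; omega)]
    · simp
  · by_cases h : j = i
    · subst h; simpa using hwl
    · simpa [h] using h2 j (by omega)
  · have e : s3.time = s'.time + 2 := by simp [hs3]
    rw [add_mul, one_mul]
    omega

/-! ## The coordinator: choice of the budgets -/

open Classical in
/-- The least of `R` and the budgets number `0, …, b - 1` that require a level of at most `y`. -/
def leastW (L : ℕ → ℝ) (R : ℕ) (y : ℝ) : ℕ → ℕ
  | 0 => R
  | b + 1 => if L b ≤ y ∧ bud b + 1 ≤ leastW L R y b then bud b else leastW L R y b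

lemma leastW_le (L : ℕ → ℝ) (R : ℕ) (y : ℝ) (n : ℕ) :
    leastW L R y n ≤ R ∧ ∀ b < n, L b ≤ y → leastW L R y n ≤ bud b := by
  induction n with
  | zero => simp [leastW]
  | succ n ih =>
    rw [leastW]
    split_ifs with h
    · refine ⟨by omega, fun b hb hy => ?_⟩
      rcases lt_or_eq hb with hb | rfl
      · have := ih.2 b hb hy; omega
      · exact le_rfl
    · refine ⟨ih.1, fun b hb hy => ?_⟩
      rcases lt_or_eq hb with hb | rfl
      · exact ih.2 b hb hy
      · rw [not_and] at h
        have := h hy; omega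

variable {pp mm : ℕ → ℕ → ℕ}

lemma numB_pos (t : ℕ) : 0 < numB t := by unfold numB; omega

/-- The levels sent by the sites are in place. -/
structure Tables (n t : ℕ) (pp mm : ℕ → ℕ → ℕ) (s : St P A) : Prop where
  val : ∀ i < n, ∀ b < numB t, s.arr aLV (i * numB t + b) = .real (V (pp i b) (mm i b))
  fst : ∀ i < n, ∀ b < numB t, s.arr aLP (i * numB t + b) = .nat (pp i b)
  snd : ∀ i < n, ∀ b < numB t, s.arr aLM (i * numB t + b) = .nat (mm i b)

lemma Tables.mono (h : Tables n t pp mm s) {c : Stm} (ag : Agree c s s')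
    (hc : (c.wa aLV || c.wa aLP || c.wa aLM) = false := by rfl) : Tables n t pp mm s' := by
  simp only [Bool.or_eq_false_iff] at hc
  exact ⟨fun i hi b hb => by rw [ag.arr _ hc.1.1]; exact h.val i hi b hb,
    fun i hi b hb => by rw [ag.arr _ hc.1.2]; exact h.fst i hi b hb,
    fun i hi b hb => by rw [ag.arr _ hc.2]; exact h.snd i hi b hb⟩

lemma readProfileS_spec (hp : Params k t ε n s) {i : ℕ} (hvi : s.var vi = .nat i)
    (hvd : s.var vd = .nat (i * numB t)) {pi mi : ℕ → ℕ}
    (hin : s.inbox (i + 1) = (List.range' 0 (numB t)).flatMap fun b => [.nat (pi b), .nat (mi b)]) :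
    ((ℛ readProfileS s).var vd = .nat ((i + 1) * numB t) ∧
      (∀ b < numB t, (ℛ readProfileS s).arr aLV (i * numB t + b) = .real (V (pi b) (mi b)) ∧
        (ℛ readProfileS s).arr aLP (i * numB t + b) = .nat (pi b) ∧
        (ℛ readProfileS s).arr aLM (i * numB t + b) = .nat (mi b)) ∧
      (∀ d < i * numB t, (ℛ readProfileS s).arr aLV d = s.arr aLV d ∧
        (ℛ readProfileS s).arr aLP d = s.arr aLP d ∧
        (ℛ readProfileS s).arr aLM d = s.arr aLM d)) ∧
    ((ℛ readProfileS s).inbox (i + 1) = [] ∧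
      ∀ q, q ≠ i + 1 → (ℛ readProfileS s).inbox q = s.inbox q) ∧
    (ℛ readProfileS s).time ≤ s.time + 1 + numB t * 7 := by
  have := for_rule D md (x := vb) (e := vNB)
    (c := .recv vp (vi +ₙ ♯1) ;; .recv vm (vi +ₙ ♯1) ;;
      .put aLP vd vp ;; .put aLM vd vm ;; .put aLV vd (levelE vp vm) ;; .set vd (vd +ₙ ♯1))
    (s := s) (n := numB t) (fun j s' => (s'.var vd = .nat (i * numB t + j) ∧
      (∀ b < j, s'.arr aLV (i * numB t + b) = .real (V (pi b) (mi b)) ∧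
        s'.arr aLP (i * numB t + b) = .nat (pi b) ∧ s'.arr aLM (i * numB t + b) = .nat (mi b)) ∧
      (∀ d < i * numB t, s'.arr aLV d = s.arr aLV d ∧ s'.arr aLP d = s.arr aLP d ∧
        s'.arr aLM d = s.arr aLM d)) ∧
      (s'.inbox (i + 1) =
        ((List.range' j (numB t - j)).flatMap fun b => [.nat (pi b), .nat (mi b)]) ∧
        ∀ q, q ≠ i + 1 → s'.inbox q = s.inbox q) ∧
      s'.time ≤ s.time + 1 + j * 7) (by simp [hp.hnb])
    ⟨⟨by simpa using hvd, by simp, by simp⟩, ⟨by simpa using hin, by simp⟩, by simp⟩ ?_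
  · obtain ⟨⟨h1, h2, h3⟩, ⟨h4, h5⟩, h6⟩ := this
    refine ⟨⟨?_, h2, h3⟩, ⟨h4.trans (by simp), h5⟩, h6⟩
    rw [add_mul, one_mul]; exact h1
  rintro j hj s' ag ⟨⟨h1, h2, h3⟩, ⟨h4, h5⟩, h6⟩
  rw [show numB t - j = numB t - (j + 1) + 1 by omega, List.range'_succ, List.flatMap_cons] at h4
  have evi : s'.var vi = .nat i := (ag.var _ rfl).trans hvi
  set s1 := ((s'.setVar vb (.nat j)).read vp (i + 1)).read vm (i + 1) with hs1
  set d := i * numB t + j with hd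
  rw [show ℛ (.recv vp (vi +ₙ ♯1) ;; .recv vm (vi +ₙ ♯1) ;;
      .put aLP vd vp ;; .put aLM vd vm ;; .put aLV vd (levelE vp vm) ;; .set vd (vd +ₙ ♯1))
      (s'.setVar vb (.nat j)) =
      (((s1.setArr aLP d (.nat (pi j))).setArr aLM d (.nat (mi j))).setArr aLV d
        (.real (V (pi j) (mi j)))).setVar vd (.nat (d + 1)) by
    simp only [Stm.run]
    rw [eval_levelE (p := pi j) (m := mi j) (by simp [evi, h4]) (by simp [evi, h4])]
    simp [evi, h4, h1, hs1]]
  refine ⟨⟨?_, fun b hb => ?_, fun d' hd' => ?_⟩, ⟨?_, fun q hq => ?_⟩, ?_⟩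
  · simp [hd, add_assoc]
  · by_cases h : b = j
    · subst h; simp [← hd]
    · simp [hd, h, hs1]; exact h2 b (by omega)
  · simp [hs1, show d' ≠ d by omega]; exact h3 d' hd'
  · simp [hs1, h4]
  · simp [hs1, hq]; exact h5 q hq
  · simp [hs1]; omega

lemma readProfilesS_spec (hp : Params k t ε n s)
    (hin : ∀ i < n, s.inbox (i + 1) =
      (List.range' 0 (numB t)).flatMap fun b => [.nat (pp i b), .nat (mm i b)]) :
    Tables n t pp mm (ℛ readProfilesS s) ∧
    (ℛ readProfilesS s).var vd = .nat (n * numB t) ∧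
    (∀ i < n, (ℛ readProfilesS s).inbox (i + 1) = []) ∧
    (ℛ readProfilesS s).time ≤ s.time + 2 + n * (2 + numB t * 7) := by
  set s0 := s.setVar vd (.nat 0) with hs0
  rw [show ℛ readProfilesS s = ℛ (.rep vi vN _) s0 from rfl]
  have hp0 : Params k t ε n s0 := hp.setVar _
  have := for_rule D md (x := vi) (e := vN) (c := readProfileS) (s := s0) (n := n) (fun j s' =>
    Tables j t pp mm s' ∧ s'.var vd = .nat (j * numB t) ∧
    (∀ i < n, s'.inbox (i + 1) = if i < j then [] else s.inbox (i + 1)) ∧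
    s'.time ≤ s.time + 2 + j * (2 + numB t * 7)) (by simp [hp0.hn])
    ⟨⟨by simp, by simp, by simp⟩, by simp [hs0], by simp [hs0], by simp [hs0]⟩ ?_
  · refine ⟨this.1, this.2.1, fun i hi => ?_, this.2.2.2⟩
    rw [this.2.2.1 i hi, if_pos hi]
  rintro i hi s' ag ⟨h1, h2, h3, h4⟩
  obtain ⟨⟨a1, a2, a3⟩, ⟨a4, a5⟩, a6⟩ := readProfileS_spec D md
    (s := s'.setVar vi (.nat i)) (pi := pp i) (mi := mm i) (i := i)
    ((hp0.mono ag).setVar _) (by simp) (by simp [h2])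
    (by simp [h3 i hi, hin i hi])
  have hlt : ∀ j < i, ∀ b < numB t, j * numB t + b < i * numB t := fun j hj b hb => by
    calc j * numB t + b < (j + 1) * numB t := by rw [add_mul, one_mul]; omega
      _ ≤ i * numB t := Nat.mul_le_mul_right _ hj
  refine ⟨⟨fun j hj b hb => ?_, fun j hj b hb => ?_, fun j hj b hb => ?_⟩, a1, fun j hj => ?_, ?_⟩
  · rcases lt_or_eq hj with hj | rfl
    · rw [(a3 _ (hlt j hj b hb)).1]; exact h1.val j hj b hb
    · exact (a2 b hb).1
  · rcases lt_or_eq hj with hj | rfl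
    · rw [(a3 _ (hlt j hj b hb)).2.1]; exact h1.fst j hj b hb
    · exact (a2 b hb).2.1
  · rcases lt_or_eq hj with hj | rfl
    · rw [(a3 _ (hlt j hj b hb)).2.2]; exact h1.snd j hj b hb
    · exact (a2 b hb).2.2
  · by_cases h : j = i
    · subst h; simp [a4]
    · rw [a5 _ (by omega)]
      simp only [St.setVar_inbox, h3 j hj]
      by_cases h' : j < i
      · simp [h', show j < i + 1 by omega]
      · simp [h', show ¬ j < i + 1 by omega]
  · simp at a6
    rw [add_mul i, one_mul]; omega

/-- The level that site `i` requires for budget number `b`. -/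
def lvl (pp mm : ℕ → ℕ → ℕ) (i b : ℕ) : ℝ := V (pp i b) (mm i b)

/-- The total of the budgets required at level `y`. -/
def total (n t : ℕ) (pp mm : ℕ → ℕ → ℕ) (y : ℝ) : ℕ :=
  ∑ i ∈ range n, leastW (lvl pp mm i) (4 * t + 5) y (numB t)

lemma leastBudgetS_spec (hp : Params k t ε n s) (ht : Tables n t pp mm s) {i : ℕ} (hi : i < n)
    {y : ℝ} (hvi : s.var vi = .nat i) (hvd : s.var vd = .nat (i * numB t))
    (hvv : s.var vv = .real y) (hvw : s.var vw = .nat (4 * t + 5)) :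
    (ℛ leastBudgetS s).var vd = .nat ((i + 1) * numB t) ∧
    (ℛ leastBudgetS s).var vw = .nat (leastW (lvl pp mm i) (4 * t + 5) y (numB t)) ∧
    (leastW (lvl pp mm i) (4 * t + 5) y (numB t) < 4 * t + 5 → ∃ b < numB t,
      (ℛ leastBudgetS s).arr aBI i = .nat b ∧ lvl pp mm i b ≤ y ∧
      bud b = leastW (lvl pp mm i) (4 * t + 5) y (numB t)) ∧
    (∀ j, j ≠ i → (ℛ leastBudgetS s).arr aBI j = s.arr aBI j) ∧
    (ℛ leastBudgetS s).time ≤ s.time + 1 + numB t * 6 := by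
  have := for_rule D md (x := vb) (e := vNB) (c := .ite .real (.arr aLV vd) vv
      (.ite .nat (.arr aBud vb +ₙ ♯1) vw (.set vw (.arr aBud vb) ;; .put aBI vi vb) .skip) .skip ;;
    .set vd (vd +ₙ ♯1)) (s := s) (n := numB t) (fun j s' =>
    s'.var vd = .nat (i * numB t + j) ∧
    s'.var vw = .nat (leastW (lvl pp mm i) (4 * t + 5) y j) ∧
    (leastW (lvl pp mm i) (4 * t + 5) y j < 4 * t + 5 → ∃ b < numB t,
      s'.arr aBI i = .nat b ∧ lvl pp mm i b ≤ y ∧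
      bud b = leastW (lvl pp mm i) (4 * t + 5) y j) ∧
    (∀ j, j ≠ i → s'.arr aBI j = s.arr aBI j) ∧
    s'.time ≤ s.time + 1 + j * 6) (by simp [hp.hnb])
    ⟨by simpa using hvd, by simpa [leastW] using hvw, by simp [leastW], by simp, by simp⟩ ?_
  · obtain ⟨h1, h2⟩ := this
    refine ⟨?_, h2⟩
    rw [add_mul, one_mul]; exact h1
  rintro j hj s' ag ⟨h1, h2, h3, h4, h5⟩
  have e1 : s'.arr aBud j = .nat (bud j) := by rw [ag.arr _ rfl]; exact hp.bud j hj.le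
  have e2 : s'.arr aLV (i * numB t + j) = .real (lvl pp mm i j) := by
    rw [ag.arr _ rfl]; exact ht.val i hi j hj
  have e3 : s'.var vi = .nat i := (ag.var _ rfl).trans hvi
  have e4 : s'.var vv = .real y := (ag.var _ rfl).trans hvv
  rw [leastW]
  by_cases hc : lvl pp mm i j ≤ y
  · by_cases hd : bud j + 1 ≤ leastW (lvl pp mm i) (4 * t + 5) y j
    · have hr : ℛ (.ite .real (.arr aLV vd) vv (.ite .nat (.arr aBud vb +ₙ ♯1) vw
          (.set vw (.arr aBud vb) ;; .put aBI vi vb) .skip) .skip ;;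
          .set vd (vd +ₙ ♯1)) (s'.setVar vb (.nat j)) =
          ((((s'.setVar vb (.nat j)).tick.tick).setVar vw (.nat (bud j))).setArr aBI i
            (.nat j)).setVar vd (.nat (i * numB t + j + 1)) := by
        simp [h1, h2, e1, e2, e3, e4, hc, hd]
      rw [hr, if_pos ⟨hc, hd⟩]
      refine ⟨by simp [add_assoc], by simp, fun _ => ⟨j, hj, by simp, hc, rfl⟩, fun l hl => ?_, ?_⟩
      · simpa [hl] using h4 l hl
      · simp; omega
    · have hr : ℛ (.ite .real (.arr aLV vd) vv (.ite .nat (.arr aBud vb +ₙ ♯1) vw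
          (.set vw (.arr aBud vb) ;; .put aBI vi vb) .skip) .skip ;;
          .set vd (vd +ₙ ♯1)) (s'.setVar vb (.nat j)) =
          ((s'.setVar vb (.nat j)).tick.tick).setVar vd (.nat (i * numB t + j + 1)) := by
        simp [h1, h2, e1, e2, e4, hc, hd]
      rw [hr, if_neg (fun h => hd h.2)]
      refine ⟨by simp [add_assoc], by simpa using h2, h3, fun l hl => h4 l hl, ?_⟩
      simp; omega
  · have hr : ℛ (.ite .real (.arr aLV vd) vv (.ite .nat (.arr aBud vb +ₙ ♯1) vw
        (.set vw (.arr aBud vb) ;; .put aBI vi vb) .skip) .skip ;;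
        .set vd (vd +ₙ ♯1)) (s'.setVar vb (.nat j)) =
        ((s'.setVar vb (.nat j)).tick).setVar vd (.nat (i * numB t + j + 1)) := by
      simp [h1, e2, e4, hc]
    rw [hr, if_neg (fun h => hc h.1)]
    refine ⟨by simp [add_assoc], by simpa using h2, h3, fun l hl => h4 l hl, ?_⟩
    simp; omega

/-- The time bound of `evalLevelS`. -/
def evalTime (n t : ℕ) : ℕ := 3 + n * (4 + numB t * 6)

lemma evalLevelS_spec (hp : Params k t ε n s) (ht : Tables n t pp mm s) {y : ℝ}
    (hvv : s.var vv = .real y) :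
    (ℛ evalLevelS s).var vtot = .nat (total n t pp mm y) ∧
    (total n t pp mm y < 4 * t + 5 → ∃ β : ℕ → ℕ, ∀ i < n, β i < numB t ∧
      (ℛ evalLevelS s).arr aBI i = .nat (β i) ∧ lvl pp mm i (β i) ≤ y ∧
      bud (β i) = leastW (lvl pp mm i) (4 * t + 5) y (numB t)) ∧
    (ℛ evalLevelS s).time ≤ s.time + evalTime n t := by
  set s0 := (s.setVar vtot (.nat 0)).setVar vd (.nat 0) with hs0
  rw [show ℛ evalLevelS s = ℛ (.rep vi vN _) s0 from rfl]
  have hp0 : Params k t ε n s0 := (hp.setVar _).setVar _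
  have ht0 : Tables n t pp mm s0 := ⟨ht.val, ht.fst, ht.snd⟩
  have hvv0 : s0.var vv = .real y := by simp [hs0, hvv]
  have := for_rule D md (x := vi) (e := vN) (c := .set vw vR ;; leastBudgetS ;;
    .set vtot (vtot +ₙ vw)) (s := s0) (n := n) (fun j s' =>
    s'.var vtot = .nat (total j t pp mm y) ∧ s'.var vd = .nat (j * numB t) ∧
    (∀ i < j, leastW (lvl pp mm i) (4 * t + 5) y (numB t) < 4 * t + 5 → ∃ b < numB t,
      s'.arr aBI i = .nat b ∧ lvl pp mm i b ≤ y ∧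
      bud b = leastW (lvl pp mm i) (4 * t + 5) y (numB t)) ∧
    s'.time ≤ s.time + 3 + j * (4 + numB t * 6)) (by simp [hp0.hn])
    ⟨by simp [hs0, total], by simp [hs0], by simp, by simp [hs0]⟩ ?_
  · obtain ⟨h1, h2, h3, h4⟩ := this
    refine ⟨h1, fun h => ?_, by unfold evalTime; omega⟩
    have h5 : ∀ i < n, leastW (lvl pp mm i) (4 * t + 5) y (numB t) < 4 * t + 5 := fun i hi =>
      lt_of_le_of_lt (single_le_sum
        (f := fun i => leastW (lvl pp mm i) (4 * t + 5) y (numB t)) (fun _ _ => Nat.zero_le _)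
        (mem_range.2 hi)) h
    choose! β hβ using fun i hi => h3 i hi (h5 i hi)
    exact ⟨β, fun i hi => hβ i hi⟩
  rintro i hi s' ag ⟨h1, h2, h3, h4⟩
  have hp1 : Params k t ε n s' := hp0.mono ag
  set s1 := (s'.setVar vi (.nat i)).setVar vw (.nat (4 * t + 5)) with hs1
  have hr : ℛ (.set vw vR ;; leastBudgetS ;; .set vtot (vtot +ₙ vw))
      (s'.setVar vi (.nat i)) = ℛ (.set vtot (vtot +ₙ vw)) (ℛ leastBudgetS s1) := by
    simp only [Stm.run, hs1, Expr.eval]; simp [hp1.hr]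
  have evv : s1.var vv = .real y := by
    have : s'.var vv = .real y := (ag.var _ rfl).trans hvv0
    simp [hs1, this]
  have ht1 : Tables n t pp mm s' := ht0.mono ag
  obtain ⟨a1, a2, a3, a4, a5⟩ := leastBudgetS_spec D md (s := s1) (i := i) (y := y)
    ((hp1.setVar _).setVar _) ⟨ht1.val, ht1.fst, ht1.snd⟩ hi
    (by simp [hs1]) (by simp [hs1, h2]) evv (by simp [hs1])
  have ag2 := frame D md leastBudgetS s1
  have htot : (ℛ leastBudgetS s1).var vtot = .nat (total i t pp mm y) :=
    (ag2.var _ rfl).trans (by simp [hs1, h1])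
  rw [hr]
  refine ⟨?_, ?_, fun j hj hw => ?_, ?_⟩
  · simp [a2, htot, total, sum_range_succ]
  · simpa using a1
  · by_cases h : j = i
    · subst h; exact a3 hw
    · obtain ⟨b, hb, hb1, hb2⟩ := h3 j (by omega) hw
      exact ⟨b, hb, (a4 j h).trans hb1, hb2⟩
  · simp [hs1] at a5 ⊢
    rw [add_mul i, one_mul]; omega

/-- The least acceptable level is in place. -/
structure Chosen (n t : ℕ) (pp mm : ℕ → ℕ → ℕ) (i₀ b₀ : ℕ) (s : St P A) : Prop where
  lt_site : i₀ < n
  lt_bud : b₀ < numB t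
  best : s.var vbest = .real (lvl pp mm i₀ b₀)
  fst : s.var vbp = .nat (pp i₀ b₀)
  snd : s.var vbm = .nat (mm i₀ b₀)
  tot : total n t pp mm (lvl pp mm i₀ b₀) ≤ 4 * t
  le : ∀ i < n, ∀ b < numB t, total n t pp mm (lvl pp mm i b) ≤ 4 * t →
    lvl pp mm i₀ b₀ ≤ lvl pp mm i b

lemma chooseS_spec (hp : Params k t ε n s) (ht : Tables n t pp mm s)
    (hvd : s.var vd = .nat (n * numB t))
    (hex : ∃ i < n, ∃ b < numB t, total n t pp mm (lvl pp mm i b) ≤ 4 * t) :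
    (∃ i0 b0, Chosen n t pp mm i0 b0 (ℛ chooseS s)) ∧
    (ℛ chooseS s).time ≤ s.time + 3 + n * numB t * (9 + evalTime n t) := by
  set s0 := (s.setVar vok (.nat 0)).setVar vu (.nat (n * numB t)) with hs0
  rw [show ℛ chooseS s = ℛ (.rep vc vu (.set vv (.arr aLV vc) ;; evalLevelS ;;
    tryAcceptS)) s0 by
    simp [chooseS, hvd, hs0]]
  have hp0 : Params k t ε n s0 := (hp.setVar _).setVar _
  have ht0 : Tables n t pp mm s0 := ⟨ht.val, ht.fst, ht.snd⟩
  set ii := fun c => c / numB t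
  set bb := fun c => c % numB t
  set Lc := fun c => lvl pp mm (ii c) (bb c) with hLc
  have hii : ∀ c < n * numB t, ii c < n := fun c hc =>
    Nat.div_lt_of_lt_mul (by rwa [mul_comm] at hc)
  have hbb : ∀ c, bb c < numB t := fun c => Nat.mod_lt _ (numB_pos t)
  have hcc : ∀ c, ii c * numB t + bb c = c := fun c => Nat.div_add_mod' c _
  have := for_rule D md (x := vc) (e := vu) (c := .set vv (.arr aLV vc) ;; evalLevelS ;; tryAcceptS)
    (s := s0) (n := n * numB t) (fun j s' =>
    ((s'.var vok = .nat 0 ∧ ∀ c < j, 4 * t < total n t pp mm (Lc c)) ∨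
      (s'.var vok = .nat 1 ∧ ∃ c₀ < j, s'.var vbest = .real (Lc c₀) ∧
        s'.var vbp = .nat (pp (ii c₀) (bb c₀)) ∧ s'.var vbm = .nat (mm (ii c₀) (bb c₀)) ∧
        total n t pp mm (Lc c₀) ≤ 4 * t ∧
        ∀ c < j, total n t pp mm (Lc c) ≤ 4 * t → Lc c₀ ≤ Lc c)) ∧
    s'.time ≤ s.time + 3 + j * (9 + evalTime n t)) (by simp [hs0])
    ⟨.inl ⟨by simp [hs0], by simp⟩, by simp [hs0]⟩ ?_
  · obtain ⟨h1, h2⟩ := this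
    refine ⟨?_, h2⟩
    have key : ∀ i < n, ∀ b < numB t, i * numB t + b < n * numB t ∧ Lc (i * numB t + b) =
        lvl pp mm i b := fun i hi b hb => by
      refine ⟨?_, ?_⟩
      · calc i * numB t + b < (i + 1) * numB t := by rw [add_mul, one_mul]; omega
          _ ≤ n * numB t := Nat.mul_le_mul_right _ hi
      · have e1 : ii (i * numB t + b) = i := by
          show (i * numB t + b) / numB t = i
          rw [mul_comm, Nat.mul_add_div (numB_pos t), Nat.div_eq_of_lt hb, add_zero]
        have e2 : bb (i * numB t + b) = b := by
          show (i * numB t + b) % numB t = b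
          rw [mul_comm, Nat.mul_add_mod, Nat.mod_eq_of_lt hb]
        simp only [hLc, e1, e2]
    rcases h1 with ⟨-, h1⟩ | ⟨-, c₀, hc0, h3, h4, h5, h6, h7⟩
    · obtain ⟨i, hi, b, hb, hib⟩ := hex
      obtain ⟨k1, k2⟩ := key i hi b hb
      have := h1 _ k1
      rw [k2] at this; omega
    · exact ⟨ii c₀, bb c₀, hii c₀ hc0, hbb c₀, h3, h4, h5, h6, fun i hi b hb h => by
        obtain ⟨k1, k2⟩ := key i hi b hb
        have := h7 _ k1 (by rwa [k2])
        rwa [k2] at this⟩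
  rintro c hc s' ag ⟨h1, h2⟩
  have hp1 : Params k t ε n s' := hp0.mono ag
  have ht1 : Tables n t pp mm s' := ht0.mono ag
  have ec : s'.arr aLV c = .real (Lc c) := by
    have := ht1.val _ (hii c hc) _ (hbb c)
    rwa [hcc] at this
  set s1 := (s'.setVar vc (.nat c)).setVar vv (.real (Lc c)) with hs1
  have ht1' : Tables n t pp mm s1 := ⟨ht1.val, ht1.fst, ht1.snd⟩
  obtain ⟨a1, -, a3⟩ := evalLevelS_spec D md (s := s1) (y := Lc c)
    ((hp1.setVar _).setVar _) ht1' (by simp [hs1])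
  have ag2 := frame D md evalLevelS s1
  have hr : ℛ (.set vv (.arr aLV vc) ;; evalLevelS ;; tryAcceptS)
      (s'.setVar vc (.nat c)) = ℛ tryAcceptS (ℛ evalLevelS s1) := by
    have : ℛ (.set vv (.arr aLV vc)) (s'.setVar vc (.nat c)) = s1 := by
      simp [ec, hs1]
    rw [← this]; rfl
  rw [hr]
  set s2 := ℛ evalLevelS s1 with hs2
  have ht2 : Tables n t pp mm s2 := ht1'.mono ag2
  have eR : s2.var vR = .nat (4 * t + 5) :=
    (ag2.var _ rfl).trans (by simp [hs1, hp1.hr])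
  have ecc : s2.var vc = .nat c := (ag2.var _ rfl).trans (by simp [hs1])
  have evv : s2.var vv = .real (Lc c) := (ag2.var _ rfl).trans (by simp [hs1])
  have eok : s2.var vok = s'.var vok := (ag2.var _ rfl).trans (by simp [hs1])
  have ebe : s2.var vbest = s'.var vbest := (ag2.var _ rfl).trans (by simp [hs1])
  have ebp : s2.var vbp = s'.var vbp := (ag2.var _ rfl).trans (by simp [hs1])
  have ebm : s2.var vbm = s'.var vbm := (ag2.var _ rfl).trans (by simp [hs1])
  have e1 : s2.arr aLP c = .nat (pp (ii c) (bb c)) := by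
    have := ht2.fst _ (hii c hc) _ (hbb c)
    rwa [hcc] at this
  have e2 : s2.arr aLM c = .nat (mm (ii c) (bb c)) := by
    have := ht2.snd _ (hii c hc) _ (hbb c)
    rwa [hcc] at this
  have et : s2.time ≤ s'.time + 2 + evalTime n t := by simpa [hs1] using a3
  have htime : ∀ m, m ≤ s2.time + 7 → m ≤ s.time + 3 + (c + 1) * (9 + evalTime n t) := by
    intro m hm; rw [add_mul, one_mul]; omega
  set s3 := ℛ tryAcceptS s2 with hs3
  by_cases hacc : total n t pp mm (Lc c) ≤ 4 * t
  · have hacc' : (∀ c' < c, total n t pp mm (Lc c') ≤ 4 * t → Lc c ≤ Lc c') →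
      s3 = ℛ acceptS s2.tick.tick ∨ s3 = ℛ acceptS s2.tick.tick.tick →
      (s3.var vok = .nat 1 ∧ ∃ c₀ < c + 1, s3.var vbest = .real (Lc c₀) ∧
        s3.var vbp = .nat (pp (ii c₀) (bb c₀)) ∧ s3.var vbm = .nat (mm (ii c₀) (bb c₀)) ∧
        total n t pp mm (Lc c₀) ≤ 4 * t ∧
        ∀ c' < c + 1, total n t pp mm (Lc c') ≤ 4 * t → Lc c₀ ≤ Lc c') ∧
      s3.time ≤ s2.time + 7 := by
      intro hmin hrun
      have hle : ∀ c' < c + 1, total n t pp mm (Lc c') ≤ 4 * t → Lc c ≤ Lc c' := fun c' hc' h => by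
        rcases lt_or_eq hc' with h' | rfl
        · exact hmin c' h' h
        · exact le_rfl
      rcases hrun with hrun | hrun <;> rw [hrun] <;>
        refine ⟨⟨by simp [acceptS], c, by omega, by simp [acceptS, evv], by simp [acceptS, ecc, e1],
          by simp [acceptS, ecc, e2], hacc, hle⟩, by simp [acceptS]⟩
    rcases h1 with ⟨hok, hall⟩ | ⟨hok, c₀, hc0, b1, b2, b3, b4, b5⟩
    · have := hacc' (fun c' hc' h => absurd (hall c' hc') (by omega)) (.inl (by
        simp [hs3, tryAcceptS, a1, eR, hacc, eok, hok]))
      exact ⟨.inr this.1, htime _ this.2⟩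
    · by_cases hb : Lc c₀ ≤ Lc c
      · have hr : s3 = s2.tick.tick.tick := by
          simp [hs3, tryAcceptS, a1, eR, hacc, eok, hok, ebe, b1, evv, hb]
        rw [hr]
        refine ⟨.inr ⟨by simp [eok, hok], c₀, by omega, by simp [ebe, b1], by simp [ebp, b2],
          by simp [ebm, b3], b4, fun c' hc' h => ?_⟩, htime _ (by simp)⟩
        rcases lt_or_eq hc' with h' | rfl
        · exact b5 c' h' h
        · exact hb
      · have := hacc' (fun c' hc' h => (le_of_not_ge hb).trans (b5 c' hc' h)) (.inr (by
          simp [hs3, tryAcceptS, a1, eR, hacc, eok, hok, ebe, b1, evv, hb]))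
        exact ⟨.inr this.1, htime _ this.2⟩
  · have hr : s3 = s2.tick := by
      simp [hs3, tryAcceptS, a1, eR, hacc]
    rw [hr]
    refine ⟨?_, htime _ (by simp)⟩
    rcases h1 with ⟨hok, hall⟩ | ⟨hok, c₀, hc0, b1, b2, b3, b4, b5⟩
    · refine .inl ⟨by simp [eok, hok], fun c' hc' => ?_⟩
      rcases lt_or_eq hc' with h' | rfl
      · exact hall c' h'
      · omega
    · refine .inr ⟨by simp [eok, hok], c₀, by omega, by simp [ebe, b1], by simp [ebp, b2],
          by simp [ebm, b3], b4, fun c' hc' h => ?_⟩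
      rcases lt_or_eq hc' with h' | rfl
      · exact b5 c' h' h
      · exact absurd h hacc

/-- The time bound of `coord₁S`. -/
def coordTime₁ (n t : ℕ) : ℕ :=
  19 + numB t * 3 + n * (4 + numB t * 7) + n * numB t * (9 + evalTime n t) + evalTime n t

lemma coord₁S_spec
    (hin0 : s.inbox 0 = [.nat k, .nat t, .real ε, .real (dmin P), .real (dmax P), .nat n])
    (hin : ∀ i < n, s.inbox (i + 1) =
      (List.range' 0 (numB t)).flatMap fun b => [.nat (pp i b), .nat (mm i b)])
    (hout : ∀ p, s.outbox p = [])
    (hex : ∃ i < n, ∃ b < numB t, total n t pp mm (lvl pp mm i b) ≤ 4 * t) :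
    ∃ (i0 b0 : ℕ) (β : ℕ → ℕ), Params k t ε n (ℛ coord₁S s) ∧ Chosen n t pp mm i0 b0 (ℛ coord₁S s) ∧
      (∀ i < n, β i < numB t ∧ lvl pp mm i (β i) ≤ lvl pp mm i0 b0) ∧
      ∑ i ∈ range n, bud (β i) ≤ 4 * t ∧
      (∀ i < n, (ℛ coord₁S s).outbox (i + 1) = [.nat (β i)]) ∧
      (∀ i < n, (ℛ coord₁S s).inbox (i + 1) = []) ∧
      (ℛ coord₁S s).time ≤ s.time + coordTime₁ n t := by
  obtain ⟨p1, i1, t1⟩ := initS_spec D md (rest := []) (by simpa using hin0)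
  have ag1 := frame D md initS s
  have hrun : ℛ coord₁S s = ℛ (readProfilesS ;; chooseS ;; .set vv vbest ;;
    evalLevelS ;; sendBudgetsS) (ℛ initS s) := rfl
  have ag := frame D md coord₁S s
  rw [hrun] at ag ⊢
  set s1 := ℛ initS s
  obtain ⟨T2, d2, i2, t2⟩ := readProfilesS_spec D md (pp := pp) (mm := mm) p1
    (fun i hi => by rw [i1]; simpa using hin i hi)
  have ag2 := frame D md readProfilesS s1
  rw [show ℛ (readProfilesS ;; chooseS ;; .set vv vbest ;;
    evalLevelS ;; sendBudgetsS) s1 = ℛ (chooseS ;; .set vv vbest ;;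
    evalLevelS ;; sendBudgetsS) (ℛ readProfilesS s1) from rfl]
  set s2 := ℛ readProfilesS s1
  have p2 : Params k t ε n s2 := p1.mono ag2
  obtain ⟨⟨i0, b0, C3⟩, t3⟩ := chooseS_spec D md p2 T2 d2 hex
  have ag3 := frame D md chooseS s2
  rw [show ℛ (chooseS ;; .set vv vbest ;; evalLevelS ;; sendBudgetsS) s2 =
    ℛ (evalLevelS ;; sendBudgetsS) ((ℛ chooseS s2).setVar vv
      (.real (lvl pp mm i0 b0))) by
    simp only [Stm.run, Expr.eval, C3.best]]
  set s3 := ℛ chooseS s2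
  have p3 : Params k t ε n s3 := p2.mono ag3
  have T3 : Tables n t pp mm s3 := T2.mono ag3
  set s4 := s3.setVar vv (.real (lvl pp mm i0 b0)) with hs4
  have p4 : Params k t ε n s4 := p3.setVar _
  obtain ⟨-, h5, t5⟩ := evalLevelS_spec D md (s := s4) (y := lvl pp mm i0 b0) p4
    (pp := pp) (mm := mm) ⟨T3.val, T3.fst, T3.snd⟩ (by simp [hs4])
  obtain ⟨β, hβ⟩ := h5 (by have := C3.tot; omega)
  have ag5 := frame D md evalLevelS s4
  rw [show ℛ (evalLevelS ;; sendBudgetsS) s4 = ℛ sendBudgetsS (ℛ evalLevelS s4) from rfl]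
  set s5 := ℛ evalLevelS s4
  have p5 : Params k t ε n s5 := p4.mono ag5
  have ag6 := frame D md sendBudgetsS s5
  have o5 : s5.outbox = s.outbox := by
    rw [ag5.outbox rfl]; show s3.outbox = _; rw [ag3.outbox rfl, ag2.outbox rfl, ag1.outbox rfl]
  have h6 := for_rule D md (x := vi) (e := vN) (c := .send (vi +ₙ ♯1) (.arr aBI vi))
    (s := s5) (n := n) (fun j s' => (∀ i, s'.outbox (i + 1) = if i < j then [.nat (β i)] else []) ∧
      s'.time ≤ s5.time + 1 + j * 2) (by simp [p5.hn])
    (⟨fun i => by simp [o5, hout], by simp⟩) (by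
      rintro i hi s' ag ⟨h1, h2⟩
      have e : s'.arr aBI i = .nat (β i) := by rw [ag.arr _ rfl]; exact (hβ i hi).2.1
      refine ⟨fun j => ?_, by simp; omega⟩
      by_cases h : j = i
      · subst h; simp [e, h1]
      · simp only [Stm.run, Expr.eval, Op2.eval]
        simp only [St.write_outbox, St.setVar_var, St.setVar_outbox, if_true, Word.toNat_nat,
          Nat.add_right_cancel_iff, h, if_false, h1]
        by_cases h' : j < i
        · simp [h', show j < i + 1 by omega]
        · simp [h', show ¬ j < i + 1 by omega])
  refine ⟨i0, b0, β, p5.mono ag6, ⟨C3.lt_site, C3.lt_bud, ?_, ?_, ?_, C3.tot, C3.le⟩,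
    fun i hi => ⟨(hβ i hi).1, (hβ i hi).2.2.1⟩, ?_, fun i hi => ?_, fun i hi => ?_, ?_⟩
  · rw [ag6.var _ rfl, ag5.var _ rfl]; simpa [hs4] using C3.best
  · rw [ag6.var _ rfl, ag5.var _ rfl]; simpa [hs4] using C3.fst
  · rw [ag6.var _ rfl, ag5.var _ rfl]; simpa [hs4] using C3.snd
  · refine le_trans (le_of_eq ?_) C3.tot
    exact sum_congr rfl fun i hi => (hβ i (mem_range.1 hi)).2.2.2
  · exact (h6.1 i).trans (if_pos hi)
  · rw [ag6.inbox rfl, ag5.inbox rfl]; show s3.inbox _ = _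
    rw [ag3.inbox rfl]; exact i2 i hi
  · have e : (ℛ sendBudgetsS s5).time ≤ s5.time + 1 + n * 2 := h6.2
    have e4 : s4.time = s3.time + 1 := by simp [hs4]
    unfold coordTime₁
    have : n * (4 + numB t * 7) = n * 2 + n * (2 + numB t * 7) := by ring
    omega

/-! ## The coordinator: the items -/

/-- A weighted point with a key. -/
structure Item (P : Type u) where
  pt : P
  wt : ℕ
  kp : ℕ
  km : ℕ

def Item.val {P : Type u} (a : Item P) : ℝ := V a.kp a.km

/-- What a site reports. -/
structure Report (A : Type v) where
  n : ℕ
  nd : ℕ → A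
  x : ℕ → ℝ
  X : ℝ
  cnt : ℕ
  c : ℕ → ℕ
  w : ℕ → ℕ

def Report.words (r : Report A) (k : ℕ) (md : A → P) : List (Word P A) :=
  summaryWords r.n k r.nd (md ∘ r.nd) r.x r.X r.cnt r.c r.w

def Report.netItem (r : Report A) (md : A → P) (l : ℕ) : Item P := ⟨md (r.nd (r.c l)), r.w l, 0, 0⟩

def Report.cutItem (r : Report A) (md : A → P) (j : ℕ) : Item P :=
  ⟨md (r.nd j), 1, keyP (r.x j), keyM (r.x j)⟩

def Report.items (r : Report A) (md : A → P) : List (Item P) :=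
  (List.range r.cnt).map (r.netItem md) ++ (cutList r.n r.x r.X).map (r.cutItem md)

/-- The items in the list are in place. -/
def ItemList (L : List (Item P)) (s : St P A) : Prop :=
  s.var vM = .nat L.length ∧ ∀ l a, L[l]? = some a → s.arr aPt l = .pt a.pt ∧
    s.arr aWt l = .nat a.wt ∧ s.arr aKP l = .nat a.kp ∧ s.arr aKM l = .nat a.km ∧
    s.arr aKV l = .real a.val

lemma pushItemS_spec {L : List (Item P)} (h : ItemList L s) {e : Expr} {a : Item P}
    (he : e.eval D md s = .pt a.pt) (hw : s.var vw = .nat a.wt) (hp : s.var vp = .nat a.kp)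
    (hm : s.var vm = .nat a.km) :
    ItemList (L ++ [a]) (ℛ (pushItemS e) s) ∧
      (ℛ (pushItemS e) s).time = s.time + 6 := by
  rw [show ℛ (pushItemS e) s = (((((s.setArr aPt L.length (.pt a.pt)).setArr aWt L.length
      (.nat a.wt)).setArr aKP L.length (.nat a.kp)).setArr aKM L.length (.nat a.km)).setArr aKV
      L.length (.real a.val)).setVar vM (.nat (L.length + 1)) by
    simp only [pushItemS, Stm.run]
    rw [eval_levelE (p := a.kp) (m := a.km) (by simp [hp]) (by simp [hm])]
    simp [he, hw, hp, hm, h.1, Item.val]]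
  refine ⟨⟨by simp, fun l b hb => ?_⟩, by simp⟩
  rcases lt_trichotomy l L.length with hl | rfl | hl
  · rw [List.getElem?_append_left hl] at hb
    simpa [hl.ne] using h.2 l b hb
  · rw [List.getElem?_append_right le_rfl] at hb
    simp only [Nat.sub_self, List.getElem?_cons_zero, Option.some.injEq] at hb
    subst hb
    simp
  · rw [List.getElem?_eq_none (by simp; omega)] at hb
    cases hb

lemma readNetS_spec (hp : Params k t ε n s) {L : List (Item P)} (hL : ItemList L s) {i : ℕ}
    (r : Report A) (hi : s.var vi = .nat i) (hc : s.var vc = .nat r.cnt) {rest : List (Word P A)}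
    (hin : s.inbox (i + 1) =
      (List.range' 0 r.cnt).flatMap (netWords k r.nd (md ∘ r.nd) r.c r.w) ++ rest) :
    ItemList (L ++ (List.range r.cnt).map (r.netItem md)) (ℛ readNetS s) ∧
    (ℛ readNetS s).inbox (i + 1) = rest ∧
    (∀ q, q ≠ i + 1 → (ℛ readNetS s).inbox q = s.inbox q) ∧
    (ℛ readNetS s).time ≤ s.time + 3 + r.cnt * 9 := by
  set s0 := (s.setVar vp (.nat 0)).setVar vm (.nat 0) with hs0
  rw [show ℛ readNetS s = ℛ (.rep vl vc _) s0 from rfl]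
  have hp0 : Params k t ε n s0 := (hp.setVar _).setVar _
  have hL0 : ItemList L s0 := ⟨by simpa [hs0] using hL.1, hL.2⟩
  have := for_rule D md (x := vl) (e := vc) (c := .recv vx (vi +ₙ ♯1) ;;
    .recv vw (vi +ₙ ♯1) ;; pushNetS)
    (s := s0) (n := r.cnt) (fun j s' =>
    ItemList (L ++ (List.range j).map (r.netItem md)) s' ∧
    s'.inbox (i + 1) = (List.range' j (r.cnt - j)).flatMap
      (netWords k r.nd (md ∘ r.nd) r.c r.w) ++ rest ∧
    (s'.var vp = .nat 0 ∧ s'.var vm = .nat 0) ∧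
    (∀ q, q ≠ i + 1 → s'.inbox q = s.inbox q) ∧
    s'.time ≤ s.time + 3 + j * 9) (by simp [hs0, hc])
    ⟨by simp only [List.range_zero, List.map_nil, List.append_nil]; exact ⟨hL0.1, hL0.2⟩,
      by simpa [hs0] using hin, by simp [hs0], by simp [hs0], by simp [hs0]⟩ ?_
  · refine ⟨this.1, ?_, this.2.2.2.1, this.2.2.2.2⟩
    simpa using this.2.1
  rintro j hj s' ag ⟨h1, h2, ⟨h3, h3'⟩, h4, h5⟩
  rw [show r.cnt - j = r.cnt - (j + 1) + 1 by omega, List.range'_succ, List.flatMap_cons] at h2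
  have ei : s'.var vi = .nat i := (ag.var _ rfl).trans (by simp [hs0, hi])
  have ek : s'.var vK = .nat k := (hp0.mono ag).hk
  set s1 := ((s'.setVar vl (.nat j)).read vx (i + 1)).read vw (i + 1) with hs1
  rw [show ℛ (.recv vx (vi +ₙ ♯1) ;; .recv vw (vi +ₙ ♯1) ;; pushNetS)
      (s'.setVar vl (.nat j)) = ℛ pushNetS s1 by
    have e1 : ℛ (.recv vx (vi +ₙ ♯1) ;; .recv vw (vi +ₙ ♯1))
        (s'.setVar vl (.nat j)) = s1 := by
      simp [ei, hs1]
    rw [← e1]; rfl]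
  have hL1 : ItemList (L ++ (List.range j).map (r.netItem md)) s1 :=
    ⟨by simpa [hs1] using h1.1, h1.2⟩
  obtain ⟨a1, a2⟩ : _ ∧ (ℛ pushNetS s1).time = _ := pushItemS_spec D md (a := r.netItem md j)
    (e := .cond .nat (vl +ₙ ♯1) vK vx (.median vx)) hL1 (by
      by_cases hjk : j + 1 ≤ k
      · simp [hs1, h2, netWords, ek, hjk, Report.netItem]
      · simp [hs1, h2, netWords, ek, hjk, Report.netItem])
    (by simp [hs1, h2, netWords, Report.netItem]) (by simp [hs1, h3, Report.netItem])
    (by simp [hs1, h3', Report.netItem])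
  have ag2 := frame D md pushNetS s1
  refine ⟨by simpa [List.range_succ] using a1, ?_, ⟨?_, ?_⟩, fun q hq => ?_, ?_⟩
  · rw [ag2.inbox rfl]; simp [hs1, h2, netWords]
  · rw [ag2.var _ rfl]; simp [hs1, h3]
  · rw [ag2.var _ rfl]; simp [hs1, h3']
  · rw [ag2.inbox rfl]; simp [hs1, hq, h4 q hq]
  · rw [a2]; simp [hs1]; omega

lemma readCutS_spec {L : List (Item P)} (hL : ItemList L s) {i : ℕ}
    (r : Report A) (hi : s.var vi = .nat i)
    (hc : s.var vh = .nat (cutList r.n r.x r.X).length)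
    (hin : s.inbox (i + 1) = (cutList r.n r.x r.X).flatMap (cutWords r.nd r.x)) :
    ItemList (L ++ (cutList r.n r.x r.X).map (r.cutItem md)) (ℛ readCutS s) ∧
    (∀ q, q ≠ i + 1 → (ℛ readCutS s).inbox q = s.inbox q) ∧
    (ℛ readCutS s).time ≤ s.time + 2 + (cutList r.n r.x r.X).length * 10 := by
  set H := cutList r.n r.x r.X with hH
  set s0 := s.setVar vw (.nat 1) with hs0
  rw [show ℛ readCutS s = ℛ (.rep vl vh _) s0 from rfl]
  have hL0 : ItemList L s0 := ⟨by simpa [hs0] using hL.1, hL.2⟩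
  have := for_rule D md (x := vl) (e := vh) (c := .recv vx (vi +ₙ ♯1) ;;
    .recv vp (vi +ₙ ♯1) ;; .recv vm (vi +ₙ ♯1) ;; pushItemS (.median vx))
    (s := s0) (n := H.length) (fun j s' =>
    ItemList (L ++ (H.take j).map (r.cutItem md)) s' ∧
    s'.inbox (i + 1) = (H.drop j).flatMap (cutWords r.nd r.x) ∧ s'.var vw = .nat 1 ∧
    (∀ q, q ≠ i + 1 → s'.inbox q = s.inbox q) ∧
    s'.time ≤ s.time + 2 + j * 10) (by simp [hs0, hc])
    ⟨by simp only [List.take_zero, List.map_nil, List.append_nil]; exact ⟨hL0.1, hL0.2⟩,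
      by simpa [hs0] using hin, by simp [hs0], by simp [hs0], by simp [hs0]⟩ ?_
  · exact ⟨by simpa using this.1, this.2.2.2⟩
  rintro j hj s' ag ⟨h1, h2, h3, h4, h5⟩
  rw [List.drop_eq_getElem_cons hj, List.flatMap_cons] at h2
  have ei : s'.var vi = .nat i := (ag.var _ rfl).trans (by simp [hs0, hi])
  set s1 := (((s'.setVar vl (.nat j)).read vx (i + 1)).read vp (i + 1)).read vm (i + 1) with hs1
  rw [show ℛ (.recv vx (vi +ₙ ♯1) ;;
    .recv vp (vi +ₙ ♯1) ;; .recv vm (vi +ₙ ♯1) ;; pushItemS (.median vx))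
      (s'.setVar vl (.nat j)) = ℛ (pushItemS (.median vx)) s1 by
    have e1 : ℛ (.recv vx (vi +ₙ ♯1) ;; .recv vp (vi +ₙ ♯1) ;;
        .recv vm (vi +ₙ ♯1)) (s'.setVar vl (.nat j)) = s1 := by
      simp [ei, hs1]
    rw [← e1]; rfl]
  have hL1 : ItemList (L ++ (H.take j).map (r.cutItem md)) s1 := ⟨by simpa [hs1] using h1.1, h1.2⟩
  obtain ⟨a1, a2⟩ := pushItemS_spec D md (a := r.cutItem md H[j])
    (e := .median vx) hL1 (by simp [hs1, h2, cutWords, Report.cutItem])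
    (by simp [hs1, h3, Report.cutItem]) (by simp [hs1, h2, cutWords, Report.cutItem])
    (by simp [hs1, h2, cutWords, Report.cutItem])
  have ag2 := frame D md (pushItemS (.median vx)) s1
  refine ⟨?_, ?_, ?_, fun q hq => ?_, ?_⟩
  · rw [List.append_assoc] at a1
    rwa [← List.map_singleton, ← List.map_append, List.take_append_getElem] at a1
  · rw [ag2.inbox rfl]; simp [hs1, h2, cutWords]
  · rw [ag2.var _ rfl]; simp [hs1, h3]
  · rw [ag2.inbox rfl]; simp [hs1, hq, h4 q hq]
  · rw [a2]; simp [hs1]; omega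

lemma readItemsS_spec (hp : Params k t ε n s) (r : ℕ → Report A)
    (hin : ∀ i < n, s.inbox (i + 1) = (r i).words k md) :
    ItemList ((List.range n).flatMap fun i => (r i).items md) (ℛ readItemsS s) ∧
    (ℛ readItemsS s).time ≤ s.time + 2 + n * 8 +
      10 * ((List.range n).flatMap fun i => (r i).items md).length := by
  set s0 := s.setVar vM (.nat 0) with hs0
  set c : Stm := .recv vc (vi +ₙ ♯1) ;; .recv vh (vi +ₙ ♯1) ;; readNetS ;; readCutS with hc
  rw [show ℛ readItemsS s = ℛ (.rep vi vN _) s0 from rfl]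
  have hp0 : Params k t ε n s0 := hp.setVar _
  refine for_rule D md (x := vi) (e := vN) (c := c) (s := s0) (n := n) (fun j s' =>
    ItemList ((List.range j).flatMap fun i => (r i).items md) s' ∧
    (s'.time ≤ s.time + 2 + j * 8 + 10 * ((List.range j).flatMap fun i => (r i).items md).length ∧
    ∀ i, j ≤ i → s'.inbox (i + 1) = s.inbox (i + 1))) (by simp [hp0.hn])
    ⟨⟨by simp [hs0], by simp⟩, by simp [hs0], by simp [hs0]⟩ ?_ |> fun h => ⟨h.1, h.2.1⟩
  rintro i hi s' ag ⟨h1, h2, h3⟩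
  have hp1 : Params k t ε n s' := hp0.mono ag
  set s1 := ((s'.setVar vi (.nat i)).read vc (i + 1)).read vh (i + 1) with hs1
  have hr : ℛ c (s'.setVar vi (.nat i)) = ℛ readCutS (ℛ readNetS s1) := by
    have e1 : ℛ (.recv vc (vi +ₙ ♯1) ;; .recv vh (vi +ₙ ♯1))
        (s'.setVar vi (.nat i)) = s1 := by
      simp [hs1]
    rw [← e1]; rfl
  have hin' : s'.inbox (i + 1) = (r i).words k md := by rw [h3 i le_rfl, hin i hi]
  simp only [Report.words, summaryWords] at hin'
  have hp2 : Params k t ε n s1 := by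
    have := (hp1.setVar (.nat i) (show 9 ≤ vi by norm_num)).mono (frame D md
      (.recv vc (vi +ₙ ♯1) ;; .recv vh (vi +ₙ ♯1)) _) rfl
    have e1 : ℛ (.recv vc (vi +ₙ ♯1) ;; .recv vh (vi +ₙ ♯1))
        (s'.setVar vi (.nat i)) = s1 := by
      simp [hs1]
    rwa [e1] at this
  have hi1 : s1.var vi = .nat i := by simp [hs1]
  have hh1 : s1.var vh = .nat (cutList (r i).n (r i).x (r i).X).length := by simp [hs1, hin']
  obtain ⟨b1, b2, b3, b4⟩ := readNetS_spec D md (s := s1) (i := i) (r := r i)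
    (L := (List.range i).flatMap fun i => (r i).items md)
    (rest := (cutList (r i).n (r i).x (r i).X).flatMap (cutWords (r i).nd (r i).x)) hp2
    ⟨by simpa [hs1] using h1.1, h1.2⟩ hi1 (by simp [hs1, hin'])
    (by simp [hs1, hin', List.range_eq_range'])
  have ag2 := frame D md readNetS s1
  obtain ⟨d1, d2, d3⟩ := readCutS_spec D md (s := ℛ readNetS s1) (i := i)
    (r := r i) b1 ((ag2.var _ rfl).trans hi1) ((ag2.var _ rfl).trans hh1) b2
  rw [hr]
  have hl : (List.range (i + 1)).flatMap (fun i => (r i).items md) =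
      ((List.range i).flatMap fun i => (r i).items md) ++
        (List.range (r i).cnt).map ((r i).netItem md) ++
        (cutList (r i).n (r i).x (r i).X).map ((r i).cutItem md) := by
    simp [List.range_succ, Report.items, List.append_assoc]
  rw [hl]
  refine ⟨d1, ?_, fun j hj => ?_⟩
  · have e : s1.time = s'.time + 3 := by simp [hs1]
    simp only [List.length_append, List.length_map, List.length_range]
    omega
  · rw [d2 _ (by omega), b3 _ (by omega)]
    simp [hs1, show j ≠ i by omega, h3 j (by omega)]

/-! ### Candidates -/

variable {M : ℕ} {it : ℕ → Item P} {C : List (ℕ × ℕ)}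

/-- The items are in place. -/
structure Items (M : ℕ) (it : ℕ → Item P) (s : St P A) : Prop where
  num : s.var vM = .nat M
  pt : ∀ l < M, s.arr aPt l = .pt (it l).pt
  wt : ∀ l < M, s.arr aWt l = .nat (it l).wt
  kp : ∀ l < M, s.arr aKP l = .nat (it l).kp
  km : ∀ l < M, s.arr aKM l = .nat (it l).km
  kv : ∀ l < M, s.arr aKV l = .real (it l).val

lemma Items.mono (h : Items M it s) {c : Stm} (ag : Agree c s s')
    (hc : (c.wv vM || c.wa aPt || c.wa aWt || c.wa aKP || c.wa aKM || c.wa aKV) = false := by rfl) :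
    Items M it s' := by
  simp only [Bool.or_eq_false_iff] at hc
  obtain ⟨⟨⟨⟨⟨h0, h1⟩, h2⟩, h3⟩, h4⟩, h5⟩ := hc
  exact ⟨(ag.var _ h0).trans h.num, ag.arr _ h1 ▸ h.pt, ag.arr _ h2 ▸ h.wt, ag.arr _ h3 ▸ h.kp,
    ag.arr _ h4 ▸ h.km, ag.arr _ h5 ▸ h.kv⟩

lemma Items.tick (h : Items M it s) : Items M it s.tick :=
  ⟨h.num, h.pt, h.wt, h.kp, h.km, h.kv⟩

lemma Items.setVar (h : Items M it s) {x : ℕ} (w : Word P A)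
    (hx : x ≠ vM := by norm_num) : Items M it (s.setVar x w) :=
  ⟨by simp [hx.symm, h.num], h.pt, h.wt, h.kp, h.km, h.kv⟩

lemma ItemList.items [Nonempty P] {L : List (Item P)} (h : ItemList L s) :
    ∃ it : ℕ → Item P, L = (List.range L.length).map it ∧ Items L.length it s := by
  refine ⟨fun l => L.getD l ⟨Classical.arbitrary P, 0, 0, 0⟩, ?_, ?_⟩
  · refine List.ext_getElem (by simp) fun l h1 h2 => ?_
    simp [List.getElem?_eq_getElem h1]
  · have key : ∀ l < L.length, L[l]? = some (L.getD l ⟨Classical.arbitrary P, 0, 0, 0⟩) :=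
      fun l hl => by simp [List.getElem?_eq_getElem hl]
    exact ⟨h.1, fun l hl => (h.2 l _ (key l hl)).1, fun l hl => (h.2 l _ (key l hl)).2.1,
      fun l hl => (h.2 l _ (key l hl)).2.2.1, fun l hl => (h.2 l _ (key l hl)).2.2.2.1,
      fun l hl => (h.2 l _ (key l hl)).2.2.2.2⟩

/-- The candidates are in place, and `vhi` exceeds their values. -/
structure Cands (C : List (ℕ × ℕ)) (s : St P A) : Prop where
  num : s.var vcn = .nat C.length
  get : ∀ l c, C[l]? = some c → s.arr aCP l = .nat c.1 ∧ s.arr aCM l = .nat c.2 ∧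
    s.arr aCV l = .real (V c.1 c.2)
  top : ∃ h, s.var vhi = .real h ∧ 1 ≤ h ∧ ∀ c ∈ C, V c.1 c.2 + 1 ≤ h

lemma Cands.mono (h : Cands C s) {c : Stm} (ag : Agree c s s')
    (hc : (c.wv vcn || c.wv vhi || c.wa aCP || c.wa aCM || c.wa aCV) = false := by rfl) :
    Cands C s' := by
  simp only [Bool.or_eq_false_iff] at hc
  obtain ⟨⟨⟨⟨h0, h1⟩, h2⟩, h3⟩, h4⟩ := hc
  refine ⟨(ag.var _ h0).trans h.num, fun l c hl => ?_, ?_⟩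
  · rw [ag.arr _ h2, ag.arr _ h3, ag.arr _ h4]; exact h.get l c hl
  · rw [ag.var _ h1]; exact h.top

lemma Cands.setVar (h : Cands C s) {x : ℕ} (w : Word P A)
    (hx : x ≠ vcn := by norm_num) (hx' : x ≠ vhi := by norm_num) : Cands C (s.setVar x w) :=
  ⟨by simp [hx.symm, h.num], h.get, by simpa [hx'.symm] using h.top⟩

open Classical in
/-- The list of candidates after the pair `c` has been considered. -/
def pushCand (v0 : ℝ) (C : List (ℕ × ℕ)) (c : ℕ × ℕ) : List (ℕ × ℕ) :=
  if v0 ≤ V c.1 c.2 then C ++ [c] else C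

lemma mem_foldl_pushCand (v0 : ℝ) (l C : List (ℕ × ℕ)) (c : ℕ × ℕ) :
    c ∈ l.foldl (pushCand v0) C ↔ c ∈ C ∨ (c ∈ l ∧ v0 ≤ V c.1 c.2) := by
  induction l generalizing C with
  | nil => simp
  | cons a l ih =>
    rw [List.foldl_cons, ih, pushCand]
    split_ifs with h
    · simp only [List.mem_append, List.mem_cons, List.not_mem_nil, or_false]
      constructor
      · rintro ((h1 | rfl) | h1)
        · exact .inl h1
        · exact .inr ⟨.inl rfl, h⟩
        · exact .inr ⟨.inr h1.1, h1.2⟩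
      · rintro (h1 | ⟨rfl | h1, h2⟩)
        · exact .inl (.inl h1)
        · exact .inl (.inr rfl)
        · exact .inr ⟨h1, h2⟩
    · simp only [List.mem_cons]
      constructor
      · rintro (h1 | h1)
        · exact .inl h1
        · exact .inr ⟨.inr h1.1, h1.2⟩
      · rintro (h1 | ⟨rfl | h1, h2⟩)
        · exact .inl h1
        · exact absurd h2 h
        · exact .inr ⟨h1, h2⟩

lemma length_foldl_pushCand (v0 : ℝ) (l C : List (ℕ × ℕ)) :
    (l.foldl (pushCand v0) C).length ≤ C.length + l.length := by
  induction l generalizing C with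
  | nil => simp
  | cons a l ih =>
    rw [List.foldl_cons]
    refine (ih _).trans ?_
    rw [pushCand]
    split_ifs
    · simp; omega
    · simp

lemma pushCandS_spec (h : Cands C s) {v0 : ℝ} {c : ℕ × ℕ}
    (hb : s.var vbest = .real v0) (hp : s.var vp = .nat c.1) (hm : s.var vm = .nat c.2) :
    Cands (pushCand v0 C c) (ℛ pushCandS s) ∧
      (ℛ pushCandS s).time ≤ s.time + 7 := by
  obtain ⟨H, hH, hH1, hHC⟩ := h.top
  have hrun : ℛ pushCandS s = ℛ (.ite .real vbest vv (.put aCP vcn vp ;;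
      .put aCM vcn vm ;; .put aCV vcn vv ;; .set vhi (vhi +ᵣ vv) ;; .set vcn (vcn +ₙ ♯1))
      .skip) (s.setVar vv (.real (V c.1 c.2))) := by
    have e : ℛ (.set vv (levelE vp vm)) s = s.setVar vv (.real (V c.1 c.2)) := by
      simp only [Stm.run]
      rw [eval_levelE (p := c.1) (m := c.2) (by simp [hp]) (by simp [hm])]
    rw [← e]; rfl
  by_cases hv : v0 ≤ V c.1 c.2
  · have hr : ℛ pushCandS s = ((((((s.setVar vv (.real (V c.1 c.2))).tick).setArr aCP
        C.length (.nat c.1)).setArr aCM C.length (.nat c.2)).setArr aCV C.length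
        (.real (V c.1 c.2))).setVar vhi (.real (H + V c.1 c.2))).setVar vcn
        (.nat (C.length + 1)) := by
      rw [hrun]
      simp [hp, hm, hb, hv, hH, h.num]
    rw [hr, pushCand, if_pos hv]
    refine ⟨⟨by simp, fun l b hb => ?_, H + V c.1 c.2, by simp, ?_, fun b hb => ?_⟩, by simp⟩
    · rcases lt_trichotomy l C.length with hl | rfl | hl
      · rw [List.getElem?_append_left hl] at hb
        simpa [hl.ne] using h.get l b hb
      · rw [List.getElem?_append_right le_rfl] at hb
        simp only [Nat.sub_self, List.getElem?_cons_zero, Option.some.injEq] at hb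
        subst hb
        simp
      · rw [List.getElem?_eq_none (by simp; omega)] at hb
        cases hb
    · linarith [V_nonneg c.1 c.2]
    · rcases List.mem_append.1 hb with hb | hb
      · linarith [hHC b hb, V_nonneg c.1 c.2]
      · rw [List.mem_singleton.1 hb]; linarith
  · have hr : ℛ pushCandS s = (s.setVar vv (.real (V c.1 c.2))).tick := by
      rw [hrun]
      simp [hb, hv]
    rw [hr, pushCand, if_neg hv]
    exact ⟨⟨by simpa using h.num, h.get, H, by simpa using hH, hH1, hHC⟩, by simp⟩

lemma pushKeysS_spec (h : Cands C s) {v0 : ℝ} (hI : Items M it s) (hb : s.var vbest = .real v0) :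
    Cands (((List.range M).map fun l => ((it l).kp, (it l).km)).foldl (pushCand v0) C)
      (ℛ pushKeysS s) ∧ (ℛ pushKeysS s).time ≤ s.time + 1 + M * 10 := by
  refine for_rule D md (x := vi) (e := vM) (n := M) (fun j s' =>
    Cands (((List.range j).map fun l => ((it l).kp, (it l).km)).foldl (pushCand v0) C) s' ∧
    s'.time ≤ s.time + 1 + j * 10) (by simp [hI.num])
    ⟨⟨by simpa using h.num, h.get, by simpa using h.top⟩, by simp⟩ ?_
  rintro i hi s' ag ⟨h1, h2⟩
  have hI' : Items M it s' := hI.mono ag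
  set s1 := ((s'.setVar vi (.nat i)).setVar vp (.nat (it i).kp)).setVar vm (.nat (it i).km) with hs1
  rw [show ℛ (.set vp (.arr aKP vi) ;; .set vm (.arr aKM vi) ;; pushCandS)
      (s'.setVar vi (.nat i)) = ℛ pushCandS s1 by
    have e1 : ℛ (.set vp (.arr aKP vi) ;; .set vm (.arr aKM vi))
        (s'.setVar vi (.nat i)) = s1 := by
      simp [hs1, hI'.kp i hi, hI'.km i hi]
    rw [← e1]; rfl]
  have hC : Cands (((List.range i).map fun l => ((it l).kp, (it l).km)).foldl (pushCand v0) C) s1 :=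
    ((h1.setVar _).setVar _).setVar _
  have hb1 : s1.var vbest = .real v0 := by
    have : s'.var vbest = .real v0 := (ag.var _ rfl).trans hb
    simp [hs1, this]
  obtain ⟨a1, a2⟩ := pushCandS_spec D md (c := ((it i).kp, (it i).km)) hC hb1
    (by simp [hs1]) (by simp [hs1])
  refine ⟨?_, ?_⟩
  · rw [List.range_succ, List.map_append, List.foldl_append]
    exact a1
  · have e : s1.time = s'.time + 3 := by simp [hs1]
    omega

/-! ## The coordinator: farthest-first traversal -/

/-- After `z 0`, points `z 1, …, z j` have been picked, each at maximal distance `δ` from the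
previous ones. -/
structure Traversal (M : ℕ) (q : ℕ → P) (j : ℕ) (z : ℕ → ℕ) (δ : ℕ → ℝ) : Prop where
  lt : ∀ l ≤ j, z l < M
  sep : ∀ l < j, ∀ l' ≤ l, δ l ≤ dist (q (z l')) (q (z (l + 1)))
  cover : ∀ l < j, ∀ i < M, ∃ l' ≤ l, dist (q (z l')) (q i) ≤ δ l

/-- If no radius of the traversal lies in `[lo, hi)`, then distances between the points are either
less than `2 lo` or at least `hi - 2 lo`. -/
lemma Traversal.gap {M : ℕ} {q : ℕ → P} {z : ℕ → ℕ} {δ : ℕ → ℝ} (h : Traversal M q M z δ)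
    {lo hi : ℝ} (hδ : ∀ l < M, δ l < lo ∨ hi ≤ δ l) {x y : ℕ} (hx : x < M) (hy : y < M)
    (hlo : 0 ≤ lo) (hxy : dist (q x) (q y) < hi - 2 * lo) : dist (q x) (q y) < 2 * lo := by
  have hhi : 0 < hi := by have := dist_nonneg (x := q x) (y := q y); linarith
  have hfar : ∀ l ≤ M, (∀ l' < l, hi ≤ δ l') → ∀ a b, a < b → b ≤ l →
      hi ≤ dist (q (z a)) (q (z b)) := by
    intro l hl hall a b hab hb
    obtain ⟨b, rfl⟩ : ∃ b', b = b' + 1 := ⟨b - 1, by omega⟩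
    exact (hall b (by omega)).trans (h.sep b (by omega) a (by omega))
  have hex : ∃ l, l < M ∧ δ l < lo := by
    by_contra hc
    push Not at hc
    have hall : ∀ l' < M, hi ≤ δ l' := fun l hl =>
      (hδ l hl).resolve_left (not_lt.2 (hc l hl))
    have hinj : Set.InjOn z (range (M + 1)) := by
      intro a ha b hb hab
      simp only [coe_range, Set.mem_Iio] at ha hb
      rcases lt_trichotomy a b with hlt | heq | hlt
      · have := hfar M le_rfl hall a b hlt (by omega)
        rw [hab, dist_self] at this; linarith
      · exact heq
      · have := hfar M le_rfl hall b a hlt (by omega)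
        rw [hab, dist_self] at this; linarith
    have := card_le_card_of_injOn z (s := range (M + 1)) (t := range M)
      (fun a ha => by
        simp only [coe_range, Set.mem_Iio] at ha ⊢
        exact h.lt a (by omega)) hinj
    simp at this
  classical
  obtain ⟨hlM, hlo'⟩ := Nat.find_spec hex
  set l := Nat.find hex
  have hall : ∀ l' < l, hi ≤ δ l' := fun l' hl' =>
    (hδ l' (by omega)).resolve_left fun hc => Nat.find_min hex hl' ⟨by omega, hc⟩
  obtain ⟨a, ha, hax⟩ := h.cover l hlM x hx
  obtain ⟨b, hb, hby⟩ := h.cover l hlM y hy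
  have htri := dist_triangle4 (q (z a)) (q x) (q y) (q (z b))
  rw [dist_comm (q y)] at htri
  have hab : a = b := by
    rcases lt_trichotomy a b with hlt | heq | hlt
    · have := hfar l hlM.le hall a b hlt hb
      linarith
    · exact heq
    · have := hfar l hlM.le hall b a hlt ha
      rw [dist_comm] at this
      linarith
  subst hab
  have := dist_triangle_left (q x) (q y) (q (z a))
  linarith

lemma startDistS_spec (hI : Items M it s) (hM : 0 < M) :
    (∀ i < M, (ℛ startDistS s).arr aDist i = .real (dist (it 0).pt (it i).pt)) ∧
      (ℛ startDistS s).time ≤ s.time + 1 + M * 2 := by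
  refine for_rule D md (x := vi) (e := vM) (n := M) (fun j s' =>
    (∀ i < j, s'.arr aDist i = .real (dist (it 0).pt (it i).pt)) ∧ s'.time ≤ s.time + 1 + j * 2)
    (by simp [hI.num]) ⟨by simp, by simp⟩ ?_
  rintro i hi s' ag ⟨h1, h2⟩
  have hI' : Items M it s' := hI.mono ag
  refine ⟨fun j hj => ?_, by simp; omega⟩
  by_cases h : j = i
  · subst h; simp [hI'.pt 0 hM, hI'.pt j hi]
  · simp [h, h1 j (by omega)]

lemma farthestS_spec (hI : Items M it s) (hM : 0 < M) {d : ℕ → ℝ}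
    (hd : ∀ i < M, s.arr aDist i = .real (d i)) :
    (∃ x < M, (ℛ farthestS s).var vx = .nat x ∧
      (ℛ farthestS s).var vy = .real (d x) ∧ ∀ i < M, d i ≤ d x) ∧
      (ℛ farthestS s).time ≤ s.time + 3 + M * 4 := by
  set s0 := (s.setVar vx (.nat 0)).setVar vy (.real (d 0)) with hs0
  rw [show ℛ farthestS s = ℛ (.rep vi vM
    (.ite .real (.arr aDist vi) vy .skip (.set vy (.arr aDist vi) ;; .set vx vi))) s0 by
    simp [farthestS, hd 0 hM, hs0]]
  have hI0 : Items M it s0 := (hI.setVar _).setVar _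
  refine for_rule D md (x := vi) (e := vM) (n := M) (fun j s' =>
    (∃ x < M, s'.var vx = .nat x ∧ s'.var vy = .real (d x) ∧ ∀ i < j, d i ≤ d x) ∧
      s'.time ≤ s.time + 3 + j * 4)
    (by simp [hI0.num]) ⟨⟨0, hM, by simp [hs0], by simp [hs0], by simp⟩, by simp [hs0]⟩ ?_
  rintro i hi s' ag ⟨⟨x, hx, h1, h2, h3⟩, h4⟩
  have e : s'.arr aDist i = .real (d i) := by rw [ag.arr _ rfl]; exact hd i hi
  by_cases hc : d i ≤ d x
  · refine ⟨⟨x, hx, ?_, ?_, fun j hj => ?_⟩, ?_⟩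
    · simp [e, h2, hc, h1]
    · simp [e, h2, hc]
    · rcases lt_or_eq hj with h | rfl
      · exact h3 j h
      · exact hc
    · simp [e, h2, hc]; omega
  · refine ⟨⟨i, hi, ?_, ?_, fun j hj => ?_⟩, ?_⟩
    · simp [e, h2, hc]
    · simp [e, h2, hc]
    · rcases lt_or_eq hj with h | rfl
      · linarith [h3 j h]
      · exact le_rfl
    · simp [e, h2, hc]; omega

/-- The candidates that arise from radius `y`. -/
def radCands (P : Type u) [MetricSpace P] (y : ℝ) : List (ℕ × ℕ) :=
  (List.range 6).map fun i => (expo (1 + 64 * y / dmin P) - i, 0)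

lemma pushRadiusS_spec (h : Cands C s) {v0 y : ℝ}
    (hb : s.var vbest = .real v0) (hy : s.var vy = .real y) (hm : s.var vMin = .real (dmin P)) :
    Cands ((radCands P y).foldl (pushCand v0) C) (ℛ pushRadiusS s) ∧
      (ℛ pushRadiusS s).time ≤ s.time + 3 + 6 * 9 := by
  set g := expo (1 + 64 * y / dmin P) with hg
  set s0 := (s.setVar vg (.nat g)).setVar vm (.nat 0) with hs0
  rw [show ℛ pushRadiusS s = ℛ (.rep vl ♯6
    (.set vp (vg -ₙ vl) ;; pushCandS)) s0 by
    simp [pushRadiusS, hy, hm, hs0, hg, expo]]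
  refine for_rule D md (x := vl) (e := ♯6) (n := 6) (fun j s' =>
    Cands (((List.range j).map fun i => (g - i, 0)).foldl (pushCand v0) C) s' ∧
      s'.time ≤ s.time + 3 + j * 9) (by simp)
    ⟨⟨by simpa [hs0] using h.num, h.get, by simpa [hs0] using h.top⟩, by simp [hs0]⟩ ?_
  rintro i hi s' ag ⟨h1, h2⟩
  have eg : s'.var vg = .nat g := (ag.var _ rfl).trans (by simp [hs0])
  have em : s'.var vm = .nat 0 := (ag.var _ rfl).trans (by simp [hs0])
  have eb : s'.var vbest = .real v0 := (ag.var _ rfl).trans (by simp [hs0, hb])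
  set s1 := (s'.setVar vl (.nat i)).setVar vp (.nat (g - i)) with hs1
  rw [show ℛ (.set vp (vg -ₙ vl) ;; pushCandS) (s'.setVar vl (.nat i)) =
      ℛ pushCandS s1 by
    have e1 : ℛ (.set vp (vg -ₙ vl)) (s'.setVar vl (.nat i)) = s1 := by
      simp [hs1, eg]
    rw [← e1]; rfl]
  obtain ⟨a1, a2⟩ := pushCandS_spec D md (s := s1) (v0 := v0) (c := (g - i, 0))
    ((h1.setVar _).setVar _)
    (by simp [hs1, eb]) (by simp [hs1]) (by simp [hs1, em])
  refine ⟨?_, ?_⟩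
  · rw [List.range_succ, List.map_append, List.foldl_append]
    exact a1
  · have e : s1.time = s'.time + 2 := by simp [hs1]
    omega

lemma updateDistS_spec (hI : Items M it s) {d : ℕ → ℝ} {x : ℕ} (hx : x < M)
    (hd : ∀ i < M, s.arr aDist i = .real (d i)) (hvx : s.var vx = .nat x) :
    (∀ i < M, (ℛ updateDistS s).arr aDist i = .real (min (d i) (dist (it x).pt (it i).pt))) ∧
      (ℛ updateDistS s).time ≤ s.time + 1 + M * 3 := by
  have := for_rule D md (x := vi) (e := vM)
    (c := .set vz (.op2 .dist (.arr aPt vx) (.arr aPt vi)) ;;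
    .put aDist vi (.cond .real (.arr aDist vi) vz (.arr aDist vi) vz)) (s := s) (n := M)
    (fun j s' => (∀ i < M, s'.arr aDist i =
      .real (if i < j then min (d i) (dist (it x).pt (it i).pt) else d i)) ∧
      s'.time ≤ s.time + 1 + j * 3)
    (by simp [hI.num]) ⟨fun i hi => by simp [hd i hi], by simp⟩ ?_
  · exact ⟨fun i hi => (this.1 i hi).trans (by rw [if_pos hi]), this.2⟩
  rintro i hi s' ag ⟨h1, h2⟩
  have hI' : Items M it s' := hI.mono ag
  have ex : s'.var vx = .nat x := (ag.var _ rfl).trans hvx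
  have ei := h1 i hi
  simp only [lt_irrefl, if_false] at ei
  refine ⟨fun j hj => ?_, by simp; omega⟩
  by_cases h : j = i
  · subst h
    rw [if_pos (by omega), min_def]
    split_ifs with hc <;> simp [hI'.pt x hx, hI'.pt j hi, ex, ei, hc]
  · have e : s'.arr aDist j = .real (if j < i + 1 then min (d j) (dist (it x).pt (it j).pt)
        else d j) := by
      rw [h1 j hj]
      congr 1
      by_cases h' : j < i
      · simp [h', show j < i + 1 by omega]
      · simp [h', show ¬ j < i + 1 by omega]
    simp [h, e]

lemma traverseS_spec (h : Cands C s) {v0 : ℝ} (hI : Items M it s) (hM : 0 < M)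
    (hb : s.var vbest = .real v0) (hm : s.var vMin = .real (dmin P)) :
    (∃ z δ, Traversal M (fun l => (it l).pt) M z δ ∧
      Cands (((List.range M).flatMap fun l => radCands P (δ l)).foldl (pushCand v0) C)
        (ℛ traverseS s)) ∧
      (ℛ traverseS s).time ≤ s.time + 2 + M * 2 + M * (62 + M * 7) := by
  obtain ⟨hd0, ht0⟩ := startDistS_spec D md hI hM
  have ag0 := frame D md startDistS s
  rw [show ℛ traverseS s = ℛ (.rep vj vM (farthestS ;; pushRadiusS ;;
    updateDistS)) (ℛ startDistS s) from rfl]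
  set s0 := ℛ startDistS s
  have hI0 : Items M it s0 := hI.mono ag0
  have hC0 : Cands C s0 := h.mono ag0
  have hb0 : s0.var vbest = .real v0 := (ag0.var _ rfl).trans hb
  have hm0 : s0.var vMin = .real (dmin P) := (ag0.var _ rfl).trans hm
  have := for_rule D md (x := vj) (e := vM) (c := farthestS ;; pushRadiusS ;; updateDistS)
    (s := s0) (n := M) (fun j s' => (∃ z δ, Traversal M (fun l => (it l).pt) j z δ ∧
      Cands (((List.range j).flatMap fun l => radCands P (δ l)).foldl (pushCand v0) C) s' ∧
      ∃ d : ℕ → ℝ, ∀ i < M, s'.arr aDist i = .real (d i) ∧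
        (∀ l ≤ j, d i ≤ dist (it (z l)).pt (it i).pt) ∧
        ∃ l ≤ j, d i = dist (it (z l)).pt (it i).pt) ∧
      s'.time ≤ s.time + 2 + M * 2 + j * (62 + M * 7)) (by simp [hI0.num])
    ⟨⟨fun _ => 0, fun _ => 0, ⟨fun _ _ => hM, by simp, by simp⟩,
      ⟨by simpa using hC0.num, hC0.get, by simpa using hC0.top⟩,
      fun i => dist (it 0).pt (it i).pt, fun i hi => ⟨hd0 i hi, by simp, 0, le_rfl, rfl⟩⟩,
      by simp; omega⟩ ?_
  · obtain ⟨⟨z, δ, h1, h2, -⟩, h3⟩ := this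
    exact ⟨⟨z, δ, h1, h2⟩, h3⟩
  rintro j hj s' ag ⟨⟨z, δ, hT, hC, d, hd⟩, ht⟩
  set s1 := s'.setVar vj (.nat j) with hs1
  have hI1 : Items M it s1 := (hI0.mono ag).setVar _
  have hC1 := hC.setVar (x := vj) (.nat j) (by norm_num) (by norm_num)
  have hb1 : s1.var vbest = .real v0 := by
    have : s'.var vbest = .real v0 := (ag.var _ rfl).trans hb0
    simp [hs1, this]
  have hm1 : s1.var vMin = .real (dmin P) := by
    have : s'.var vMin = .real (dmin P) := (ag.var _ rfl).trans hm0
    simp [hs1, this]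
  obtain ⟨⟨x, hx, hvx, hvy, hmax⟩, ht2⟩ := farthestS_spec D md (s := s1) (d := d)
    hI1 hM (fun i hi => (hd i hi).1)
  have ag2 := frame D md farthestS s1
  rw [show ℛ (farthestS ;; pushRadiusS ;; updateDistS) s1 =
    ℛ updateDistS (ℛ pushRadiusS (ℛ farthestS s1)) from rfl]
  set s2 := ℛ farthestS s1
  obtain ⟨hC3, ht3⟩ := pushRadiusS_spec D md (s := s2) (v0 := v0)
    (hC1.mono ag2) ((ag2.var _ rfl).trans hb1) hvy ((ag2.var _ rfl).trans hm1)
  have ag3 := frame D md pushRadiusS s2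
  set s3 := ℛ pushRadiusS s2
  obtain ⟨hd4, ht4⟩ := updateDistS_spec D md (s := s3) (d := d)
    ((hI1.mono ag2).mono ag3) hx (fun i hi => by
      rw [ag3.arr _ rfl, ag2.arr _ rfl]; exact (hd i hi).1) ((ag3.var _ rfl).trans hvx)
  have ag4 := frame D md updateDistS s3
  have hz : ∀ l ≤ j, Function.update z (j + 1) x l = z l := fun l hl =>
    Function.update_of_ne (by omega) _ _
  have hδ : ∀ l < j, Function.update δ j (d x) l = δ l := fun l hl =>
    Function.update_of_ne (by omega) _ _
  refine ⟨⟨Function.update z (j + 1) x, Function.update δ j (d x), ⟨fun l hl => ?_, ?_, ?_⟩, ?_,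
    fun i => min (d i) (dist (it x).pt (it i).pt), fun i hi => ⟨hd4 i hi, fun l hl => ?_, ?_⟩⟩, ?_⟩
  · rcases Nat.le_succ_iff.1 hl with h | rfl
    · rw [hz l h]; exact hT.lt l h
    · simpa using hx
  · intro l hl l' hl'
    rw [hz l' (by omega)]
    rcases lt_or_eq hl with h | rfl
    · rw [hδ l h, hz (l + 1) (by omega)]; exact hT.sep l h l' hl'
    · rw [Function.update_self, Function.update_self]; exact (hd x hx).2.1 l' hl'
  · intro l hl i hi
    rcases lt_or_eq hl with h | rfl
    · obtain ⟨l', h1, h2⟩ := hT.cover l h i hi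
      exact ⟨l', h1, by rw [hδ l h, hz l' (by omega)]; exact h2⟩
    · obtain ⟨l', h1, h2⟩ := (hd i hi).2.2
      refine ⟨l', h1, ?_⟩
      rw [Function.update_self, hz l' h1, ← h2]; exact hmax i hi
  · have e : ((List.range (j + 1)).flatMap fun l => radCands P (Function.update δ j (d x) l)) =
        ((List.range j).flatMap fun l => radCands P (δ l)) ++ radCands P (d x) := by
      rw [List.range_succ, List.flatMap_append]
      congr 1
      · exact List.flatMap_congr fun l hl => by rw [hδ l (List.mem_range.1 hl)]
      · simp
    rw [e, List.foldl_append]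
    exact hC3.mono ag4
  · rcases Nat.le_succ_iff.1 hl with h | rfl
    · rw [hz l h]; exact (min_le_left _ _).trans ((hd i hi).2.1 l h)
    · rw [Function.update_self]; exact min_le_right _ _
  · rcases le_total (d i) (dist (it x).pt (it i).pt) with h | h
    · obtain ⟨l, h1, h2⟩ := (hd i hi).2.2
      exact ⟨l, by omega, (min_eq_left h).trans (by rw [hz l h1]; exact h2)⟩
    · exact ⟨j + 1, le_rfl, (min_eq_right h).trans (by rw [Function.update_self])⟩
  · have e : s1.time = s'.time + 1 := by simp [hs1]
    rw [add_mul, one_mul]; omega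

lemma candidatesS_spec (hI : Items M it s) (hM : 0 < M) {p m : ℕ}
    (hb : s.var vbest = .real (V p m)) (hbp : s.var vbp = .nat p) (hbm : s.var vbm = .nat m)
    (hmin : s.var vMin = .real (dmin P)) :
    (∃ C z δ, Traversal M (fun l => (it l).pt) M z δ ∧ Cands C (ℛ candidatesS s) ∧
      (∀ c, c ∈ C ↔ (c = (p, m) ∨ (∃ l < M, c = ((it l).kp, (it l).km)) ∨
        ∃ l < M, c ∈ radCands P (δ l)) ∧ V p m ≤ V c.1 c.2) ∧ C.length ≤ 1 + 7 * M) ∧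
      (ℛ candidatesS s).time ≤ s.time + 14 + M * 12 + M * (62 + M * 7) := by
  set s0 := (((s.setVar vcn (.nat 0)).setVar vhi (.real 1)).setVar vp (.nat p)).setVar vm (.nat m)
    with hs0
  rw [show ℛ candidatesS s = ℛ traverseS (ℛ pushKeysS
      (ℛ pushCandS s0)) by
    have e1 : ℛ (.set vcn ♯0 ;; .set vhi (.num 1) ;; .set vp vbp ;;
        .set vm vbm) s = s0 := by
      simp [hs0, hbp, hbm]
    rw [← e1]; rfl]
  have hI0 : Items M it s0 := (((hI.setVar _).setVar _).setVar _).setVar _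
  have hC0 : Cands [] s0 := ⟨by simp [hs0], by simp, 1, by simp [hs0], le_rfl, by simp⟩
  obtain ⟨h1, t1⟩ := pushCandS_spec D md (s := s0) (c := (p, m)) hC0
    (v0 := V p m) (by simp [hs0, hb]) (by simp [hs0]) (by simp [hs0])
  have ag1 := frame D md pushCandS s0
  set s1 := ℛ pushCandS s0
  have hI1 : Items M it s1 := hI0.mono ag1
  have hb1 : s1.var vbest = .real (V p m) := (ag1.var _ rfl).trans (by simp [hs0, hb])
  obtain ⟨h2, t2⟩ := pushKeysS_spec D md (s := s1) h1 hI1 hb1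
  have ag2 := frame D md pushKeysS s1
  set s2 := ℛ pushKeysS s1
  obtain ⟨⟨z, δ, h3, h4⟩, t3⟩ := traverseS_spec D md (s := s2) h2
    (hI1.mono ag2) hM ((ag2.var _ rfl).trans hb1)
    ((ag2.var _ rfl).trans ((ag1.var _ rfl).trans (by simp [hs0, hmin])))
  refine ⟨⟨_, z, δ, h3, h4, fun c => ?_, ?_⟩, ?_⟩
  · rw [mem_foldl_pushCand, mem_foldl_pushCand, pushCand, if_pos le_rfl]
    simp only [List.nil_append, List.mem_singleton, List.mem_map, List.mem_range, List.mem_flatMap]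
    constructor
    · rintro ((rfl | ⟨⟨l, hl, rfl⟩, hv⟩) | ⟨⟨l, hl, hc⟩, hv⟩)
      · exact ⟨.inl rfl, le_rfl⟩
      · exact ⟨.inr (.inl ⟨l, hl, rfl⟩), hv⟩
      · exact ⟨.inr (.inr ⟨l, hl, hc⟩), hv⟩
    · rintro ⟨rfl | ⟨l, hl, rfl⟩ | ⟨l, hl, hc⟩, hv⟩
      · exact .inl (.inl rfl)
      · exact .inl (.inr ⟨⟨l, hl, rfl⟩, hv⟩)
      · exact .inr ⟨⟨l, hl, hc⟩, hv⟩
  · refine (length_foldl_pushCand _ _ _).trans ?_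
    have e1 := length_foldl_pushCand (V p m) ((List.range M).map fun l => ((it l).kp, (it l).km))
      (pushCand (V p m) [] (p, m))
    have e2 : (pushCand (V p m) [] (p, m)).length = 1 := by simp [pushCand]
    have e3 : ((List.range M).flatMap fun l => radCands P (δ l)).length = M * 6 := by
      simp [radCands, List.length_flatMap]
    rw [e3]
    simp only [List.length_map, List.length_range] at e1
    omega
  · have e : s0.time = s.time + 4 := by simp [hs0]
    omega

/-! ## The coordinator: greedy covering -/

/-- One step of the greedy covering: `B` is at least as heavy in `U` as every member of `𝒞`, and
`E` contains `B` and all members of `𝒞` that meet `B`. -/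
lemma greedy_step {w : ℕ → ℕ} {U B E : Finset ℕ} {𝒞 : Finset (Finset ℕ)} (hBE : B ⊆ E)
    (hhit : ∀ Q ∈ 𝒞, (∃ a ∈ Q, a ∈ B) → Q ⊆ E)
    (hmax : ∀ Q ∈ 𝒞, ∑ l ∈ U ∩ Q, w l ≤ ∑ l ∈ U ∩ B, w l) :
    ∃ 𝒞' ⊆ 𝒞, 𝒞'.card ≤ 𝒞.card - 1 ∧ ∑ l ∈ U ∩ 𝒞.biUnion id, w l ≤
      ∑ l ∈ U ∩ E, w l + ∑ l ∈ (U \ E) ∩ 𝒞'.biUnion id, w l := by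
  rcases 𝒞.eq_empty_or_nonempty with rfl | hne
  · exact ⟨∅, subset_rfl, by simp, by simp⟩
  by_cases hex : ∃ Q ∈ 𝒞, ∃ a ∈ Q, a ∈ B
  · obtain ⟨Q, hQ, hQB⟩ := hex
    refine ⟨𝒞.erase Q, erase_subset _ _, (card_erase_of_mem hQ).le, ?_⟩
    rw [← sum_union (Finset.disjoint_left.2 fun a h1 h2 => by
      simp only [mem_inter, mem_sdiff] at h1 h2; exact h2.1.2 h1.2)]
    refine Finset.sum_le_sum_of_subset fun a ha => ?_
    simp only [mem_inter, mem_biUnion, mem_union, mem_sdiff, id, mem_erase] at ha ⊢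
    obtain ⟨haU, R, hR, haR⟩ := ha
    by_cases haE : a ∈ E
    · exact .inl ⟨haU, haE⟩
    · refine .inr ⟨⟨haU, haE⟩, R, ⟨?_, hR⟩, haR⟩
      rintro rfl
      exact haE (hhit R hQ hQB haR)
  · push Not at hex
    obtain ⟨Q, hQ⟩ := hne
    refine ⟨𝒞.erase Q, erase_subset _ _, (card_erase_of_mem hQ).le, ?_⟩
    set R := (𝒞.erase Q).biUnion id with hR
    have h1 : ∑ l ∈ U ∩ 𝒞.biUnion id, w l ≤ ∑ l ∈ U ∩ Q, w l + ∑ l ∈ U ∩ R, w l := by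
      rw [← insert_erase hQ, biUnion_insert, Finset.inter_union_distrib_left, ← hR]
      have := sum_union_inter (s₁ := U ∩ id Q) (s₂ := U ∩ R) (f := w)
      simp only [id] at *
      omega
    have h2 : ∑ l ∈ U ∩ R, w l = ∑ l ∈ (U ∩ R) ∩ E, w l + ∑ l ∈ (U \ E) ∩ R, w l := by
      rw [← sum_union (Finset.disjoint_left.2 fun a h1 h2 => by
        simp only [mem_inter, mem_sdiff] at h1 h2; exact h2.1.2 h1.2)]
      congr 1
      ext a
      simp only [mem_inter, mem_union, mem_sdiff]
      tauto
    have h3 : ∑ l ∈ U ∩ B, w l + ∑ l ∈ (U ∩ R) ∩ E, w l ≤ ∑ l ∈ U ∩ E, w l := by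
      rw [← sum_union (Finset.disjoint_left.2 fun a h1 h2 => by
        simp only [mem_inter, hR, mem_biUnion, id] at h1 h2
        obtain ⟨⟨-, S, hS, haS⟩, -⟩ := h2
        exact hex S (mem_of_mem_erase hS) a haS h1.2)]
      refine Finset.sum_le_sum_of_subset fun a ha => ?_
      simp only [mem_inter, mem_union] at ha ⊢
      rcases ha with ha | ha
      · exact ⟨ha.1, hBE ha.2⟩
      · exact ⟨ha.1.1, ha.2⟩
    have := hmax Q hQ
    omega

def wts (it : ℕ → Item P) (S : Finset ℕ) : ℕ := ∑ l ∈ S, (it l).wt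

/-- The indices below `M` of items within level `g` of item `x`. -/
def ball (M : ℕ) (it : ℕ → Item P) (g x : ℕ) : Finset ℕ :=
  (range M).filter fun l => lev (it x).pt (it l).pt ≤ g

open Classical in
/-- The items that can be covered at level `v`. -/
def liveSet (M : ℕ) (it : ℕ → Item P) (v : ℝ) : Finset ℕ :=
  (range M).filter fun l => (it l).val ≤ v

/-- All but a weight of `R` can be covered at level `(p, v)` by `k` clusters. -/
def Coverable (M : ℕ) (it : ℕ → Item P) (k p : ℕ) (v R : ℝ) : Prop :=
  ∃ 𝒞 : Finset (Finset ℕ), 𝒞.card ≤ k ∧ (∀ Q ∈ 𝒞, ∀ a ∈ Q, a < M ∧ ∀ b ∈ Q,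
    dist (it a).pt (it b).pt < 10 * rad P p) ∧
    (wts it (range M \ (liveSet M it v ∩ 𝒞.biUnion id)) : ℝ) ≤ R

/-- The weights near the items are in place for the set `U` of live items; `T` is the weight of
the items that were never live. -/
structure CoverSt (k M : ℕ) (it : ℕ → Item P) (p T : ℕ) (U : Finset ℕ) (s : St P A) : Prop where
  items : Items M it s
  hk : s.var vK = .nat k
  hmin : s.var vMin = .real (dmin P)
  hp : s.var vp = .nat p
  live : ∀ l < M, s.arr aLive l = .nat (if l ∈ U then 1 else 0)
  cnt : ∀ l < M, s.arr aCnt l = .nat (wts it (U ∩ ball M it (p + 3) l))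
  rem : s.var vrem = .nat (T + wts it U)

lemma CoverSt.setVar {p T : ℕ} {U : Finset ℕ} (h : CoverSt k M it p T U s) {x : ℕ} (w : Word P A)
    (h1 : x ≠ vM := by norm_num) (h2 : x ≠ vK := by norm_num) (h3 : x ≠ vMin := by norm_num)
    (h4 : x ≠ vp := by norm_num) (h5 : x ≠ vrem := by norm_num) :
    CoverSt k M it p T U (s.setVar x w) :=
  ⟨h.items.setVar _ h1, by simp [h2.symm, h.hk], by simp [h3.symm, h.hmin], by simp [h4.symm, h.hp],
    h.live, h.cnt, by simp [h5.symm, h.rem]⟩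

lemma CoverSt.tick {p T : ℕ} {U : Finset ℕ} (h : CoverSt k M it p T U s) :
    CoverSt k M it p T U s.tick :=
  ⟨h.items.tick, h.hk, h.hmin, h.hp, h.live, h.cnt, h.rem⟩

lemma eval_levItems (hI : Items M it s) (hm : s.var vMin = .real (dmin P)) {x y : ℕ} {a b : ℕ}
    (ha : s.var a = .nat x) (hb : s.var b = .nat y) (hx : x < M) (hy : y < M) :
    (levE (.arr aPt a) (.arr aPt b)).eval D md s = .nat (lev (it x).pt (it y).pt) :=
  eval_levE (by simp [ha, hI.pt x hx]) (by simp [hb, hI.pt y hy]) hm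

lemma killS_spec {p T j : ℕ} {U : Finset ℕ} (h : CoverSt k M it p T U s)
    (hj : s.var vj = .nat j) (hjM : j < M) (hjU : j ∈ U) :
    CoverSt k M it p T (U.erase j) (ℛ killS s) ∧
      (ℛ killS s).time ≤ s.time + 3 + M * 3 := by
  have hW : wts it U = wts it (U.erase j) + (it j).wt := (sum_erase_add U _ hjU).symm
  set s0 := (s.setArr aLive j (.nat 0)).setVar vrem (.nat (T + wts it (U.erase j))) with hs0
  rw [show ℛ killS s = ℛ (.rep vi vM (.ite .nat (levE (.arr aPt vi) (.arr aPt vj)) (vp +ₙ ♯3)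
      (.put aCnt vi (.arr aCnt vi -ₙ .arr aWt vj)) .skip)) s0 by
    have e1 : ℛ (.put aLive vj ♯0 ;; .set vrem (vrem -ₙ .arr aWt vj)) s = s0 := by
      simp [hs0, hj, h.rem, h.items.wt j hjM, hW, ← add_assoc]
    rw [← e1]; rfl]
  have hI0 : Items M it s0 := by
    constructor <;>
      simp +contextual [hs0, h.items.num, h.items.pt, h.items.wt, h.items.kp, h.items.km,
          h.items.kv]
  have hc0 : ∀ l, s0.arr aCnt l = s.arr aCnt l := fun l => by simp [hs0]
  have hj0 : s0.var vj = .nat j := by simp [hs0, hj]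
  have hp0 : s0.var vp = .nat p := by simp [hs0, h.hp]
  have hm0 : s0.var vMin = .real (dmin P) := by simp [hs0, h.hmin]
  have := for_rule D md (x := vi) (e := vM)
    (c := .ite .nat (levE (.arr aPt vi) (.arr aPt vj)) (vp +ₙ ♯3)
      (.put aCnt vi (.arr aCnt vi -ₙ .arr aWt vj)) .skip) (s := s0) (n := M) (fun i s' =>
    (∀ l < M, s'.arr aCnt l = .nat (if l < i then wts it (U.erase j ∩ ball M it (p + 3) l)
      else wts it (U ∩ ball M it (p + 3) l))) ∧ s'.time ≤ s.time + 3 + i * 3)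
    (by simp [hI0.num]) ⟨fun l hl => by simp [hc0, h.cnt l hl], by simp [hs0]⟩ ?_
  · have ag := frame D md (.rep vi vM (.ite .nat (levE (.arr aPt vi) (.arr aPt vj)) (vp +ₙ ♯3)
      (.put aCnt vi (.arr aCnt vi -ₙ .arr aWt vj)) .skip)) s0
    refine ⟨⟨hI0.mono ag, (ag.var _ rfl).trans (by simp [hs0, h.hk]), (ag.var _ rfl).trans hm0,
      (ag.var _ rfl).trans hp0, fun l hl => ?_, fun l hl => ?_, (ag.var _ rfl).trans
      (by simp [hs0])⟩,
      this.2⟩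
    · rw [ag.arr _ rfl]
      by_cases hlj : l = j
      · subst hlj; simp [hs0]
      · simp [hs0, hlj, h.live l hl]
    · rw [this.1 l hl, if_pos hl]
  rintro i hi s1 ag ⟨h1, h2⟩
  have hI1 : Items M it s1 := hI0.mono ag
  have ej : s1.var vj = .nat j := (ag.var _ rfl).trans hj0
  have ep : s1.var vp = .nat p := (ag.var _ rfl).trans hp0
  have em : s1.var vMin = .real (dmin P) := (ag.var _ rfl).trans hm0
  have ec := h1 i hi
  simp only [lt_irrefl, if_false] at ec
  simp only [Stm.run]
  rw [eval_levItems D md (x := i) (y := j) (hI1.setVar _) (by simp [em]) (by simp) (by simp [ej])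
      hi hjM]
  have hmem : j ∈ ball M it (p + 3) i ↔ lev (it i).pt (it j).pt ≤ p + 3 := by simp [ball, hjM]
  have key : wts it ((U ∩ ball M it (p + 3) i).erase j) = wts it (U ∩ ball M it (p + 3) i) -
      if lev (it i).pt (it j).pt ≤ p + 3 then (it j).wt else 0 := by
    split_ifs with hc
    · have := sum_erase_add (U ∩ ball M it (p + 3) i) (fun l => (it l).wt)
        (mem_inter.2 ⟨hjU, hmem.2 hc⟩)
      unfold wts; omega
    · rw [erase_eq_of_notMem]
      · simp
      · simp [hmem, hc]
  by_cases hc : lev (it i).pt (it j).pt ≤ p + 3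
  · rw [if_pos hc] at key
    refine ⟨fun l hl => ?_, ?_⟩
    · by_cases hl' : l = i
      · subst hl'
        simp [ep, hc, ej, hI1.wt j hjM, ec, key]
      · have hlt : (l < i + 1) ↔ (l < i) := by omega
        simp [ep, hc, ej, hl', h1 l hl, hlt]
    · simp [ep, hc]; omega
  · rw [if_neg hc, Nat.sub_zero] at key
    refine ⟨fun l hl => ?_, ?_⟩
    · by_cases hl' : l = i
      · subst hl'
        simp [ep, hc, ec, key]
      · have hlt : (l < i + 1) ↔ (l < i) := by omega
        simp [ep, hc, h1 l hl, hlt]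
    · simp [ep, hc]; omega

lemma killBallS_spec {p T x : ℕ} {U : Finset ℕ} (h : CoverSt k M it p T U s)
    (hx : s.var vx = .nat x) (hxM : x < M) :
    CoverSt k M it p T (U \ ball M it (p + 4) x) (ℛ killBallS s) ∧
      (ℛ killBallS s).time + (U \ ball M it (p + 4) x).card * (3 + M * 3) ≤
        s.time + 1 + M * 3 + U.card * (3 + M * 3) := by
  have := for_rule D md (x := vj) (e := vM) (c := killNearS) (s := s) (n := M) (fun i s' =>
    CoverSt k M it p T (U \ (ball M it (p + 4) x).filter (· < i)) s' ∧
    s'.time + (U \ (ball M it (p + 4) x).filter (· < i)).card * (3 + M * 3) ≤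
        s.time + 1 + i * 3 + U.card * (3 + M * 3)) (by simp [h.items.num])
    ⟨by simpa using h.tick, by simp⟩ ?_
  · have e : (ball M it (p + 4) x).filter (· < M) = ball M it (p + 4) x :=
      filter_true_of_mem fun l hl => by
        simp only [ball, mem_filter, mem_range] at hl; exact hl.1
    rwa [e] at this
  rintro i hi s' ag ⟨h1, h2⟩
  have hx' : s'.var vx = .nat x := (ag.var _ rfl).trans hx
  set E := ball M it (p + 4) x with hE
  set U' := U \ E.filter (· < i) with hU'
  have hiU' : i ∈ U' ↔ i ∈ U := by simp [hU']
  set s1 := s'.setVar vj (.nat i) with hs1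
  have hC1 : CoverSt k M it p T U' s1 := h1.setVar _
  have hlev : (levE (.arr aPt vx) (.arr aPt vj)).eval D md s1.tick =
      .nat (lev (it x).pt (it i).pt) :=
    eval_levItems _ _ hC1.items.tick hC1.hmin (by simp [hs1, hx']) (by simp [hs1]) hxM hi
  have hstep : U \ E.filter (· < i + 1) = if i ∈ U ∧ i ∈ E then U'.erase i else U' := by
    ext a
    split_ifs with hc
    · simp only [hU', mem_sdiff, mem_filter, mem_erase]
      by_cases ha : a = i
      · subst ha; simp [hc.2]
      · rw [show (a < i + 1) ↔ (a < i) by omega]; simp [ha]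
    · simp only [hU', mem_sdiff, mem_filter]
      by_cases ha : a = i
      · subst ha
        rw [not_and] at hc
        simp only [Nat.lt_succ_self, and_true, lt_irrefl, and_false, not_false_eq_true]
        constructor
        · exact fun h => h.1
        · exact fun h => ⟨h, hc h⟩
      · rw [show (a < i + 1) ↔ (a < i) by omega]
  have hmemE : i ∈ E ↔ lev (it x).pt (it i).pt ≤ p + 4 := by simp [hE, ball, hi]
  have hlive := hC1.live i hi
  have e1 : s1.var vj = .nat i := by simp [hs1]
  have e2 := hC1.hp
  rw [hstep]
  by_cases hiU : i ∈ U
  · rw [if_pos (hiU'.2 hiU)] at hlive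
    have hr : ℛ killNearS s1 =
        ℛ (.ite .nat (levE (.arr aPt vx) (.arr aPt vj)) (vp +ₙ ♯4) killS .skip)
          s1.tick := by
      rw [killNearS, Stm.run]; simp [e1, hlive]
    rw [hr, Stm.run, hlev]
    by_cases hc : lev (it x).pt (it i).pt ≤ p + 4
    · rw [if_pos ⟨hiU, hmemE.2 hc⟩]
      obtain ⟨a1, a2⟩ := killS_spec D md (s := s1.tick.tick) (j := i) (U := U')
        hC1.tick.tick (by simp [hs1]) hi (hiU'.2 hiU)
      rw [if_pos (by simp [e2, hc])]
      refine ⟨a1, ?_⟩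
      have e : U'.card = (U'.erase i).card + 1 :=
        (card_erase_add_one (hiU'.2 hiU)).symm
      rw [e, add_mul, one_mul] at h2
      have e3 : s1.tick.tick.time = s'.time + 3 := by simp [hs1]
      rw [e3] at a2
      omega
    · rw [if_neg (fun h => hc (hmemE.1 h.2)), if_neg (by simp [e2, hc])]
      refine ⟨hC1.tick.tick, ?_⟩
      simp [hs1]; omega
  · rw [if_neg (fun h => hiU (hiU'.1 h))] at hlive
    have hr : ℛ killNearS s1 = s1.tick := by
      rw [killNearS, Stm.run]; simp [e1, hlive]
    rw [hr, if_neg (fun h => hiU h.1)]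
    refine ⟨hC1.tick, ?_⟩
    simp [hs1]; omega

lemma heaviestS_spec {p T : ℕ} {U : Finset ℕ} (h : CoverSt k M it p T U s) (hM : 0 < M) :
    (∃ x < M, (ℛ heaviestS s).var vx = .nat x ∧
      ∀ i < M, wts it (U ∩ ball M it (p + 3) i) ≤ wts it (U ∩ ball M it (p + 3) x)) ∧
      (ℛ heaviestS s).time ≤ s.time + 3 + M * 4 := by
  set d := fun i => wts it (U ∩ ball M it (p + 3) i) with hd
  set s0 := (s.setVar vx (.nat 0)).setVar vw (.nat (d 0)) with hs0
  rw [show ℛ heaviestS s = ℛ (.rep vi vM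
    (.ite .nat (.arr aCnt vi) vw .skip (.set vw (.arr aCnt vi) ;; .set vx vi))) s0 by
    simp [heaviestS, h.cnt 0 hM, hs0, hd]]
  have := for_rule D md (x := vi) (e := vM)
    (c := .ite .nat (.arr aCnt vi) vw .skip (.set vw (.arr aCnt vi) ;; .set vx vi))
    (s := s0) (n := M) (fun j s' =>
    (∃ x < M, s'.var vx = .nat x ∧ s'.var vw = .nat (d x) ∧ ∀ i < j, d i ≤ d x) ∧
      s'.time ≤ s.time + 3 + j * 4)
    (by simp [hs0, h.items.num])
    ⟨⟨0, hM, by simp [hs0], by simp [hs0], by simp⟩, by simp [hs0]⟩ ?_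
  · obtain ⟨⟨x, hx, h1, -, h2⟩, h3⟩ := this
    exact ⟨⟨x, hx, h1, h2⟩, h3⟩
  rintro i hi s' ag ⟨⟨x, hx, h1, h2, h3⟩, h4⟩
  have e : s'.arr aCnt i = .nat (d i) := by rw [ag.arr _ rfl]; exact h.cnt i hi
  by_cases hc : d i ≤ d x
  · refine ⟨⟨x, hx, ?_, ?_, fun j hj => ?_⟩, ?_⟩
    · simp [e, h2, hc, h1]
    · simp [e, h2, hc]
    · rcases lt_or_eq hj with h | rfl
      · exact h3 j h
      · exact hc
    · simp [e, h2, hc]; omega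
  · refine ⟨⟨i, hi, ?_, ?_, fun j hj => ?_⟩, ?_⟩
    · simp [e, h2, hc]
    · simp [e, h2, hc]
    · rcases lt_or_eq hj with h | rfl
      · have := h3 j h; omega
      · exact le_rfl
    · simp [e, h2, hc]; omega

lemma liveS_spec (hI : Items M it s) {v : ℝ} (hv : s.var vv = .real v) :
    (∀ l < M, (ℛ liveS s).arr aLive l = .nat (if l ∈ liveSet M it v then 1 else 0)) ∧
    (ℛ liveS s).var vrem = .nat (wts it (range M)) ∧
    (ℛ liveS s).time ≤ s.time + 2 + M * 3 := by
  set s0 := s.setVar vrem (.nat 0) with hs0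
  rw [show ℛ liveS s = ℛ (.rep vi vM _) s0 from rfl]
  have hI0 : Items M it s0 := hI.setVar _
  refine for_rule D md (x := vi) (e := vM) (n := M) (fun j s' =>
    (∀ l < j, s'.arr aLive l = .nat (if l ∈ liveSet M it v then 1 else 0)) ∧
    s'.var vrem = .nat (wts it (range j)) ∧ s'.time ≤ s.time + 2 + j * 3)
    (by simp [hI0.num]) ⟨by simp, by simp [hs0, wts], by simp [hs0]⟩ ?_
  rintro i hi s' ag ⟨h1, h2, h3⟩
  have hI' : Items M it s' := hI0.mono ag
  have ev : s'.var vv = .real v := (ag.var _ rfl).trans (by simp [hs0, hv])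
  have hmem : i ∈ liveSet M it v ↔ (it i).val ≤ v := by simp [liveSet, hi]
  refine ⟨fun l hl => ?_, ?_, by simp; omega⟩
  · by_cases h : l = i
    · subst h
      by_cases hc : (it l).val ≤ v
      · simp [hI'.kv l hi, ev, hmem, hc]
      · simp [hI'.kv l hi, ev, hmem, hc]
    · simp [h, h1 l (by omega)]
  · simp [h2, hI'.wt i hi, wts, sum_range_succ]

lemma ballS_spec (hI : Items M it s) (hm : s.var vMin = .real (dmin P)) {p i : ℕ} {U : Finset ℕ}
    (hp : s.var vp = .nat p) (hi : s.var vi = .nat i) (hiM : i < M) (hU : U ⊆ range M)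
    (hl : ∀ l < M, s.arr aLive l = .nat (if l ∈ U then 1 else 0)) :
    (ℛ ballS s).var vw = .nat (wts it (U ∩ ball M it (p + 3) i)) ∧
      (ℛ ballS s).time ≤ s.time + 2 + M * 4 := by
  set s0 := s.setVar vw (.nat 0) with hs0
  rw [show ℛ ballS s = ℛ (.rep vj vM _) s0 from rfl]
  have hI0 : Items M it s0 := hI.setVar _
  have := for_rule D md (x := vj) (e := vM) (c := .ite .nat ♯1 (.arr aLive vj)
    (.ite .nat (levE (.arr aPt vi) (.arr aPt vj)) (vp +ₙ ♯3)
      (.set vw (vw +ₙ .arr aWt vj)) .skip) .skip) (s := s0) (n := M) (fun j s' =>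
    s'.var vw = .nat (∑ l ∈ range j, if l ∈ U ∩ ball M it (p + 3) i then (it l).wt else 0) ∧
    s'.time ≤ s.time + 2 + j * 4)
    (by simp [hI0.num]) ⟨by simp [hs0], by simp [hs0]⟩ ?_
  · refine ⟨this.1.trans ?_, this.2⟩
    rw [← sum_filter, filter_mem_eq_inter, inter_eq_right.2 (Finset.inter_subset_left.trans hU)]
    rfl
  rintro j hj s' ag ⟨h1, h2⟩
  have hI' : Items M it s' := hI0.mono ag
  have ei : s'.var vi = .nat i := (ag.var _ rfl).trans (by simp [hs0, hi])
  have ep : s'.var vp = .nat p := (ag.var _ rfl).trans (by simp [hs0, hp])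
  have em : s'.var vMin = .real (dmin P) := (ag.var _ rfl).trans (by simp [hs0, hm])
  have el : s'.arr aLive j = .nat (if j ∈ U then 1 else 0) := by rw [ag.arr _ rfl]; exact hl j hj
  have hlev : (levE (.arr aPt vi) (.arr aPt vj)).eval D md (s'.setVar vj (.nat j)).tick =
      .nat (lev (it i).pt (it j).pt) :=
    eval_levItems _ _ (hI'.setVar _).tick (by simp [em]) (by simp [ei]) (by simp) hiM hj
  have hmem : j ∈ ball M it (p + 3) i ↔ lev (it i).pt (it j).pt ≤ p + 3 := by simp [ball, hj]
  rw [sum_range_succ, Stm.run]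
  by_cases hjU : j ∈ U
  · rw [if_pos hjU] at el
    rw [if_pos (by simp [el]), Stm.run, hlev]
    by_cases hc : lev (it i).pt (it j).pt ≤ p + 3
    · simp [ep, hc, h1, hI'.wt j hj, hjU, hmem]; omega
    · simp [ep, hc, h1, hmem]; omega
  · rw [if_neg hjU] at el
    rw [if_neg (by simp [el])]
    simp [h1, hjU]; omega

lemma countS_spec (hI : Items M it s) (hm : s.var vMin = .real (dmin P)) {p : ℕ} {U : Finset ℕ}
    (hp : s.var vp = .nat p) (hU : U ⊆ range M)
    (hl : ∀ l < M, s.arr aLive l = .nat (if l ∈ U then 1 else 0)) :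
    (∀ l < M, (ℛ countS s).arr aCnt l = .nat (wts it (U ∩ ball M it (p + 3) l))) ∧
      (ℛ countS s).time ≤ s.time + 1 + M * (4 + M * 4) := by
  refine for_rule D md (x := vi) (e := vM) (n := M) (fun j s' =>
    (∀ l < j, s'.arr aCnt l = .nat (wts it (U ∩ ball M it (p + 3) l))) ∧
    s'.time ≤ s.time + 1 + j * (4 + M * 4))
    (by simp [hI.num]) ⟨by simp, by simp⟩ ?_
  rintro i hi s' ag ⟨h1, h2⟩
  set s1 := s'.setVar vi (.nat i) with hs1
  have hI1 : Items M it s1 := (hI.mono ag).setVar _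
  have ep : s'.var vp = .nat p := (ag.var _ rfl).trans hp
  have em : s'.var vMin = .real (dmin P) := (ag.var _ rfl).trans hm
  obtain ⟨a1, a2⟩ := ballS_spec D md (s := s1) (i := i) (p := p) (U := U) hI1
    (by simp [hs1, em]) (by simp [hs1, ep]) (by simp [hs1]) hi hU (fun l hl' => by
      show s'.arr aLive l = _
      rw [ag.arr _ rfl]; exact hl l hl')
  have ag2 := frame D md ballS s1
  have e1 : (ℛ ballS s1).var vi = .nat i := (ag2.var _ rfl).trans (by simp [hs1])
  have e2 : ∀ l, (ℛ ballS s1).arr aCnt l = s'.arr aCnt l := fun l => by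
    rw [ag2.arr _ rfl]; rfl
  rw [show ℛ (ballS ;; .put aCnt vi vw) s1 =
      (ℛ ballS s1).setArr aCnt i (.nat (wts it (U ∩ ball M it (p + 3) i))) by
    simp [e1, a1]]
  refine ⟨fun l hl' => ?_, ?_⟩
  · by_cases h : l = i
    · subst h; simp
    · simp [h, e2, h1 l (by omega)]
  · simp [hs1] at a2 ⊢
    rw [add_mul i, one_mul]; omega

/-- The time bound of `coverS`. -/
def coverTime (k M : ℕ) : ℕ := 4 + M * 3 + M * (4 + M * 4) + k * (6 + M * 7) + M * (3 + M * 3)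

lemma coverS_spec (hI : Items M it s) (hM : 0 < M) (hk : s.var vK = .nat k)
    (hm : s.var vMin = .real (dmin P)) {p : ℕ} {v : ℝ} (hp : s.var vp = .nat p)
    (hv : s.var vv = .real v) :
    (∃ (kc : ℕ → ℕ) (rem : ℕ), (∀ b < k, kc b < M ∧ (ℛ coverS s).arr aKC b = .pt (it (kc b)).pt) ∧
      (ℛ coverS s).var vrem = .nat rem ∧
      rem = wts it ((range M).filter fun l =>
        ¬ (l ∈ liveSet M it v ∧ ∃ b < k, lev (it (kc b)).pt (it l).pt ≤ p + 4)) ∧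
      ∀ R : ℝ, Coverable M it k p v R → (rem : ℝ) ≤ R) ∧
      (ℛ coverS s).time ≤ s.time + coverTime k M := by
  set U0 := liveSet M it v with hU0
  have hU₀M : U0 ⊆ range M := filter_subset _ _
  obtain ⟨l1, l2, l3⟩ := liveS_spec D md hI hv
  have ag1 := frame D md liveS s
  rw [show ℛ coverS s = ℛ (.rep vb vK (heaviestS ;; .put aKC vb (.arr aPt vx) ;;
    killBallS)) (ℛ countS (ℛ liveS s)) from rfl]
  set s1 := ℛ liveS s
  have hI1 : Items M it s1 := hI.mono ag1
  obtain ⟨c1, c2⟩ := countS_spec D md (s := s1) (p := p) (U := U0) hI1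
    ((ag1.var _ rfl).trans hm) ((ag1.var _ rfl).trans hp) hU₀M l1
  have ag2 := frame D md countS s1
  set s2 := ℛ countS s1
  set T := wts it (range M \ U0) with hT
  have hTW : T + wts it U0 = wts it (range M) := sum_sdiff hU₀M
  have hC2 : CoverSt k M it p T U0 s2 := ⟨hI1.mono ag2,
    (ag2.var _ rfl).trans ((ag1.var _ rfl).trans hk), (ag2.var _ rfl).trans
    ((ag1.var _ rfl).trans hm),
    (ag2.var _ rfl).trans ((ag1.var _ rfl).trans hp), fun l hl => by
      rw [ag2.arr _ rfl]; exact l1 l hl,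
    c1, by rw [ag2.var _ rfl, l2, hTW]⟩
  set Ub := fun (kc : ℕ → ℕ) (b : ℕ) =>
    U0.filter fun l => ∀ b' < b, ¬ lev (it (kc b')).pt (it l).pt ≤ p + 4 with hUb
  have hUbM : ∀ kc b, Ub kc b ⊆ range M := fun kc b => (filter_subset _ _).trans hU₀M
  have := for_rule D md (x := vb) (e := vK)
    (c := heaviestS ;; .put aKC vb (.arr aPt vx) ;; killBallS) (s := s2) (n := k) (fun b s' =>
    ∃ kc : ℕ → ℕ, (∀ b' < b, kc b' < M ∧ s'.arr aKC b' = .pt (it (kc b')).pt) ∧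
      CoverSt k M it p T (Ub kc b) s' ∧
      (∀ 𝒞₀ : Finset (Finset ℕ), 𝒞₀.card ≤ k → (∀ Q ∈ 𝒞₀, ∀ a ∈ Q, a < M ∧ ∀ b ∈ Q,
        dist (it a).pt (it b).pt < 10 * rad P p) → ∃ 𝒞 ⊆ 𝒞₀, 𝒞.card ≤ k - b ∧
        wts it (U0 ∩ 𝒞₀.biUnion id) ≤ wts it (U0 \ Ub kc b) + wts it (Ub kc b ∩ 𝒞.biUnion id)) ∧
      s'.time + (Ub kc b).card * (3 + M * 3) ≤
        s2.time + 1 + b * (6 + M * 7) + U0.card * (3 + M * 3))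
    (by simp [hC2.hk]) ⟨fun _ => 0, by simp, ?_, ?_, ?_⟩ ?_
  · obtain ⟨kc, h1, h2, h3, h4⟩ := this
    refine ⟨⟨kc, T + wts it (Ub kc k), h1, h2.rem, ?_, fun R ⟨𝒞₀, hc, hd, hR⟩ => ?_⟩, ?_⟩
    · rw [hT, wts, wts, ← sum_union (Finset.disjoint_left.2 fun a h1 h2 =>
        (mem_sdiff.1 h1).2 (filter_subset _ _ h2))]
      refine sum_congr (Finset.ext fun l => ?_) fun _ _ => rfl
      have := @hU₀M l
      simp only [mem_union, mem_sdiff, mem_filter, not_and, not_exists]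
      by_cases hl : l ∈ U0
      · simp [hl, this hl]
      · simp [hl]
    · obtain ⟨𝒞, -, h𝒞, hle⟩ := h3 𝒞₀ hc hd
      have h𝒞 : 𝒞 = ∅ := Finset.card_eq_zero.1 (by omega)
      subst h𝒞
      have e1 : wts it (U0 \ Ub kc k) + wts it (Ub kc k) = wts it U0 :=
        sum_sdiff (filter_subset _ _)
      have e2 : wts it (range M \ (U0 ∩ 𝒞₀.biUnion id)) + wts it (U0 ∩ 𝒞₀.biUnion id) =
          wts it (range M) := sum_sdiff (Finset.inter_subset_left.trans hU₀M)
      simp [wts] at hle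
      have : T + wts it (Ub kc k) ≤ wts it (range M \ (U0 ∩ 𝒞₀.biUnion id)) := by
        simp only [wts] at e1 e2 hTW hT ⊢
        simp only [hT]
        omega
      refine le_trans ?_ hR
      exact_mod_cast this
    · have hc : U0.card ≤ M := by simpa using card_le_card hU₀M
      have hc' := Nat.mul_le_mul_right (3 + M * 3) hc
      unfold coverTime
      omega
  · have e : Ub (fun _ => 0) 0 = U0 := by simp [hUb]
    rw [e]
    exact hC2.tick
  · intro 𝒞₀ hc _
    have e : Ub (fun _ => 0) 0 = U0 := by simp [hUb]
    exact ⟨𝒞₀, subset_rfl, by omega, by rw [e]; simp [wts]⟩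
  · have e : Ub (fun _ => 0) 0 = U0 := by simp [hUb]
    rw [e]; simp
  rintro b hb s' ag ⟨kc, h1, h2, h3, h4⟩
  set s3 := s'.setVar vb (.nat b) with hs3
  have hC3 : CoverSt k M it p T (Ub kc b) s3 := h2.setVar _
  obtain ⟨⟨x, hx, hvx, hmax⟩, ht⟩ := heaviestS_spec D md hC3 hM
  have ag4 := frame D md heaviestS s3
  set s4 := ℛ heaviestS s3 with hs4
  have hI4 : Items M it s4 := hC3.items.mono ag4
  set s5 := s4.setArr aKC b (.pt (it x).pt) with hs5
  have hvb : s4.var vb = .nat b := (ag4.var _ rfl).trans (by simp [hs3])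
  rw [show ℛ (heaviestS ;; .put aKC vb (.arr aPt vx) ;; killBallS) s3 =
      ℛ killBallS s5 by
    have e1 : ℛ (heaviestS ;; .put aKC vb (.arr aPt vx)) s3 = s5 := by
      have : ℛ (heaviestS ;; .put aKC vb (.arr aPt vx)) s3 = ℛ (.put aKC vb (.arr aPt vx)) s4 := rfl
      rw [this]
      simp [hvb, hvx, hI4.pt x hx, hs5]
    rw [← e1]; rfl]
  have hC5 : CoverSt k M it p T (Ub kc b) s5 := by
    refine ⟨⟨?_, ?_, ?_, ?_, ?_, ?_⟩, ?_, ?_, ?_, ?_, ?_, ?_⟩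
    · simpa [hs5] using hI4.num
    · simpa [hs5] using hI4.pt
    · simpa [hs5] using hI4.wt
    · simpa [hs5] using hI4.kp
    · simpa [hs5] using hI4.km
    · simpa [hs5] using hI4.kv
    · exact (ag4.var _ rfl).trans hC3.hk
    · exact (ag4.var _ rfl).trans hC3.hmin
    · exact (ag4.var _ rfl).trans hC3.hp
    · intro l hl
      have : s5.arr aLive l = s4.arr aLive l := by simp [hs5]
      rw [this, ag4.arr _ rfl]; exact hC3.live l hl
    · intro l hl
      have : s5.arr aCnt l = s4.arr aCnt l := by simp [hs5]
      rw [this, ag4.arr _ rfl]; exact hC3.cnt l hl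
    · exact (ag4.var _ rfl).trans hC3.rem
  obtain ⟨k1, k2⟩ := killBallS_spec D md (s := s5) (x := x) hC5 (by simpa [hs5] using hvx) hx
  have ag6 := frame D md killBallS s5
  set kc' := Function.update kc b x with hkc'
  have hkcl : ∀ b' < b, kc' b' = kc b' := fun b' hb' => Function.update_of_ne (by omega) _ _
  have hkcb : kc' b = x := Function.update_self _ _ _
  have hU' : Ub kc' (b + 1) = Ub kc b \ ball M it (p + 4) x := by
    ext l
    have hlM := @hU₀M l
    simp only [hUb, mem_filter, mem_sdiff, ball, mem_range] at hlM ⊢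
    constructor
    · rintro ⟨hl, hall⟩
      refine ⟨⟨hl, fun b' hb' => by rw [← hkcl b' hb']; exact hall b' (by omega)⟩, fun h => ?_⟩
      exact hall b (by omega) (by rw [hkcb]; exact h.2)
    · rintro ⟨⟨hl, hall⟩, hn⟩
      refine ⟨hl, fun b' hb' => ?_⟩
      rcases lt_or_eq hb' with h | rfl
      · rw [hkcl b' h]; exact hall b' h
      · rw [hkcb]; exact fun h => hn ⟨hlM hl, h⟩
  refine ⟨kc', fun b' hb' => ?_, ?_, fun 𝒞₀ hc hd => ?_, ?_⟩
  · rw [ag6.arr _ rfl]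
    rcases lt_or_eq hb' with h | rfl
    · rw [hkcl b' h]
      refine ⟨(h1 b' h).1, ?_⟩
      have : s5.arr aKC b' = s4.arr aKC b' := by simp [hs5, h.ne]
      rw [this, ag4.arr _ rfl]; exact (h1 b' h).2
    · rw [hkcb]; exact ⟨hx, by simp [hs5]⟩
  · rw [hU']; exact k1
  · obtain ⟨𝒞, h𝒞, h𝒞c, hle⟩ := h3 𝒞₀ hc hd
    obtain ⟨𝒞', h𝒞', hcard, hstep⟩ := greedy_step (w := fun l => (it l).wt) (U := Ub kc b)
      (B := ball M it (p + 3) x) (E := ball M it (p + 4) x) (𝒞 := 𝒞)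
      (fun l hl => by
        simp only [ball, mem_filter] at hl ⊢; exact ⟨hl.1, by omega⟩)
      (fun Q hQ ⟨a, haQ, haB⟩ l hl => by
        simp only [ball, mem_filter, mem_range] at haB ⊢
        refine ⟨(hd Q (h𝒞 hQ) l hl).1, lev_le_of_dist (g := p) 4 ?_⟩
        have q1 := dist_lt_of_lev (g := p) 3 haB.2
        have q2 := (hd Q (h𝒞 hQ) a haQ).2 l hl
        have q3 := dist_triangle (it x).pt (it a).pt (it l).pt
        have q4 := rad_pos (P := P) p
        norm_num at q1 ⊢
        linarith)
      (fun Q hQ => by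
        rcases Q.eq_empty_or_nonempty with rfl | ⟨a, ha⟩
        · simp
        · refine le_trans (Finset.sum_le_sum_of_subset ?_) (hmax a (hd Q (h𝒞 hQ) a ha).1)
          refine inter_subset_inter_left fun l hl => ?_
          simp only [ball, mem_filter, mem_range]
          refine ⟨(hd Q (h𝒞 hQ) l hl).1, lev_le_of_dist (g := p) 3 ?_⟩
          have q2 := (hd Q (h𝒞 hQ) a ha).2 l hl
          have q4 := rad_pos (P := P) p
          norm_num
          linarith)
    refine ⟨𝒞', h𝒞'.trans h𝒞, by omega, ?_⟩
    rw [hU']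
    have e1 : wts it (U0 \ (Ub kc b \ ball M it (p + 4) x)) = wts it (U0 \ Ub kc b) +
        wts it (Ub kc b ∩ ball M it (p + 4) x) := by
      rw [wts, wts, wts, ← sum_union (Finset.disjoint_left.2 fun a h1 h2 =>
        (mem_sdiff.1 h1).2 (mem_inter.1 h2).1)]
      refine sum_congr (Finset.ext fun l => ?_) fun _ _ => rfl
      have hs : l ∈ Ub kc b → l ∈ U0 := fun h => filter_subset _ _ h
      simp only [mem_sdiff, mem_union, mem_inter]
      tauto
    rw [e1]
    unfold wts at hle ⊢
    omega
  · rw [hU']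
    have e3 : s5.time = s4.time + 1 := by simp [hs5]
    have e4 : s3.time = s'.time + 1 := by simp [hs3]
    rw [add_mul b, one_mul]; omega

/-! ## The coordinator: bisection among the candidates -/

lemma exists_median {S : Finset ℕ} (hS : S.Nonempty) (f : ℕ → ℝ) : ∃ i ∈ S,
    2 * (S.filter fun j => f j < f i).card ≤ S.card ∧
      2 * (S.filter fun j => f i < f j).card ≤ S.card := by
  classical
  obtain ⟨i0, hi0, hmin⟩ := S.exists_min_image f hS
  set G := S.filter fun i => 2 * (S.filter fun j => f j < f i).card ≤ S.card with hG
  have hGne : G.Nonempty := ⟨i0, mem_filter.2 ⟨hi0, by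
    rw [filter_false_of_mem fun j hj => not_lt.2 (hmin j hj)]; simp⟩⟩
  obtain ⟨i, hi, hmax⟩ := G.exists_max_image f hGne
  obtain ⟨hiS, hi2⟩ := mem_filter.1 hi
  refine ⟨i, hiS, hi2, ?_⟩
  by_contra hlt
  push Not at hlt
  set T := S.filter fun j => f i < f j with hT
  have hTne : T.Nonempty := Finset.card_pos.1 (by omega)
  obtain ⟨i', hi', hmin'⟩ := T.exists_min_image f hTne
  obtain ⟨hiS', hii'⟩ := mem_filter.1 hi'
  have hsub : (S.filter fun j => f j < f i') ⊆ S \ T := fun j hj => by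
    obtain ⟨hjS, hj⟩ := mem_filter.1 hj
    exact mem_sdiff.2 ⟨hjS, fun h => (hmin' j h).not_gt hj⟩
  have h1 := card_le_card hsub
  have h2 := card_sdiff_add_card_eq_card (filter_subset (fun j => f i < f j) S)
  refine (hmax i' (mem_filter.2 ⟨hiS', ?_⟩)).not_gt hii'
  rw [← hT] at h2
  omega

variable {N : ℕ} {cf : ℕ → ℕ × ℕ}

/-- The value of candidate `l`. -/
def cval (cf : ℕ → ℕ × ℕ) (l : ℕ) : ℝ := V (cf l).1 (cf l).2

/-- The candidates `cf 0, …, cf (N - 1)` are in place. -/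
structure CandArr (N : ℕ) (cf : ℕ → ℕ × ℕ) (s : St P A) : Prop where
  num : s.var vcn = .nat N
  fst : ∀ l < N, s.arr aCP l = .nat (cf l).1
  snd : ∀ l < N, s.arr aCM l = .nat (cf l).2
  val : ∀ l < N, s.arr aCV l = .real (cval cf l)

lemma Cands.candArr {C : List (ℕ × ℕ)} (h : Cands C s) :
    ∃ cf, C = (List.range C.length).map cf ∧ CandArr C.length cf s := by
  refine ⟨fun l => C.getD l (0, 0), ?_, h.num, fun l hl => ?_, fun l hl => ?_, fun l hl => ?_⟩
  · refine List.ext_getElem (by simp) fun i h1 h2 => ?_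
    simp [h1]
  all_goals
    have := h.get l C[l] (by simp)
    simp [cval, hl, this]

lemma CandArr.mono (h : CandArr N cf s) {c : Stm} (ag : Agree c s s')
    (hc : (c.wv vcn || c.wa aCP || c.wa aCM || c.wa aCV) = false := by rfl) : CandArr N cf s' := by
  simp only [Bool.or_eq_false_iff] at hc
  obtain ⟨⟨⟨h0, h2⟩, h3⟩, h4⟩ := hc
  exact ⟨(ag.var _ h0).trans h.num, by rw [ag.arr _ h2]; exact h.fst, by
    rw [ag.arr _ h3]; exact h.snd, by rw [ag.arr _ h4]; exact h.val⟩

lemma CandArr.setVar (h : CandArr N cf s) {x : ℕ} (w : Word P A) (hx : x ≠ vcn := by norm_num) :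
    CandArr N cf (s.setVar x w) :=
  ⟨by simp [hx.symm, h.num], h.fst, h.snd, h.val⟩

open Classical in
/-- The candidates strictly between `lo` and `hi`. -/
def active (N : ℕ) (cf : ℕ → ℕ × ℕ) (lo hi : ℝ) : Finset ℕ :=
  (range N).filter fun l => lo < cval cf l ∧ cval cf l < hi

open Classical in
lemma rankS_spec (h : CandArr N cf s) {lo hi : ℝ} {i : ℕ} (hlo : s.var vlo = .real lo)
    (hhi : s.var vhi = .real hi) (hi' : s.var vi = .nat i) (hiN : i < N) :
    ((ℛ rankS s).var vtot = .nat (active N cf lo hi).card ∧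
      (ℛ rankS s).var va = .nat ((active N cf lo hi).filter fun j => cval cf j < cval cf i).card ∧
      (ℛ rankS s).var vu = .nat ((active N cf lo hi).filter fun j => cval cf i < cval cf j).card) ∧
      (ℛ rankS s).time ≤ s.time + 4 + N * 8 := by
  set s0 := ((s.setVar vtot (.nat 0)).setVar va (.nat 0)).setVar vu (.nat 0) with hs0
  rw [show ℛ rankS s = ℛ (.rep vj vcn _) s0 from rfl]
  have h0 : CandArr N cf s0 := ((h.setVar _).setVar _).setVar _
  have := for_rule D md (x := vj) (e := vcn) (c := compareS) (s := s0) (n := N) (fun j s' =>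
    (s'.var vtot = .nat ((range j).filter fun l => lo < cval cf l ∧ cval cf l < hi).card ∧
      s'.var va = .nat (((range j).filter fun l => lo < cval cf l ∧ cval cf l < hi).filter
        fun j => cval cf j < cval cf i).card ∧
      s'.var vu = .nat (((range j).filter fun l => lo < cval cf l ∧ cval cf l < hi).filter
        fun j => cval cf i < cval cf j).card) ∧ s'.time ≤ s.time + 4 + j * 8)
    (by simp [h0.num]) ⟨by simp [hs0], by simp [hs0]⟩ ?_
  · exact this
  rintro j hj s' ag ⟨⟨h1, h2, h3⟩, h4⟩
  have e1 : s'.var vlo = .real lo := (ag.var _ rfl).trans (by simp [hs0, hlo])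
  have e2 : s'.var vhi = .real hi := (ag.var _ rfl).trans (by simp [hs0, hhi])
  have e3 : s'.var vi = .nat i := (ag.var _ rfl).trans (by simp [hs0, hi'])
  have e4 : s'.arr aCV j = .real (cval cf j) := by rw [ag.arr _ rfl]; exact h0.val j hj
  have e5 : s'.arr aCV i = .real (cval cf i) := by rw [ag.arr _ rfl]; exact h0.val i hiN
  simp only [range_add_one, filter_insert]
  rw [compareS, Stm.run]
  by_cases c1 : cval cf j ≤ lo
  · rw [if_pos (by simpa [e1, e4] using c1), if_neg (fun h => h.1.not_ge c1)]
    exact ⟨by simp [h1, h2, h3], by simp; omega⟩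
  rw [if_neg (by simpa [e1, e4] using c1), Stm.run]
  by_cases c2 : hi ≤ cval cf j
  · rw [if_pos (by simpa [e2, e4] using c2), if_neg (fun h => h.2.not_ge c2)]
    exact ⟨by simp [h1, h2, h3], by simp; omega⟩
  rw [if_neg (by simpa [e2, e4] using c2), if_pos ⟨not_le.1 c1, not_le.1 c2⟩]
  rcases lt_trichotomy (cval cf j) (cval cf i) with c3 | c3 | c3
  · simp [e3, e4, e5, h1, h2, h3, filter_insert, c3, c3.le, c3.not_ge, c3.not_gt]
    omega
  · simp [e3, e4, e5, h1, h2, h3, filter_insert, c3]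
    omega
  · simp [e3, e4, e5, h1, h2, h3, filter_insert, c3, c3.le, c3.not_ge, c3.not_gt]
    omega

open Classical in
lemma pivotS_spec (h : CandArr N cf s) {lo hi : ℝ} (hlo : s.var vlo = .real lo)
    (hhi : s.var vhi = .real hi) :
    (∃ f, (ℛ pivotS s).var vf = .nat f ∧
      ((f < N ∧ f ∈ active N cf lo hi ∧
        2 * ((active N cf lo hi).filter fun j => cval cf j < cval cf f).card ≤
          (active N cf lo hi).card ∧
        2 * ((active N cf lo hi).filter fun j => cval cf f < cval cf j).card ≤
          (active N cf lo hi).card) ∨ f = N ∧ active N cf lo hi = ∅)) ∧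
      (ℛ pivotS s).time ≤ s.time + 2 + N * (10 + N * 8) := by
  set S := active N cf lo hi with hS
  set Good : ℕ → Prop := fun f => f < N ∧ f ∈ S ∧
    2 * (S.filter fun j => cval cf j < cval cf f).card ≤ S.card ∧
    2 * (S.filter fun j => cval cf f < cval cf j).card ≤ S.card with hGood
  set s0 := s.setVar vf (.nat N) with hs0
  set body : Stm := (.ite .real (.arr aCV vi) vlo .skip (.ite .real vhi (.arr aCV vi) .skip
    (rankS ;; .ite .nat (va +ₙ va) vtot (.ite .nat (vu +ₙ vu) vtot (.set vf vi) .skip) .skip)))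
    with hbody
  rw [show ℛ pivotS s = ℛ (.rep vi vcn body) s0 by
    simp [pivotS, h.num, hs0, hbody]]
  have h0 : CandArr N cf s0 := h.setVar _
  have := for_rule D md (x := vi) (e := vcn) (c := body) (s := s0) (n := N) (fun j s' =>
    (∃ f, s'.var vf = .nat f ∧ (Good f ∨ f = N ∧ ∀ i < j, ¬ Good i)) ∧
      s'.time ≤ s.time + 2 + j * (10 + N * 8))
    (by simp [h0.num]) ⟨⟨N, by simp [hs0], .inr ⟨rfl, by simp⟩⟩, by simp [hs0]⟩ ?_
  · obtain ⟨⟨f, h1, h2⟩, h3⟩ := this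
    refine ⟨⟨f, h1, h2.imp_right fun ⟨h4, h5⟩ => ⟨h4, ?_⟩⟩, h3⟩
    by_contra hne
    obtain ⟨i, hi1, hi2⟩ := exists_median (nonempty_iff_ne_empty.2 hne) (cval cf)
    have hiN : i < N := by
      simp only [hS, active, mem_filter, mem_range] at hi1; exact hi1.1
    exact h5 i hiN ⟨hiN, hi1, hi2⟩
  rintro i hi₁ s' ag ⟨⟨f, h1, h2⟩, h3⟩
  have e1 : s'.var vlo = .real lo := (ag.var _ rfl).trans (by simp [hs0, hlo])
  have e2 : s'.var vhi = .real hi := (ag.var _ rfl).trans (by simp [hs0, hhi])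
  have hC : CandArr N cf s' := h0.mono ag
  have e4 : s'.arr aCV i = .real (cval cf i) := hC.val i hi₁
  have hmem : i ∈ S ↔ lo < cval cf i ∧ cval cf i < hi := by
    simp [hS, active, hi₁]
  have stay : ¬ Good i → Good f ∨ f = N ∧ ∀ i' < i + 1, ¬ Good i' := fun hn =>
    h2.imp_right fun ⟨h4, h5⟩ => ⟨h4, fun i' hi' => by
      rcases lt_or_eq hi' with h | rfl
      · exact h5 i' h
      · exact hn⟩
  rw [add_mul i, one_mul, hbody, Stm.run]
  by_cases c1 : cval cf i ≤ lo
  · rw [if_pos (by simpa [e1, e4] using c1)]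
    exact ⟨⟨f, by simp [h1], stay fun h => (hmem.1 h.2.1).1.not_ge c1⟩, by simp; omega⟩
  rw [if_neg (by simpa [e1, e4] using c1), Stm.run]
  by_cases c2 : hi ≤ cval cf i
  · rw [if_pos (by simpa [e2, e4] using c2)]
    exact ⟨⟨f, by simp [h1], stay fun h => (hmem.1 h.2.1).2.not_ge c2⟩, by simp; omega⟩
  rw [if_neg (by simpa [e2, e4] using c2)]
  set s1 := (s'.setVar vi (.nat i)).tick.tick with hs1
  have hC1 : CandArr N cf s1 := by
    have := hC.setVar (x := vi) (.nat i) (by norm_num)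
    exact ⟨this.num, this.fst, this.snd, this.val⟩
  obtain ⟨⟨r1, r2, r3⟩, rt⟩ := rankS_spec D md hC1 (i := i) (lo := lo) (hi := hi)
    (by simp [hs1, e1]) (by simp [hs1, e2]) (by simp [hs1]) hi₁
  rw [← hS] at r1 r2 r3
  have ag2 := frame D md rankS s1
  have f1 : (ℛ rankS s1).var vf = .nat f := (ag2.var _ rfl).trans (by simp [hs1, h1])
  have f2 : (ℛ rankS s1).var vi = .nat i := (ag2.var _ rfl).trans (by simp [hs1])
  have ht : s1.time = s'.time + 3 := by simp [hs1]
  rw [Stm.run]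
  set s2 := ℛ rankS s1
  rw [Stm.run]
  by_cases c3 : 2 * (S.filter fun j => cval cf j < cval cf i).card ≤ S.card
  · rw [if_pos (by simp [r1, r2]; omega), Stm.run]
    by_cases c4 : 2 * (S.filter fun j => cval cf i < cval cf j).card ≤ S.card
    · rw [if_pos (by simp [r1, r3]; omega)]
      refine ⟨⟨i, by simp [f2],
        .inl ⟨hi₁, hmem.2 ⟨not_le.1 c1, not_le.1 c2⟩, c3, c4⟩⟩, by simp; omega⟩
    · rw [if_neg (by simp [r1, r3]; omega)]
      exact ⟨⟨f, by simp [f1], stay fun h => c4 h.2.2.2⟩, by simp; omega⟩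
  · rw [if_neg (by simp [r1, r2]; omega)]
    exact ⟨⟨f, by simp [f1], stay fun h => c3 h.2.2.1⟩, by simp; omega⟩

/-- The uncovered weight that `k` centers leave at level `(p, v)`. -/
def leftover (M : ℕ) (it : ℕ → Item P) (k p : ℕ) (v : ℝ) (kc : ℕ → ℕ) : ℕ :=
  wts it ((range M).filter fun l =>
        ¬ (l ∈ liveSet M it v ∧ ∃ b < k, lev (it (kc b)).pt (it l).pt ≤ p + 4))

/-- A successful candidate of value `hi` and its centers have been saved. -/
def Saved (M : ℕ) (it : ℕ → Item P) (N : ℕ) (cf : ℕ → ℕ × ℕ) (k : ℕ) (R hi : ℝ) (s : St P A) :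
    Prop :=
  ∃ l < N, ∃ kc : ℕ → ℕ, hi = cval cf l ∧ s.var vrp = .nat (cf l).1 ∧ s.var vrm = .nat (cf l).2 ∧
    (∀ b < k, kc b < M ∧ s.arr aBest b = .pt (it (kc b)).pt) ∧
    (leftover M it k (cf l).1 (cval cf l) kc : ℝ) ≤ R

structure BisectSt (M : ℕ) (it : ℕ → Item P) (N : ℕ) (cf : ℕ → ℕ × ℕ) (k t : ℕ) (ε : ℝ) (n : ℕ)
    (lo hi : ℝ) (s : St P A) : Prop where
  items : Items M it s
  cands : CandArr N cf s
  params : Params k t ε n s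
  hlo : s.var vlo = .real lo
  hhi : s.var vhi = .real hi
  low : lo < 0 ∨ ∃ l < N, lo = cval cf l ∧ ¬ Coverable M it k (cf l).1 (cval cf l) (t + quota ε t)
  high : (∀ l < N, cval cf l < hi) ∨ Saved M it N cf k (t + quota ε t) hi s

lemma BisectSt.setVar {lo hi : ℝ} (h : BisectSt M it N cf k t ε n lo hi s) {x : ℕ} (w : Word P A)
    (hx : 9 ≤ x := by norm_num) (h1 : x ≠ vM := by norm_num) (h2 : x ≠ vcn := by norm_num)
    (h3 : x ≠ vlo := by norm_num) (h4 : x ≠ vhi := by norm_num) (h5 : x ≠ vrp := by norm_num)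
    (h6 : x ≠ vrm := by norm_num) : BisectSt M it N cf k t ε n lo hi (s.setVar x w) :=
  ⟨h.items.setVar _ h1, h.cands.setVar _ h2, h.params.setVar _ hx, by simp [h3.symm, h.hlo],
    by simp [h4.symm, h.hhi], h.low, h.high.imp_right fun ⟨l, hl, kc, a, b, c, d⟩ =>
      ⟨l, hl, kc, a, by simp [h5.symm, b], by simp [h6.symm, c], d⟩⟩

lemma BisectSt.tick {lo hi : ℝ} (h : BisectSt M it N cf k t ε n lo hi s) :
    BisectSt M it N cf k t ε n lo hi s.tick :=
  ⟨h.items.tick,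
    ⟨h.cands.num, h.cands.fst, h.cands.snd, h.cands.val⟩, h.params.tick, h.hlo, h.hhi, h.low,
    h.high⟩

lemma BisectSt.mono {lo hi : ℝ} (h : BisectSt M it N cf k t ε n lo hi s) {c : Stm}
    (ag : Agree c s s') (hs : c.safe = true := by rfl)
    (hc : (c.wv vM || c.wa aPt || c.wa aWt || c.wa aKP || c.wa aKM || c.wa aKV) = false := by rfl)
    (hc1 : (c.wv vcn || c.wa aCP || c.wa aCM || c.wa aCV) = false := by rfl)
    (hc2 : (c.wv vlo || c.wv vhi || c.wv vrp || c.wv vrm || c.wa aBest) = false := by rfl) :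
    BisectSt M it N cf k t ε n lo hi s' := by
  simp only [Bool.or_eq_false_iff] at hc2
  obtain ⟨⟨⟨⟨h0, h1⟩, h2⟩, h3⟩, h4⟩ := hc2
  refine ⟨h.items.mono ag hc, h.cands.mono ag hc1, h.params.mono ag hs, (ag.var _ h0).trans h.hlo,
    (ag.var _ h1).trans h.hhi, h.low, h.high.imp_right fun ⟨l, hl, kc, a, b, c, d, e⟩ =>
      ⟨l, hl, kc, a, (ag.var _ h2).trans b, (ag.var _ h3).trans c, ?_, e⟩⟩
  rw [ag.arr _ h4]; exact d

lemma saveS_spec (hk : s.var vK = .nat k) {w : ℕ → P} (hw : ∀ b < k, s.arr aKC b = .pt (w b)) :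
    (∀ b < k, (ℛ saveS s).arr aBest b = .pt (w b)) ∧
      (ℛ saveS s).time ≤ s.time + 1 + k * 2 := by
  refine for_rule D md (x := vi) (e := vK) (n := k) (fun j s' =>
    (∀ b < j, s'.arr aBest b = .pt (w b)) ∧ s'.time ≤ s.time + 1 + j * 2)
    (by simp [hk]) ⟨by simp, by simp⟩ ?_
  rintro i hi s' ag ⟨h1, h2⟩
  refine ⟨fun b hb => ?_, by simp; omega⟩
  by_cases h : b = i
  · subst h; simp [ag.arr aKC rfl, hw b hi]
  · simp [h, h1 b (by omega)]

/-- The time bound of `probeS`. -/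
def probeTime (k M : ℕ) : ℕ := 7 + coverTime k M + k * 2

open Classical in
lemma probeS_spec {lo hi : ℝ} (h : BisectSt M it N cf k t ε n lo hi s) (hM : 0 < M)
    {f : ℕ} (hf : s.var vf = .nat f) (hfN : f < N) :
    (∃ lo' hi', BisectSt M it N cf k t ε n lo' hi' (ℛ probeS s) ∧
      (lo' = lo ∧ hi' = cval cf f ∨ lo' = cval cf f ∧ hi' = hi)) ∧
      (ℛ probeS s).time ≤ s.time + probeTime k M := by
  set s0 := (s.setVar vp (.nat (cf f).1)).setVar vv (.real (cval cf f)) with hs0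
  have h0 : BisectSt M it N cf k t ε n lo hi s0 :=
    (h.setVar _).setVar _
  set s1 := ℛ coverS s0 with hs1
  rw [show ℛ probeS s = ℛ (.ite .real (.real vrem) (.real vT +ᵣ vQ)
    (.set vhi vv ;; .set vrp vp ;; .set vrm (.arr aCM vf) ;; saveS) (.set vlo vv)) s1 by
    have e1 : ℛ (.set vp (.arr aCP vf) ;; .set vv (.arr aCV vf)) s = s0 := by
      simp [hs0, hf, h.cands.fst f hfN, h.cands.val f hfN]
    rw [hs1, ← e1]; rfl]
  obtain ⟨⟨kc, rem, a1, a2, a3, a4⟩, at'⟩ := coverS_spec D md h0.items hM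
    h0.params.hk h0.params.hmin (p := (cf f).1) (v := cval cf f) (by simp [hs0]) (by simp [hs0])
  have ag := frame D md coverS s0
  rw [← hs1] at a1 a2 at' ag
  have h1 : BisectSt M it N cf k t ε n lo hi s1 := h0.mono ag
  have e1 : s1.var vp = .nat (cf f).1 := (ag.var _ rfl).trans (by simp [hs0])
  have e2 : s1.var vv = .real (cval cf f) := (ag.var _ rfl).trans (by simp [hs0])
  have e3 : s1.var vf = .nat f := (ag.var _ rfl).trans (by simp [hs0, hf])
  have et : s0.time = s.time + 2 := by simp [hs0]
  unfold probeTime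
  rw [Stm.run]
  by_cases hc : (rem : ℝ) ≤ t + quota ε t
  · rw [if_pos (by simpa [a2, h1.params.ht, h1.params.hq] using hc)]
    set s2 := ((s1.tick.setVar vhi (.real (cval cf f))).setVar vrp (.nat (cf f).1)).setVar vrm
      (.nat (cf f).2) with hs2
    rw [show ℛ (.set vhi vv ;; .set vrp vp ;; .set vrm (.arr aCM vf) ;; saveS) s1.tick =
        ℛ saveS s2 by
      have e1 : ℛ (.set vhi vv ;; .set vrp vp ;; .set vrm (.arr aCM vf)) s1.tick = s2 := by
        simp [hs2, e1, e2, e3, h1.cands.snd f hfN]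
      rw [← e1]; rfl]
    have hk2 : s2.var vK = .nat k := by simp [hs2, h1.params.hk]
    have ag2 := frame D md saveS s2
    obtain ⟨b1, b2⟩ := saveS_spec D md (s := s2) hk2
      (w := fun b => (it (kc b)).pt) (fun b hb => by simpa [hs2] using (a1 b hb).2)
    refine ⟨⟨lo, cval cf f, ⟨?_, ?_, ?_, ?_, ?_, h1.low, .inr ⟨f, hfN, kc, rfl, ?_, ?_, ?_, ?_⟩⟩,
      .inl ⟨rfl, rfl⟩⟩, ?_⟩
    · exact (((h1.tick.items.setVar (x := vhi) _).setVar _).setVar _).mono ag2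
    · exact (((h1.tick.cands.setVar (x := vhi) _).setVar _).setVar _).mono ag2
    · exact (((h1.tick.params.setVar (x := vhi) _).setVar _).setVar _).mono ag2
    · exact (ag2.var _ rfl).trans (by simp [hs2, h1.hlo])
    · exact (ag2.var _ rfl).trans (by simp [hs2])
    · exact (ag2.var _ rfl).trans (by simp [hs2])
    · exact (ag2.var _ rfl).trans (by simp [hs2])
    · exact fun b hb => ⟨(a1 b hb).1, b1 b hb⟩
    · unfold leftover; rw [← a3]; exact hc
    · simp [hs2] at b2 ⊢; omega
  · rw [if_neg (by simpa [a2, h1.params.ht, h1.params.hq] using hc)]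
    rw [show ℛ (.set vlo vv) s1.tick = s1.tick.setVar vlo (.real (cval cf f)) by
      simp [e2]]
    have h2 := h1.tick
    refine ⟨⟨cval cf f, hi, ⟨h2.items.setVar _, h2.cands.setVar _,
      h2.params.setVar _, by simp, by simp [h1.hhi],
      .inr ⟨f, hfN, rfl, fun hcov => hc (a4 _ hcov)⟩, h1.high.imp_right
        fun ⟨l, hl, kc, a, b, c, d⟩ => ⟨l, hl, kc, a, by simp [b], by simp [c], d⟩⟩,
        .inr ⟨rfl, rfl⟩⟩, by simp; omega⟩

/-- The time bound of `bisectS`. -/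
def bisectTime (k N M : ℕ) : ℕ :=
  2 + (expo N + 1) * (4 + N * (10 + N * 8) + probeTime k M)

open Classical in
lemma bisectS_spec (hI : Items M it s) (hM : 0 < M) (hC : CandArr N cf s)
    (hp : Params k t ε n s) {hi0 : ℝ} (hhi : s.var vhi = .real hi0)
    (htop : ∀ l < N, cval cf l < hi0)
    {c : ℕ} (hc : c < N) (hcov : ∀ l < N, cval cf c ≤ cval cf l →
      Coverable M it k (cf l).1 (cval cf l) (t + quota ε t)) :
    (∃ hi ≤ cval cf c, Saved M it N cf k (t + quota ε t) hi (ℛ bisectS s)) ∧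
      Params k t ε n (ℛ bisectS s) ∧
      (ℛ bisectS s).time ≤ s.time + bisectTime k N M := by
  set s0 := s.setVar vlo (.real (-1)) with hs0
  set body : Stm := pivotS ;; .ite .nat vcn vf .skip probeS with hbody
  rw [show ℛ bisectS s =
      ℛ (.rep vr (.expo (.real vcn) +ₙ ♯1) body) s0 by
    simp [bisectS, hs0, hbody]]
  have h0 : BisectSt M it N cf k t ε n (-1) hi0 s0 :=
    ⟨hI.setVar _, hC.setVar _, hp.setVar _,
      by simp [hs0], by simp [hs0, hhi], .inl (by norm_num), .inl htop⟩
  have := for_rule D md (x := vr) (e := .expo (.real vcn) +ₙ ♯1) (c := body) (s := s0)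
    (n := expo N + 1) (fun r s' => (∃ lo hi, BisectSt M it N cf k t ε n lo hi s' ∧
      (active N cf lo hi).card * 2 ^ r ≤ N) ∧
      s'.time ≤ s.time + 2 + r * (4 + N * (10 + N * 8) + probeTime k M))
    (by simp [h0.cands.num, expo])
    ⟨⟨-1, hi0, h0.tick, ?_⟩, by simp [hs0]⟩ ?_
  · obtain ⟨⟨lo, hi, h, hcard⟩, ht⟩ := this
    have hN : N < 2 ^ (expo N + 1) := by
      have := Nat.lt_pow_succ_log_self (b := 2) (by norm_num) N
      simpa [expo] using this
    have hcard0 : active N cf lo hi = ∅ := by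
      by_contra hne
      have := Finset.card_pos.2 (nonempty_iff_ne_empty.2 hne)
      have := Nat.mul_le_mul_right (2 ^ (expo (N : ℝ) + 1)) this
      omega
    have hlo : lo < cval cf c := by
      rcases h.low with h1 | ⟨l, hl, h1, h2⟩
      · exact h1.trans_le (V_nonneg _ _)
      · by_contra h3
        exact h2 (hcov l hl (by linarith))
    have hhi : hi ≤ cval cf c := by
      by_contra h3
      have : c ∈ active N cf lo hi := by simp [active, hc, hlo, not_le.1 h3]
      simp [hcard0] at this
    refine ⟨⟨hi, hhi, ?_⟩, h.params, ht.trans_eq (by unfold bisectTime; ring)⟩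
    rcases h.high with h1 | h1
    · exact absurd (h1 c hc) (not_lt.2 hhi)
    · exact h1
  · rw [pow_zero, mul_one]
    exact (card_filter_le _ _).trans (by simp)
  rintro r hr s' - ⟨⟨lo, hi, h, hcard⟩, ht⟩
  set s1 := s'.setVar vr (.nat r) with hs1
  have h₁ : BisectSt M it N cf k t ε n lo hi s1 := h.setVar _
  obtain ⟨⟨f, hf, hcases⟩, pt⟩ := pivotS_spec D md h₁.cands h₁.hlo h₁.hhi
  have ag := frame D md pivotS s1
  have h₂ := h₁.mono ag
  have et : s1.time = s'.time + 1 := by simp [hs1]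
  rw [hbody, Stm.run, Stm.run]
  set s2 := ℛ pivotS s1
  rw [add_mul r, one_mul]
  rcases hcases with ⟨hfN, hfa, m1, m2⟩ | ⟨rfl, hemp⟩
  · rw [if_neg (by simpa [h₂.cands.num, hf] using hfN)]
    obtain ⟨⟨lo', hi', h₃, hch⟩, qt⟩ := probeS_spec D md h₂.tick hM (f := f) (by simpa using hf) hfN
    refine ⟨⟨lo', hi', h₃, ?_⟩, by simp at qt; omega⟩
    have hhalf : 2 * (active N cf lo' hi').card ≤ (active N cf lo hi).card := by
      have hfa' := hfa
      simp only [active, mem_filter, mem_range] at hfa'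
      rcases hch with ⟨rfl, rfl⟩ | ⟨rfl, rfl⟩
      · refine le_trans (Nat.mul_le_mul_left _ (card_le_card fun l hl => ?_)) m1
        simp only [active, mem_filter, mem_range] at hl ⊢
        exact ⟨⟨hl.1, hl.2.1, hl.2.2.trans hfa'.2.2⟩, hl.2.2⟩
      · refine le_trans (Nat.mul_le_mul_left _ (card_le_card fun l hl => ?_)) m2
        simp only [active, mem_filter, mem_range] at hl ⊢
        exact ⟨⟨hl.1, hfa'.2.1.trans hl.2.1, hl.2.2⟩, hl.2.1⟩
    calc (active N cf lo' hi').card * 2 ^ (r + 1)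
        = 2 * (active N cf lo' hi').card * 2 ^ r := by ring
      _ ≤ _ := Nat.mul_le_mul_right _ hhalf
      _ ≤ _ := hcard
  · rw [if_pos (by simp [h₂.cands.num, hf])]
    exact ⟨⟨lo, hi, h₂.tick, by simp [hemp]⟩, by simp; omega⟩

lemma sendCentersS_spec (hk : s.var vK = .nat k) {w : ℕ → P}
    (hw : ∀ b < k, s.arr aBest b = .pt (w b))
    {e : Expr} {q : ℕ} (he : ∀ s', Agree (sendCentersS e) s s' → (e.eval D md s').toNat = q)
    (hq : ∀ i s', e.eval D md (s'.setVar vi (.nat i)) = e.eval D md s') :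
    (∀ q', (ℛ (sendCentersS e) s).outbox q' =
      if q' = q then s.outbox q ++ (List.range k).map (fun b => .pt (w b)) else s.outbox q') ∧
      (ℛ (sendCentersS e) s).time ≤ s.time + 1 + k * 2 := by
  refine for_rule D md (x := vi) (e := vK) (s := s) (c := .send e (.arr aBest vi)) (n := k)
    (fun j s' => (∀ q', s'.outbox q' = if q' = q then s.outbox q ++ (List.range j).map
    (fun b => .pt (w b))
      else s.outbox q') ∧ s'.time ≤ s.time + 1 + j * 2)
    (by simp [hk]) ⟨fun q' => by by_cases h : q' = q <;> simp [h], by simp⟩ ?_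
  rintro i hi s' ag ⟨h1, h2⟩
  refine ⟨fun q' => ?_, by simp; omega⟩
  have hb : s'.arr aBest i = .pt (w i) := by rw [ag.arr _ rfl]; exact hw i hi
  by_cases h : q' = q
  · simp [hq, he s' ag, h, h1, hb, List.range_succ]
  · simp [hq, he s' ag, h, h1]

lemma announceS_spec (hp : Params k t ε n s) {w : ℕ → P} {p m : ℕ}
    (hw : ∀ b < k, s.arr aBest b = .pt (w b)) (hrp : s.var vrp = .nat p) (hrm : s.var vrm = .nat m)
    (hout : ∀ q, s.outbox q = []) :
    ((ℛ announceS s).outbox 0 = (List.range k).map (fun b => .pt (w b)) ∧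
      ∀ i < n, (ℛ announceS s).outbox (i + 1) =
        (List.range k).map (fun b => .pt (w b)) ++ [.nat p, .nat m]) ∧
      (ℛ announceS s).time ≤ s.time + 2 + k * 2 + n * (4 + k * 2) := by
  obtain ⟨a1, a2⟩ := sendCentersS_spec D md hp.hk hw (e := ♯0) (q := 0)
    (fun _ _ => rfl) (fun _ _ => rfl)
  have ag1 := frame D md (sendCentersS ♯0) s
  set s1 := ℛ (sendCentersS ♯0) s with hs1
  rw [show ℛ announceS s = ℛ (.rep vj vN _) s1 from rfl]
  have hp1 : Params k t ε n s1 := hp.mono ag1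
  have := for_rule D md (x := vj) (e := vN) (c := sendCentersS (vj +ₙ ♯1) ;;
    .send (vj +ₙ ♯1) vrp ;; .send (vj +ₙ ♯1) vrm) (s := s1) (n := n) (fun j s' =>
    (s'.outbox 0 = (List.range k).map (fun b => .pt (w b)) ∧
      ∀ i, s'.outbox (i + 1) = if i < j then
        (List.range k).map (fun b => .pt (w b)) ++ [.nat p, .nat m] else []) ∧
    s'.time ≤ s.time + 2 + k * 2 + j * (4 + k * 2))
    (by simp [hp1.hn])
    ⟨⟨by simp [a1, hout], fun i => by simp [a1, hout]⟩, by simp; omega⟩ ?_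
  · exact ⟨⟨this.1.1, fun i hi => by rw [this.1.2, if_pos hi]⟩, this.2⟩
  rintro i hi s' ag ⟨⟨h1, h2⟩, h3⟩
  set s2 := s'.setVar vj (.nat i) with hs2
  have ek : s2.var vK = .nat k := by
    simp only [hs2, St.setVar_var]; exact (ag.var _ rfl).trans hp1.hk
  have eb : ∀ b < k, s2.arr aBest b = .pt (w b) := fun b hb => by
    show s'.arr aBest b = _
    rw [ag.arr _ rfl, ag1.arr _ rfl]; exact hw b hb
  obtain ⟨b1, b2⟩ := sendCentersS_spec D md (s := s2) ek eb (e := vj +ₙ ♯1)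
    (q := i + 1) (fun s3 ag3 => by
      have : s3.var vj = .nat i := (ag3.var _ rfl).trans (by simp [hs2])
      simp [this]) (fun l s3 => by simp)
  have ag3 := frame D md (sendCentersS (vj +ₙ ♯1)) s2
  have f1 : (ℛ (sendCentersS (vj +ₙ ♯1)) s2).var vj = .nat i :=
    (ag3.var _ rfl).trans (by simp [hs2])
  have f2 : (ℛ (sendCentersS (vj +ₙ ♯1)) s2).var vrp = .nat p :=
    (ag3.var _ rfl).trans (by
      simp only [hs2, St.setVar_var]; exact (ag.var _ rfl).trans ((ag1.var _ rfl).trans hrp))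
  have f3 : (ℛ (sendCentersS (vj +ₙ ♯1)) s2).var vrm = .nat m :=
    (ag3.var _ rfl).trans (by
      simp only [hs2, St.setVar_var]; exact (ag.var _ rfl).trans ((ag1.var _ rfl).trans hrm))
  rw [Stm.run]
  set s3 := ℛ (sendCentersS (vj +ₙ ♯1)) s2
  have ht : s2.time = s'.time + 1 := by simp [hs2]
  refine ⟨⟨?_, fun l => ?_⟩, ?_⟩
  · simp [f1, b1, hs2, h1]
  · by_cases hl : l = i
    · subst hl
      simp [f1, f2, f3, b1, hs2, h2]
    · have : l < i + 1 ↔ l < i := by omega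
      simp [f1, b1, hs2, h2, hl, this]
  · rw [add_mul i, one_mul]
    simp; omega

/-- The candidates, for the items `it 0, …, it (M - 1)`, the radii `δ l` and the least level
`c₀`. -/
def IsCand (M : ℕ) (it : ℕ → Item P) (δ : ℕ → ℝ) (c₀ c : ℕ × ℕ) : Prop :=
  (c = c₀ ∨ (∃ l < M, c = ((it l).kp, (it l).km)) ∨ ∃ l < M, c ∈ radCands P (δ l)) ∧
    V c₀.1 c₀.2 ≤ V c.1 c.2

/-- Some candidate of value at most `v` is such that all candidates not below it are
coverable. -/
def CoverUpTo (M : ℕ) (it : ℕ → Item P) (k : ℕ) (R : ℝ) (c₀ : ℕ × ℕ) (v : ℝ) : Prop :=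
  ∀ z δ, Traversal M (fun l => (it l).pt) M z δ → ∃ c, IsCand M it δ c₀ c ∧ V c.1 c.2 ≤ v ∧
    ∀ c', IsCand M it δ c₀ c' → V c.1 c.2 ≤ V c'.1 c'.2 → Coverable M it k c'.1 (V c'.1 c'.2) R

/-- The time bound of `coord₂S`. -/
def coordTime₂ (k n M : ℕ) : ℕ :=
  20 + n * 8 + M * 22 + M * (62 + M * 7) + bisectTime k (1 + 7 * M) M + k * 2 + n * (4 + k * 2)

lemma bisectTime_mono {M N N' : ℕ} (h : N ≤ N') : bisectTime k N M ≤ bisectTime k N' M := by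
  unfold bisectTime
  have := expo_mono (Nat.cast_le (α := ℝ).2 h)
  gcongr

lemma coord₂S_spec (hp : Params k t ε n s) {c₀ : ℕ × ℕ} (hb : s.var vbest = .real (V c₀.1 c₀.2))
    (hbp : s.var vbp = .nat c₀.1) (hbm : s.var vbm = .nat c₀.2) (r : ℕ → Report A)
    (hin : ∀ i < n, s.inbox (i + 1) = (r i).words k md) (hout : ∀ q, s.outbox q = [])
    {L : List (Item P)} (hL : L = (List.range n).flatMap fun i => (r i).items md)
    (hM : 0 < L.length) {v : ℝ}
    (hcov : ∀ it, L = (List.range L.length).map it → CoverUpTo L.length it k (t + quota ε t) c₀ v) :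
    (∃ (it : ℕ → Item P) (δ : ℕ → ℝ) (c : ℕ × ℕ) (kc : ℕ → ℕ),
      L = (List.range L.length).map it ∧ (∀ l < L.length, δ l ≤ dmax P)
          ∧ IsCand L.length it δ c₀ c ∧ V c.1 c.2 ≤ v ∧
      (∀ b < k, kc b < L.length) ∧
      (leftover L.length it k c.1 (V c.1 c.2) kc : ℝ) ≤ t + quota ε t ∧
      (ℛ coord₂S s).outbox 0 = (List.range k).map (fun b => .pt (it (kc b)).pt) ∧
      ∀ i < n, (ℛ coord₂S s).outbox (i + 1) =
        (List.range k).map (fun b => .pt (it (kc b)).pt) ++ [.nat c.1, .nat c.2]) ∧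
      (ℛ coord₂S s).time ≤ s.time + coordTime₂ k n L.length := by
  obtain ⟨h1, t1⟩ := readItemsS_spec D _ hp r hin
  rw [← hL] at h1 t1
  have ag1 := frame D md readItemsS s
  rw [show ℛ coord₂S s = ℛ announceS (ℛ bisectS (ℛ candidatesS (ℛ readItemsS s))) from rfl]
  have hp1 := hp.mono ag1
  have ho1 := ag1.outbox rfl
  have hb1 := (ag1.var vbest rfl).trans hb
  have hbp1 := (ag1.var vbp rfl).trans hbp
  have hbm1 := (ag1.var vbm rfl).trans hbm
  set s1 := ℛ readItemsS s
  obtain ⟨it, hit, hI1⟩ := h1.items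
  obtain ⟨⟨C, z, δ, hT, hC, hmem, hlen⟩, t2⟩ := candidatesS_spec D md hI1 hM hb1 hbp1 hbm1 hp1.hmin
  have ag2 := frame D md candidatesS s1
  have hp2 := hp1.mono ag2
  have ho2 := ag2.outbox rfl
  have hI2 := hI1.mono ag2
  set s2 := ℛ candidatesS s1
  obtain ⟨cf, hCcf, hCA⟩ := hC.candArr
  obtain ⟨hi0, e1, -, htop⟩ := hC.top
  obtain ⟨c, hc, hcv, hcc⟩ := hcov it hit z δ hT
  have hmemC : ∀ c, c ∈ C ↔ IsCand L.length it δ c₀ c := hmem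
  have hget : ∀ l < C.length, cf l ∈ C := fun l hl => by
    rw [hCcf]; exact List.mem_map_of_mem (by simpa using hl)
  obtain ⟨l0, hl0, rfl⟩ : ∃ l < C.length, cf l = c := by
    have := (hmemC c).2 hc
    rw [hCcf] at this
    simpa using this
  obtain ⟨⟨hi, hhi, l, hl, kc, h4, h5, h6, h7, h8⟩, hp3, t3⟩ := bisectS_spec D md hI2 hM hCA hp2 e1
    (fun l hl => by have := htop _ (hget l hl); unfold cval; linarith) hl0
    (fun l hl h => hcc _ ((hmemC _).1 (hget l hl)) h)
  have ag3 := frame D md bisectS s2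
  have ho3 := ag3.outbox rfl
  set s3 := ℛ bisectS s2
  obtain ⟨⟨h9, h10⟩, t4⟩ := announceS_spec D md hp3 (fun b hb => (h7 b hb).2) h5 h6
    (fun q => by rw [ho3, ho2, ho1, hout])
  refine ⟨⟨it, δ, cf l, kc, hit,
    fun l hl => (hT.sep l hl l le_rfl).trans (dist_le_dmax _ _), (hmemC _).1 (hget l hl), ?_,
    fun b hb => (h7 b hb).1, h8, h9, h10⟩,
    ?_⟩
  · rw [h4] at hhi; exact le_trans hhi hcv
  · have := bisectTime_mono (k := k) (M := L.length) hlen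
    unfold coordTime₂
    omega

/-! ## Analysis: the levels that the sites require -/

lemma exists_bud {U : ℕ} (hU : U ≤ 2 * t) : ∃ b < numB t, U ≤ bud b ∧ bud b ≤ 2 * U := by
  rcases Nat.eq_zero_or_pos U with rfl | hpos
  · exact ⟨0, by unfold numB; omega, by simp, by simp [bud]⟩
  refine ⟨Nat.log 2 U + 2, ?_, ?_, ?_⟩
  · have h1 : 2 ^ Nat.log 2 U ≤ U := Nat.pow_log_le_self 2 hpos.ne'
    have h2 : (1 + t : ℝ) < 2 ^ (expo (1 + t) + 1) := lt_pow_expo (by positivity)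
    have h3 : 1 + t < 2 ^ (expo (1 + t) + 1) := by exact_mod_cast h2
    have h4 : 2 ^ Nat.log 2 U < 2 ^ (expo (1 + t) + 2) := by
      rw [pow_succ _ (expo (1 + (t : ℝ)) + 1)]; omega
    have := (Nat.pow_lt_pow_iff_right (by norm_num : 1 < 2)).1 h4
    unfold numB; omega
  · have := Nat.lt_pow_succ_log_self (b := 2) (by norm_num) U
    simp only [bud, Nat.add_eq_zero_iff, OfNat.ofNat_ne_zero, and_false, if_false]
    exact this.le
  · have h1 : 2 ^ Nat.log 2 U ≤ U := Nat.pow_log_le_self 2 hpos.ne'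
    simp only [bud, Nat.add_eq_zero_iff, OfNat.ofNat_ne_zero, and_false, if_false]
    rw [show Nat.log 2 U + 2 - 1 = Nat.log 2 U + 1 by omega, pow_succ]; omega

lemma netList_lt {g cap i j : ℕ} (h : j ∈ netList mp g cap i) : j < i := by
  induction i with
  | zero => simp [netList] at h
  | succ i ih =>
    rw [netList] at h
    split_ifs at h with hc
    · rcases List.mem_append.1 h with h | h
      · exact (ih h).trans (Nat.lt_succ_self _)
      · simp at h; omega
    · exact (ih h).trans (Nat.lt_succ_self _)

lemma netList_pairwise (mp : ℕ → P) (g cap i : ℕ) :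
    (netList mp g cap i).Pairwise fun a b => a ≠ b ∧ g + 1 < lev (mp a) (mp b) := by
  induction i with
  | zero => simp [netList]
  | succ i ih =>
    rw [netList]
    split_ifs with hc
    · refine List.pairwise_append.2 ⟨ih, by simp, fun a ha b hb => ?_⟩
      obtain rfl : b = i := by simpa using hb
      exact ⟨(netList_lt ha).ne, by rw [lev_comm]; exact hc.1 a ha⟩
    · exact ih

open Classical in
/-- The net at level `p` is no larger than a cover with balls of radius `rad P p`. -/
lemma netList_length_le {p cap : ℕ} {K : Finset P} {O : ℕ → Prop}
    [DecidablePred O] (h : ∀ j < n, ¬ O j → ∃ y ∈ K, dist (mp j) y ≤ rad P p) :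
    (netList mp p cap n).length ≤ K.card + ((range n).filter O).card := by
  have hnd : (netList mp p cap n).Nodup := (netList_pairwise mp p cap n).imp fun h => h.1
  set S := (netList mp p cap n).toFinset with hS
  have hSl : S.card = (netList mp p cap n).length := List.toFinset_card_of_nodup hnd
  have hmem : ∀ j ∈ S, j < n := fun j hj => netList_lt (List.mem_toFinset.1 hj)
  have hsep : ∀ a ∈ S, ∀ b ∈ S, a ≠ b → 3 * rad P p ≤ dist (mp a) (mp b) := by
    intro a ha b hb hab
    have : Std.Symm fun a b => a = b ∨ 3 * rad P p ≤ dist (mp a) (mp b) :=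
      ⟨fun a b h => h.imp Eq.symm fun h => by rwa [dist_comm]⟩
    have := ((netList_pairwise mp p cap n).imp (S := fun a b => a = b ∨
      3 * rad P p ≤ dist (mp a) (mp b)) fun {a b} h => .inr <| by
        by_contra hlt
        have := lev_le_of_dist (g := p) 1 (x := mp a) (y := mp b) (by norm_num; linarith)
        omega).forall_of_forall (fun _ _ => .inl rfl) (List.mem_toFinset.1 ha)
        (List.mem_toFinset.1 hb)
    exact this.resolve_left hab
  rw [← hSl, ← card_filter_add_card_filter_not (s := S) (fun j => ¬ O j)]
  refine Nat.add_le_add ?_ (card_le_card fun j hj => ?_)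
  · choose! y hyK hy using h
    refine card_le_card_of_injOn y (fun j hj => ?_) fun a ha b hb hab => ?_
    · have hj := mem_filter.1 hj
      exact hyK j (hmem j hj.1) hj.2
    · have ha := mem_filter.1 (Finset.mem_coe.1 ha)
      have hb := mem_filter.1 (Finset.mem_coe.1 hb)
      by_contra hne
      have h1 := hsep a ha.1 b hb.1 hne
      have h2 := hy a (hmem a ha.1) ha.2
      have h3 := hy b (hmem b hb.1) hb.2
      rw [hab] at h2
      have h4 := dist_triangle_right (mp a) (mp b) (y b)
      have h5 := rad_pos (P := P) p
      linarith
  · have hj := mem_filter.1 hj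
    exact mem_filter.2 ⟨mem_range.2 (hmem j hj.1), not_not.1 hj.2⟩

lemma TopKey.keyV_le {r : ℕ} {z v : ℝ} (h : TopKey n x r z) (hv : 0 ≤ v)
    (hx : ∀ j < n, ValidKey (x j)) {S : Finset ℕ} (hS : ∀ j < n, v < keyV (x j) → j ∈ S)
    (hr : S.card ≤ r) : ValidKey z ∧ keyV z ≤ v := by
  have hz : ValidKey z := by
    rcases h.1 with rfl | ⟨j, hj, rfl⟩
    · exact .inl rfl
    · exact hx j hj
  refine ⟨hz, ?_⟩
  by_contra hlt
  push Not at hlt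
  rcases h.2.2 with rfl | hcard
  · rw [keyV_zero] at hlt; linarith
  have : ((range n).filter fun j => z ≤ x j) ⊆ S := fun j hj => by
    obtain ⟨hj, hle⟩ := mem_filter.1 hj
    have hj := mem_range.1 hj
    exact hS j hj (hlt.trans_le (keyV_mono hz (hx j hj) hle))
  have := card_le_card this
  omega

lemma Profile.valid {b g : ℕ} {y : ℝ} (h : Profile n k t mp x b y g)
    (hx : ∀ j < n, ValidKey (x j)) : ValidKey y ∧ g ≤ keyP y := by
  obtain ⟨z, hz, rfl⟩ := h.top
  have hzv : ValidKey z := by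
    rcases hz.1 with rfl | ⟨j, hj, rfl⟩
    · exact .inl rfl
    · exact hx j hj
  rcases Nat.eq_zero_or_pos g with rfl | hg
  · simp only [if_true]
    exact ⟨by rwa [max_eq_left hzv.nonneg], Nat.zero_le _⟩
  · rw [if_neg hg.ne']
    constructor
    · rcases max_choice z (2 ^ g) with h | h <;> rw [h]
      · exact hzv
      · exact .inr (.inr ⟨g, hg, rfl⟩)
    · calc g = keyP (2 ^ g) := (keyP_pow hg).symm
        _ ≤ _ := expo_mono (by gcongr; exact le_max_right _ _)

open Classical in
lemma Profile.keyV_le {b g : ℕ} {y : ℝ}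
    (h : Profile n k t mp x b y g) (hx : ∀ j < n, ValidKey (x j)) {p m : ℕ} {K : Finset P}
    {O : ℕ → Prop} [DecidablePred O] (hK : K.card ≤ k)
        (hcov : ∀ j < n, ¬ O j → ∃ y ∈ K, dist (mp j) y ≤ rad P p)
    (hb : ((range n).filter O).card +
      ((range n).filter fun j => ¬ O j ∧ V p m < keyV (x j)).card ≤ bud b) :
    keyV y ≤ V p m := by
  obtain ⟨z, hz, rfl⟩ := h.top
  obtain ⟨hz1, hz2⟩ := hz.keyV_le (V_nonneg p m) hx
    (S := ((range n).filter O) ∪ (range n).filter fun j => ¬ O j ∧ V p m < keyV (x j))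
    (fun j hj hlt => by
      simp only [mem_union, mem_filter, mem_range]; tauto)
    ((card_union_le _ _).trans hb)
  have hg : g ≤ p := by
    by_contra hlt
    have h1 := h.min p (not_le.1 hlt)
    have h2 := netList_length_le (cap := k + (4 * t + 5)) hcov
    omega
  rcases Nat.eq_zero_or_pos g with rfl | hg'
  · simpa [hz1.nonneg] using hz2
  · rw [if_neg hg'.ne']
    rcases max_choice z (2 ^ g) with h | h <;> rw [h]
    · exact hz2
    · rw [keyV_pow hg']
      exact le_trans (by exact_mod_cast hg) (le_V p m)

/-! ## Analysis: the items represent the nodes -/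

variable {X : Input P} {med : X.Node → P} {kx : X.Node → ℝ} {M : ℕ} {q : ℝ} {it : ℕ → Item P}
  {item : X.Node → Item P} {c₀ : ℕ × ℕ}

open Classical in
/-- Every node is represented by an item nearby, with the right total weights. -/
structure ItemMap (X : Input P) (med : X.Node → P) (kx : X.Node → ℝ) (M : ℕ) (it : ℕ → Item P)
    (item : X.Node → Item P) (c₀ : ℕ × ℕ) : Prop where
  valid₀ : ValidPair c₀.1 c₀.2
  weight : ∀ Q : Item P → Prop, wts it ((range M).filter fun l => Q (it l)) =
    (univ.filter fun a => Q (item a)).card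
  near : ∀ a, dist (med a) (item a).pt < 4 * rad P c₀.1
  val : ∀ a, ((item a).val = 0 ∧ keyV (kx a) ≤ V c₀.1 c₀.2) ∨
    ((item a).kp = keyP (kx a) ∧ (item a).km = keyM (kx a))
  mem : ∀ a, ∃ l < M, it l = item a
  valid : ∀ l < M, ValidPair (it l).kp (it l).km

lemma ItemMap.weight_eq (h : ItemMap X med kx M it item c₀) (Q : Item P → Prop)
    [DecidablePred fun l => Q (it l)] [DecidablePred fun a => Q (item a)] :
    wts it ((range M).filter fun l => Q (it l)) =
      (univ.filter fun a => Q (item a)).card := by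
  convert h.weight Q

lemma ItemMap.isCand_valid (h : ItemMap X med kx M it item c₀) {δ : ℕ → ℝ} {c : ℕ × ℕ}
    (hc : IsCand M it δ c₀ c) : ValidPair c.1 c.2 := by
  rcases hc.1 with rfl | ⟨l, hl, rfl⟩ | ⟨l, hl, h⟩
  · exact h.valid₀
  · exact h.valid l hl
  · obtain ⟨i, -, rfl⟩ := List.mem_map.1 h
    exact .inl rfl

open Classical in
lemma ItemMap.coverable (h : ItemMap X med kx M it item c₀) {p m : ℕ} {K : Finset P}
    {O : Finset X.Node} (hK : K.card ≤ k) (hO : O.card ≤ t)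
    (hcov : ∀ a, a ∉ O → ∃ y ∈ K, dist (med a) y ≤ rad P p)
    (hq : (((univ \ O).filter fun a => V p m < keyV (kx a)).card : ℝ) ≤ q) {p' : ℕ} {v : ℝ}
    (hdiam : ∀ l < M, ∀ l' < M, dist (it l).pt (it l').pt < 2 * (rad P p + 4 * rad P c₀.1) →
      dist (it l).pt (it l').pt < 10 * rad P p')
    (hlive : ∀ a, a ∉ O → keyV (kx a) ≤ V p m → (item a).val ≤ v) :
    Coverable M it k p' v (t + q) := by
  set Q : P → Finset ℕ := fun y => (range M).filter fun l => ∃ a, a ∉ O ∧ item a = it l ∧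
    dist (med a) y ≤ rad P p with hQ
  refine ⟨K.image Q, card_image_le.trans hK, ?_, ?_⟩
  · simp only [mem_image]
    rintro _ ⟨y, -, rfl⟩ l hl
    obtain ⟨hlM, a, ha, hal, hay⟩ := mem_filter.1 hl
    have hlM := mem_range.1 hlM
    refine ⟨hlM, fun l' hl' => ?_⟩
    obtain ⟨hlM', a', ha', hal', hay'⟩ := mem_filter.1 hl'
    refine hdiam l hlM l' (mem_range.1 hlM') ?_
    have h1 := h.near a
    have h2 := h.near a'
    rw [hal] at h1
    rw [hal'] at h2
    have h3 := dist_triangle4 (it l).pt (med a) (med a') (it l').pt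
    have h4 := dist_triangle_right (med a) (med a') y
    rw [dist_comm (it l).pt (med a)] at h3
    linarith
  · have hset : range M \ (liveSet M it v ∩ (K.image Q).biUnion id) =
        (range M).filter fun l => ¬ ((it l).val ≤ v ∧ ∃ y ∈ K, ∃ a, a ∉ O ∧ item a = it l ∧
          dist (med a) y ≤ rad P p) := by
      ext l
      simp only [mem_sdiff, mem_inter, liveSet, mem_filter, mem_range,
        mem_biUnion, mem_image, hQ, id, exists_exists_and_eq_and]
      constructor
      · rintro ⟨h1, h2⟩
        exact ⟨h1, fun ⟨h3, y, hy, h4⟩ => h2 ⟨⟨h1, h3⟩, y, hy, h1, h4⟩⟩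
      · rintro ⟨h1, h2⟩
        exact ⟨h1, fun ⟨h3, y, hy, h4⟩ => h2 ⟨h3.2, y, hy, h4.2⟩⟩
    rw [hset, h.weight_eq fun x => ¬ (x.val ≤ v ∧ ∃ y ∈ K, ∃ a, a ∉ O ∧ item a = x ∧
          dist (med a) y ≤ rad P p)]
    have hsub : (univ.filter fun a => ¬ ((item a).val ≤ v ∧ ∃ y ∈ K, ∃ a', a' ∉ O ∧
        item a' = item a ∧ dist (med a') y ≤ rad P p)) ⊆
        O ∪ (univ \ O).filter fun a => V p m < keyV (kx a) := fun a ha => by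
      have ha := (mem_filter.1 ha).2
      by_contra hn
      simp only [mem_union, mem_filter, mem_sdiff, mem_univ, true_and,
        not_or, not_and, not_lt] at hn
      obtain ⟨y, hy, hd⟩ := hcov a hn.1
      exact ha ⟨hlive a hn.1 (hn.2 hn.1), y, hy, a, hn.1, rfl, hd⟩
    have h1 := (card_le_card hsub).trans (card_union_le _ _)
    have h2 : ((univ.filter fun a => ¬ ((item a).val ≤ v ∧ ∃ y ∈ K, ∃ a', a' ∉ O ∧
        item a' = item a ∧ dist (med a') y ≤ rad P p)).card : ℝ) ≤
        O.card + ((univ \ O).filter fun a => V p m < keyV (kx a)).card := by exact_mod_cast h1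
    have h3 : (O.card : ℝ) ≤ t := by exact_mod_cast hO
    linarith

/-- The radii of the traversal leave a gap below the largest candidate that is not too large. -/
lemma radius_gap {p p' : ℕ} (hpp : p' < p) {y : ℝ} (hy : 0 ≤ y)
    (h : ∀ c ∈ radCands P y, c.1 ≤ p' ∨ p < c.1) : y < 2 * rad P p' ∨ 63 * rad P p ≤ y := by
  have hd := dmin_pos (P := P)
  set e := expo (1 + 64 * y / dmin P) with he
  have hnn : 0 ≤ 64 * y / dmin P := by positivity
  have hc : ∀ i < 6, e - i ≤ p' ∨ p < e - i := fun i hi =>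
    h (e - i, 0) (List.mem_map.2 ⟨i, List.mem_range.2 hi, rfl⟩)
  have hcase : e ≤ p' ∨ p + 6 ≤ e := by
    rcases hc 0 (by norm_num) with h0 | h0
    · exact .inl (by omega)
    · by_contra hn
      push Not at hn
      rcases hc (e - p) (by omega) with h1 | h1 <;> omega
  rcases hcase with h1 | h1
  · left
    have h2 := (expo_le_iff (x := 1 + 64 * y / dmin P) (by positivity) p').1 h1
    have h3 : 64 * y / dmin P < 2 ^ (p' + 1) := by linarith
    rw [div_lt_iff₀ hd] at h3
    unfold rad
    rw [pow_succ] at h3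
    linarith
  · right
    have h2 := (le_expo_iff (x := 1 + 64 * y / dmin P) (by linarith) (p + 6)).1 h1
    have h3 : (1 : ℝ) ≤ 2 ^ p := one_le_pow₀ (by norm_num)
    have h4 : 63 * 2 ^ p ≤ 64 * y / dmin P := by
      rw [pow_add] at h2; norm_num at h2; linarith
    rw [le_div_iff₀ hd] at h4
    unfold rad
    linarith

lemma Traversal.nonneg {M j : ℕ} {f : ℕ → P} {z : ℕ → ℕ} {δ : ℕ → ℝ} (h : Traversal M f j z δ)
    {l : ℕ} (hl : l < j) (hM : 0 < M) : 0 ≤ δ l := by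
  obtain ⟨l', -, h⟩ := h.cover l hl 0 hM
  exact dist_nonneg.trans h

open Classical in
lemma ItemMap.coverUpTo (h : ItemMap X med kx M it item c₀) {p m : ℕ}
    (hg : Good X med kx k t q p m) (h0 : V c₀.1 c₀.2 ≤ V p m) :
    CoverUpTo M it k (t + q) c₀ (V p m) := by
  obtain ⟨hv, K, O, hK, hO, hcov, hq⟩ := hg
  intro z δ hT
  set S : Finset (ℕ × ℕ) := ({c₀} ∪ (range M).image fun l => ((it l).kp, (it l).km)) ∪
    (range M).biUnion fun l => (radCands P (δ l)).toFinset with hS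
  have hfin : ∀ c, IsCand M it δ c₀ c → c ∈ S := fun c hc => by
    simp only [hS, mem_union, mem_singleton, mem_image, mem_biUnion, mem_range, List.mem_toFinset]
    rcases hc.1 with h | ⟨l, hl, h⟩ | h
    · exact .inl (.inl h)
    · exact .inl (.inr ⟨l, hl, h.symm⟩)
    · exact .inr h
  have hc0 : IsCand M it δ c₀ c₀ := ⟨.inl rfl, le_rfl⟩
  obtain ⟨c, hcS, hmax⟩ := (S.filter fun c => IsCand M it δ c₀ c ∧ V c.1 c.2 ≤ V p m).exists_max_image
    (fun c => V c.1 c.2) ⟨c₀, mem_filter.2 ⟨hfin _ hc0, hc0, h0⟩⟩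
  obtain ⟨-, hc, hcv⟩ := mem_filter.1 hcS
  have hmax' : ∀ c', IsCand M it δ c₀ c' → V c'.1 c'.2 ≤ V p m → V c'.1 c'.2 ≤ V c.1 c.2 :=
    fun c' h1 h2 => hmax c' (mem_filter.2 ⟨hfin _ h1, h1, h2⟩)
  refine ⟨c, hc, hcv, fun c' hc' hle => ?_⟩
  have hv' := h.isCand_valid hc'
  have hp0 : c₀.1 ≤ c'.1 := hv'.le_of_V_le hc'.2
  have hr0 := rad_mono (P := P) hp0
  have hvalid : ∀ a, (item a).val = 0 ∨ (item a).val = keyV (kx a) := fun a => by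
    rcases h.val a with h1 | ⟨h1, h2⟩
    · exact .inl h1.1
    · exact .inr (by unfold Item.val keyV; rw [h1, h2])
  by_cases hbig : V p m ≤ V c'.1 c'.2
  · have hr := rad_mono (P := P) (hv'.le_of_V_le hbig)
    refine h.coverable hK hO hcov hq (fun l _ l' _ hlt => by linarith) fun a _ hav => ?_
    rcases hvalid a with h1 | h1 <;> rw [h1]
    · exact V_nonneg _ _
    · linarith
  push Not at hbig
  have hlive : ∀ a, a ∉ O → keyV (kx a) ≤ V p m → (item a).val ≤ V c'.1 c'.2 := fun a _ hav => by
    by_cases hlow : (item a).val ≤ V c₀.1 c₀.2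
    · exact hlow.trans hc'.2
    push Not at hlow
    obtain ⟨l, hl, hla⟩ := h.mem a
    have h1 : (item a).val ≤ V p m := by
      rcases hvalid a with h1 | h1 <;> rw [h1]
      · exact V_nonneg _ _
      · exact hav
    refine (hmax' ((item a).kp, (item a).km) ⟨.inr (.inl ⟨l, hl, by rw [hla]⟩), hlow.le⟩
        h1).trans hle
  have hpp : c'.1 ≤ p := hv.le_of_V_le hbig.le
  rcases hpp.eq_or_lt with heq | hlt
  · refine h.coverable hK hO hcov hq (fun l _ l' _ hlt => ?_) hlive
    rw [heq] at hr0 ⊢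
    linarith
  have hm : m = 0 := by
    rcases hv with h1 | ⟨h1, -⟩
    · exact h1
    · omega
  have hVp : V p m = p := by simp [V, hm]
  refine h.coverable hK hO hcov hq (fun l hl l' hl' hd => ?_) hlive
  have hM : 0 < M := by omega
  have hrad : 2 * rad P c'.1 ≤ rad P p := by
    have : rad P (c'.1 + 1) ≤ rad P p := rad_mono hlt
    have h2 : rad P (c'.1 + 1) = 2 * rad P c'.1 := by unfold rad; ring
    linarith
  have hpos := rad_pos (P := P) c'.1
  have := hT.gap (lo := 2 * rad P c'.1) (hi := 63 * rad P p) (fun i hi => radius_gap hlt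
    (hT.nonneg hi hM) fun d hd => by
      by_contra hn
      push Not at hn
      have hd2 : d.2 = 0 := by
        obtain ⟨_, -, rfl⟩ := List.mem_map.1 hd
        rfl
      have hVd : V d.1 d.2 = d.1 := by simp [V, hd2]
      have h1 : V c'.1 c'.2 < d.1 := hv'.V_lt.trans_le (by exact_mod_cast hn.1)
      have h2 : (d.1 : ℝ) ≤ p := by exact_mod_cast hn.2
      have h3 := hmax' d ⟨.inr (.inr ⟨i, hi, hd⟩), by rw [hVd]; linarith [hc'.2]⟩
        (by rw [hVd, hVp]; exact h2)
      rw [hVd] at h3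
      linarith) hl hl' (by positivity) (by linarith)
  linarith

open Classical in
/-- The uncovered weight bounds the number of nodes that cannot be labelled. -/
lemma ItemMap.card_unlabelled_le (h : ItemMap X med kx M it item c₀) {δ : ℕ → ℝ} {c : ℕ × ℕ}
    (hc : IsCand M it δ c₀ c) (kc : ℕ → ℕ) :
    (univ.filter fun a => ¬ (keyV (kx a) ≤ V c.1 c.2 ∧
      ∃ b < k, lev (med a) (it (kc b)).pt ≤ c.1 + 5)).card ≤ leftover M it k c.1 (V c.1 c.2)
          kc := by
  have hset : ((range M).filter fun l => ¬ (l ∈ liveSet M it (V c.1 c.2) ∧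
      ∃ b < k, lev (it (kc b)).pt (it l).pt ≤ c.1 + 4)) =
      (range M).filter fun l => ¬ ((it l).val ≤ V c.1 c.2 ∧
        ∃ b < k, lev (it (kc b)).pt (it l).pt ≤ c.1 + 4) := by
    refine filter_congr fun l hl => ?_
    simp [liveSet, mem_range.1 hl]
  unfold leftover
  rw [hset, h.weight_eq fun x => ¬ (x.val ≤ V c.1 c.2 ∧ ∃ b < k, lev (it (kc b)).pt x.pt ≤ c.1 + 4)]
  refine card_le_card fun a ha => ?_
  simp only [mem_filter, mem_univ, true_and] at ha ⊢
  rintro ⟨h1, b, hb, h2⟩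
  refine ha ⟨?_, b, hb, lev_le_of_dist (g := c.1) 5 ?_⟩
  · rcases h.val a with h3 | ⟨h3, h4⟩
    · exact h3.2.trans hc.2
    · unfold Item.val at h1
      rw [h3, h4] at h1
      exact h1
  · have h3 := dist_lt_of_lev (g := c.1) 4 h2
    have h4 := h.near a
    have h5 := rad_mono (P := P) ((h.isCand_valid hc).le_of_V_le hc.2)
    have h6 := dist_triangle (med a) (item a).pt (it (kc b)).pt
    have h7 := rad_pos (P := P) c.1
    rw [dist_comm (item a).pt] at h6
    norm_num at h3 ⊢
    linarith

/-! ## Analysis: the nodes of the sites -/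

variable (X : Input P)

/-- The number of nodes of site `i`. -/
def Input.sz (i : ℕ) : ℕ := if h : i < X.s then X.size ⟨i, h⟩ else 0

open Classical in
/-- Node `j` of site `i`. -/
def Input.nodeAt [Nonempty X.Node] (i j : ℕ) : X.Node :=
  if h : ∃ hi : i < X.s, j < X.size ⟨i, hi⟩ then ⟨⟨i, h.choose⟩, ⟨j, h.choose_spec⟩⟩
  else Classical.arbitrary _

variable {X}

lemma Input.sz_fin (i : Fin X.s) : X.sz i = X.size i := by simp [Input.sz]

variable [Nonempty X.Node]

lemma Input.nodeAt_fin (i : Fin X.s) (j : Fin (X.size i)) : X.nodeAt i j = ⟨i, j⟩ := by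
  have h : ∃ hi : (i : ℕ) < X.s, (j : ℕ) < X.size ⟨i, hi⟩ := ⟨i.2, j.2⟩
  rw [Input.nodeAt, dif_pos h]

lemma Input.exists_node {i j : ℕ} (hi : i < X.s) (hj : j < X.sz i) :
    ∃ a : X.Node, (a.1 : ℕ) = i ∧ (a.2 : ℕ) = j ∧ X.nodeAt i j = a := by
  have h : j < X.size ⟨i, hi⟩ := by simpa [Input.sz, hi] using hj
  exact ⟨⟨⟨i, hi⟩, ⟨j, h⟩⟩, rfl, rfl, Input.nodeAt_fin ⟨i, hi⟩ ⟨j, h⟩⟩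

lemma Input.sum_node (f : X.Node → ℕ) :
    ∑ a, f a = ∑ i ∈ range X.s, ∑ j ∈ range (X.sz i), f (X.nodeAt i j) := by
  rw [Fintype.sum_sigma, sum_range]
  refine sum_congr rfl fun i _ => ?_
  rw [Input.sz_fin, sum_range]
  exact sum_congr rfl fun j _ => by rw [Input.nodeAt_fin]

lemma Input.card_node (Q : X.Node → Prop) [DecidablePred Q] : (univ.filter Q).card =
    ∑ i ∈ range X.s, ((range (X.sz i)).filter fun j => Q (X.nodeAt i j)).card := by
  simp only [card_filter]
  exact Input.sum_node fun a => if Q a then 1 else 0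

lemma Input.sum_sz : ∑ i ∈ range X.s, X.sz i = X.n := by
  rw [sum_range]
  exact sum_congr rfl fun i _ => Input.sz_fin i

variable {med : X.Node → P} {kx : X.Node → ℝ} {q : ℝ} {xs lv : ℕ → ℕ → ℝ} {gn : ℕ → ℕ → ℕ}

/-- What the sites know after the first phase. -/
structure Profiles (X : Input P) [Nonempty X.Node] (med : X.Node → P) (kx : X.Node → ℝ) (k t : ℕ)
    (xs lv : ℕ → ℕ → ℝ) (gn : ℕ → ℕ → ℕ) : Prop where
  profile : ∀ i < X.s, ∀ b < numB t,
    Profile (X.sz i) k t (med ∘ X.nodeAt i) (xs i) b (lv i b) (gn i b)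
  key : ∀ i < X.s, ∀ j < X.sz i, xs i j = kx (X.nodeAt i j)
  valid : ∀ a, ValidKey (kx a)

lemma Profiles.valid' (h : Profiles X med kx k t xs lv gn) {i : ℕ} (hi : i < X.s) :
    ∀ j < X.sz i, ValidKey (xs i j) := fun j hj => by
  rw [h.key i hi j hj]; exact h.valid _

open Classical in
/-- The total of the budgets required at a good level is small. -/
lemma Profiles.exists_level (h : Profiles X med kx k t xs lv gn) {p m : ℕ}
    (hg : Good X med kx k t q p m) (hq : q ≤ t) :
    ∃ i < X.s, ∃ b < numB t, total X.s t (fun i b => keyP (lv i b)) (fun i b => keyM (lv i b))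
      (keyV (lv i b)) ≤ 4 * t ∧ keyV (lv i b) ≤ V p m := by
  obtain ⟨-, K, O, hK, hO, hcov, hcut⟩ := hg
  set U : ℕ → ℕ := fun i => ((range (X.sz i)).filter fun j => X.nodeAt i j ∈ O).card +
    ((range (X.sz i)).filter fun j => ¬ X.nodeAt i j ∈ O ∧
      V p m < keyV (kx (X.nodeAt i j))).card with hU
  have hUsum : ∑ i ∈ range X.s, U i ≤ 2 * t := by
    rw [hU, sum_add_distrib, ← Input.card_node fun a => a ∈ O,
      ← Input.card_node fun a => ¬ a ∈ O ∧ V p m < keyV (kx a)]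
    have e1 : (univ.filter fun a => a ∈ O) = O := by ext; simp
    have e2 : (univ.filter fun a => ¬ a ∈ O ∧ V p m < keyV (kx a)) =
        (univ \ O).filter fun a => V p m < keyV (kx a) := by ext; simp
    rw [e1, e2]
    have h1 : (((univ \ O).filter fun a => V p m < keyV (kx a)).card : ℝ) ≤ t := hcut.trans hq
    have h2 : ((univ \ O).filter fun a => V p m < keyV (kx a)).card ≤ t := by
      exact_mod_cast h1
    omega
  have hUi : ∀ i < X.s, U i ≤ 2 * t := fun i hi =>
    (single_le_sum (f := U) (fun _ _ => Nat.zero_le _) (mem_range.2 hi)).trans hUsum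
  have hb : ∀ i, ∃ b, i < X.s → b < numB t ∧ U i ≤ bud b ∧ bud b ≤ 2 * U i := fun i => by
    by_cases hi : i < X.s
    · obtain ⟨b, hb⟩ := exists_bud (hUi i hi)
      exact ⟨b, fun _ => hb⟩
    · exact ⟨0, fun h => absurd h hi⟩
  choose β hβ using hb
  have hlv : ∀ i < X.s, keyV (lv i (β i)) ≤ V p m := fun i hi => by
    obtain ⟨h1, h2, -⟩ := hβ i hi
    refine (h.profile i hi _ h1).keyV_le (h.valid' hi) (K := K) (O := fun j => X.nodeAt i j ∈ O) hK
      (fun j _ hj => hcov _ hj) ?_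
    refine le_trans (le_of_eq ?_) h2
    rw [hU]
    congr 2
    refine filter_congr fun j hj => ?_
    rw [h.key i hi j (mem_range.1 hj)]
  obtain ⟨a⟩ := ‹Nonempty X.Node›
  obtain ⟨i, hi, hmax⟩ := (range X.s).exists_max_image (fun i => keyV (lv i (β i)))
    ⟨a.1, mem_range.2 a.1.2⟩
  have hi := mem_range.1 hi
  refine ⟨i, hi, β i, (hβ i hi).1, ?_, hlv i hi⟩
  calc total X.s t _ _ (keyV (lv i (β i))) ≤ ∑ i ∈ range X.s, 2 * U i := by
        refine sum_le_sum fun i' hi' => ?_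
        obtain ⟨h1, -, h3⟩ := hβ i' (mem_range.1 hi')
        exact ((leastW_le _ _ _ _).2 _ h1 (hmax i' hi')).trans h3
    _ = 2 * ∑ i ∈ range X.s, U i := by rw [mul_sum]
    _ ≤ _ := by omega

variable {md : A → P}

open Classical in
/-- The item that represents node `j`. -/
def Report.itemAt (r : Report A) (md : A → P) (f : ℕ → ℕ) (j : ℕ) : Item P :=
  if r.x j ≤ r.X then r.netItem md (f j) else r.cutItem md j

variable {R g : ℕ} {f : ℕ → ℕ} {r : Report A}

open Classical in
lemma Report.sum_items (h : Summary r.n k (md ∘ r.nd) r.x R r.X g r.cnt r.c r.w f)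
    (Q : Item P → Prop) : ((r.items md).map fun a => if Q a then a.wt else 0).sum =
      ((range r.n).filter fun j => Q (r.itemAt md f j)).card := by
  have e1 : (((List.range r.cnt).map (r.netItem md)).map fun a => if Q a then a.wt else 0).sum =
      ((range r.n).filter fun j => r.x j ≤ r.X ∧ Q (r.netItem md (f j))).card := by
    rw [List.map_map, ← List.sum_toFinset _ List.nodup_range, List.toFinset_range]
    simp only [Function.comp_apply]
    rw [← sum_filter, card_eq_sum_card_fiberwise (f := f)
      (t := (range r.cnt).filter fun l => Q (r.netItem md l)) (fun j hj => by
        have hj := mem_filter.1 (Finset.mem_coe.1 hj)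
        exact Finset.mem_coe.2 (mem_filter.2 ⟨mem_range.2 (h.att j (mem_range.1 hj.1)).1, hj.2.2⟩))]
    refine sum_congr rfl fun l hl => ?_
    obtain ⟨hl, hQ⟩ := mem_filter.1 hl
    show r.w l = _
    rw [h.weight l (mem_range.1 hl), filter_filter]
    congr 1
    refine filter_congr fun j _ => ⟨fun h => ⟨⟨h.1, h.2 ▸ hQ⟩, h.2⟩, fun h => ⟨h.1.1, h.2⟩⟩
  have e2 : (((cutList r.n r.x r.X).map (r.cutItem md)).map fun a => if Q a then a.wt else 0).sum =
      ((range r.n).filter fun j => ¬ r.x j ≤ r.X ∧ Q (r.cutItem md j)).card := by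
    rw [List.map_map, cutList, ← List.sum_toFinset _ (List.nodup_range.filter _),
      List.toFinset_filter, List.toFinset_range, card_filter, sum_filter]
    refine sum_congr rfl fun j _ => ?_
    by_cases h1 : r.x j ≤ r.X <;> by_cases h2 : Q (r.cutItem md j) <;>
      simp [h1, h2, show (r.cutItem md j).wt = 1 from rfl]
  unfold Report.items
  rw [List.map_append, List.sum_append, e1, e2, ← card_union_of_disjoint]
  · congr 1
    ext j
    rw [mem_union, mem_filter, mem_filter, mem_filter]
    unfold Report.itemAt
    by_cases h1 : r.x j ≤ r.X <;> simp [h1]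
  · refine Finset.disjoint_left.2 fun j h1 h2 => ?_
    exact (mem_filter.1 h2).2.1 (mem_filter.1 h1).2.1

lemma Report.length_items (h : Summary r.n k (md ∘ r.nd) r.x R r.X g r.cnt r.c r.w f) :
    (r.items md).length ≤ k + 2 * R := by
  have := h.cnt_le
  have := h.cut_le
  simp only [Report.items, List.length_append, List.length_map, List.length_range]
  omega

lemma Report.itemAt_mem (h : Summary r.n k (md ∘ r.nd) r.x R r.X g r.cnt r.c r.w f) {j : ℕ}
    (hj : j < r.n) : r.itemAt md f j ∈ r.items md := by
  unfold Report.itemAt Report.items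
  split_ifs with h1
  · exact List.mem_append_left _ (List.mem_map_of_mem (List.mem_range.2 (h.att j hj).1))
  · refine List.mem_append_right _ (List.mem_map_of_mem ?_)
    simpa [cutList, hj] using h1

variable {c₀ : ℕ × ℕ}

/-- The report of site `i` for budget number `b`. -/
def report (X : Input P) [Nonempty X.Node] (xs lv : ℕ → ℕ → ℝ) (β cnt : ℕ → ℕ) (c w : ℕ → ℕ → ℕ)
    (i : ℕ) : Report X.Node :=
  ⟨X.sz i, X.nodeAt i, xs i, lv i (β i), cnt i, c i, w i⟩

open Classical in
lemma Profiles.itemMap (h : Profiles X med kx k t xs lv gn) (hc0 : ValidPair c₀.1 c₀.2)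
    {β cnt : ℕ → ℕ} {c w f : ℕ → ℕ → ℕ}
    (hβ : ∀ i < X.s, β i < numB t ∧ keyV (lv i (β i)) ≤ V c₀.1 c₀.2)
    (hsum : ∀ i < X.s, Summary (X.sz i) k (med ∘ X.nodeAt i) (xs i) (bud (β i)) (lv i (β i))
      (gn i (β i)) (cnt i) (c i) (w i) (f i)) {L : List (Item P)}
    (hL : L = (List.range X.s).flatMap fun i => (report X xs lv β cnt c w i).items med)
    {it : ℕ → Item P} (hit : L = (List.range L.length).map it) :
    ItemMap X med kx L.length it
      (fun a => (report X xs lv β cnt c w a.1).itemAt med (f a.1) a.2) c₀ := by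
  set r := report X xs lv β cnt c w with hr
  have hmemL : ∀ x, x ∈ L ↔ ∃ i < X.s, x ∈ (r i).items med := fun x => by simp [hL]
  have hget : ∀ l < L.length, it l ∈ L := fun l hl => by
    rw [hit]; exact List.mem_map_of_mem (by simpa using hl)
  have hnode : ∀ a : X.Node, (a.2 : ℕ) < X.sz a.1 ∧ X.nodeAt a.1 a.2 = a ∧
      xs a.1 a.2 = kx a := fun a => by
    have h1 : (a.2 : ℕ) < X.sz a.1 := by rw [Input.sz_fin]; exact a.2.2
    have h2 : X.nodeAt a.1 a.2 = a := Input.nodeAt_fin a.1 a.2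
    exact ⟨h1, h2, by rw [h.key _ a.1.2 _ h1, h2]⟩
  refine ⟨hc0, fun Q => ?_, fun a => ?_, fun a => ?_, fun a => ?_, fun l hl => ?_⟩
  · have e1 : wts it ((range L.length).filter fun l => Q (it l)) =
        (L.map fun a => if Q a then a.wt else 0).sum := by
      conv_rhs => rw [hit]
      rw [List.map_map, ← List.sum_toFinset _ List.nodup_range, List.toFinset_range, wts,
        sum_filter]
      rfl
    rw [e1, Input.card_node, hL]
    have e2 : ∀ N ≤ X.s, (((List.range N).flatMap fun i => (r i).items med).map
        fun a => if Q a then a.wt else 0).sum = ∑ i ∈ range N,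
        ((range (X.sz i)).filter fun j => Q ((r i).itemAt med (f i) j)).card := by
      intro N hN
      induction N with
      | zero => simp
      | succ N ih =>
        rw [List.range_succ, List.flatMap_append, List.map_append, List.sum_append, ih (by omega),
          sum_range_succ, List.flatMap_singleton, Report.sum_items (hsum N (by omega))]
        rfl
    rw [e2 _ le_rfl]
    refine sum_congr rfl fun i hi => congrArg _ (filter_congr fun j hj => ?_)
    obtain ⟨a, h1, h2, h3⟩ := Input.exists_node (mem_range.1 hi) (mem_range.1 hj)
    rw [h3, h1, h2]
  · obtain ⟨h1, h2, h3⟩ := hnode a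
    have hpos := rad_pos (P := P) c₀.1
    have hs := hsum a.1 a.1.2
    obtain ⟨hb1, hb2⟩ := hβ a.1 a.1.2
    simp only [Report.itemAt]
    split_ifs with hc
    · have h4 := dist_lt_of_lev 1 (hs.att _ h1).2
      obtain ⟨h5, h6⟩ := (h.profile _ a.1.2 _ hb1).valid (h.valid' a.1.2)
      have h7 := rad_mono (P := P) (h6.trans (hc0.le_of_V_le hb2))
      simp only [Function.comp_apply, h2] at h4
      refine lt_of_lt_of_le (show dist (med a) (med (X.nodeAt a.1 (c a.1 (f a.1 a.2)))) < _ from h4)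
          ?_
      norm_num
      linarith
    · show dist (med a) (med (X.nodeAt a.1 a.2)) < _
      rw [h2, dist_self]
      positivity
  · obtain ⟨h1, h2, h3⟩ := hnode a
    obtain ⟨hb1, hb2⟩ := hβ a.1 a.1.2
    simp only [Report.itemAt]
    split_ifs with hc
    · refine .inl ⟨by simp [Report.netItem, Item.val, V], ?_⟩
      refine le_trans (keyV_mono (h.valid a)
          ((h.profile _ a.1.2 _ hb1).valid (h.valid' a.1.2)).1 ?_)
        hb2
      rw [← h3]; exact hc
    · right
      rw [← h3]
      exact ⟨rfl, rfl⟩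
  · have : (r a.1).itemAt med (f a.1) a.2 ∈ L :=
      (hmemL _).2 ⟨a.1, a.1.2, Report.itemAt_mem (hsum a.1 a.1.2) (hnode a).1⟩
    rw [hit] at this
    obtain ⟨l, hl, hl'⟩ := List.mem_map.1 this
    exact ⟨l, List.mem_range.1 hl, hl'⟩
  · obtain ⟨i, hi, hmem⟩ := (hmemL _).1 (hget l hl)
    rcases List.mem_append.1 hmem with h1 | h1
    · obtain ⟨l', -, hl'⟩ := List.mem_map.1 h1
      rw [← hl']
      exact .inl rfl
    · obtain ⟨j, hj, hj'⟩ := List.mem_map.1 h1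
      rw [← hj']
      have hj : j < X.sz i := by
        have := List.mem_of_mem_filter hj
        exact List.mem_range.1 this
      exact (h.valid' hi j hj).validPair

/-! ## The run of the protocol -/

def St.initial (tape : List (Word P A)) : St P A :=
  ⟨fun _ => .blank, fun _ _ => .blank, fun p => if p = 0 then tape else [], fun _ => [], 0⟩

/-- Start of a new phase. -/
def St.arrive (s : St P A) (msg : ℕ → List (Word P A)) : St P A :=
  ⟨s.var, s.arr, fun p => s.inbox p ++ msg p, fun _ => [], 0⟩

@[simp] lemma St.initial_time (tape : List (Word P A)) : (St.initial tape).time = 0 := rfl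
@[simp] lemma St.arrive_time (s : St P A) (msg : ℕ → List (Word P A)) :
    (s.arrive msg).time = 0 := rfl

lemma Rel.initial (tape : List (Word P A)) : Rel (.initial tape) (State.start tape) :=
  ⟨fun _ => rfl, fun _ _ => rfl, rfl, rfl⟩

lemma Rel.arrive {st : State P A} (h : Rel s st) (msg : ℕ → List (Word P A)) :
    Rel (s.arrive msg) (st.deliver msg) :=
  ⟨h.var, h.arr, by simp [St.arrive, State.deliver, h.inbox], rfl⟩

variable (X : Input P) (med : X.Node → P) (k t : ℕ) (ε : ℝ)

variable {X} in
def gather (T : Fin X.s → St P X.Node) : ℕ → List (Word P X.Node)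
  | 0 => []
  | i + 1 => if h : i < X.s then (T ⟨i, h⟩).outbox 1 else []

variable {X} in
def scatter (C : St P X.Node) (i : Fin X.s) : ℕ → List (Word P X.Node) :=
  fun p => if p = 1 then C.outbox (i + 1) else []

def siteSt₁ (i : Fin X.s) : St P X.Node :=
  site₁S.run X.law med (.initial (siteTape X k t ε i))

def coordSt₁ : St P X.Node :=
  coord₁S.run X.law med ((St.initial (coordTape X k t ε)).arrive (gather (siteSt₁ X med k t ε)))

def siteSt₂ (i : Fin X.s) : St P X.Node :=
  site₂S.run X.law med ((siteSt₁ X med k t ε i).arrive (scatter (coordSt₁ X med k t ε) i))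

def coordSt₂ : St P X.Node :=
  coord₂S.run X.law med ((coordSt₁ X med k t ε).arrive (gather (siteSt₂ X med k t ε)))

def siteSt₃ (i : Fin X.s) : St P X.Node :=
  site₃S.run X.law med ((siteSt₂ X med k t ε i).arrive (scatter (coordSt₂ X med k t ε) i))

lemma siteSt₁_def (i : Fin X.s) : siteSt₁ X med k t ε i =
    site₁S.run X.law med (.initial (siteTape X k t ε i)) := rfl

lemma coordSt₁_def : coordSt₁ X med k t ε = coord₁S.run X.law med
    ((St.initial (coordTape X k t ε)).arrive (gather (siteSt₁ X med k t ε))) := rfl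

lemma siteSt₂_def (i : Fin X.s) : siteSt₂ X med k t ε i = site₂S.run X.law med
    ((siteSt₁ X med k t ε i).arrive (scatter (coordSt₁ X med k t ε) i)) := rfl

lemma coordSt₂_def : coordSt₂ X med k t ε = coord₂S.run X.law med
    ((coordSt₁ X med k t ε).arrive (gather (siteSt₂ X med k t ε))) := rfl

lemma siteSt₃_def (i : Fin X.s) : siteSt₃ X med k t ε i = site₃S.run X.law med
    ((siteSt₂ X med k t ε i).arrive (scatter (coordSt₂ X med k t ε) i)) := rfl

lemma toCoord_eq {S : Fin X.s → State P X.Node} {T : Fin X.s → St P X.Node}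
    (h : ∀ i, Rel (T i) (S i)) : toCoord S = gather T := by
  funext p
  cases p with
  | zero => rfl
  | succ i =>
    simp only [toCoord, gather]
    split_ifs with hi
    · rw [(h _).outbox]
    · rfl

lemma toSite_eq {Q : State P X.Node} {C : St P X.Node} (h : Rel C Q) (i : Fin X.s) :
    toSite Q i = scatter C i := by
  funext p
  simp only [toSite, scatter, h.outbox]

/-- The compiled protocol has a run with the outputs of the programs. -/
lemma exists_run : ∃ R : Run centerProtocol X med k t ε,
    ((∀ i, (R.S₁ i).outbox = (siteSt₁ X med k t ε i).outbox) ∧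
      (∀ i, (R.S₂ i).outbox = (siteSt₂ X med k t ε i).outbox) ∧
      (∀ i, (R.S₃ i).outbox = (siteSt₃ X med k t ε i).outbox) ∧
      R.Q₁.outbox = (coordSt₁ X med k t ε).outbox ∧
      R.Q₂.outbox = (coordSt₂ X med k t ε).outbox) ∧
    (∀ i, R.a₁ i ≤ site₁S.factor * (siteSt₁ X med k t ε i).time) ∧
    (∀ i, R.a₂ i ≤ site₂S.factor * (siteSt₂ X med k t ε i).time) ∧
    (∀ i, R.a₃ i ≤ site₃S.factor * (siteSt₃ X med k t ε i).time) ∧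
    R.b₁ ≤ coord₁S.factor * (coordSt₁ X med k t ε).time ∧
    R.b₂ ≤ coord₂S.factor * (coordSt₂ X med k t ε).time := by
  choose S1 a1 e1 m1 r1 _ using fun i : Fin X.s => site₁S.compile_exec X.law med 0
    (.initial (siteTape X k t ε i)) _ (Rel.initial _)
  have r1' : ∀ i, Rel (siteSt₁ X med k t ε i) (S1 i) := r1
  obtain ⟨Q1, b1, f1, n1, q1, -⟩ := coord₁S.compile_exec X.law med 0
    ((St.initial (coordTape X k t ε)).arrive (gather (siteSt₁ X med k t ε))) _
    ((Rel.initial _).arrive _)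
  have q1' : Rel (coordSt₁ X med k t ε) Q1 := q1
  choose S2 a2 e2 m2 r2 _ using fun i : Fin X.s => site₂S.compile_exec X.law med 0
    ((siteSt₁ X med k t ε i).arrive (scatter (coordSt₁ X med k t ε) i)) _ ((r1' i).arrive _)
  have r2' : ∀ i, Rel (siteSt₂ X med k t ε i) (S2 i) := r2
  obtain ⟨Q2, b2, f2, n2, q2, -⟩ := coord₂S.compile_exec X.law med 0
    ((coordSt₁ X med k t ε).arrive (gather (siteSt₂ X med k t ε))) _ (q1'.arrive _)
  have q2' : Rel (coordSt₂ X med k t ε) Q2 := q2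
  choose S3 a3 e3 m3 r3 _ using fun i : Fin X.s => site₃S.compile_exec X.law med 0
    ((siteSt₂ X med k t ε i).arrive (scatter (coordSt₂ X med k t ε) i)) _ ((r2' i).arrive _)
  have r3' : ∀ i, Rel (siteSt₃ X med k t ε i) (S3 i) := r3
  refine ⟨⟨S1, S2, S3, Q1, Q2, a1, a2, a3, b1, b2, e1, ?_, fun i => ?_, ?_, fun i => ?_⟩,
    ⟨fun i => (r1' i).outbox, fun i => (r2' i).outbox, fun i => (r3' i).outbox, q1'.outbox,
      q2'.outbox⟩, fun i => (Nat.le_add_right _ _).trans (m1 i),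
    fun i => (Nat.le_add_right _ _).trans (m2 i), fun i => (Nat.le_add_right _ _).trans (m3 i),
    (Nat.le_add_right _ _).trans n1, (Nat.le_add_right _ _).trans n2⟩
  · rw [toCoord_eq X r1']; exact f1
  · rw [toSite_eq X q1']; exact e2 i
  · rw [toCoord_eq X r2']; exact f2
  · rw [toSite_eq X q2']; exact e3 i

attribute [irreducible] siteSt₁ coordSt₁ siteSt₂ coordSt₂ siteSt₃

variable {X med k t ε} [Nonempty X.Node]

open Classical in
/-- What happens in a run. -/
structure Trace (X : Input P) [Nonempty X.Node] (med : X.Node → P) (k t : ℕ) (ε : ℝ)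
    (kx : X.Node → ℝ) (xs lv : ℕ → ℕ → ℝ) (gn : ℕ → ℕ → ℕ) (β cnt : ℕ → ℕ) (c w f : ℕ → ℕ → ℕ)
    (c' : ℕ × ℕ) (kc : ℕ → P) : Prop where
  isKey : ∀ a, IsKey (X.law a) (med a) (quota ε t) (kx a)
  profiles : Profiles X med kx k t xs lv gn
  out₁ : ∀ i : Fin X.s, (siteSt₁ X med k t ε i).outbox 1 =
    (List.range (numB t)).flatMap fun b => [.nat (keyP (lv i b)), .nat (keyM (lv i b))]
  bud_lt : ∀ i < X.s, β i < numB t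
  bud_sum : ∑ i ∈ range X.s, bud (β i) ≤ 4 * t
  outc₁ : ∀ i : Fin X.s, (coordSt₁ X med k t ε).outbox (i + 1) = [.nat (β i)]
  summary : ∀ i < X.s, Summary (X.sz i) k (med ∘ X.nodeAt i) (xs i) (bud (β i)) (lv i (β i))
      (gn i (β i)) (cnt i) (c i) (w i) (f i)
  out₂ : ∀ i : Fin X.s, (siteSt₂ X med k t ε i).outbox 1 = (report X xs lv β cnt c w i).words k med
  pair : (c'.2 = 0 ∧ c'.1 ≤ numL P + 1) ∨
    (∃ i < X.s, ∃ b < numB t, c' = (keyP (lv i b), keyM (lv i b))) ∨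
    ∃ a, c' = (keyP (kx a), keyM (kx a))
  outc₀ : (coordSt₂ X med k t ε).outbox 0 = (List.range k).map fun b => .pt (kc b)
  outc₂ : ∀ i : Fin X.s, (coordSt₂ X med k t ε).outbox (i + 1) =
    ((List.range k).map fun b => .pt (kc b)) ++ [.nat c'.1, .nat c'.2]
  label : ∀ a : X.Node, ∃ o, ((siteSt₃ X med k t ε a.1).outbox 0)[(a.2 : ℕ)]? = some o ∧
    LabelOK k kc c'.1 (V c'.1 c'.2) (med a) (kx a) o
  few : ((univ.filter fun a => ¬ (keyV (kx a) ≤ V c'.1 c'.2 ∧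
      ∃ b < k, lev (med a) (kc b) ≤ c'.1 + 5)).card : ℝ) ≤ t + quota ε t
  cheap : ∀ S : Solution P X.Node,
    (∀ a, a ∉ S.O → keyV (kx a) ≤ V c'.1 c'.2 ∧ lev (med a) (S.asg a) ≤ c'.1 + 5) →
      cost X S ≤ 1060 * (1 + 1 / ε) * optCost X k t
  time₁ : ∀ i, (siteSt₁ X med k t ε i).time ≤ siteTime₁ k t (X.size i) (numL P)
  time₂ : ∀ i, (siteSt₂ X med k t ε i).time ≤ siteTime₂ k t (X.size i)
  time₃ : ∀ i, (siteSt₃ X med k t ε i).time ≤ siteTime₃ k (X.size i)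
  timec₁ : (coordSt₁ X med k t ε).time ≤ coordTime₁ X.s t
  timec₂ : ∃ M ≤ X.s * k + 8 * t, (coordSt₂ X med k t ε).time ≤ coordTime₂ k X.s M

variable {D} in
lemma SiteSt.arrive {lv : ℕ → ℝ} {gn : ℕ → ℕ} (h : SiteSt D k t ε n nd mp x lv gn s)
    (msg : ℕ → List (Word P A)) :
    SiteSt D k t ε n nd mp x lv gn (s.arrive msg) :=
  ⟨h.params.congr (fun _ _ => rfl) rfl, ⟨h.nodes.node, h.nodes.med⟩, h.key, h.isKey, h.lev, h.gen,
  h.profile⟩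

lemma quota_le (ε : ℝ) (t : ℕ) : quota ε t ≤ t := by
  unfold quota
  have := min_le_right ε 1
  nlinarith [(Nat.cast_nonneg t : (0 : ℝ) ≤ t)]

lemma fst_le_of_mem_radCands {y : ℝ} (hy : y ≤ dmax P) {c : ℕ × ℕ} (hc : c ∈ radCands P y) :
    c.2 = 0 ∧ c.1 ≤ numL P + 1 := by
  obtain ⟨i, -, rfl⟩ := List.mem_map.1 hc
  refine ⟨rfl, (Nat.sub_le _ _).trans ?_⟩
  have hd := dmin_pos (P := P)
  have h1 := dmax_lt_pow (P := P)
  have h0 : (0 : ℝ) ≤ dmax P := hd.le.trans dmin_le_dmax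
  refine (expo_mono (y := 1 + 64 * dmax P / dmin P) (by gcongr)).trans
    ((expo_le_iff (by positivity) _).2 ?_)
  have h2 : 64 * dmax P / dmin P < 2 ^ numL P := by
    rw [div_lt_iff₀ hd]; nlinarith [pow_pos (show (0 : ℝ) < 2 by norm_num) (numL P)]
  have h3 : (1 : ℝ) ≤ 2 ^ numL P := one_le_pow₀ (by norm_num)
  rw [pow_add, pow_succ]
  norm_num
  linarith

lemma siteSt₁_spec (hk : 1 ≤ k) (hε : 0 < ε) (i : Fin X.s) : ∃ x lv gn,
    SiteSt X.law k t ε (X.sz i) (X.nodeAt i) (med ∘ X.nodeAt i) x lv gn (siteSt₁ X med k t ε i) ∧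
    (siteSt₁ X med k t ε i).outbox 1 =
      (List.range (numB t)).flatMap (fun b => [.nat (keyP (lv b)), .nat (keyM (lv b))]) ∧
    (siteSt₁ X med k t ε i).inbox 1 = [] ∧
    (siteSt₁ X med k t ε i).time ≤ siteTime₁ k t (X.sz i) (numL P) := by
  have hin : (St.initial (siteTape X k t ε i)).inbox 0 =
      [.nat k, .nat t, .real ε, .real (dmin P), .real (dmax P), .nat (X.sz i)] ++
        (List.range' 0 (X.sz i)).map fun j => .node (X.nodeAt i j) := by
    simp only [St.initial, if_true, siteTape, Input.sz_fin]
    congr 1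
    refine List.ext_getElem (by simp) fun j h1 h2 => ?_
    have hj : j < X.size i := by simpa using h1
    simpa using (Input.nodeAt_fin i ⟨j, hj⟩).symm
  obtain ⟨x, lv, gn, h1, h2, h3, h4⟩ := site₁S_spec X.law med hk hin rfl
    (fun _ => rfl) (quota_nonneg hε t) rfl
  rw [St.initial_time, zero_add] at h4
  rw [siteSt₁_def]
  exact ⟨x, lv, gn, h1, h2, h3, h4⟩

lemma siteSt₂_spec {i : Fin X.s} {lv : ℕ → ℝ} {gn : ℕ → ℕ}
    (h : SiteSt X.law k t ε (X.sz i) (X.nodeAt i) (med ∘ X.nodeAt i) x lv gn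
    (siteSt₁ X med k t ε i))
    (hin : (siteSt₁ X med k t ε i).inbox 1 = []) {b : ℕ} (hb : b < numB t)
    (hout : (coordSt₁ X med k t ε).outbox (i + 1) = [.nat b]) : ∃ cnt c w f,
    Summary (X.sz i) k (med ∘ X.nodeAt i) x (bud b) (lv b) (gn b) cnt c w f ∧
    (siteSt₂ X med k t ε i).outbox 1 =
      summaryWords (X.sz i) k (X.nodeAt i) (med ∘ X.nodeAt i) x (lv b) cnt c w ∧
    SiteSt X.law k t ε (X.sz i) (X.nodeAt i) (med ∘ X.nodeAt i) x lv gn (siteSt₂ X med k t ε i) ∧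
    (siteSt₂ X med k t ε i).inbox 1 = [] ∧
    (siteSt₂ X med k t ε i).time ≤ siteTime₂ k t (X.sz i) := by
  have hin' : ((siteSt₁ X med k t ε i).arrive (scatter (coordSt₁ X med k t ε) i)).inbox 1 =
      [.nat b] := by
    simp only [St.arrive, scatter, if_true, hin, List.nil_append, hout]
  obtain ⟨cnt, c, w, f, a1, a2, a3, a4, a5⟩ := site₂S_spec X.law med
    (h.arrive (scatter (coordSt₁ X med k t ε) i)) hb hin' rfl
  rw [St.arrive_time, zero_add, ← siteSt₂_def] at a5
  rw [← siteSt₂_def] at a2 a3 a4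
  exact ⟨cnt, c, w, f, a1, a2, a3, a4, a5⟩

lemma siteSt₃_spec {i : Fin X.s} {lv : ℕ → ℝ} {gn : ℕ → ℕ}
    (h : SiteSt X.law k t ε (X.sz i) (X.nodeAt i) (med ∘ X.nodeAt i) x lv gn
    (siteSt₂ X med k t ε i))
    (hin : (siteSt₂ X med k t ε i).inbox 1 = []) {kc : ℕ → P} {p m : ℕ}
    (hout : (coordSt₂ X med k t ε).outbox (i + 1) =
      ((List.range k).map fun b => .pt (kc b)) ++ [.nat p, .nat m]) :
    (∃ out : ℕ → Word P X.Node, (siteSt₃ X med k t ε i).outbox 0 = (List.range (X.sz i)).map out ∧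
      ∀ j < X.sz i, LabelOK k kc p (V p m) (med (X.nodeAt i j)) (x j) (out j)) ∧
    (siteSt₃ X med k t ε i).time ≤ siteTime₃ k (X.sz i) := by
  have hin' : ((siteSt₂ X med k t ε i).arrive (scatter (coordSt₂ X med k t ε) i)).inbox 1 =
      ((List.range' 0 k).map fun b => .pt (kc b)) ++ [.nat p, .nat m] := by
    simp only [St.arrive, scatter, if_true, hin, List.nil_append, hout, List.range_eq_range']
  have h' := h.arrive (scatter (coordSt₂ X med k t ε) i)
  obtain ⟨a1, a2⟩ := site₃S_spec X.law med h'.params h'.nodes h'.key hin' rfl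
  rw [St.arrive_time, zero_add, ← siteSt₃_def] at a2
  rw [← siteSt₃_def] at a1
  exact ⟨a1, a2⟩

open Classical in
theorem exists_trace (hk : 1 ≤ k) (hε : 0 < ε) (hmed : ∀ a, IsMedian (X.law a) (med a)) :
    ∃ kx xs lv gn β cnt c w f c' kc, Trace X med k t ε kx xs lv gn β cnt c w f c' kc := by
  have hq0 := quota_nonneg hε t
  choose xs lv gn h1 using fun i : ℕ => show ∃ x lv gn, ∀ hi : i < X.s,
      SiteSt X.law k t ε (X.sz i) (X.nodeAt i) (med ∘ X.nodeAt i) x lv gn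
        (siteSt₁ X med k t ε ⟨i, hi⟩) ∧
      (siteSt₁ X med k t ε ⟨i, hi⟩).outbox 1 =
        (List.range (numB t)).flatMap (fun b => [.nat (keyP (lv b)), .nat (keyM (lv b))]) ∧
      (siteSt₁ X med k t ε ⟨i, hi⟩).inbox 1 = [] ∧
      (siteSt₁ X med k t ε ⟨i, hi⟩).time ≤ siteTime₁ k t (X.sz i) (numL P) by
    by_cases hi : i < X.s
    · obtain ⟨x, lv, gn, h⟩ := siteSt₁_spec (med := med) (t := t) hk hε ⟨i, hi⟩
      exact ⟨x, lv, gn, fun _ => h⟩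
    · exact ⟨fun _ => 0, fun _ => 0, fun _ => 0, fun h => absurd h hi⟩
  set kx : X.Node → ℝ := fun a => xs a.1 a.2 with hkx
  have hsz : ∀ a : X.Node, (a.2 : ℕ) < X.sz a.1 := fun a => by rw [Input.sz_fin]; exact a.2.2
  have hisKey : ∀ a, IsKey (X.law a) (med a) (quota ε t) (kx a) := fun a => by
    have := (h1 a.1 a.1.2).1.isKey a.2 (hsz a)
    simpa only [Function.comp_apply, Input.nodeAt_fin] using this
  have hprof : Profiles X med kx k t xs lv gn := by
    refine ⟨fun i hi => (h1 i hi).1.profile, fun i hi j hj => ?_, fun a => (hisKey a).valid hq0⟩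
    obtain ⟨a, e1, e2, e3⟩ := Input.exists_node hi hj
    rw [e3, hkx]
    simp only [e1, e2]
  obtain ⟨p, m, hgood, hcheap⟩ := exists_good_level (X := X) (k := k) (t := t) hk hε hmed hisKey
  obtain ⟨i1, hi1, b1, hb1, htot, hle1⟩ := hprof.exists_level hgood (quota_le ε t)
  set pp : ℕ → ℕ → ℕ := fun i b => keyP (lv i b) with hpp
  set mm : ℕ → ℕ → ℕ := fun i b => keyM (lv i b) with hmm
  obtain ⟨i0, b0, β, hpar, hch, hβ, hβs, houtc, hinc, htc⟩ := coord₁S_spec X.law med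
    (k := k) (t := t) (ε := ε) (n := X.s) (pp := pp) (mm := mm)
    (s := (St.initial (coordTape X k t ε)).arrive (gather (siteSt₁ X med k t ε)))
    (by simp [St.arrive, St.initial, gather, coordTape])
    (fun i hi => by
      simp only [St.arrive, St.initial, gather, hi, dif_pos, Nat.add_eq_zero_iff, one_ne_zero,
        and_false, if_false, List.nil_append]
      rw [(h1 i hi).2.1, List.range_eq_range'])
    (fun _ => rfl) ⟨i1, hi1, b1, hb1, htot⟩
  rw [← coordSt₁_def] at hpar hch houtc hinc htc
  rw [St.arrive_time, zero_add] at htc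
  set c₀ : ℕ × ℕ := (pp i0 b0, mm i0 b0) with hc0
  have hv0 : V c₀.1 c₀.2 ≤ V p m := (hch.le i1 hi1 b1 hb1 htot).trans hle1
  have hc₀v : ValidPair c₀.1 c₀.2 := ((hprof.profile i0 hch.lt_site b0 hch.lt_bud).valid
    (hprof.valid' hch.lt_site)).1.validPair
  choose cnt c w f h2 using fun i : ℕ => show ∃ cnt c w f, ∀ hi : i < X.s,
      Summary (X.sz i) k (med ∘ X.nodeAt i) (xs i) (bud (β i)) (lv i (β i)) (gn i (β i)) cnt c w f ∧
      (siteSt₂ X med k t ε ⟨i, hi⟩).outbox 1 =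
        summaryWords (X.sz i) k (X.nodeAt i) (med ∘ X.nodeAt i) (xs i) (lv i (β i)) cnt c w ∧
      SiteSt X.law k t ε (X.sz i) (X.nodeAt i) (med ∘ X.nodeAt i) (xs i) (lv i) (gn i)
        (siteSt₂ X med k t ε ⟨i, hi⟩) ∧
      (siteSt₂ X med k t ε ⟨i, hi⟩).inbox 1 = [] ∧
      (siteSt₂ X med k t ε ⟨i, hi⟩).time ≤ siteTime₂ k t (X.sz i) by
    by_cases hi : i < X.s
    · obtain ⟨cnt, c, w, f, h⟩ := siteSt₂_spec (i := ⟨i, hi⟩) (h1 i hi).1 (h1 i hi).2.2.1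
        (hβ i hi).1
        (houtc i hi)
      exact ⟨cnt, c, w, f, fun _ => h⟩
    · exact ⟨0, fun _ => 0, fun _ => 0, fun _ => 0, fun h => absurd h hi⟩
  set L : List (Item P) :=
    (List.range X.s).flatMap fun i => (report X xs lv β cnt c w i).items med with hL
  have hIM : ∀ it, L = (List.range L.length).map it → ItemMap X med kx L.length it
      (fun a => (report X xs lv β cnt c w a.1).itemAt med (f a.1) a.2) c₀ := fun it hit =>
    hprof.itemMap hc₀v hβ (fun i hi => (h2 i hi).1) hL hit
  have hMle : L.length ≤ X.s * k + 8 * t := by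
    have e : L.length = ∑ i ∈ range X.s,
        ((report X xs lv β cnt c w i).items med).length := by
      rw [hL, List.length_flatMap, ← List.sum_toFinset _ List.nodup_range, List.toFinset_range]
    rw [e]
    calc _ ≤ ∑ i ∈ range X.s, (k + 2 * bud (β i)) := sum_le_sum fun i hi =>
          Report.length_items (h2 i (mem_range.1 hi)).1
      _ = X.s * k + 2 * ∑ i ∈ range X.s, bud (β i) := by
          rw [sum_add_distrib, ← mul_sum]; simp
      _ ≤ _ := by omega
  have hM : 0 < L.length := by
    obtain ⟨a⟩ := ‹Nonempty X.Node›
    refine List.length_pos_of_mem (a := (report X xs lv β cnt c w a.1).itemAt med (f a.1) a.2) ?_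
    rw [hL]
    exact List.mem_flatMap.2 ⟨a.1, List.mem_range.2 a.1.2,
      Report.itemAt_mem (h2 a.1 a.1.2).1 (hsz a)⟩
  obtain ⟨⟨it, δ, c', kc, hit, hδ, hcand, hcv, hkc, hleft, ho0, ho1⟩, htc2⟩ := coord₂S_spec
    X.law med (k := k) (t := t) (ε := ε) (n := X.s) (c₀ := c₀) (v := V p m)
    (s := (coordSt₁ X med k t ε).arrive (gather (siteSt₂ X med k t ε)))
    (hpar.congr (fun _ _ => rfl) rfl)
    hch.best hch.fst hch.snd (report X xs lv β cnt c w)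
    (fun i hi => by
      simp only [St.arrive, gather, hi, dif_pos]
      have : (coordSt₁ X med k t ε).inbox (i + 1) = [] := hinc i hi
      rw [this, (h2 i hi).2.1]
      rfl)
    (fun _ => rfl) hL hM (fun it hit => (hIM it hit).coverUpTo hgood hv0)
  rw [← coordSt₂_def] at ho0 ho1 htc2
  rw [St.arrive_time, zero_add] at htc2
  have hI := hIM it hit
  have hlab : ∀ a : X.Node, ∃ o, ((siteSt₃ X med k t ε a.1).outbox 0)[(a.2 : ℕ)]? = some o ∧
      LabelOK k (fun b => (it (kc b)).pt) c'.1 (V c'.1 c'.2) (med a) (kx a) o := fun a => by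
    obtain ⟨⟨out, e1, e2⟩, -⟩ := siteSt₃_spec (i := a.1) (h2 a.1 a.1.2).2.2.1 (h2 a.1 a.1.2).2.2.2.1
      (ho1 a.1 a.1.2)
    refine ⟨out a.2, by rw [e1]; simp [hsz a], ?_⟩
    have := e2 a.2 (hsz a)
    rwa [Input.nodeAt_fin] at this
  refine ⟨kx, xs, lv, gn, β, cnt, c, w, f, c', fun b => (it (kc b)).pt, hisKey, hprof,
    fun i => (h1 i i.2).2.1, fun i hi => (hβ i hi).1, hβs, fun i => houtc i i.2,
    fun i hi => (h2 i hi).1, fun i => (h2 i i.2).2.1, ?_, ho0, fun i => ho1 i i.2, hlab, ?_,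
    fun S hS => hcheap c'.1 c'.2 (hI.isCand_valid hcand) hcv S hS, fun i => ?_, fun i => ?_,
    fun i => ?_, htc, L.length, hMle, htc2⟩
  · rcases hcand.1 with rfl | ⟨l, hl, rfl⟩ | ⟨l, hl, hmem⟩
    · exact .inr (.inl ⟨i0, hch.lt_site, b0, hch.lt_bud, rfl⟩)
    · have hmem : it l ∈ L := by
        rw [hit]; exact List.mem_map_of_mem (by simpa using hl)
      obtain ⟨i, hi, hmem⟩ := List.mem_flatMap.1 hmem
      have hi := List.mem_range.1 hi
      rcases List.mem_append.1 hmem with h3 | h3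
      · obtain ⟨l', -, h4⟩ := List.mem_map.1 h3
        rw [← h4]
        exact .inl ⟨rfl, Nat.zero_le _⟩
      · obtain ⟨j, hj, h4⟩ := List.mem_map.1 h3
        have hj := List.mem_range.1 (List.mem_of_mem_filter hj)
        rw [← h4]
        refine .inr (.inr ⟨X.nodeAt i j, ?_⟩)
        rw [← hprof.key i hi j hj]
        rfl
    · exact .inl (fst_le_of_mem_radCands (hδ l hl) hmem)
  · refine le_trans ?_ hleft
    exact_mod_cast hI.card_unlabelled_le hcand kc
  · rw [← Input.sz_fin]; exact (h1 i i.2).2.2.2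
  · rw [← Input.sz_fin]; exact (h2 i i.2).2.2.2.2
  · rw [← Input.sz_fin]
    exact (siteSt₃_spec (h2 i i.2).2.2.1 (h2 i i.2).2.2.2.1 (ho1 i i.2)).2

/-! ## The solution -/

variable {X : Input P} [Nonempty X.Node] {med : X.Node → P} {kx : X.Node → ℝ} {xs lv : ℕ → ℕ → ℝ}
  {gn : ℕ → ℕ → ℕ} {β cnt : ℕ → ℕ} {c w f : ℕ → ℕ → ℕ} {c' : ℕ × ℕ} {kc : ℕ → P}

open Classical in
lemma Trace.exists_solution (h : Trace X med k t ε kx xs lv gn β cnt c w f c' kc) (hk : 1 ≤ k)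
    {R : Run centerProtocol X med k t ε}
    (h₃ : ∀ i, (R.S₃ i).outbox = (siteSt₃ X med k t ε i).outbox)
    (hc : R.Q₂.outbox = (coordSt₂ X med k t ε).outbox) :
    ∃ S : Solution P X.Node, R.Outputs S ∧ S.Feasible k ((1 + ε) * t) ∧
      cost X S ≤ 1060 * (1 + 1 / ε) * optCost X k t := by
  have hlab : ∀ a, (R.label a = none ∧ ¬ (keyV (kx a) ≤ V c'.1 c'.2 ∧
      ∃ b < k, lev (med a) (kc b) ≤ c'.1 + 5)) ∨ ∃ b < k, R.label a = some (kc b) ∧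
      keyV (kx a) ≤ V c'.1 c'.2 ∧ lev (med a) (kc b) ≤ c'.1 + 5 := fun a => by
    obtain ⟨o, h1, h2⟩ := h.label a
    have e : R.label a = o.pt? := by
      unfold Run.label
      rw [h₃, h1]; rfl
    rcases h2 with ⟨h3, b, hb, h4, rfl⟩ | ⟨h3, h4⟩
    · exact .inr ⟨b, hb, e, h3, h4⟩
    · refine .inl ⟨e.trans h4, fun ⟨h5, b, hb, h6⟩ => ?_⟩
      rcases h3 with h3 | h3
      · exact h3.not_ge h5
      · exact (h3 b hb).not_ge h6
  set S : Solution P X.Node := ⟨(range k).image kc,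
    univ.filter fun a => R.label a = none, fun a => (R.label a).getD (kc 0)⟩ with hS
  have hO : ∀ a, a ∉ S.O → ∃ b < k, R.label a = some (kc b) ∧
      keyV (kx a) ≤ V c'.1 c'.2 ∧ lev (med a) (kc b) ≤ c'.1 + 5 := fun a ha =>
    (hlab a).resolve_left fun h => ha (by simp [hS, h.1])
  refine ⟨S, ⟨fun p => ?_, fun a ha => by simpa [hS] using ha, fun a ha => ?_⟩,
      ⟨?_, ?_, fun a => ?_⟩,
    h.cheap S fun a ha => ?_⟩
  · rw [hc, h.outc₀]
    simp [hS]
  · obtain ⟨b, -, h1, -⟩ := hO a ha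
    simp [hS, h1]
  · exact card_image_le.trans (card_range k).le
  · have h1 : S.O.card ≤ (univ.filter fun a => ¬ (keyV (kx a) ≤ V c'.1 c'.2 ∧
        ∃ b < k, lev (med a) (kc b) ≤ c'.1 + 5)).card := by
      refine card_le_card fun a ha => ?_
      have ha : R.label a = none := by simpa [hS] using ha
      rcases hlab a with h | ⟨b, -, h, -⟩
      · simpa using h.2
      · rw [ha] at h; cases h
    have h2 : (S.O.card : ℝ) ≤ t + quota ε t := le_trans (by exact_mod_cast h1) h.few
    have h3 : quota ε t ≤ ε * t := by
      unfold quota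
      exact mul_le_mul_of_nonneg_right (min_le_left _ _) (Nat.cast_nonneg t)
    linarith
  · rcases hlab a with h | ⟨b, hb, h, -⟩
    · simp only [hS, h.1, Option.getD_none, mem_image, mem_range]
      exact ⟨0, by omega, rfl⟩
    · simp only [hS, h, Option.getD_some, mem_image, mem_range]
      exact ⟨b, hb, rfl⟩
  · obtain ⟨b, -, h1, h2, h3⟩ := hO a ha
    simp only [hS, h1, Option.getD_some]
    exact ⟨h2, h3⟩

/-! ## The size of the keys -/

/-- A bound for the second components of the keys. -/
def maxM (t I : ℕ) : ℕ := if t = 0 then 0 else I + 1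

def SmallKey (P : Type u) [MetricSpace P] (t I : ℕ) (x : ℝ) : Prop :=
  0 ≤ x ∧ x ≤ 2 ^ numL P ∧ keyM x ≤ maxM t I

lemma SmallKey.zero (t I : ℕ) : SmallKey P t I 0 := ⟨le_rfl, by positivity, by simp [keyM]⟩

lemma SmallKey.pow {I g : ℕ} (h1 : 1 ≤ g) (hg : g ≤ numL P) : SmallKey P t I (2 ^ g) :=
  ⟨by positivity, pow_le_pow_right₀ (by norm_num) hg, by rw [keyM_pow h1]; exact Nat.zero_le _⟩

lemma SmallKey.max {I : ℕ} {x y : ℝ} (hx : SmallKey P t I x) (hy : SmallKey P t I y) :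
    SmallKey P t I (max x y) := by
  rcases max_choice x y with h | h <;> rw [h] <;> assumption

lemma SmallKey.keyP_le {I : ℕ} {x : ℝ} (h : SmallKey P t I x) : keyP x ≤ numL P + 1 := by
  refine (expo_le_iff (by linarith [h.1]) _).2 ?_
  have h1 := h.2.1
  have h2 : (1 : ℝ) ≤ 2 ^ numL P := one_le_pow₀ (by norm_num)
  rw [pow_succ, pow_succ]
  linarith

lemma IsKey.smallKey {μ : PMF P} {m : P} {I : ℕ} {x : ℝ}
    (hI : ∀ y, μ y ≠ 0 → (1 / 2 : ℝ) ^ I ≤ (μ y).toReal) (h : IsKey μ m (quota ε t) x) :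
    SmallKey P t I x := by
  have hd := dmin_pos (P := P)
  rcases h with ⟨-, rfl⟩ | ⟨h1, h2, rfl⟩ | ⟨-, g, hg, rfl, -, hmin⟩
  · exact .zero t I
  · have ht : t ≠ 0 := by rintro rfl; simp [quota] at h1
    have hr0 : rho μ 0 m ≠ 0 := by rintro h; simp [h] at h1
    have hr := rho_zero_lower hI hr0 hd.le
    have hrnn := rho_nonneg μ 0 m
    have hM : (1 : ℝ) ≤ Max.max 1 (quota ε t) := le_max_left _ _
    set x := rho μ 0 m * Max.max 1 (quota ε t) / dmin P with hx
    have hlow : (1 / 2 : ℝ) ^ I ≤ x := by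
      rw [hx, le_div_iff₀ hd]; nlinarith
    have hx0 : 0 < x := lt_of_lt_of_le (by positivity) hlow
    have hx1 : x ≤ 1 / 4 := by
      rw [hx, div_le_iff₀ hd]; linarith
    refine ⟨hx0.le, hx1.trans (le_trans (by norm_num) (one_le_pow₀ (by norm_num))), ?_⟩
    rw [keyM, if_neg hx0.not_ge, maxM, if_neg ht]
    refine (expo_le_iff (by positivity) _).2 ?_
    have h3 : 1 / x ≤ 2 ^ I := by
      rw [div_le_iff₀ hx0]
      calc (1 : ℝ) = 2 ^ I * (1 / 2) ^ I := by rw [← mul_pow]; norm_num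
        _ ≤ 2 ^ I * x := by gcongr
    have h4 : (1 : ℝ) ≤ 2 ^ I := one_le_pow₀ (by norm_num)
    rw [pow_add, pow_add]
    norm_num
    norm_num at h3
    linarith
  · refine .pow hg ?_
    by_contra hlt
    have h1 := hmin (numL P) (by unfold numL; omega) (not_le.1 hlt)
    rw [rho_eq_zero, zero_mul] at h1
    · have := tau_pos (P := P) (numL P); linarith
    · have := dmax_lt_pow (P := P)
      unfold tau
      nlinarith [pow_pos (show (0 : ℝ) < 2 by norm_num) (numL P)]

lemma Trace.smallKey (h : Trace X med k t ε kx xs lv gn β cnt c w f c' kc) {I : ℕ}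
    (hI : NodesHaveBits X I) (a : X.Node) : SmallKey P t I (kx a) :=
  (h.isKey a).smallKey (hI.2.2 a)

lemma Trace.smallKey_xs (h : Trace X med k t ε kx xs lv gn β cnt c w f c' kc) {I : ℕ}
    (hI : NodesHaveBits X I) {i j : ℕ} (hi : i < X.s) (hj : j < X.sz i) :
    SmallKey P t I (xs i j) := by
  rw [h.profiles.key i hi j hj]; exact h.smallKey hI _

lemma Trace.smallKey_lv (h : Trace X med k t ε kx xs lv gn β cnt c w f c' kc) {I : ℕ}
    (hI : NodesHaveBits X I) {i b : ℕ} (hi : i < X.s) (hb : b < numB t) :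
    SmallKey P t I (lv i b) := by
  have hp := h.profiles.profile i hi b hb
  obtain ⟨z, hz, hy⟩ := hp.top
  rw [hy]
  refine SmallKey.max ?_ ?_
  · rcases hz.1 with rfl | ⟨j, hj, rfl⟩
    · exact .zero t I
    · exact h.smallKey_xs hI hi hj
  · split_ifs with hg
    · exact .zero t I
    · exact .pow (by omega) hp.le

lemma Trace.pair_le (h : Trace X med k t ε kx xs lv gn β cnt c w f c' kc) {I : ℕ}
    (hI : NodesHaveBits X I) : c'.1 ≤ numL P + 1 ∧ c'.2 ≤ maxM t I := by
  rcases h.pair with ⟨h1, h2⟩ | ⟨i, hi, b, hb, rfl⟩ | ⟨a, rfl⟩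
  · exact ⟨h2, by rw [h1]; exact Nat.zero_le _⟩
  · exact ⟨(h.smallKey_lv hI hi hb).keyP_le, (h.smallKey_lv hI hi hb).2.2⟩
  · exact ⟨(h.smallKey hI a).keyP_le, (h.smallKey hI a).2.2⟩

/-! ## Communication -/

/-- The number of bits of a message. -/
def msgBits {A : Type v} (B I : ℕ) (l : List (Word P A)) : ℕ := (l.map (Word.bits B I)).sum

lemma msgBits_append {A : Type v} (B I : ℕ) (l l' : List (Word P A)) :
    msgBits B I (l ++ l') = msgBits B I l + msgBits B I l' := by simp [msgBits]

lemma msgBits_flatMap_le {A : Type v} {B I N : ℕ} {l : List ℕ} {g : ℕ → List (Word P A)}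
    (h : ∀ j ∈ l, msgBits B I (g j) ≤ N) : msgBits B I (l.flatMap g) ≤ l.length * N := by
  induction l with
  | nil => simp [msgBits]
  | cons j l ih =>
    rw [List.flatMap_cons, msgBits_append, List.length_cons, add_mul, one_mul]
    have h1 := h j (by simp)
    have h2 := ih fun j hj => h j (by simp [hj])
    omega

lemma size_le_self (m : ℕ) : m.size ≤ m := Nat.size_le.2 Nat.lt_two_pow_self

lemma msgBits_netWords {B I cnt r : ℕ} {c w : ℕ → ℕ}
    (hcnt : cnt ≤ k + r) (hw : ∀ l < cnt, w l ≤ n) :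
    msgBits B I ((List.range cnt).flatMap (netWords k nd mp c w)) ≤
      k * (B + 5 + 2 * n.size) + r * (I + 5 + 2 * n.size) := by
  have key : ∀ m ≤ cnt, msgBits B I ((List.range m).flatMap (netWords k nd mp c w)) ≤
      min m k * (B + 5 + 2 * n.size) + (m - k) * (I + 5 + 2 * n.size) := by
    intro m hm
    induction m with
    | zero => simp [msgBits]
    | succ m ih =>
      have hsz := Nat.size_le_size (hw m hm)
      have := ih (by omega)
      rw [List.range_succ, List.flatMap_append, msgBits_append, List.flatMap_singleton]
      by_cases hmk : m + 1 ≤ k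
      · have e : msgBits B I (netWords k nd mp c w m) ≤ B + 5 + 2 * n.size := by
          simp [msgBits, netWords, hmk, Word.bits]; omega
        rw [min_eq_left (by omega : m ≤ k), Nat.sub_eq_zero_of_le (by omega : m ≤ k)] at this
        rw [min_eq_left hmk, Nat.sub_eq_zero_of_le hmk, add_mul, one_mul]
        omega
      · have e : msgBits B I (netWords k nd mp c w m) ≤ I + 5 + 2 * n.size := by
          simp [msgBits, netWords, hmk, Word.bits]; omega
        rw [min_eq_right (by omega : k ≤ m)] at this
        rw [min_eq_right (by omega : k ≤ m + 1), show m + 1 - k = m - k + 1 by omega, add_mul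
            (m - k),
          one_mul]
        omega
  refine (key cnt le_rfl).trans (Nat.add_le_add (Nat.mul_le_mul_right _ (min_le_right _ _))
    (Nat.mul_le_mul_right _ (by omega)))

lemma msgBits_summary {B I r g cnt : ℕ} {Y : ℝ}
    {c w f : ℕ → ℕ} (h : Summary n k mp x r Y g cnt c w f) (hx : ∀ j < n, SmallKey P t I (x j)) :
    msgBits B I (summaryWords n k nd mp x Y cnt c w) ≤ 6 + k * (B + 7 + 2 * n.size) +
      r * (2 * I + 17 + 2 * n.size + 2 * (numL P + 1).size + 2 * (maxM t I).size) := by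
  have h1 := msgBits_netWords (k := k) (n := n) (B := B) (I := I) (nd := nd) (mp := mp) (c := c)
      (w := w)
    h.cnt_le
    (fun l hl => by
      rw [h.weight l hl]
      exact (card_filter_le _ _).trans (card_range n).le)
  have h2 : msgBits B I ((cutList n x Y).flatMap (cutWords (P := P) nd x)) ≤
      (cutList n x Y).length *
      (I + 8 + 2 * (numL P + 1).size + 2 * (maxM t I).size) := by
    refine msgBits_flatMap_le fun j hj => ?_
    have hs := hx j (List.mem_range.1 (List.mem_of_mem_filter hj))
    have e1 := Nat.size_le_size hs.keyP_le
    have e2 := Nat.size_le_size hs.2.2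
    simp [msgBits, cutWords, Word.bits]
    omega
  have h3 := h2.trans (Nat.mul_le_mul_right _ h.cut_le)
  have h4 := size_le_self cnt
  have h5 := size_le_self (cutList n x Y).length
  have h6 := h.cnt_le
  have h7 := h.cut_le
  have h8 : msgBits B I ([.nat cnt, .nat (cutList n x Y).length] : List (Word P A)) =
      2 * cnt.size + 2 * (cutList n x Y).length.size + 6 := by
    simp [msgBits, Word.bits]; omega
  unfold summaryWords
  rw [msgBits_append, msgBits_append, h8]
  have e1 : k * (B + 7 + 2 * n.size) = k * (B + 5 + 2 * n.size) + 2 * k := by ring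
  have e2 : r * (2 * I + 17 + 2 * n.size + 2 * (numL P + 1).size + 2 * (maxM t I).size) =
      r * (I + 5 + 2 * n.size) + r * (I + 8 + 2 * (numL P + 1).size + 2 * (maxM t I).size) +
      4 * r := by ring
  omega

lemma Trace.comm_le (h : Trace X med k t ε kx xs lv gn β cnt c w f c' kc) {B I : ℕ}
    (hI : NodesHaveBits X I) {R : Run centerProtocol X med k t ε}
    (h1 : ∀ i, (R.S₁ i).outbox = (siteSt₁ X med k t ε i).outbox)
    (h2 : ∀ i, (R.S₂ i).outbox = (siteSt₂ X med k t ε i).outbox)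
    (hc1 : R.Q₁.outbox = (coordSt₁ X med k t ε).outbox)
    (hc2 : R.Q₂.outbox = (coordSt₂ X med k t ε).outbox) :
    R.comm B I ≤ X.s * (numB t * (2 * (numL P + 1).size + 2 * (maxM t I).size + 8) +
        k * (2 * B + 9 + 2 * X.n.size) + 2 * (numL P + 1).size + 2 * (maxM t I).size + 15) +
      4 * t * (2 * I + 17 + 2 * X.n.size + 2 * (numL P + 1).size + 2 * (maxM t I).size) := by
  set π := (numL P + 1).size with hπ
  set μ := (maxM t I).size with hμ
  set σ := X.n.size with hσ
  have key : ∀ i : Fin X.s, msgBits B I ((R.S₁ i).outbox 1 ++ R.Q₁.outbox (i + 1) ++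
      (R.S₂ i).outbox 1 ++ R.Q₂.outbox (i + 1)) ≤ numB t * (2 * π + 2 * μ + 8) +
        k * (2 * B + 9 + 2 * σ) + 2 * π + 2 * μ + 15 +
        bud (β i) * (2 * I + 17 + 2 * σ + 2 * π + 2 * μ) := by
    intro i
    rw [h1, h2, hc1, hc2, h.out₁, h.out₂, h.outc₁, h.outc₂]
    simp only [msgBits_append]
    have e1 : msgBits B I ((List.range (numB t)).flatMap fun b =>
        ([.nat (keyP (lv i b)), .nat (keyM (lv i b))] : List (Word P X.Node))) ≤
        (List.range (numB t)).length * (2 * π + 2 * μ + 6) := by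
      refine msgBits_flatMap_le fun b hb => ?_
      have hs := h.smallKey_lv hI i.2 (List.mem_range.1 hb)
      have e1 := Nat.size_le_size hs.keyP_le
      have e2 := Nat.size_le_size hs.2.2
      simp [msgBits, Word.bits]
      omega
    have e2 : msgBits B I ([.nat (β i)] : List (Word P X.Node)) ≤ 2 * numB t + 3 := by
      have a1 := size_le_self (β i)
      have a2 := h.bud_lt i i.2
      simp [msgBits, Word.bits]
      omega
    have e3 : msgBits B I ((report X xs lv β cnt c w i).words k med) ≤ 6 + k * (B + 7 + 2 * σ) +
        bud (β i) * (2 * I + 17 + 2 * σ + 2 * π + 2 * μ) := by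
      refine (msgBits_summary (h.summary i i.2) fun j hj => h.smallKey_xs hI i.2 hj).trans ?_
      have hn : X.sz i ≤ X.n := by
        rw [← Input.sum_sz]
        exact single_le_sum (f := X.sz) (fun _ _ => Nat.zero_le _) (mem_range.2 i.2)
      have hn := Nat.size_le_size hn
      gcongr
    have e4 : msgBits B I ((List.range k).map fun b => (.pt (kc b) : Word P X.Node)) =
        k * (B + 2) := by
      simp [msgBits, Function.comp_def, Word.bits]
    have e5 : msgBits B I ([.nat c'.1, .nat c'.2] : List (Word P X.Node)) ≤ 2 * π + 2 * μ + 6 := by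
      obtain ⟨a1, a2⟩ := h.pair_le hI
      have a1 := Nat.size_le_size a1
      have a2 := Nat.size_le_size a2
      simp [msgBits, Word.bits]
      omega
    rw [List.length_range] at e1
    rw [e4]
    have e6 : numB t * (2 * π + 2 * μ + 8) = numB t * (2 * π + 2 * μ + 6) + 2 * numB t := by ring
    have e7 : k * (2 * B + 9 + 2 * σ) = k * (B + 7 + 2 * σ) + k * (B + 2) := by ring
    omega
  have hsum : R.comm B I ≤ ∑ i : Fin X.s, (numB t * (2 * π + 2 * μ + 8) +
        k * (2 * B + 9 + 2 * σ) + 2 * π + 2 * μ + 15 +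
        bud (β i) * (2 * I + 17 + 2 * σ + 2 * π + 2 * μ)) := sum_le_sum fun i _ => key i
  refine hsum.trans ?_
  rw [sum_add_distrib, ← sum_mul, ← sum_range (fun i => bud (β i))]
  have := Nat.mul_le_mul_right (2 * I + 17 + 2 * σ + 2 * π + 2 * μ) h.bud_sum
  simp only [sum_const, card_univ, Fintype.card_fin, smul_eq_mul]
  omega

/-! ## Bounds on time and communication -/

lemma numB_le (hn : 1 ≤ n) (h : t ≤ n) : numB t ≤ 5 * n.size := by
  have h1 : 1 ≤ n.size := Nat.size_pos.2 hn
  have h2 : expo (1 + t) ≤ n.size := by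
    refine (expo_le_iff (by positivity) _).2 ?_
    have h3 : n < 2 ^ n.size := Nat.lt_size_self n
    have h4 : 1 + t < 2 ^ (n.size + 1) := by rw [pow_succ]; omega
    exact_mod_cast h4
  unfold numB
  omega

lemma siteTime_le {l z : ℕ} (hk : 1 ≤ k) (hn : 1 ≤ n) (hz : 1 ≤ z) (ht : numB t ≤ 5 * z) :
    siteTime₁ k t n l ≤ 500 * (z * ((k + t) * n * (l + 1))) ∧
      siteTime₂ k t n ≤ 500 * (z * ((k + t) * n * (l + 1))) ∧
      siteTime₃ k n ≤ 500 * (z * ((k + t) * n * (l + 1))) := by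
  obtain ⟨k, rfl⟩ := Nat.exists_eq_add_of_le hk
  obtain ⟨n, rfl⟩ := Nat.exists_eq_add_of_le hn
  obtain ⟨z, rfl⟩ := Nat.exists_eq_add_of_le hz
  unfold siteTime₁ siteTime₂ siteTime₃ netTime
  refine ⟨?_, ?_, ?_⟩
  · have h : 22 + numB t * 6 + (1 + n) * 6 + (1 + n) * (l * 4 + 7) + (4 * t + 5) * (6 + (1 + n) * 4)
      +
        (l + 1) * (3 + (1 + n) * (3 * (1 + k + (4 * t + 6)) + 11) + (3 + numB t * 5)) ≤
        22 + 5 * (1 + z) * 6 + (1 + n) * 6 + (1 + n) * (l * 4 + 7) + (4 * t + 5) * (6 + (1 + n) * 4)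
            +
        (l + 1) * (3 + (1 + n) * (3 * (1 + k + (4 * t + 6)) + 11) + (3 + 5 * (1 + z) * 5)) := by
      gcongr
    refine h.trans ?_
    ring_nf
    omega
  · ring_nf
    omega
  · ring_nf
    omega

lemma coordTime₁_le {y z : ℕ} (hy : 1 ≤ y) (hz : 1 ≤ z) (hn : n ≤ y) (ht : numB t ≤ 5 * z) :
    coordTime₁ n t ≤ 500 * (z ^ 2 * y ^ 2) := by
  have h : coordTime₁ n t ≤ 19 + 5 * z * 3 + y * (4 + 5 * z * 7) + y * (5 * z) * (9 +
      (3 + y * (4 + 5 * z * 6))) + (3 + y * (4 + 5 * z * 6)) := by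
    unfold coordTime₁ evalTime
    gcongr
  refine h.trans ?_
  obtain ⟨y, rfl⟩ := Nat.exists_eq_add_of_le hy
  obtain ⟨z, rfl⟩ := Nat.exists_eq_add_of_le hz
  ring_nf
  omega

lemma coordTime₂_le {M y z : ℕ} (hy : 1 ≤ y) (hz : 1 ≤ z) (hn : n ≤ y) (hk : k ≤ y)
    (hM : M ≤ 8 * y) (he : expo ((1 + 7 * M : ℕ) : ℝ) + 1 ≤ 9 * z) :
    coordTime₂ k n M ≤ 300000 * (z ^ 2 * y ^ 2) := by
  have hN : 1 + 7 * M ≤ 57 * y := by omega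
  have h : coordTime₂ k n M ≤ 20 + y * 8 + 8 * y * 22 + 8 * y * (62 + 8 * y * 7) +
      (2 + 9 * z * (4 + 57 * y * (10 + 57 * y * 8) + (7 + (4 + 8 * y * 3 + 8 * y * (4 + 8 * y * 4) +
        y * (6 + 8 * y * 7) + 8 * y * (3 + 8 * y * 3)) + y * 2))) + y * 2 + y * (4 + y * 2) := by
    unfold coordTime₂ bisectTime probeTime coverTime
    gcongr
  refine h.trans ?_
  obtain ⟨y, rfl⟩ := Nat.exists_eq_add_of_le hy
  obtain ⟨z, rfl⟩ := Nat.exists_eq_add_of_le hz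
  ring_nf
  omega

lemma expo_candidates_le {y M : ℕ} (hn : 1 ≤ n) (hy : y ≤ (n + 1) ^ 2) (hM : M ≤ 8 * y) :
    expo ((1 + 7 * M : ℕ) : ℝ) + 1 ≤ 9 * n.size := by
  have h1 : 1 ≤ n.size := Nat.size_pos.2 hn
  have h2 : n + 1 ≤ 2 ^ n.size := Nat.lt_size_self n
  have h3 : 1 + 7 * M < 2 ^ (2 * n.size + 6) := by
    rw [pow_add, mul_comm 2, pow_mul]
    have := Nat.pow_le_pow_left h2 2
    have := Nat.one_le_pow 2 (n + 1) (by omega)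
    omega
  have h4 := (expo_le_iff (Nat.cast_nonneg _) (2 * n.size + 5)).2
    (show ((1 + 7 * M : ℕ) : ℝ) < _ from by exact_mod_cast h3)
  omega

lemma mul_size_le (a N : ℕ) : a * N.size ≤ a * (2 * a.size + 5) + N := by
  by_contra! h
  have h1 : 2 * a.size + 5 < N.size := by
    by_contra! h1
    exact absurd (Nat.mul_le_mul_left a h1) (by omega)
  obtain ⟨m, hm⟩ := Nat.exists_eq_add_of_lt h1
  have h2 : 2 ^ (2 * a.size + 5 + m) ≤ N := Nat.lt_size.1 (by omega)
  have h3 : a < 2 ^ a.size := Nat.lt_size_self a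
  have h4 : m < 2 ^ m := Nat.lt_two_pow_self
  have h5 : a.size < 2 ^ a.size := Nat.lt_two_pow_self
  have h6 : a * N.size ≤ 2 ^ a.size * (2 ^ a.size * (2 ^ m * 32)) := by
    refine Nat.mul_le_mul h3.le ?_
    have : 2 ^ a.size * 1 ≤ 2 ^ a.size * 2 ^ m := Nat.mul_le_mul_left _ (by omega)
    have : 1 * 2 ^ m ≤ 2 ^ a.size * 2 ^ m := Nat.mul_le_mul_right _ (by omega)
    rw [← mul_assoc]
    omega
  have h7 : 2 ^ (2 * a.size + 5 + m) = 2 ^ a.size * (2 ^ a.size * (2 ^ m * 32)) := by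
    rw [pow_add, pow_add, mul_comm 2, pow_mul]; ring
  omega

/-- The bound of `Trace.comm_le`, for `p = numL P`. -/
lemma comm_bound {s B I p : ℕ} (hs : 1 ≤ s) (hk : 1 ≤ k) (hsn : s ≤ n) (ht : t ≤ n)
    (hB : 1 ≤ B) (hI : 1 ≤ I) :
    s * (numB t * (2 * (p + 1).size + 2 * (maxM t I).size + 8) +
        k * (2 * B + 9 + 2 * n.size) + 2 * (p + 1).size + 2 * (maxM t I).size + 15) +
      4 * t * (2 * I + 17 + 2 * n.size + 2 * (p + 1).size + 2 * (maxM t I).size) ≤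
    1000 * (n.size ^ 2 * (s * k * B + s * p + t * I)) := by
  have hz : 1 ≤ n.size := Nat.size_pos.2 (by omega)
  have hnB := numB_le (by omega) ht
  set z := n.size
  set G := s * k * B + s * p + t * I with hG
  have hsG : s * k ≤ G := by
    have := Nat.mul_le_mul_left (s * k) hB
    omega
  have hs1 : s ≤ s * k := Nat.le_mul_of_pos_right _ hk
  have h1 : s * (p + 1).size ≤ 2 * G := by
    refine (Nat.mul_le_mul_left s (size_le_self _)).trans ?_
    rw [mul_add]; omega
  have hp : p ≤ s * p := Nat.le_mul_of_pos_left _ hs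
  have htI : t ≤ t * I := Nat.le_mul_of_pos_right _ hI
  have hst : s.size ≤ z := Nat.size_le_size hsn
  have htt : t.size ≤ z := Nat.size_le_size ht
  have hzG : G ≤ z * G := Nat.le_mul_of_pos_left _ hz
  have hzG2 : z * G ≤ z * (z * G) := Nat.le_mul_of_pos_left _ hz
  have h2 : s * (maxM t I).size ≤ 10 * (z * G) := by
    unfold maxM
    split_ifs with h0
    · simp
    · have e1 := mul_size_le s (I + 1)
      have e2 : s * (2 * s.size + 5) ≤ G * (2 * z + 5) := Nat.mul_le_mul (by omega) (by omega)
      have e3 : I ≤ t * I := Nat.le_mul_of_pos_left _ (by omega)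
      have e4 : G * (2 * z + 5) = 2 * (z * G) + 5 * G := by ring
      omega
  have h3 : t * (p + 1).size ≤ 10 * (z * G) := by
    have e1 := mul_size_le t (p + 1)
    have e2 : t * (2 * t.size + 5) ≤ G * (2 * z + 5) := Nat.mul_le_mul (by omega) (by omega)
    have e4 : G * (2 * z + 5) = 2 * (z * G) + 5 * G := by ring
    omega
  have h4 : t * (maxM t I).size ≤ 2 * G := by
    refine (Nat.mul_le_mul_left t (size_le_self _)).trans ?_
    unfold maxM
    split_ifs with h0
    · simp
    · rw [mul_add]; omega
  have f1 : numB t * (s * (2 * (p + 1).size + 2 * (maxM t I).size + 8)) ≤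
      5 * z * (32 * (z * G)) := by
    refine Nat.mul_le_mul hnB ?_
    have e : s * (2 * (p + 1).size + 2 * (maxM t I).size + 8) =
      2 * (s * (p + 1).size) + 2 * (s * (maxM t I).size) + 8 * s := by ring
    omega
  have f2 : s * k * z ≤ G * z := Nat.mul_le_mul_right _ hsG
  have f3 : t * z ≤ G * z := Nat.mul_le_mul_right _ (by omega)
  calc _ = numB t * (s * (2 * (p + 1).size + 2 * (maxM t I).size + 8)) + 2 * (s * k * B) +
        9 * (s * k) + 2 * (s * k * z) + 2 * (s * (p + 1).size) + 2 * (s * (maxM t I).size)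
            + 15 * s +
        8 * (t * I) + 68 * t + 8 * (t * z) + 8 * (t * (p + 1).size) +
        8 * (t * (maxM t I).size) := by ring
    _ ≤ 160 * (z * (z * G)) + 2 * G + 9 * G + 2 * (z * G) + 4 * G + 20 * (z * G) + 15 * G + 8 * G +
        68 * G + 8 * (z * G) + 80 * (z * G) + 16 * G := by
      have e1 : 5 * z * (32 * (z * G)) = 160 * (z * (z * G)) := by ring
      have e2 : G * z = z * G := mul_comm _ _
      omega
    _ ≤ 1000 * (z * (z * G)) := by omega
    _ = _ := by ring

lemma size_le_log (hn : 1 ≤ n) : (n.size : ℝ) ≤ 4 * Real.log (n + 1) := by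
  have h1 : 1 ≤ n.size := Nat.size_pos.2 hn
  obtain ⟨m, hm⟩ := Nat.exists_eq_add_of_le' h1
  have h2 : 2 ^ m ≤ n := Nat.lt_size.1 (by omega)
  have h3 : (2 : ℝ) ^ m ≤ n + 1 := by
    have : (2 : ℝ) ^ m ≤ n := by exact_mod_cast h2
    linarith
  have h4 := Real.log_le_log (by positivity) h3
  have h5 : Real.log 2 ≤ Real.log (n + 1) := Real.log_le_log (by norm_num) (by
    have : (1 : ℝ) ≤ n := by exact_mod_cast hn
    linarith)
  have h6 : (1 / 2 : ℝ) ≤ Real.log 2 := by linarith [Real.log_two_gt_d9]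
  rw [Real.log_pow] at h4
  have h7 : (m : ℝ) * (1 / 2) ≤ m * Real.log 2 := by gcongr
  rw [hm]
  push_cast
  linarith

lemma size_sq_le (hn : 1 ≤ n) {x y : ℝ} (hx : x ≤ (n.size : ℝ) ^ 2 * y) (hy : 0 ≤ y) :
    x ≤ 16 * Real.log (n + 1) ^ 2 * y := by
  refine hx.trans (mul_le_mul_of_nonneg_right ?_ hy)
  have := pow_le_pow_left₀ (Nat.cast_nonneg _) (size_le_log hn) 2
  nlinarith

lemma one_le_dmax_div_dmin : 1 ≤ dmax P / dmin P :=
  (one_le_div dmin_pos).2 dmin_le_dmax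

lemma logDelta_nonneg : 0 ≤ logDelta P :=
  Real.logb_nonneg (by norm_num) one_le_dmax_div_dmin

lemma numL_le : (numL P : ℝ) ≤ logDelta P + 8 := by
  have h := pow_expo_le (one_le_dmax_div_dmin (P := P))
  have h1 : (expo (dmax P / dmin P) : ℝ) ≤ logDelta P := by
    rw [logDelta, Real.le_logb_iff_rpow_le (by norm_num)
        (by linarith [one_le_dmax_div_dmin (P := P)])]
    exact_mod_cast h
  unfold numL
  push_cast
  linarith

/-- The sum of the constants of the programs. -/
def totalFactor : ℕ := site₁S.factor + site₂S.factor + site₃S.factor + coord₁S.factor + coord₂S.factor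

variable {X : Input P} {med : X.Node → P} {kx : X.Node → ℝ} {xs lv : ℕ → ℕ → ℝ} {gn : ℕ → ℕ → ℕ}
  {β cnt : ℕ → ℕ} {c w f : ℕ → ℕ → ℕ} {c' : ℕ × ℕ} {kc : ℕ → P}

lemma Input.s_le_n (hX : ∀ i, 0 < X.size i) : X.s ≤ X.n := by
  unfold Input.n
  calc X.s = ∑ _i : Fin X.s, 1 := by simp
    _ ≤ _ := sum_le_sum fun i _ => hX i

lemma Input.s_pos (h : 1 ≤ X.n) : 1 ≤ X.s := by
  by_contra! h0
  have : IsEmpty (Fin X.s) := by rw [Nat.lt_one_iff.1 h0]; infer_instance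
  simp [Input.n] at h

lemma Input.nonempty_node (hX : ∀ i, 0 < X.size i) (h : 1 ≤ X.n) : Nonempty X.Node :=
  ⟨⟨0, X.s_pos h⟩, ⟨0, hX _⟩⟩

lemma comm_bound_real {s B I : ℕ} (hs : 1 ≤ s) (hk : 1 ≤ k) (hsn : s ≤ n) (hB : 1 ≤ B) {m : ℕ}
    (hm : m ≤ 1000 * (n.size ^ 2 * (s * k * B + s * numL P + t * I))) :
    (m : ℝ) ≤ 144000 * Real.log (n + 1) ^ 2 * (s * k * B + s * logDelta P + t * I) := by
  have hl := logDelta_nonneg (P := P)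
  have hL := mul_le_mul_of_nonneg_left (numL_le (P := P)) (Nat.cast_nonneg (α := ℝ) s)
  have h1 : (s : ℝ) ≤ s * k * B := by
    have : s ≤ s * k * B := (Nat.le_mul_of_pos_right _ hk).trans (Nat.le_mul_of_pos_right _ hB)
    exact_mod_cast this
  have h2 : (0 : ℝ) ≤ s * logDelta P := by positivity
  have h3 : (0 : ℝ) ≤ t * I := by positivity
  have h4 : (s * k * B + s * numL P + t * I : ℝ) ≤ 9 * (s * k * B + s * logDelta P + t * I) := by
    have : (0 : ℝ) ≤ s := by positivity
    linarith
  have h5 : (m : ℝ) ≤ (n.size : ℝ) ^ 2 * (9000 * (s * k * B + s * logDelta P + t * I)) := by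
    calc (m : ℝ) ≤ 1000 * (n.size ^ 2 * (s * k * B + s * numL P + t * I)) := by exact_mod_cast hm
      _ ≤ 1000 * (n.size ^ 2 * (9 * (s * k * B + s * logDelta P + t * I))) := by gcongr
      _ = _ := by ring
  refine (size_sq_le (by omega) h5 (by positivity)).trans (le_of_eq (by ring))

lemma siteTime_bound_real {m l F : ℕ} (hn : 1 ≤ n) (hl : l = numL P)
    {T : ℕ} (hT : T ≤ F * (500 * (n.size * ((k + t) * m * (l + 1))))) :
    (T : ℝ) ≤ 72000 * F * Real.log (n + 1) ^ 2 * ((k + t) * m * (logDelta P + 1)) := by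
  have hl' := logDelta_nonneg (P := P)
  have hz : (1 : ℝ) ≤ n.size := by exact_mod_cast Nat.size_pos.2 hn
  have hL : (l + 1 : ℝ) ≤ 9 * (logDelta P + 1) := by
    rw [hl]; linarith [numL_le (P := P)]
  have h5 : (T : ℝ) ≤ (n.size : ℝ) ^ 2 * (4500 * F * ((k + t) * m * (logDelta P + 1))) := by
    calc (T : ℝ) ≤ F * (500 * (n.size * ((k + t) * m * (l + 1)))) := by exact_mod_cast hT
      _ ≤ F * (500 * ((n.size * n.size) * ((k + t) * m * (9 * (logDelta P + 1))))) := by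
        gcongr
        exact le_mul_of_one_le_left (by positivity) hz
      _ = _ := by ring
  refine (size_sq_le hn h5 (by positivity)).trans (le_of_eq (by ring))

lemma Trace.siteTime_le [Nonempty X.Node] (h : Trace X med k t ε kx xs lv gn β cnt c w f c' kc)
    (hX : ∀ i, 0 < X.size i) (hk : 1 ≤ k) (hn : 1 ≤ X.n) (ht : t ≤ X.n)
    {R : Run centerProtocol X med k t ε} {i : Fin X.s}
    (h1 : R.a₁ i ≤ site₁S.factor * (siteSt₁ X med k t ε i).time)
    (h2 : R.a₂ i ≤ site₂S.factor * (siteSt₂ X med k t ε i).time)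
    (h3 : R.a₃ i ≤ site₃S.factor * (siteSt₃ X med k t ε i).time) :
    R.siteTime i ≤ totalFactor *
      (500 * (X.n.size * ((k + t) * X.size i * (numL P + 1)))) := by
  obtain ⟨e1, e2, e3⟩ := CenterG.siteTime_le (t := t) (l := numL P) hk (hX i)
    (Nat.size_pos.2 hn) (numB_le hn ht)
  have g1 := h1.trans (Nat.mul_le_mul_left _ ((h.time₁ i).trans e1))
  have g2 := h2.trans (Nat.mul_le_mul_left _ ((h.time₂ i).trans e2))
  have g3 := h3.trans (Nat.mul_le_mul_left _ ((h.time₃ i).trans e3))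
  unfold Run.siteTime totalFactor
  simp only [add_mul] at g1 g2 g3 ⊢
  omega

lemma Trace.coordTime_le [Nonempty X.Node] (h : Trace X med k t ε kx xs lv gn β cnt c w f c' kc)
    (hX : ∀ i, 0 < X.size i) (hk : 1 ≤ k) (hkn : k ≤ X.n) (ht : t ≤ X.n)
    {R : Run centerProtocol X med k t ε}
    (h1 : R.b₁ ≤ coord₁S.factor * (coordSt₁ X med k t ε).time)
    (h2 : R.b₂ ≤ coord₂S.factor * (coordSt₂ X med k t ε).time) :
    R.coordTime ≤ totalFactor * (300000 * (X.n.size ^ 2 * (X.s * k + t) ^ 2)) := by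
  have hn : 1 ≤ X.n := hk.trans hkn
  have hs := X.s_pos hn
  have hz := Nat.size_pos.2 hn
  have hsn := Input.s_le_n hX
  have hsy : X.s ≤ X.s * k := Nat.le_mul_of_pos_right _ hk
  have hky : k ≤ X.s * k := Nat.le_mul_of_pos_left _ hs
  set y := X.s * k + t with hy
  have hyn : y ≤ (X.n + 1) ^ 2 := by
    have := Nat.mul_le_mul hsn hkn
    nlinarith
  obtain ⟨M, hM, e2⟩ := h.timec₂
  have hM : M ≤ 8 * y := by omega
  have g1 := h1.trans (Nat.mul_le_mul_left _ (h.timec₁.trans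
    (coordTime₁_le (y := y) (by omega) hz (by omega) (numB_le hn ht))))
  have g2 := h2.trans (Nat.mul_le_mul_left _ (e2.trans
    (coordTime₂_le (y := y) (by omega) hz (by omega) (by omega) hM (expo_candidates_le hn hyn hM))))
  unfold Run.coordTime totalFactor
  rw [Nat.mul_left_comm] at g1 g2 ⊢
  simp only [add_mul]
  omega

end
end CenterG
end

open CenterG in
theorem mainTheorem5 :
    ∃ (pr : Protocol) (C : ℝ) (c : ℕ), 0 < C ∧
      ∀ (P : Type*) [MetricSpace P] [Fintype P] [Nontrivial P] (X : Input P) (_ : ∀ i, 0 < X.size i)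
        (med : X.Node → P) (_ : ∀ a, IsMedian (X.law a) (med a))
        (B I : ℕ) (_ : Fintype.card P ≤ 2 ^ B) (_ : NodesHaveBits X I)
        (k t : ℕ) (_ : 1 ≤ k) (_ : k ≤ X.n) (_ : t ≤ X.n) (ε : ℝ) (_ : 0 < ε),
        ∃ (R : Run pr X med k t ε) (S : Solution P X.Node), R.Outputs S ∧
          S.Feasible k ((1 + ε) * t) ∧
          cost X S ≤ C * (1 + 1 / ε) * optCost X k t ∧
          (R.comm B I : ℝ) ≤ C * Real.log (X.n + 1) ^ c * (X.s * k * B + X.s * logDelta P + t * I) ∧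
          (∀ i, (R.siteTime i : ℝ) ≤
            C * Real.log (X.n + 1) ^ c * ((k + t) * X.size i * (logDelta P + 1))) ∧
          (R.coordTime : ℝ) ≤ C * Real.log (X.n + 1) ^ c * (X.s * k + t) ^ 2 := by
  have hF : (0 : ℝ) ≤ totalFactor := Nat.cast_nonneg _
  refine ⟨centerProtocol, 10 ^ 7 * (totalFactor + 1), 2, by positivity, ?_⟩
  intro P _ _ _ X hX med hmed B I hB hI k t hk hkn ht ε hε
  have hn : 1 ≤ X.n := hk.trans hkn
  have hs := X.s_pos hn
  have := Input.nonempty_node hX hn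
  have hB1 : 1 ≤ B := by
    rcases Nat.eq_zero_or_pos B with rfl | h
    · exact absurd hB (not_le.2 Fintype.one_lt_card)
    · exact h
  have hl := logDelta_nonneg (P := P)
  obtain ⟨R, ⟨ho1, ho2, ho3, hc1, hc2⟩, ha1, ha2, ha3, hb1, hb2⟩ := exists_run X med k t ε
  obtain ⟨kx, xs, lv, gn, β, cnt, c, w, f, c', kc, h⟩ := exists_trace hk hε hmed
  obtain ⟨S, hS, hfeas, hcost⟩ := h.exists_solution hk ho3 hc2
  refine ⟨R, S, hS, hfeas, hcost.trans ?_, ?_, fun i => ?_, ?_⟩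
  · have h0 : 0 ≤ optCost X k t := by
      obtain ⟨S', -, h⟩ := exists_opt X hk t
      exact h ▸ cost_nonneg S'
    gcongr
    linarith
  · refine (comm_bound_real (P := P) hs hk (Input.s_le_n hX) hB1
      ((h.comm_le hI ho1 ho2 hc1 hc2).trans
        (comm_bound hs hk (Input.s_le_n hX) ht hB1 hI.1))).trans ?_
    gcongr
    linarith
  · refine (siteTime_bound_real hn rfl (h.siteTime_le hX hk hn ht (ha1 i) (ha2 i) (ha3 i))).trans ?_
    gcongr <;> linarith
  · have h1 := h.coordTime_le hX hk hkn ht hb1 hb2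
    have h2 : (R.coordTime : ℝ) ≤ (X.n.size : ℝ) ^ 2 *
        (300000 * totalFactor * ((X.s * k + t) ^ 2 : ℝ)) := by
      calc (R.coordTime : ℝ) ≤ totalFactor * (300000 * (X.n.size ^ 2 * (X.s * k + t) ^ 2)) := by
            exact_mod_cast h1
        _ = _ := by ring
    refine (size_sq_le hn h2 (by positivity)).trans ?_
    rw [← mul_assoc, mul_right_comm]
    calc _ = 4800000 * (totalFactor : ℝ) * Real.log (X.n + 1) ^ 2 * (X.s * k + t) ^ 2 := by ring
      _ ≤ _ := by
        gcongr <;> linarith
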